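/- **Setting.** Fix $\ell\ge 0$, put $\mathcal O=\mathcal T=\mathbb R^\ell$, $\mathcal O^+=\mathcal O\oplus\mathcal T$, and let $f:\mathcal O^+\times\mathcal T\to\mathbb R$, $(r,\epsilon)\mapsto f(r;\epsilon)$ with $r=x\oplus x^\star$, be measurable. For a positive semidefinite $2\ell\times2\ell$ matrix $B$ let $\mathbb E_B$ be the expectation over independent $r=x\oplus x^\star\sim N(0,B)$ and $\epsilon\sim N(0,I_\ell)$, and put $\mathbf I(B)=\mathbb E_B[\nabla_xf(r;\epsilon)\otimes\nabla_xf(r;\epsilon)]$. All matrix norms $\|\cdot\|$ are Frobenius norms. Assume that there are $\alpha\ge0$, constants $L(f),L(h),L(I)$, $\hat L>0$ and an open set $\mathcal U$ of $2\ell\times 2\ell$ matrices such that: * $|f(r;\epsilon)-f(\hat r;\epsilon)|\le L(f)\|r-\hat r\|(1+\|r\|^\alpha+\|\hat r\|^\alpha+\|\epsilon\|^\alpha)$ for all $r,\hat r,\epsilon$, and $f(0;\epsilon)$ is integrable for $\epsilon\sim N(0,I_\ell)$; * there is $h$ on $2\ell\times2\ell$ matrices with $h(B)=h(B^T)$, with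 $h(B)=\mathbb E_B f(r;\epsilon)$ for positive semidefinite $B\in\mathcal U$, which is $C^1$ on $\mathcal U$ and satisfies $\|\nabla h(B)-\nabla h(\hat B)\|\le L(h)\|B-\hat B\|(1+\|B\|^\alpha+\|\hat B\|^\alpha)$ for $B,\hat B\in\mathcal U$; * $\|\mathbf I(B)-\mathbf I(\hat B)\|\le L(I)\|B-\hat B\|(1+\|B\|^\alpha+\|\hat B\|^\alpha)$ for positive semidefinite $B,\hat B\in\mathcal U$; * for all $x^\star,\epsilon$ the function $x\mapsto f(x\oplus x^\star;\epsilon)$ is $C^1$, convex and $\hat L$-smooth, i.e. $f(\hat x\oplus x^\star;\epsilon)\le f(x\oplus x^\star;\epsilon)+\langle\nabla_xf(x\oplus x^\star;\epsilon),\hat x-x\rangle+\tfrac{\hat L}{2}\|\hat x-x\|^2$ for all $x,\hat x$. For every dimension $d\ge d_0\ge 1$ let there be given a positive semidefinite $K\in\mathbb R^{d\times d}$ with eigenvalues $\lambda_i$ and orthonormal eigenvectors $\omega_i$, and $X_0,X^\star\in\mathbb R^{d\times\ell}$, where the operator norm of $K$ and the norms $\|X_0\|,\|X^\star\|$ are bounded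 independently of $d$, and $W_0^TKW_0\in\mathcal U$ for $W_0=(X_0,X^\star)$. Suppose that $X^\star$ minimizes the risk $\mathcal R(X)=\mathbb E f(X^Ta\oplus X^{\star T}a;\epsilon)$, where $a\sim N(0,K)$ and $\epsilon\sim N(0,I_\ell)$ are independent, and that almost surely $X^{\star T}a$ minimizes $x\mapsto f(x\oplus X^{\star T}a;\epsilon)$. Let $\gamma:[0,\infty)\to[0,\infty)$ be bounded and measurable, independent of $d$. From i.i.d. samples $(a_k,\epsilon_k)_{k\ge 1}$ with the law of $(a,\epsilon)$, SGD is $$X_{k+1}=X_k-\tfrac{\gamma(k/d)}{d}\,a_{k+1}\otimes\nabla_xf\bigl(X_k^Ta_{k+1}\oplus X^{\star T}a_{k+1};\epsilon_{k+1}\bigr).$$ **Deterministic curve.** Write $\mathscr B(t)=\frac1d\sum_i\lambda_i\mathscr B_i(t)$ and let $H_1,H_2$ be the blocks $\nabla h_{11}$, $\nabla h_{12}=\nabla h_{21}^T$ of $\nabla h(\mathscr B(t))$. A solution on $[0,\tau]$ is a family of continuous positive semidefinite $\mathscr B_i=\begin{bmatrix}\mathscr B_{11,i}&\mathscr B_{12,i}\\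 \mathscr B_{12,i}^T&\mathscr B_{22,i}\end{bmatrix}$, $1\le i\le d$, with $\mathscr B(t)\in\mathcal U$ on $[0,\tau]$, $\mathscr B_i(0)=d\,(W_0^T\omega_i)(W_0^T\omega_i)^T$, and (in integrated form) $$\begin{aligned}\tfrac{d}{dt}\mathscr B_{11,i}&=-2\lambda_i\gamma(t)\bigl(\mathscr B_{11,i}H_1+H_1\mathscr B_{11,i}+\mathscr B_{12,i}H_2^T+H_2\mathscr B_{12,i}^T\bigr)+\lambda_i\gamma(t)^2\,\mathbf I(\mathscr B(t)),\\ \tfrac{d}{dt}\mathscr B_{12,i}&=-2\lambda_i\gamma(t)\bigl(H_1\mathscr B_{12,i}+H_2\mathscr B_{22,i}\bigr),\qquad \tfrac{d}{dt}\mathscr B_{22,i}=0.\end{aligned}$$ Put $\mathscr D^2(t)=\frac1d\sum_{i}\operatorname{tr}\bigl(\mathscr B_{11,i}(t)-2\mathscr B_{12,i}(t)+\mathscr B_{22,i}(t)\bigr)$. Fix $T>0$ and suppose that for some $\eta>0$ independent of $d$, for as long as the solution is defined and $t\le T$, one has $\|\mathscr B(t)-V\|\ge\eta$ for all $V\notin\mathcal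 U$. **Corollary (descent of convex, $\hat L$-smooth outer function).** Suppose that $\gamma(t)\cdot\hat L\,\tfrac1d\operatorname{tr}K\le1$ for all $t\ge0$ and $d\ge d_0$ (i.e. $\gamma(t)\le\bar\gamma=1/(\hat L\,\tfrac1d\operatorname{tr}K)$). Then, for every $d\ge d_0$: 1. the descent condition holds with $q=\frac1{2\hat L}$: for every positive semidefinite $B$ with lower right block $B_{22}=X^{\star T}KX^\star$, $$q\,\mathbb E_B\|\nabla_xf(x\oplus x^\star;\epsilon)\|^2\le\mathbb E_B\langle x-x^\star,\nabla_xf(x\oplus x^\star;\epsilon)\rangle,$$ both expectations being finite; 2. a solution exists on $[0,T]$, and on every interval $[0,\tau]$ on which a solution is defined, $\mathscr D^2$ is non-increasing. 3. If moreover there are $C$ and $\beta>0$ with $\int_0^T|\gamma(s)-\gamma(\lfloor sd\rfloor/d)|\,ds\le Cd^{-\beta}$ for all $d\ge1$ (as for constant, piecewise Hölder or bounded variation $\gamma$), then for some $\varepsilon>0$ $$\sup_{0\le t\le T}\bigl|\|X_{\lfloor td\rfloor}-X^\star\|^2-\mathscr D^2(t)\bigr|\le d^{-\varepsilon}\quad\text{with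 overwhelming probability,}$$ i.e. with probability at least $1-e^{-w(d)}$ for some $w$ with $w(d)/\log d\to\infty$. -/

import Mathlib

open MeasureTheory ProbabilityTheory Filter Topology Matrix

-- Matrices carry the Frobenius (Hilbert space) norm.
attribute [local instance] Matrix.frobeniusNormedAddCommGroup Matrix.frobeniusNormedSpace

noncomputable section

namespace HighDimSGD

/-- The observable space `𝒪 = ℝ^ℓ`; it is also the latent space `𝒯` and the noise space. -/
abbrev Obs (ℓ : ℕ) : Type := EuclideanSpace ℝ (Fin ℓ)

/-- The space `𝒪⁺ = 𝒪 ⊕ 𝒯`, with the Euclidean norm. -/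
abbrev ObsPlus (ℓ : ℕ) : Type := EuclideanSpace ℝ (Fin ℓ ⊕ Fin ℓ)

/-- The space `(𝒪⁺) ⊗ (𝒪⁺)`, as `2ℓ × 2ℓ` block matrices. -/
abbrev GramMat (ℓ : ℕ) : Type := Matrix (Fin ℓ ⊕ Fin ℓ) (Fin ℓ ⊕ Fin ℓ) ℝ

/-- The vector `x ⊕ y`. -/
def join {ℓ : ℕ} (x y : Obs ℓ) : ObsPlus ℓ := WithLp.toLp 2 (Sum.elim x y)

/-- The `𝒪`-component `x` of `r = x ⊕ x⋆`. -/
def fstPart {ℓ : ℕ} (r : ObsPlus ℓ) : Obs ℓ := WithLp.toLp 2 (fun i => r (Sum.inl i))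

/-- The `𝒯`-component `x⋆` of `r = x ⊕ x⋆`. -/
def sndPart {ℓ : ℕ} (r : ObsPlus ℓ) : Obs ℓ := WithLp.toLp 2 (fun i => r (Sum.inr i))

/-! ### The outer function -/

/-- `∇ₓ f (x ⊕ x⋆; ε)`: the gradient in the first variable only. -/
def gradX {ℓ : ℕ} (f : ObsPlus ℓ → Obs ℓ → ℝ) (r : ObsPlus ℓ) (e : Obs ℓ) : Obs ℓ :=
  gradient (fun x => f (join x (sndPart r)) e) (fstPart r)

/-- `f` is `α`-pseudo-Lipschitz in `r` with constant `L`. -/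
def PseudoLipschitzOuter {ℓ : ℕ} (α L : ℝ) (f : ObsPlus ℓ → Obs ℓ → ℝ) : Prop :=
  ∀ (r r' : ObsPlus ℓ) (e : Obs ℓ),
    |f r e - f r' e| ≤ L * ‖r - r'‖ * (1 + ‖r‖ ^ α + ‖r'‖ ^ α + ‖e‖ ^ α)

/-- As a function of `x ∈ 𝒪`, the outer function is `C¹`, convex, and satisfies the quadratic upper
bound with constant `Lhat` (for all values of the hidden parameters `x⋆` and `ε`). -/
structure ConvexSmoothOuter {ℓ : ℕ} (Lhat : ℝ) (f : ObsPlus ℓ → Obs ℓ → ℝ) : Prop where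
  contDiff : ∀ y e : Obs ℓ, ContDiff ℝ 1 (fun x => f (join x y) e)
  convex : ∀ y e : Obs ℓ, ConvexOn ℝ Set.univ (fun x => f (join x y) e)
  smooth : ∀ y e x x' : Obs ℓ,
    f (join x' y) e ≤ f (join x y) e + inner ℝ (gradX f (join x y) e) (x' - x)
      + Lhat / 2 * ‖x' - x‖ ^ 2

/-! ### Gaussian expectations as functions of the covariance -/

/-- The law of `(r, ε)` with `r ∼ N(0, B)` and `ε ∼ N(0, I)` independent. -/
def jointLaw {ℓ : ℕ} (B : GramMat ℓ) : Measure (ObsPlus ℓ × Obs ℓ) :=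
  (multivariateGaussian 0 B).prod (stdGaussian (Obs ℓ))

/-- The Fisher matrix `I(B) = 𝔼 [∇ₓ f(r; ε) ⊗ ∇ₓ f(r; ε)]`, `r ∼ N(0, B)`. -/
def fisher {ℓ : ℕ} (f : ObsPlus ℓ → Obs ℓ → ℝ) (B : GramMat ℓ) : Matrix (Fin ℓ) (Fin ℓ) ℝ :=
  Matrix.of fun i j => ∫ p, gradX f p.1 p.2 i * gradX f p.1 p.2 j ∂(jointLaw B)

/-- The descent condition with constant `q` at the covariance `B`: with `x ⊕ x⋆ ∼ N(0, B)`,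
`q · 𝔼 ‖∇ₓ f(x ⊕ x⋆; ε)‖² ≤ 𝔼 ⟨x - x⋆, ∇ₓ f(x ⊕ x⋆; ε)⟩`, both expectations being finite. -/
def DescentCondition {ℓ : ℕ} (f : ObsPlus ℓ → Obs ℓ → ℝ) (q : ℝ) (B : GramMat ℓ) : Prop :=
  Integrable (fun p : ObsPlus ℓ × Obs ℓ => ‖gradX f p.1 p.2‖ ^ 2) (jointLaw B) ∧
  Integrable (fun p : ObsPlus ℓ × Obs ℓ =>
    inner ℝ (fstPart p.1 - sndPart p.1) (gradX f p.1 p.2)) (jointLaw B) ∧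
  q * ∫ p, ‖gradX f p.1 p.2‖ ^ 2 ∂(jointLaw B)
    ≤ ∫ p, inner ℝ (fstPart p.1 - sndPart p.1) (gradX f p.1 p.2) ∂(jointLaw B)

/-- The gradient of `h` as a matrix of partial derivatives. -/
def matGrad {ℓ : ℕ} (h : GramMat ℓ → ℝ) (B : GramMat ℓ) : GramMat ℓ :=
  Matrix.of fun p q => fderiv ℝ h B (Matrix.single p q 1)

/-- The first block column `[[∇h₁₁, 0], [∇h₂₁, 0]]` of `∇h(B)`. -/
def gradCol {ℓ : ℕ} (h : GramMat ℓ → ℝ) (B : GramMat ℓ) : GramMat ℓ :=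
  Matrix.fromBlocks (matGrad h B).toBlocks₁₁ 0 (matGrad h B).toBlocks₂₁ 0

/-- `h` represents the risk on `U`: at positive semidefinite `B ∈ U` it is the expectation of
`f(r; ε)` with `r ∼ N(0, B)`. It is symmetric, `C¹` on `U`, with pseudo-Lipschitz gradient there. -/
structure RiskRepresentation {ℓ : ℕ} (α L : ℝ) (f : ObsPlus ℓ → Obs ℓ → ℝ)
    (U : Set (GramMat ℓ)) (h : GramMat ℓ → ℝ) : Prop where
  represents : ∀ B ∈ U, B.PosSemidef → h B = ∫ p, f p.1 p.2 ∂(jointLaw B)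
  symmetric : ∀ B, h Bᵀ = h B
  contDiffOn : ContDiffOn ℝ 1 h U
  pseudoLipschitz : ∀ B ∈ U, ∀ B' ∈ U,
    ‖matGrad h B - matGrad h B'‖ ≤ L * ‖B - B'‖ * (1 + ‖B‖ ^ α + ‖B'‖ ^ α)

/-- The Fisher matrix is `α`-pseudo-Lipschitz on the covariances in `U`. -/
def PseudoLipschitzFisher {ℓ : ℕ} (α L : ℝ) (f : ObsPlus ℓ → Obs ℓ → ℝ)
    (U : Set (GramMat ℓ)) : Prop :=
  ∀ B ∈ U, ∀ B' ∈ U, B.PosSemidef → B'.PosSemidef →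
    ‖fisher f B - fisher f B'‖ ≤ L * ‖B - B'‖ * (1 + ‖B‖ ^ α + ‖B'‖ ^ α)

/-! ### The data in ambient dimension `d` -/

/-- The data in dimension `d`: a covariance `K` with an orthonormal eigenbasis, the initial
point `X₀` and the hidden parameters `X⋆`. -/
structure Setup (ℓ d : ℕ) where
  K : Matrix (Fin d) (Fin d) ℝ
  posSemidef : K.PosSemidef
  eigval : Fin d → ℝ
  eigvec : OrthonormalBasis (Fin d) ℝ (EuclideanSpace ℝ (Fin d))
  eigen : ∀ i, K *ᵥ (eigvec i).ofLp = eigval i • (eigvec i).ofLp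
  X₀ : Matrix (Fin d) (Fin ℓ) ℝ
  Xstar : Matrix (Fin d) (Fin ℓ) ℝ

/-- The contraction `⟨X, a⟩_𝒜 = Xᵀ a ∈ 𝒪`. -/
def contract {ℓ d : ℕ} (X : Matrix (Fin d) (Fin ℓ) ℝ) (a : EuclideanSpace ℝ (Fin d)) : Obs ℓ :=
  WithLp.toLp 2 (Xᵀ *ᵥ a.ofLp)

namespace Setup

variable {ℓ d : ℕ} (S : Setup ℓ d)

/-- The law of a sample `(a, ε)`: `a ∼ N(0, K)` and `ε ∼ N(0, I)` independent. -/
def dataLaw : Measure (EuclideanSpace ℝ (Fin d) × Obs ℓ) :=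
  (multivariateGaussian 0 S.K).prod (stdGaussian (Obs ℓ))

/-- `r = ⟨X, a⟩ ⊕ ⟨X⋆, a⟩`. -/
def preact (X : Matrix (Fin d) (Fin ℓ) ℝ) (a : EuclideanSpace ℝ (Fin d)) : ObsPlus ℓ :=
  join (contract X a) (contract S.Xstar a)

/-- The risk `ℛ(X) = 𝔼 f(⟨X, a⟩ ⊕ ⟨X⋆, a⟩; ε)`. -/
def risk (f : ObsPlus ℓ → Obs ℓ → ℝ) (X : Matrix (Fin d) (Fin ℓ) ℝ) : ℝ :=
  ∫ p, f (S.preact X p.1) p.2 ∂S.dataLaw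

/-- The Gram matrix `⟨W ⊗ W, K⟩ = Wᵀ K W` for `W = (X, X⋆)`. -/
def gram (X : Matrix (Fin d) (Fin ℓ) ℝ) : GramMat ℓ :=
  (Matrix.fromCols X S.Xstar)ᵀ * S.K * Matrix.fromCols X S.Xstar

/-- `X⋆` minimizes the risk, and almost surely `⟨X⋆, a⟩` minimizes the loss in `x`. -/
structure RiskLossMinimizer (f : ObsPlus ℓ → Obs ℓ → ℝ) : Prop where
  risk_min : ∀ X, S.risk f S.Xstar ≤ S.risk f X
  loss_min : ∀ᵐ p ∂S.dataLaw, ∀ x : Obs ℓ,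
    f (S.preact S.Xstar p.1) p.2 ≤ f (join x (contract S.Xstar p.1)) p.2

/-- Streaming SGD with step size `γ(k/d)/d` along a sequence of samples; the step from `X_k` to
`X_{k+1}` uses `sample k`. -/
def sgd (f : ObsPlus ℓ → Obs ℓ → ℝ) (γ : ℝ → ℝ)
    (sample : ℕ → EuclideanSpace ℝ (Fin d) × Obs ℓ) : ℕ → Matrix (Fin d) (Fin ℓ) ℝ
  | 0 => S.X₀
  | k + 1 =>
    sgd f γ sample k - (γ ((k : ℝ) / d) / d) •
      Matrix.vecMulVec (sample k).1.ofLp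
        (gradX f (S.preact (sgd f γ sample k) (sample k).1) (sample k).2).ofLp

/-! ### The coupled deterministic system -/

/-- `𝓑(t) = (1/d) ∑ᵢ λᵢ 𝓑ᵢ(t)`. -/
def avg (𝓑 : Fin d → ℝ → GramMat ℓ) (t : ℝ) : GramMat ℓ :=
  (1 / (d : ℝ)) • ∑ i, S.eigval i • 𝓑 i t

/-- The initial value `𝓑ᵢ(0) = d ⟨W₀ ⊗ W₀, ωᵢ ⊗ ωᵢ⟩` with `W₀ = (X₀, X⋆)`. -/
def init (i : Fin d) : GramMat ℓ :=
  (d : ℝ) • Matrix.vecMulVec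
    ((Matrix.fromCols S.X₀ S.Xstar)ᵀ *ᵥ (S.eigvec i).ofLp)
    ((Matrix.fromCols S.X₀ S.Xstar)ᵀ *ᵥ (S.eigvec i).ofLp)

/-- The right-hand side of the equation for `𝓑ᵢ`, where `H = gradCol h 𝓑(t)`:
`-2 λᵢ γ(t) (𝓑ᵢ H + Hᵀ 𝓑ᵢ) + λᵢ γ(t)² [[I(𝓑(t)), 0], [0, 0]]`. -/
def field (f : ObsPlus ℓ → Obs ℓ → ℝ) (h : GramMat ℓ → ℝ) (γ : ℝ → ℝ)
    (𝓑 : Fin d → ℝ → GramMat ℓ) (i : Fin d) (t : ℝ) : GramMat ℓ :=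
  -(2 * S.eigval i * γ t) •
      (𝓑 i t * gradCol h (S.avg 𝓑 t) + (gradCol h (S.avg 𝓑 t))ᵀ * 𝓑 i t)
    + (S.eigval i * γ t ^ 2) • Matrix.fromBlocks (fisher f (S.avg 𝓑 t)) 0 0 0

/-- `𝓑` is a solution on `[0, τ]`, in positive semidefinite matrices, of the coupled equations,
with `𝓑(t)` in `U`. As `γ` is only measurable, the equations are written in integrated form. -/
structure IsSolution (f : ObsPlus ℓ → Obs ℓ → ℝ) (h : GramMat ℓ → ℝ) (U : Set (GramMat ℓ))
    (γ : ℝ → ℝ) (τ : ℝ) (𝓑 : Fin d → ℝ → GramMat ℓ) : Prop where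
  continuousOn : ∀ i, ContinuousOn (𝓑 i) (Set.Icc 0 τ)
  posSemidef : ∀ i, ∀ t ∈ Set.Icc 0 τ, (𝓑 i t).PosSemidef
  mem : ∀ t ∈ Set.Icc 0 τ, S.avg 𝓑 t ∈ U
  integrable : ∀ i p q,
    IntervalIntegrable (fun s => S.field f h γ 𝓑 i s p q) volume 0 τ
  equation : ∀ i, ∀ t ∈ Set.Icc 0 τ, ∀ p q,
    𝓑 i t p q = S.init i p q + ∫ s in (0 : ℝ)..t, S.field f h γ 𝓑 i s p q

end Setup

/-- `𝓓²(t) = (1/d) ∑ᵢ tr(𝓑₁₁,ᵢ(t) - 2 𝓑₁₂,ᵢ(t) + 𝓑₂₂,ᵢ(t))`. -/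
def distSq {ℓ d : ℕ} (𝓑 : Fin d → ℝ → GramMat ℓ) (t : ℝ) : ℝ :=
  (1 / (d : ℝ)) * ∑ i, ((𝓑 i t).toBlocks₁₁ - 2 • (𝓑 i t).toBlocks₁₂ + (𝓑 i t).toBlocks₂₂).trace

/-! ### Step size schedules and overwhelming probability -/

/-- On `[0, T]` the step sizes `γ(k/d)` seen by the algorithm represent the function `γ` up to a
power of `d`, in the mean. It holds for all `γ` that are piecewise Hölder or of bounded variation. -/
def SampledAtRate (γ : ℝ → ℝ) (T : ℝ) : Prop :=
  ∃ C β : ℝ, 0 < β ∧ ∀ d : ℕ, 1 ≤ d →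
    ∫ s in (0 : ℝ)..T, |γ s - γ ((⌊s * d⌋₊ : ℝ) / d)| ≤ C * (d : ℝ) ^ (-β)

/-- The events `E d` hold with overwhelming probability: `E d` has probability at least
`1 - e^{-w(d)}` with `w(d) / log d → ∞`. -/
def WithOverwhelmingProbability {Ω : ℕ → Type*} [∀ d, MeasurableSpace (Ω d)]
    (P : ∀ d, Measure (Ω d)) (E : ∀ d, Set (Ω d)) : Prop :=
  ∃ w : ℕ → ℝ, Tendsto (fun d : ℕ => w d / Real.log d) atTop atTop ∧
    ∀ d, P d (E d)ᶜ ≤ ENNReal.ofReal (Real.exp (-w d))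

end HighDimSGD

end

/-! The descent inequality is pointwise. If `∇ₓf` vanishes at `x = x⋆`, then `x⋆` minimizes the
convex function of `x`; a gradient step of length `1/L̂` from `x` lowers the value by at least
`‖∇ₓf‖²/(2L̂)`, while convexity bounds the whole gap to the minimum by `⟨x - x⋆, ∇ₓf⟩`. The almost
sure criticality of `x⋆` depends only on the covariance of `x⋆`, so the inequality can be integrated
over every Gaussian `r` with the right lower block (`Admissible.descentCondition`). It also bounds
`∇ₓf` linearly in `x - x⋆`, which makes all gradient terms integrable.

The gradient of `h` is linked to `f` by differentiating the risk along a line of parameters in two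
ways: by the chain rule for `h`, and under the integral sign (`integral_inner_gradX_eq_fderiv`).
This takes the place of Gaussian integration by parts. It shows that `𝓓²` has derivative `-2γ 𝔼⟨x -
x⋆, ∇ₓf⟩ + γ² (tr K / d) 𝔼‖∇ₓf‖²`, which is nonpositive for the admitted step sizes
(`Admissible.sum_blockDist_field_nonpos`). As the `x⋆`-blocks do not move, the monotonicity bounds
the traces of a solution a priori.

For existence, the coefficients are Lipschitz on bounded parts of `U`. They are extended to the
whole space, the extended equation is solved by Picard iteration, and the a priori bound together
with the margin keeps the solution where nothing was changed (`Admissible.exists_isSolution`).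
Positivity holds because a time step of the equation is, up to second order, a congruence plus a
positive semidefinite matrix.

For the comparison with SGD, let `wᵢ = Wᵀωᵢ` and consider the spectral moments `Mⱼ = ∑ᵢ μᵢʲ wᵢ ⊗ wᵢ`
with `μᵢ = λᵢ/(2b) ∈ [0, 1/2]`. The drift of `Mⱼ` involves only `Mⱼ₊₁` and functions of `M₁`, and
the moments decay like `2⁻ʲ`, so the first `d + 2` of them form a closed system up to an error
`O(1/d)`. Their deviation `Δ` from the curve lives in a Hilbert space. One step of SGD changes `Δ`
by `O(1/d)` in every moment, with mean at most a constant times `‖Δ‖/d + e`, where `e` collects a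
fluctuation of order `d^(-3/2)` and the error of sampling `γ` in that step. Hence `𝔼(‖Δ‖² + ρ²)^p`
grows by a factor `1 + G(1/d + e/ρ)` per step and stays comparable to `ρ^(2p)` during `O(d)` steps,
as long as the iterate remains in a tube of radius `θ`
(`Setup.Controlled.lintegral_deviation_update_le`). Leaving the tube thus has probability `O(d
(ρ/θ)^(2p))`. With `ρ = d^(-s)`, `θ = d^(-s/2)` and `p` arbitrary this beats every power of `d`. The
zeroth moment carries both squared distances. -/

noncomputable section

namespace HighDimSGD

/-! ### The gradient of the outer function -/

section OuterFunction

variable {ℓ : ℕ}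

@[simp] lemma fstPart_join (x y : Obs ℓ) : fstPart (join x y) = x := rfl

@[simp] lemma sndPart_join (x y : Obs ℓ) : sndPart (join x y) = y := rfl

@[simp] lemma join_fstPart_sndPart (r : ObsPlus ℓ) : join (fstPart r) (sndPart r) = r := by
  ext i; rcases i with i | i <;> rfl

lemma gradX_join (f : ObsPlus ℓ → Obs ℓ → ℝ) (x y e : Obs ℓ) :
    gradX f (join x y) e = gradient (fun x => f (join x y) e) x := rfl

lemma continuous_join : Continuous (fun p : Obs ℓ × Obs ℓ => join p.1 p.2) := by
  unfold join
  refine (PiLp.continuous_toLp 2 _).comp (continuous_pi fun i => ?_)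
  rcases i with i | i <;> simp <;> fun_prop

lemma continuous_fstPart : Continuous (fstPart : ObsPlus ℓ → Obs ℓ) := by
  unfold fstPart; fun_prop

lemma continuous_sndPart : Continuous (sndPart : ObsPlus ℓ → Obs ℓ) := by
  unfold sndPart; fun_prop

variable {Lhat : ℝ} {f : ObsPlus ℓ → Obs ℓ → ℝ}

lemma ConvexSmoothOuter.hasGradientAt (hc : ConvexSmoothOuter Lhat f) (x y e : Obs ℓ) :
    HasGradientAt (fun x => f (join x y) e) (gradX f (join x y) e) x :=
  (((hc.contDiff y e).differentiable one_ne_zero) x).hasGradientAt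

lemma ConvexSmoothOuter.hasDerivAt_comp (hc : ConvexSmoothOuter Lhat f) (x v y e : Obs ℓ) (s : ℝ) :
    HasDerivAt (fun s : ℝ => f (join (x + s • v) y) e)
      (inner ℝ (gradX f (join (x + s • v) y) e) v) s := by
  have h1 : HasDerivAt (fun s : ℝ => x + s • v) v s := by
    simpa using ((hasDerivAt_id s).smul_const v).const_add x
  have h2 := (hc.hasGradientAt (x + s • v) y e).hasFDerivAt.comp_hasDerivAt s h1
  exact h2.congr_deriv (by simp)

/-- As `f` is only jointly measurable, each component of the gradient is written as the pointwise
limit of difference quotients of step `1/(n+1)` along a coordinate vector. -/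
lemma ConvexSmoothOuter.measurable_gradX (hc : ConvexSmoothOuter Lhat f)
    (hm : Measurable (fun p : ObsPlus ℓ × Obs ℓ => f p.1 p.2)) :
    Measurable (fun p : ObsPlus ℓ × Obs ℓ => gradX f p.1 p.2) := by
  suffices h : ∀ q, Measurable (fun p : ObsPlus ℓ × Obs ℓ => gradX f p.1 p.2 q) by
    exact (WithLp.measurable_toLp 2 (Fin ℓ → ℝ)).comp (measurable_pi_iff.2 h)
  intro q
  refine measurable_of_tendsto_metrizable (f := fun (n : ℕ) (p : ObsPlus ℓ × Obs ℓ) =>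
    ((1 : ℝ) / (n + 1))⁻¹ * (f (join (fstPart p.1 + (0 + (1 : ℝ) / (n + 1)) •
      EuclideanSpace.single q (1 : ℝ)) (sndPart p.1)) p.2 -
      f (join (fstPart p.1 + (0 : ℝ) • EuclideanSpace.single q (1 : ℝ)) (sndPart p.1)) p.2)) ?_ ?_
  · intro n
    have key : ∀ v : Obs ℓ, Measurable (fun p : ObsPlus ℓ × Obs ℓ =>
        f (join (fstPart p.1 + v) (sndPart p.1)) p.2) := fun v =>
      hm.comp (f := fun p : ObsPlus ℓ × Obs ℓ => (join (fstPart p.1 + v) (sndPart p.1), p.2))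
        (Measurable.prodMk (continuous_join.measurable.comp (Measurable.prodMk
          ((continuous_fstPart.measurable.comp measurable_fst).add_const _)
          (continuous_sndPart.measurable.comp measurable_fst))) measurable_snd)
    exact ((key _).sub (key _)).const_mul _
  · rw [tendsto_pi_nhds]
    intro p
    have h := hc.hasDerivAt_comp (fstPart p.1) (EuclideanSpace.single q (1 : ℝ)) (sndPart p.1) p.2 0
    have h2 := h.tendsto_slope_zero
    have h3 : Tendsto (fun n : ℕ => (1 : ℝ) / (n + 1)) atTop (𝓝[≠] 0) := by
      refine tendsto_nhdsWithin_iff.2 ⟨tendsto_one_div_add_atTop_nhds_zero_nat, ?_⟩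
      filter_upwards with n
      have : (0 : ℝ) < 1 / (n + 1) := by positivity
      exact this.ne'
    have h4 := h2.comp h3
    simp only [zero_smul, add_zero, join_fstPart_sndPart] at h4
    simp only [zero_smul, add_zero, join_fstPart_sndPart]
    rw [EuclideanSpace.inner_single_right] at h4
    simpa [Function.comp_def] using h4

lemma gradX_eq_zero_of_isMin (x y e : Obs ℓ)
    (h : ∀ x', f (join x y) e ≤ f (join x' y) e) : gradX f (join x y) e = 0 := by
  have : IsLocalMin (fun x => f (join x y) e) x := Filter.Eventually.of_forall h
  rw [gradX_join, gradient, this.fderiv_eq_zero, map_zero]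

/-- On the segment from `x` to `x'` the function is convex in one variable, so its slope over `[0,
1]` is at least its derivative at `0`. -/
lemma ConvexSmoothOuter.le_of_gradient (hc : ConvexSmoothOuter Lhat f) (x x' y e : Obs ℓ) :
    f (join x y) e + inner ℝ (gradX f (join x y) e) (x' - x) ≤ f (join x' y) e := by
  have hcv := hc.convex y e
  have h1 : ConvexOn ℝ Set.univ (fun s : ℝ => f (join (x + s • (x' - x)) y) e) := by
    have := hcv.comp_affineMap (AffineMap.lineMap x x')
    simpa [Function.comp_def, AffineMap.lineMap_apply, add_comm] using this
  have h2 := hc.hasDerivAt_comp x (x' - x) y e 0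
  have h3 := h1.le_slope_of_hasDerivAt (Set.mem_univ 0) (Set.mem_univ 1) one_pos h2
  simp [slope_def_field] at h3
  linarith

/-- The point `x - g/L̂`, where `g` is the gradient at `x`, minimizes the quadratic upper bound and
lowers the value by `‖g‖²/(2L̂)`. The value there is still at least the value at the critical point
`y`, and convexity bounds the gap between `x` and `y` by `⟨x - y, g⟩`. -/
lemma ConvexSmoothOuter.descent (hc : ConvexSmoothOuter Lhat f) (hL : 0 < Lhat) {y e : Obs ℓ}
    (h0 : gradX f (join y y) e = 0) (x : Obs ℓ) :
    1 / (2 * Lhat) * ‖gradX f (join x y) e‖ ^ 2 ≤ inner ℝ (x - y) (gradX f (join x y) e) := by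
  set g := gradX f (join x y) e with hg
  have h1 := hc.le_of_gradient y (x - (1 / Lhat) • g) y e
  have h2 := hc.smooth y e x (x - (1 / Lhat) • g)
  have h3 := hc.le_of_gradient x y y e
  rw [h0, inner_zero_left, add_zero] at h1
  rw [← hg] at h2 h3
  have e1 : x - (1 / Lhat) • g - x = -((1 / Lhat) • g) := by abel
  rw [e1, inner_neg_right, real_inner_smul_right, real_inner_self_eq_norm_sq, norm_neg, norm_smul,
    mul_pow, Real.norm_eq_abs, sq_abs] at h2
  have e2 : inner ℝ g (y - x) = - inner ℝ (x - y) g := by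
    rw [← neg_sub x y, inner_neg_right, real_inner_comm]
  rw [e2] at h3
  have e3 : Lhat / 2 * ((1 / Lhat) ^ 2 * ‖g‖ ^ 2) = 1 / (2 * Lhat) * ‖g‖ ^ 2 := by
    field_simp
  have e4 : 1 / Lhat * ‖g‖ ^ 2 = 2 * (1 / (2 * Lhat) * ‖g‖ ^ 2) := by field_simp
  linarith

/-- Cauchy-Schwarz in the descent inequality. This linear growth is what dominates all later
expectations involving the gradient. -/
lemma ConvexSmoothOuter.norm_gradX_le (hc : ConvexSmoothOuter Lhat f) (hL : 0 < Lhat) {y e : Obs ℓ}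
    (h0 : gradX f (join y y) e = 0) (x : Obs ℓ) :
    ‖gradX f (join x y) e‖ ≤ 2 * Lhat * ‖x - y‖ := by
  have h1 := hc.descent hL h0 x
  have h2 := real_inner_le_norm (x - y) (gradX f (join x y) e)
  rcases (norm_nonneg (gradX f (join x y) e)).eq_or_lt with h | h
  · rw [← h]; positivity
  · have h3 : ‖gradX f (join x y) e‖ ^ 2 ≤ 2 * Lhat * (‖x - y‖ * ‖gradX f (join x y) e‖) := by
      have := h1.trans h2
      rw [one_div, inv_mul_le_iff₀ (by positivity)] at this
      exact this
    nlinarith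

end OuterFunction

/-! ### Linear images and moments of Gaussian vectors -/

section Gaussian

set_option linter.unusedSectionVars false

variable {n m : Type*} [Fintype n] [DecidableEq n] [Fintype m] [DecidableEq m]

/-- The linear map `a ↦ Wᵀ a` between Euclidean spaces. -/
def applyT (W : Matrix n m ℝ) (a : EuclideanSpace ℝ n) : EuclideanSpace ℝ m :=
  WithLp.toLp 2 (Wᵀ *ᵥ a.ofLp)

lemma continuous_applyT (W : Matrix n m ℝ) : Continuous (applyT W) := by
  unfold applyT
  refine (PiLp.continuous_toLp 2 _).comp (continuous_const.matrix_mulVec ?_)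
  exact PiLp.continuous_ofLp 2 _

lemma inner_applyT (W : Matrix n m ℝ) (a : EuclideanSpace ℝ n) (t : EuclideanSpace ℝ m) :
    inner ℝ (applyT W a) t = inner ℝ a (WithLp.toLp 2 (W *ᵥ t.ofLp)) := by
  simp only [applyT, EuclideanSpace.inner_eq_star_dotProduct, star_trivial]
  rw [dotProduct_mulVec, vecMul_transpose]

variable {K : Matrix n n ℝ}

lemma posSemidef_gram (hK : K.PosSemidef) (W : Matrix n m ℝ) : (Wᵀ * K * W).PosSemidef := by
  have := hK.conjTranspose_mul_mul_same W
  simpa [conjTranspose_eq_transpose_of_trivial] using this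

/-- Comparison of characteristic functions, which needs no invertibility of `K`. This moves
expectations between the ambient space and the `2ℓ`-dimensional space of `r`. -/
lemma map_applyT_multivariateGaussian (hK : K.PosSemidef) (W : Matrix n m ℝ) :
    (multivariateGaussian 0 K).map (applyT W) = multivariateGaussian 0 (Wᵀ * K * W) := by
  have : IsProbabilityMeasure ((multivariateGaussian 0 K).map (applyT W)) :=
    Measure.isProbabilityMeasure_map (continuous_applyT W).measurable.aemeasurable
  apply Measure.ext_of_charFun
  ext t
  rw [charFun_apply, integral_map (continuous_applyT W).measurable.aemeasurable
    (by fun_prop)]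
  simp_rw [inner_applyT]
  rw [← charFun_apply, charFun_multivariateGaussian hK,
    charFun_multivariateGaussian (posSemidef_gram hK W)]
  simp only [inner_zero_right]
  have : (W *ᵥ t.ofLp) ⬝ᵥ K *ᵥ (W *ᵥ t.ofLp) = t.ofLp ⬝ᵥ (Wᵀ * K * W) *ᵥ t.ofLp := by
    rw [← mulVec_mulVec, ← mulVec_mulVec, dotProduct_mulVec t.ofLp, vecMul_transpose]
  simp only [this, Complex.ofReal_zero, zero_mul]

lemma map_dotProduct_multivariateGaussian (hK : K.PosSemidef) (l : n → ℝ) :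
    (multivariateGaussian 0 K).map (fun a => l ⬝ᵥ a.ofLp)
      = gaussianReal 0 (l ⬝ᵥ K *ᵥ l).toNNReal := by
  have hm : Measurable (fun a : EuclideanSpace ℝ n => l ⬝ᵥ a.ofLp) := by
    unfold dotProduct; fun_prop
  have : IsProbabilityMeasure ((multivariateGaussian 0 K).map (fun a => l ⬝ᵥ a.ofLp)) :=
    Measure.isProbabilityMeasure_map hm.aemeasurable
  apply Measure.ext_of_charFun
  ext t
  rw [charFun_apply, integral_map hm.aemeasurable (by fun_prop)]
  have h1 : ∀ a : EuclideanSpace ℝ n, inner ℝ (l ⬝ᵥ a.ofLp) t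
      = inner ℝ a (WithLp.toLp 2 (t • l) : EuclideanSpace ℝ n) := by
    intro a
    simp [EuclideanSpace.inner_eq_star_dotProduct]
  simp_rw [h1]
  rw [← charFun_apply, charFun_multivariateGaussian hK, charFun_gaussianReal]
  have h0 : 0 ≤ l ⬝ᵥ K *ᵥ l := by simpa using hK.dotProduct_mulVec_nonneg l
  have h2 : (t • l) ⬝ᵥ K *ᵥ (t • l) = (l ⬝ᵥ K *ᵥ l) * t ^ 2 := by
    simp [mulVec_smul]; ring
  simp [h2, Real.coe_toNNReal _ h0]

/-- The even moments of the standard normal distribution. -/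
def normalMoment (q : ℕ) : ℝ := ∫ x, x ^ (2 * q) ∂(gaussianReal 0 1)

lemma normalMoment_nonneg (q : ℕ) : 0 ≤ normalMoment q :=
  integral_nonneg fun x => (even_two_mul q).pow_nonneg x

@[simp] lemma normalMoment_zero : normalMoment 0 = 1 := by simp [normalMoment]

@[simp] lemma normalMoment_one : normalMoment 1 = 1 := by
  have h : Var[fun x ↦ x; gaussianReal 0 1] = 1 := by simp
  rw [variance_eq_integral (by fun_prop)] at h
  simpa [normalMoment] using h

lemma integrable_pow_gaussianReal (v : NNReal) (k : ℕ) :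
    Integrable (fun x : ℝ => x ^ k) (gaussianReal 0 v) := by
  have := (memLp_id_gaussianReal' (μ := 0) (v := v) (k : ENNReal) (by simp)).integrable_norm_pow'
  exact (integrable_norm_iff (by fun_prop)).1 (by simpa using this)

lemma integral_even_pow_gaussianReal (v : NNReal) (q : ℕ) :
    ∫ x, x ^ (2 * q) ∂(gaussianReal 0 v) = v ^ q * normalMoment q := by
  have h := gaussianReal_map_const_mul (μ := 0) (v := 1) (Real.sqrt v)
  have h2 : gaussianReal 0 v = (gaussianReal 0 1).map (Real.sqrt v * ·) := by
    rw [h]; congr 1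
    · simp
    · ext; simp
  rw [h2, integral_map (by fun_prop) (by fun_prop)]
  simp_rw [mul_pow, integral_const_mul]
  rw [pow_mul, Real.sq_sqrt v.coe_nonneg, normalMoment]

lemma integrable_dotProduct_pow (hK : K.PosSemidef) (l : n → ℝ) (k : ℕ) :
    Integrable (fun a : EuclideanSpace ℝ n => (l ⬝ᵥ a.ofLp) ^ k) (multivariateGaussian 0 K) := by
  have hm : Measurable (fun a : EuclideanSpace ℝ n => l ⬝ᵥ a.ofLp) := by
    unfold dotProduct; fun_prop
  have := integrable_pow_gaussianReal (l ⬝ᵥ K *ᵥ l).toNNReal k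
  rw [← map_dotProduct_multivariateGaussian hK] at this
  exact this.comp_measurable hm

lemma integral_dotProduct_even_pow (hK : K.PosSemidef) (l : n → ℝ) (q : ℕ) :
    ∫ a, (l ⬝ᵥ a.ofLp) ^ (2 * q) ∂(multivariateGaussian 0 K)
      = (l ⬝ᵥ K *ᵥ l) ^ q * normalMoment q := by
  have hm : Measurable (fun a : EuclideanSpace ℝ n => l ⬝ᵥ a.ofLp) := by
    unfold dotProduct; fun_prop
  have h0 : 0 ≤ l ⬝ᵥ K *ᵥ l := by simpa using hK.dotProduct_mulVec_nonneg l
  have := integral_even_pow_gaussianReal (l ⬝ᵥ K *ᵥ l).toNNReal q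
  rw [← map_dotProduct_multivariateGaussian hK, integral_map hm.aemeasurable (by fun_prop),
    Real.coe_toNNReal _ h0] at this
  exact this

/-- Jensen's inequality for powers of a finite sum, with positive weights `w`. -/
lemma sum_pow_le_weighted {I : Type*} [Fintype I] [Nonempty I] (w x : I → ℝ) (hw : ∀ k, 0 < w k)
    (hx : ∀ k, 0 ≤ x k) (q : ℕ) :
    (∑ k, x k) ^ q ≤ ∑ k, w k / (∑ j, w j) * ((∑ j, w j) / w k * x k) ^ q := by
  have hW : 0 < ∑ j, w j := Finset.sum_pos (fun k _ => hw k) Finset.univ_nonempty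
  have h := Real.pow_arith_mean_le_arith_mean_pow Finset.univ (fun k => w k / (∑ j, w j))
    (fun k => (∑ j, w j) / w k * x k) (fun k _ => (div_pos (hw k) hW).le)
    (by rw [← Finset.sum_div, div_self hW.ne'])
    (fun k _ => mul_nonneg (div_pos hW (hw k)).le (hx k)) q
  have e : ∀ k, w k / (∑ j, w j) * ((∑ j, w j) / w k * x k) = x k := by
    intro k
    have := (hw k).ne'
    field_simp
  simp_rw [e] at h
  exact h

lemma integrable_sum_sq_pow (hK : K.PosSemidef) {I : Type*} [Fintype I] (l : I → n → ℝ) (q : ℕ) :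
    Integrable (fun a : EuclideanSpace ℝ n => (∑ k, (l k ⬝ᵥ a.ofLp) ^ 2) ^ q)
      (multivariateGaussian 0 K) := by
  classical
  rcases isEmpty_or_nonempty I with hI | hI
  · simp
  have hm : ∀ k, Measurable (fun a : EuclideanSpace ℝ n => l k ⬝ᵥ a.ofLp) := by
    intro k; unfold dotProduct; fun_prop
  -- Jensen with equal weights reduces to even moments of single Gaussian variables.
  refine Integrable.mono' (g := fun a => ∑ k, 1 / (∑ j : I, (1 : ℝ)) * ((∑ j : I, (1 : ℝ)) / 1) ^ q *
    (l k ⬝ᵥ a.ofLp) ^ (2 * q)) ?_ ?_ ?_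
  · exact integrable_finsetSum _ fun k _ => (integrable_dotProduct_pow hK _ _).const_mul _
  · exact ((Finset.measurable_sum _ fun k _ => (hm k).pow_const 2).pow_const q).aestronglyMeasurable
  · filter_upwards with a
    rw [Real.norm_of_nonneg (by positivity)]
    refine (sum_pow_le_weighted (fun _ => 1) _ (fun _ => one_pos) (fun k => sq_nonneg _) q).trans
      (le_of_eq ?_)
    refine Finset.sum_congr rfl fun k _ => ?_
    rw [mul_pow, ← pow_mul, mul_assoc]

/-- Moments of a sum of squares of Gaussian variables whose variances are at most `w k`. -/
lemma integral_sum_sq_pow_le (hK : K.PosSemidef) {I : Type*} [Fintype I] (l : I → n → ℝ)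
    (w : I → ℝ) (hw : ∀ k, 0 < w k) (hl : ∀ k, l k ⬝ᵥ K *ᵥ l k ≤ w k) (q : ℕ) :
    ∫ a, (∑ k, (l k ⬝ᵥ a.ofLp) ^ 2) ^ q ∂(multivariateGaussian 0 K)
      ≤ (∑ k, w k) ^ q * normalMoment q := by
  rcases isEmpty_or_nonempty I with hI | hI
  · rcases q with _ | q <;> simp
  have hW : 0 < ∑ j, w j := Finset.sum_pos (fun k _ => hw k) Finset.univ_nonempty
  -- Weights proportional to `w k` make the `k`-th term a share `w k / ∑ w` of the final bound. The
  -- result depends only on the total variance and not on the number of functionals, which will grow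
  -- with the dimension.
  calc ∫ a, (∑ k, (l k ⬝ᵥ a.ofLp) ^ 2) ^ q ∂(multivariateGaussian 0 K)
      ≤ ∫ a, ∑ k, w k / (∑ j, w j) * ((∑ j, w j) / w k) ^ q * (l k ⬝ᵥ a.ofLp) ^ (2 * q)
          ∂(multivariateGaussian 0 K) := by
        refine integral_mono (integrable_sum_sq_pow hK l q)
          (integrable_finsetSum _ fun k _ => (integrable_dotProduct_pow hK _ _).const_mul _) ?_
        intro a
        refine (sum_pow_le_weighted w _ hw (fun k => sq_nonneg _) q).trans (le_of_eq ?_)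
        refine Finset.sum_congr rfl fun k _ => ?_
        rw [mul_pow, ← pow_mul, mul_assoc]
    _ = ∑ k, w k / (∑ j, w j) * ((∑ j, w j) / w k) ^ q * ((l k ⬝ᵥ K *ᵥ l k) ^ q * normalMoment q) := by
        rw [integral_finsetSum _ fun k _ => (integrable_dotProduct_pow hK _ _).const_mul _]
        simp_rw [integral_const_mul, integral_dotProduct_even_pow hK]
    _ ≤ ∑ k, w k / (∑ j, w j) * ((∑ j, w j) / w k) ^ q * (w k ^ q * normalMoment q) := by
        refine Finset.sum_le_sum fun k _ => ?_
        have h0 : 0 ≤ l k ⬝ᵥ K *ᵥ l k := by simpa using hK.dotProduct_mulVec_nonneg (l k)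
        have := hw k
        have := normalMoment_nonneg q
        gcongr
        exact hl k
    _ = ∑ k, w k / (∑ j, w j) * ((∑ k, w k) ^ q * normalMoment q) := by
        refine Finset.sum_congr rfl fun k _ => ?_
        rw [div_pow]
        have := (pow_pos (hw k) q).ne'
        field_simp
    _ = (∑ k, w k) ^ q * normalMoment q := by
        rw [← Finset.sum_mul, ← Finset.sum_div, div_self hW.ne', one_mul]

/-- The coefficients of a Gaussian vector in an orthonormal eigenbasis of its covariance are
independent. -/
lemma map_eigenbasis_multivariateGaussian (hK : K.PosSemidef) (lam : n → ℝ)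
    (b : OrthonormalBasis n ℝ (EuclideanSpace ℝ n))
    (hb : ∀ i, K *ᵥ (b i).ofLp = lam i • (b i).ofLp) (hlam : ∀ i, 0 ≤ lam i) :
    (multivariateGaussian 0 K).map (fun a i => (b i).ofLp ⬝ᵥ a.ofLp)
      = Measure.pi fun i => gaussianReal 0 (lam i).toNNReal := by
  set W : Matrix n n ℝ := Matrix.of fun j i => b i j with hW
  have hWe : ∀ t : n → ℝ, W *ᵥ t = ∑ i, t i • (b i).ofLp := by
    intro t
    ext j
    simp [hW, mulVec, dotProduct, mul_comm]
  have horth : ∀ i j, (b i).ofLp ⬝ᵥ (b j).ofLp = if i = j then 1 else 0 := by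
    intro i j
    have := orthonormal_iff_ite.1 b.orthonormal j i
    simp only [EuclideanSpace.inner_eq_star_dotProduct, star_trivial] at this
    rw [this]
    simp [eq_comm]
  have hquad : ∀ t : n → ℝ, t ⬝ᵥ (Wᵀ * K * W) *ᵥ t = ∑ i, lam i * t i ^ 2 := by
    intro t
    rw [← mulVec_mulVec, ← mulVec_mulVec, dotProduct_mulVec t, vecMul_transpose, hWe, mulVec_sum]
    simp_rw [mulVec_smul, hb, sum_dotProduct, dotProduct_sum, smul_dotProduct, dotProduct_smul,
      horth]
    refine Finset.sum_congr rfl fun i _ => ?_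
    simp; ring
  -- In the eigenbasis the quadratic form of the covariance is diagonal, so both characteristic
  -- functions are the same product.
  have key : (Measure.pi fun i => gaussianReal 0 (lam i).toNNReal).map (WithLp.toLp 2)
      = (multivariateGaussian 0 K).map (applyT W) := by
    rw [map_applyT_multivariateGaussian hK]
    have : IsProbabilityMeasure ((Measure.pi fun i => gaussianReal 0 (lam i).toNNReal).map
      (WithLp.toLp 2)) := Measure.isProbabilityMeasure_map (by fun_prop)
    apply Measure.ext_of_charFun (E := EuclideanSpace ℝ n)
    ext t
    rw [charFun_pi, charFun_multivariateGaussian (posSemidef_gram hK W), hquad]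
    simp_rw [charFun_gaussianReal, Real.coe_toNNReal _ (hlam _)]
    rw [← Complex.exp_sum]
    congr 1
    simp [Finset.sum_div]
  have key2 := congrArg (Measure.map (WithLp.ofLp)) key
  rw [Measure.map_map (by fun_prop) (by fun_prop),
    Measure.map_map (by fun_prop) (continuous_applyT W).measurable] at key2
  have e : (WithLp.ofLp ∘ applyT W) = fun (a : EuclideanSpace ℝ n) i => (b i).ofLp ⬝ᵥ a.ofLp := by
    ext a i
    simp [applyT, hW, mulVec, dotProduct]
  rw [← e, ← key2]
  exact (Measure.map_id (μ := Measure.pi fun i => gaussianReal 0 (lam i).toNNReal))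

/-- The summands are independent and centred, so the variances add. For bounded `c` and `lam` the
second moment is therefore of order `d`, whereas the sum has `d` terms of order one; this is the
concentration on which the comparison with SGD rests. -/
lemma integral_sq_weighted_sum_sq_sub_le (hK : K.PosSemidef) (lam : n → ℝ)
    (b : OrthonormalBasis n ℝ (EuclideanSpace ℝ n))
    (hb : ∀ i, K *ᵥ (b i).ofLp = lam i • (b i).ofLp) (hlam : ∀ i, 0 ≤ lam i) (c : n → ℝ) :
    ∫ a, (∑ i, c i * (((b i).ofLp ⬝ᵥ a.ofLp) ^ 2 - lam i)) ^ 2 ∂(multivariateGaussian 0 K)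
      ≤ ∑ i, c i ^ 2 * lam i ^ 2 * normalMoment 2 := by
  have hm : Measurable (fun (a : EuclideanSpace ℝ n) i => (b i).ofLp ⬝ᵥ a.ofLp) := by
    unfold dotProduct; fun_prop
  have hm' : Measurable (fun x : n → ℝ => (∑ i, c i * (x i ^ 2 - lam i)) ^ 2) := by
    refine Measurable.pow_const (Finset.measurable_sum _ fun i _ => ?_) 2
    exact (((measurable_pi_apply i).pow_const 2).sub_const _).const_mul _
  have hL : ∀ i, MemLp (fun x : ℝ => c i * (x ^ 2 - lam i)) 2
      (gaussianReal 0 (lam i).toNNReal) := by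
    intro i
    refine MemLp.const_mul (MemLp.sub ?_ (memLp_const _)) _
    rw [memLp_two_iff_integrable_sq (by fun_prop)]
    simp_rw [← pow_mul]
    exact integrable_pow_gaussianReal _ _
  have h0 : ∀ i, ∫ x, c i * (x ^ 2 - lam i) ∂(gaussianReal 0 (lam i).toNNReal) = 0 := by
    intro i
    rw [integral_const_mul, integral_sub (integrable_pow_gaussianReal _ _) (integrable_const _)]
    have := integral_even_pow_gaussianReal (lam i).toNNReal 1
    simp [Real.coe_toNNReal _ (hlam i)] at this
    simp [this]
  have hv := variance_sum_pi hL
  have e1 : ∫ a, (∑ i, c i * (((b i).ofLp ⬝ᵥ a.ofLp) ^ 2 - lam i)) ^ 2 ∂(multivariateGaussian 0 K)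
      = ∫ x, (∑ i, c i * (x i ^ 2 - lam i)) ^ 2
        ∂(Measure.pi fun i => gaussianReal 0 (lam i).toNNReal) := by
    rw [← map_eigenbasis_multivariateGaussian hK lam b hb hlam,
      integral_map hm.aemeasurable hm'.aestronglyMeasurable]
  have e2 : ∫ x, ∑ i, c i * (x i ^ 2 - lam i)
        ∂(Measure.pi fun i => gaussianReal 0 (lam i).toNNReal) = 0 := by
    rw [integral_finsetSum]
    · refine Finset.sum_eq_zero fun i _ => ?_
      exact (integral_comp_eval (i := i) (μ := fun i => gaussianReal 0 (lam i).toNNReal)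
        (f := fun x => c i * (x ^ 2 - lam i)) (by fun_prop)).trans (h0 i)
    · intro i _
      exact integrable_comp_eval (μ := fun i => gaussianReal 0 (lam i).toNNReal)
        (f := fun x => c i * (x ^ 2 - lam i)) ((hL i).integrable one_le_two)
  rw [variance_eq_integral (by fun_prop)] at hv
  simp only [Finset.sum_apply, e2, sub_zero] at hv
  rw [e1, hv]
  refine Finset.sum_le_sum fun i _ => ?_
  rw [variance_of_integral_eq_zero (by fun_prop) (h0 i)]
  calc ∫ x, (c i * (x ^ 2 - lam i)) ^ 2 ∂(gaussianReal 0 (lam i).toNNReal)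
      = ∫ x, c i ^ 2 * (x ^ 4 - 2 * lam i * x ^ 2 + lam i ^ 2)
          ∂(gaussianReal 0 (lam i).toNNReal) := by
        refine integral_congr_ae (ae_of_all _ fun x => ?_); simp only; ring
    _ = c i ^ 2 * (lam i ^ 2 * normalMoment 2 - lam i ^ 2) := by
        have i4 := integral_even_pow_gaussianReal (lam i).toNNReal 2
        have i2 := integral_even_pow_gaussianReal (lam i).toNNReal 1
        have j4 := integrable_pow_gaussianReal (lam i).toNNReal 4
        have j2 := integrable_pow_gaussianReal (lam i).toNNReal 2
        simp only [Real.coe_toNNReal _ (hlam i), Nat.reduceMul, normalMoment_one, mul_one,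
          pow_one] at i4 i2
        have k : Integrable (fun x : ℝ => x ^ 4 - 2 * lam i * x ^ 2)
          (gaussianReal 0 (lam i).toNNReal) := j4.sub (j2.const_mul _)
        rw [integral_const_mul, integral_add k (integrable_const _),
          integral_sub j4 (j2.const_mul _), integral_const_mul, i4, i2]
        simp; left; ring
    _ ≤ c i ^ 2 * lam i ^ 2 * normalMoment 2 := by nlinarith [mul_nonneg (sq_nonneg (c i)) (sq_nonneg (lam i))]

end Gaussian

/-! ### Gaussian samples with independent noise -/

section Model

set_option linter.unusedSectionVars false

variable {n m : Type*} [Fintype n] [DecidableEq n] [Fintype m] [DecidableEq m] {ℓ : ℕ}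

/-- The law of independent `a ∼ N(0, K)` and `ε ∼ N(0, I)`. -/
def modelLaw (ℓ : ℕ) (K : Matrix n n ℝ) : Measure (EuclideanSpace ℝ n × Obs ℓ) :=
  (multivariateGaussian 0 K).prod (stdGaussian (Obs ℓ))

lemma jointLaw_eq_modelLaw (B : GramMat ℓ) : jointLaw B = modelLaw ℓ B := rfl

lemma contract_eq_applyT {d : ℕ} (X : Matrix (Fin d) (Fin ℓ) ℝ) (a : EuclideanSpace ℝ (Fin d)) :
    contract X a = applyT X a := rfl

lemma measurable_applyT_fst (W : Matrix n m ℝ) :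
    Measurable (fun p : EuclideanSpace ℝ n × Obs ℓ => applyT W p.1) :=
  (continuous_applyT W).measurable.comp measurable_fst

lemma map_applyT_modelLaw {K : Matrix n n ℝ} (hK : K.PosSemidef) (W : Matrix n m ℝ) :
    (modelLaw ℓ K).map (fun p => (applyT W p.1, p.2)) = modelLaw ℓ (Wᵀ * K * W) := by
  unfold modelLaw
  rw [← map_applyT_multivariateGaussian hK]
  have := Measure.map_prod_map (multivariateGaussian 0 K) (stdGaussian (Obs ℓ))
    (continuous_applyT W).measurable measurable_id
  rw [Measure.map_id] at this
  rw [this]; rfl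

lemma applyT_fromCols (X Y : Matrix n (Fin ℓ) ℝ) (a : EuclideanSpace ℝ n) :
    applyT (Matrix.fromCols X Y) a = join (applyT X a) (applyT Y a) := by
  ext i; rcases i with i | i <;> simp [applyT, join, mulVec, dotProduct]

lemma applyT_add_smul (X Y : Matrix n m ℝ) (s : ℝ) (a : EuclideanSpace ℝ n) :
    applyT (X + s • Y) a = applyT X a + s • applyT Y a := by
  ext i; simp [applyT, transpose_add, add_mulVec, smul_mulVec]

lemma applyT_sub (X Y : Matrix n m ℝ) (a : EuclideanSpace ℝ n) :
    applyT (X - Y) a = applyT X a - applyT Y a := by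
  ext i; simp [applyT, transpose_sub, sub_mulVec]

lemma norm_applyT_sq (W : Matrix n m ℝ) (a : EuclideanSpace ℝ n) :
    ‖applyT W a‖ ^ 2 = ∑ k, ((fun i => W i k) ⬝ᵥ a.ofLp) ^ 2 := by
  rw [EuclideanSpace.real_norm_sq_eq]; rfl

lemma integrable_norm_applyT_pow {K : Matrix n n ℝ} (hK : K.PosSemidef) (W : Matrix n m ℝ) (q : ℕ) :
    Integrable (fun p : EuclideanSpace ℝ n × Obs ℓ => (‖applyT W p.1‖ ^ 2) ^ q)
      (modelLaw ℓ K) := by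
  simp_rw [norm_applyT_sq]
  exact (integrable_sum_sq_pow hK (fun k i => W i k) q).comp_fst _

/-- At almost every sample the point `y = x⋆` is critical for the outer function, where the
hidden parameter has covariance `G`. -/
def CriticalAE (f : ObsPlus ℓ → Obs ℓ → ℝ) (G : Matrix (Fin ℓ) (Fin ℓ) ℝ) : Prop :=
  ∀ᵐ p ∂modelLaw ℓ G, gradX f (join p.1 p.1) p.2 = 0

variable {Lhat : ℝ} {f : ObsPlus ℓ → Obs ℓ → ℝ}

lemma ConvexSmoothOuter.measurableSet_critical (hc : ConvexSmoothOuter Lhat f)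
    (hm : Measurable (fun p : ObsPlus ℓ × Obs ℓ => f p.1 p.2)) :
    MeasurableSet {p : Obs ℓ × Obs ℓ | gradX f (join p.1 p.1) p.2 = 0} := by
  have h : Measurable (fun p : Obs ℓ × Obs ℓ => gradX f (join p.1 p.1) p.2) :=
    (hc.measurable_gradX hm).comp (f := fun p : Obs ℓ × Obs ℓ => (join p.1 p.1, p.2))
      ((continuous_join.comp (continuous_fst.prodMk continuous_fst)).measurable.prodMk
        measurable_snd)
  exact h (measurableSet_singleton 0)

/-- Criticality is an event of `(x⋆, ε)` alone, so it passes to any Gaussian model in which `x⋆` has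
the same covariance. In particular it is available at covariances that do not come from an iterate.
-/
lemma ConvexSmoothOuter.criticalAE_iff (hc : ConvexSmoothOuter Lhat f)
    (hm : Measurable (fun p : ObsPlus ℓ × Obs ℓ => f p.1 p.2))
    {K : Matrix n n ℝ} (hK : K.PosSemidef) (V : Matrix n (Fin ℓ) ℝ) :
    CriticalAE f (Vᵀ * K * V) ↔
      ∀ᵐ p ∂modelLaw ℓ K, gradX f (join (applyT V p.1) (applyT V p.1)) p.2 = 0 := by
  unfold CriticalAE
  rw [← map_applyT_modelLaw hK V,
    ae_map_iff ((measurable_applyT_fst V).prodMk measurable_snd).aemeasurable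
      (hc.measurableSet_critical hm)]

lemma Setup.RiskLossMinimizer.criticalAE {d : ℕ} {S : Setup ℓ d} (h : S.RiskLossMinimizer f)
    (hc : ConvexSmoothOuter Lhat f) (hm : Measurable (fun p : ObsPlus ℓ × Obs ℓ => f p.1 p.2)) :
    CriticalAE f (S.Xstarᵀ * S.K * S.Xstar) := by
  rw [hc.criticalAE_iff hm S.posSemidef]
  filter_upwards [h.loss_min] with p hp
  exact gradX_eq_zero_of_isMin _ _ _ hp

/-- The growth and descent bounds that hold at almost every sample. -/
lemma ConvexSmoothOuter.ae_bounds (hc : ConvexSmoothOuter Lhat f) (hL : 0 < Lhat)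
    (hm : Measurable (fun p : ObsPlus ℓ × Obs ℓ => f p.1 p.2))
    {K : Matrix n n ℝ} (hK : K.PosSemidef) {V : Matrix n (Fin ℓ) ℝ}
    (hcrit : CriticalAE f (Vᵀ * K * V)) :
    ∀ᵐ p ∂modelLaw ℓ K, ∀ x : Obs ℓ,
      ‖gradX f (join x (applyT V p.1)) p.2‖ ≤ 2 * Lhat * ‖x - applyT V p.1‖ ∧
      1 / (2 * Lhat) * ‖gradX f (join x (applyT V p.1)) p.2‖ ^ 2
        ≤ inner ℝ (x - applyT V p.1) (gradX f (join x (applyT V p.1)) p.2) := by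
  filter_upwards [(hc.criticalAE_iff hm hK V).1 hcrit] with p hp x
  exact ⟨hc.norm_gradX_le hL hp x, hc.descent hL hp x⟩

lemma ConvexSmoothOuter.measurable_gradX_applyT (hc : ConvexSmoothOuter Lhat f)
    (hm : Measurable (fun p : ObsPlus ℓ × Obs ℓ => f p.1 p.2)) (W : Matrix n (Fin ℓ ⊕ Fin ℓ) ℝ) :
    Measurable (fun p : EuclideanSpace ℝ n × Obs ℓ => gradX f (applyT W p.1) p.2) :=
  (hc.measurable_gradX hm).comp ((measurable_applyT_fst W).prodMk measurable_snd)

/-- The pseudo-Lipschitz bound compares `f` with `f 0` up to a polynomial in the norms, after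
rounding the exponent `α` up to an integer; Gaussian vectors have all moments. -/
lemma integrable_outer {α Lf : ℝ} (hα : 0 ≤ α)
    (hm : Measurable (fun p : ObsPlus ℓ × Obs ℓ => f p.1 p.2))
    (hf_int : Integrable (fun e : Obs ℓ => f 0 e) (stdGaussian (Obs ℓ)))
    (hf : PseudoLipschitzOuter α Lf f) (K : Matrix n n ℝ) (W : Matrix n (Fin ℓ ⊕ Fin ℓ) ℝ) :
    Integrable (fun p : EuclideanSpace ℝ n × Obs ℓ => f (applyT W p.1) p.2) (modelLaw ℓ K) := by
  set k := ⌈α⌉₊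
  have hpow : ∀ t : ℝ, 0 ≤ t → t ^ α ≤ 1 + t ^ k := by
    intro t ht
    rcases le_total t 1 with h | h
    · have := Real.rpow_le_one ht h hα
      have := pow_nonneg ht k
      linarith
    · have := Real.rpow_le_rpow_of_exponent_le h (Nat.le_ceil α)
      rw [Real.rpow_natCast] at this
      linarith
  have hg : ∀ j : ℕ, Integrable (fun a : EuclideanSpace ℝ n => ‖applyT W a‖ ^ j)
      (multivariateGaussian 0 K) := by
    intro j
    have hG : IsGaussian ((multivariateGaussian 0 K).map (applyT W)) := by
      let Lw : EuclideanSpace ℝ n →ₗ[ℝ] ObsPlus ℓ :=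
        { toFun := applyT W
          map_add' := fun x y => by ext i; simp [applyT, mulVec_add]
          map_smul' := fun c x => by ext i; simp [applyT, mulVec_smul] }
      exact (inferInstance : IsGaussian ((multivariateGaussian 0 K).map
        (LinearMap.toContinuousLinearMap Lw)))
    have := (IsGaussian.memLp_id ((multivariateGaussian 0 K).map (applyT W)) j
      (by simp)).integrable_norm_pow'
    exact this.comp_measurable (continuous_applyT W).measurable
  have he : ∀ j : ℕ, Integrable (fun e : Obs ℓ => ‖e‖ ^ j) (stdGaussian (Obs ℓ)) := fun j =>
    (IsGaussian.memLp_id (stdGaussian (Obs ℓ)) j (by simp)).integrable_norm_pow'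
  refine Integrable.mono' (g := fun p => |f 0 p.2| + |Lf| * (4 * (‖applyT W p.1‖ ^ 1 * 1)
    + ‖applyT W p.1‖ ^ (k + 1) * 1 + ‖applyT W p.1‖ ^ 1 * ‖p.2‖ ^ k)) ?_ ?_ ?_
  · refine (hf_int.abs.comp_snd _).add (Integrable.const_mul ?_ _)
    refine Integrable.add (Integrable.add (Integrable.const_mul ?_ _) ?_) ?_
    · exact (hg 1).mul_prod (integrable_const 1)
    · exact (hg (k + 1)).mul_prod (integrable_const 1)
    · exact (hg 1).mul_prod (he k)
  · exact (hm.comp ((measurable_applyT_fst W).prodMk measurable_snd)).aestronglyMeasurable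
  · filter_upwards with p
    have h1 := hf (applyT W p.1) 0 p.2
    rw [sub_zero, norm_zero] at h1
    have h2 := hpow _ (norm_nonneg (applyT W p.1))
    have h3 := hpow _ (norm_nonneg p.2)
    have h4 : (0 : ℝ) ^ α ≤ 1 := by
      rcases hα.eq_or_lt with h | h
      · rw [← h]; simp
      · rw [Real.zero_rpow h.ne']; norm_num
    have h5 : |f (applyT W p.1) p.2| ≤ |f 0 p.2| + |f (applyT W p.1) p.2 - f 0 p.2| := by
      have := abs_add_le (f 0 p.2) (f (applyT W p.1) p.2 - f 0 p.2)
      simpa using this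
    have h0 := Real.rpow_nonneg (norm_nonneg (applyT W p.1)) α
    have h0' := Real.rpow_nonneg (norm_nonneg p.2) α
    have h0'' := Real.rpow_nonneg (le_refl (0 : ℝ)) α
    have h6 : Lf * ‖applyT W p.1‖ * (1 + ‖applyT W p.1‖ ^ α + 0 ^ α + ‖p.2‖ ^ α)
        ≤ |Lf| * (‖applyT W p.1‖ * (4 + ‖applyT W p.1‖ ^ k + ‖p.2‖ ^ k)) := by
      rw [mul_assoc]
      calc Lf * (‖applyT W p.1‖ * (1 + ‖applyT W p.1‖ ^ α + 0 ^ α + ‖p.2‖ ^ α))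
          ≤ |Lf| * (‖applyT W p.1‖ * (1 + ‖applyT W p.1‖ ^ α + 0 ^ α + ‖p.2‖ ^ α)) := by
            gcongr; exact le_abs_self _
        _ ≤ _ := mul_le_mul_of_nonneg_left (mul_le_mul_of_nonneg_left (by linarith) (norm_nonneg _))
            (abs_nonneg _)
    rw [Real.norm_eq_abs]
    refine h5.trans (add_le_add le_rfl (h1.trans (h6.trans (le_of_eq ?_))))
    ring

variable {α Lf Lh : ℝ} {h : GramMat ℓ → ℝ} {U : Set (GramMat ℓ)}

/-- The derivative of the risk in a direction `Y`, computed in two ways. -/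
lemma integral_inner_gradX_eq_fderiv (hα : 0 ≤ α) (hL : 0 < Lhat)
    (hm : Measurable (fun p : ObsPlus ℓ × Obs ℓ => f p.1 p.2))
    (hf_int : Integrable (fun e : Obs ℓ => f 0 e) (stdGaussian (Obs ℓ)))
    (hf : PseudoLipschitzOuter α Lf f) (hc : ConvexSmoothOuter Lhat f) (hU : IsOpen U)
    (hh : RiskRepresentation α Lh f U h)
    {K : Matrix n n ℝ} (hK : K.PosSemidef) (X V Y : Matrix n (Fin ℓ) ℝ)
    (hcrit : CriticalAE f (Vᵀ * K * V))
    (hmem : (Matrix.fromCols X V)ᵀ * K * Matrix.fromCols X V ∈ U) :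
    ∫ p, inner ℝ (gradX f (applyT (Matrix.fromCols X V) p.1) p.2) (applyT Y p.1) ∂modelLaw ℓ K
      = fderiv ℝ h ((Matrix.fromCols X V)ᵀ * K * Matrix.fromCols X V)
        ((Matrix.fromCols Y 0)ᵀ * K * Matrix.fromCols X V
          + (Matrix.fromCols X V)ᵀ * K * Matrix.fromCols Y 0) := by
  set W := Matrix.fromCols X V with hW
  -- Only the columns of `X` are perturbed. The hidden parameters stay at `V`, so the almost sure
  -- bounds on the gradient hold along the whole line.
  set Z : Matrix n (Fin ℓ ⊕ Fin ℓ) ℝ := Matrix.fromCols Y 0 with hZ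
  have hWs : ∀ s : ℝ, W + s • Z = Matrix.fromCols (X + s • Y) V := by
    intro s
    ext i j; rcases j with j | j <;> simp [hW, hZ]
  set G : ℝ → GramMat ℓ := fun s => (W + s • Z)ᵀ * K * (W + s • Z) with hG
  have hGe : ∀ s, G s = Wᵀ * K * W + s • (Zᵀ * K * W + Wᵀ * K * Z) + s ^ 2 • (Zᵀ * K * Z) := by
    intro s
    simp only [hG, transpose_add, transpose_smul, Matrix.add_mul, Matrix.mul_add, Matrix.smul_mul,
      Matrix.mul_smul, smul_add, smul_smul]
    rw [pow_two]
    abel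
  have hG0 : G 0 = Wᵀ * K * W := by simp [hGe]
  have hGd : HasDerivAt G (Zᵀ * K * W + Wᵀ * K * Z) 0 := by
    have h1 : HasDerivAt (fun s : ℝ => s • (Zᵀ * K * W + Wᵀ * K * Z))
        ((1 : ℝ) • (Zᵀ * K * W + Wᵀ * K * Z)) 0 := (hasDerivAt_id (0 : ℝ)).smul_const _
    have h2 : HasDerivAt (fun s : ℝ => s ^ 2 • (Zᵀ * K * Z))
        ((((2 : ℕ) : ℝ) * 0 ^ (2 - 1)) • (Zᵀ * K * Z)) 0 := (hasDerivAt_pow 2 (0 : ℝ)).smul_const _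
    have h3 := (h1.const_add (Wᵀ * K * W)).add h2
    have e : G = (fun x => Wᵀ * K * W + x • (Zᵀ * K * W + Wᵀ * K * Z)) + fun s => s ^ 2 • (Zᵀ * K * Z) := by
      funext s; exact hGe s
    rw [e]
    exact h3.congr_deriv (by simp)
  have hmem' : ∀ᶠ s in 𝓝 (0 : ℝ), G s ∈ U :=
    hGd.continuousAt.eventually_mem (hU.mem_nhds (by rw [hG0]; exact hmem))
  have hhd : HasFDerivAt h (fderiv ℝ h (G 0)) (G 0) := by
    rw [hG0]
    exact ((hh.contDiffOn.contDiffAt (hU.mem_nhds hmem)).differentiableAt one_ne_zero).hasFDerivAt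
  have hd1 : HasDerivAt (fun s => h (G s)) (fderiv ℝ h (G 0) (Zᵀ * K * W + Wᵀ * K * Z)) 0 :=
    hhd.comp_hasDerivAt 0 hGd
  -- Near `s = 0` the Gram matrix stays in the open set `U`, where `h` is the risk of the perturbed
  -- parameters.
  have hrep : ∀ᶠ s in 𝓝 (0 : ℝ), h (G s)
      = ∫ p, f (applyT (W + s • Z) p.1) p.2 ∂modelLaw ℓ K := by
    filter_upwards [hmem'] with s hs
    rw [hh.represents _ hs (posSemidef_gram hK _), jointLaw_eq_modelLaw, hG,
      ← map_applyT_modelLaw hK,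
      integral_map ((measurable_applyT_fst _).prodMk measurable_snd).aemeasurable
        hm.aestronglyMeasurable]
  have happ : ∀ (s : ℝ) (a : EuclideanSpace ℝ n),
      applyT (W + s • Z) a = join (applyT X a + s • applyT Y a) (applyT V a) := by
    intro s a
    rw [hWs, applyT_fromCols, applyT_add_smul]
  -- Differentiation under the integral for `|s| < 1`. The linear growth of the gradient dominates
  -- the derivative by a quadratic polynomial in the Gaussian vector.
  have hd2 := hasDerivAt_integral_of_dominated_loc_of_deriv_le (μ := modelLaw ℓ K) (𝕜 := ℝ)
    (F := fun s p => f (applyT (W + s • Z) p.1) p.2)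
    (F' := fun s p => inner ℝ (gradX f (applyT (W + s • Z) p.1) p.2) (applyT Y p.1))
    (x₀ := (0 : ℝ)) (s := Metric.ball 0 1)
    (bound := fun p => 2 * Lhat * (‖applyT (X - V) p.1‖ ^ 2 + 2 * ‖applyT Y p.1‖ ^ 2))
    (Metric.ball_mem_nhds 0 one_pos)
    (Filter.Eventually.of_forall fun s =>
      (hm.comp ((measurable_applyT_fst _).prodMk measurable_snd)).aestronglyMeasurable)
    (integrable_outer hα hm hf_int hf K _)
    (by
      have h1 := hc.measurable_gradX_applyT hm (W + (0 : ℝ) • Z)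
      exact (h1.inner (measurable_applyT_fst Y)).aestronglyMeasurable)
    (by
      filter_upwards [hc.ae_bounds hL hm hK hcrit] with p hp s hs
      rw [happ]
      have h1 := (hp (applyT X p.1 + s • applyT Y p.1)).1
      have h2 : ‖applyT X p.1 + s • applyT Y p.1 - applyT V p.1‖
          ≤ ‖applyT (X - V) p.1‖ + ‖applyT Y p.1‖ := by
        rw [applyT_sub]
        calc _ = ‖(applyT X p.1 - applyT V p.1) + s • applyT Y p.1‖ := by congr 1; abel
          _ ≤ _ := by
            refine (norm_add_le _ _).trans (add_le_add le_rfl ?_)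
            rw [norm_smul]
            have : ‖s‖ ≤ 1 := by simpa using (mem_ball_zero_iff.1 hs).le
            exact mul_le_of_le_one_left (norm_nonneg _) this
      refine (norm_inner_le_norm _ _).trans ?_
      calc _ ≤ 2 * Lhat * (‖applyT (X - V) p.1‖ + ‖applyT Y p.1‖) * ‖applyT Y p.1‖ := by
            gcongr; exact h1.trans (by gcongr)
        _ = 2 * Lhat * ((‖applyT (X - V) p.1‖ + ‖applyT Y p.1‖) * ‖applyT Y p.1‖) := by ring
        _ ≤ _ := by
          gcongr
          nlinarith [sq_nonneg (‖applyT (X - V) p.1‖ - ‖applyT Y p.1‖)])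
    (by
      have h1 := integrable_norm_applyT_pow (ℓ := ℓ) hK (X - V) 1
      have h2 := integrable_norm_applyT_pow (ℓ := ℓ) hK Y 1
      simp only [pow_one] at h1 h2
      exact (h1.add (h2.const_mul 2)).const_mul _)
    (by
      filter_upwards with p s hs
      simp_rw [happ]
      exact hc.hasDerivAt_comp _ _ _ _ s)
  have hd3 := hd2.2.congr_of_eventuallyEq hrep
  have := hd3.unique hd1
  rw [hG0] at this
  rw [← this]
  simp

end Model

/-! ### Spectral decomposition -/

section Spectral

variable {ℓ d : ℕ} (S : Setup ℓ d)

lemma Setup.eigval_nonneg (i : Fin d) : 0 ≤ S.eigval i := by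
  have h := S.posSemidef.dotProduct_mulVec_nonneg (S.eigvec i).ofLp
  have h1 := real_inner_self_eq_norm_sq (S.eigvec i)
  rw [S.eigvec.orthonormal.1 i] at h1
  simp only [EuclideanSpace.inner_eq_star_dotProduct, star_trivial] at h1
  simpa [S.eigen, h1] using h

lemma Setup.eigval_le {M : ℝ} (hK : ‖Matrix.toEuclideanCLM (n := Fin d) (𝕜 := ℝ) S.K‖ ≤ M)
    (i : Fin d) : S.eigval i ≤ M := by
  have h := (Matrix.toEuclideanCLM (n := Fin d) (𝕜 := ℝ) S.K).le_opNorm (S.eigvec i)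
  have e : Matrix.toEuclideanCLM (n := Fin d) (𝕜 := ℝ) S.K (S.eigvec i)
      = S.eigval i • S.eigvec i := by
    ext j
    have := congrFun (S.eigen i) j
    simpa using this
  rw [e, norm_smul, S.eigvec.orthonormal.1 i, mul_one, mul_one] at h
  exact (le_abs_self _).trans (h.trans hK)

lemma Setup.sum_vecMulVec_eigvec :
    ∑ i, vecMulVec (S.eigvec i).ofLp (S.eigvec i).ofLp = (1 : Matrix (Fin d) (Fin d) ℝ) := by
  ext j k
  have := S.eigvec.sum_inner_mul_inner (EuclideanSpace.single j (1 : ℝ)) (EuclideanSpace.single k (1 : ℝ))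
  simp only [EuclideanSpace.inner_single_left, EuclideanSpace.inner_single_right] at this
  simp only [map_one, conj_trivial, one_mul, PiLp.single_apply] at this
  simp only [Matrix.sum_apply, vecMulVec_apply, Matrix.one_apply, eq_comm (a := j)]
  exact this

lemma Setup.sum_eigval_vecMulVec :
    ∑ i, S.eigval i • vecMulVec (S.eigvec i).ofLp (S.eigvec i).ofLp = S.K := by
  have h := congrArg (S.K * ·) S.sum_vecMulVec_eigvec
  simp only [Matrix.mul_one, Matrix.mul_sum, mul_vecMulVec, S.eigen] at h
  rw [← h]
  simp [smul_vecMulVec]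

lemma Setup.trace_K : S.K.trace = ∑ i, S.eigval i := by
  conv_lhs => rw [← S.sum_eigval_vecMulVec]
  simp only [trace_sum, trace_smul, trace_vecMulVec]
  refine Finset.sum_congr rfl fun i _ => ?_
  have h1 := real_inner_self_eq_norm_sq (S.eigvec i)
  rw [S.eigvec.orthonormal.1 i] at h1
  simp only [EuclideanSpace.inner_eq_star_dotProduct, star_trivial] at h1
  simp [h1]

/-- The coefficient `Wᵀ ωᵢ` of `W = (X, X⋆)`. -/
def Setup.coeff (X : Matrix (Fin d) (Fin ℓ) ℝ) (i : Fin d) : Fin ℓ ⊕ Fin ℓ → ℝ :=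
  (Matrix.fromCols X S.Xstar)ᵀ *ᵥ (S.eigvec i).ofLp

lemma Setup.transpose_vecMulVec_mul {m : Type*} (W : Matrix (Fin d) m ℝ) (v : Fin d → ℝ) :
    Wᵀ * vecMulVec v v * W = vecMulVec (Wᵀ *ᵥ v) (Wᵀ *ᵥ v) := by
  rw [mul_vecMulVec, vecMulVec_mul, ← mulVec_transpose]

lemma Setup.gram_eq_sum (X : Matrix (Fin d) (Fin ℓ) ℝ) :
    S.gram X = ∑ i, S.eigval i • vecMulVec (S.coeff X i) (S.coeff X i) := by
  unfold Setup.gram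
  conv_lhs => rw [← S.sum_eigval_vecMulVec]
  simp only [Matrix.mul_sum, Matrix.sum_mul, Matrix.mul_smul, Matrix.smul_mul,
    Setup.transpose_vecMulVec_mul]
  rfl

lemma Setup.transpose_mul_eq_sum (X : Matrix (Fin d) (Fin ℓ) ℝ) :
    (Matrix.fromCols X S.Xstar)ᵀ * Matrix.fromCols X S.Xstar
      = ∑ i, vecMulVec (S.coeff X i) (S.coeff X i) := by
  rw [← Matrix.mul_one (Matrix.fromCols X S.Xstar)ᵀ, ← S.sum_vecMulVec_eigvec]
  simp only [Matrix.mul_sum, Matrix.sum_mul, Setup.transpose_vecMulVec_mul]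
  rfl

lemma Setup.init_eq (i : Fin d) :
    S.init i = (d : ℝ) • vecMulVec (S.coeff S.X₀ i) (S.coeff S.X₀ i) := rfl

lemma Setup.posSemidef_gram (X : Matrix (Fin d) (Fin ℓ) ℝ) : (S.gram X).PosSemidef :=
  HighDimSGD.posSemidef_gram S.posSemidef _

lemma Setup.gram_toBlocks₂₂ (X : Matrix (Fin d) (Fin ℓ) ℝ) :
    (S.gram X).toBlocks₂₂ = S.Xstarᵀ * S.K * S.Xstar := by
  ext i j
  simp [Setup.gram, toBlocks₂₂, Matrix.mul_apply, fromCols]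

end Spectral

/-! ### The gradient of the risk as a matrix -/

section MatGrad

variable {ℓ : ℕ} {h : GramMat ℓ → ℝ}

lemma fderiv_eq_sum_matGrad (B M : GramMat ℓ) :
    fderiv ℝ h B M = ∑ p, ∑ q, M p q * matGrad h B p q := by
  conv_lhs => rw [matrix_eq_sum_single M]
  simp only [map_sum, matGrad, Matrix.of_apply]
  refine Finset.sum_congr rfl fun p _ => Finset.sum_congr rfl fun q _ => ?_
  rw [← smul_eq_mul, ← map_smul]
  congr 1
  simp [smul_single]

/-- The derivative of a function invariant under transposition is itself invariant at a symmetric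
matrix. -/
lemma matGrad_transpose (hs : ∀ B, h Bᵀ = h B) {B : GramMat ℓ} (hB : Bᵀ = B) (p q) :
    matGrad h B p q = matGrad h B q p := by
  let T : GramMat ℓ ≃L[ℝ] GramMat ℓ :=
    (Matrix.transposeLinearEquiv (Fin ℓ ⊕ Fin ℓ) (Fin ℓ ⊕ Fin ℓ) ℝ ℝ).toContinuousLinearEquiv
  have h1 := T.comp_right_fderiv (f := h) (x := B)
  have h2 : h ∘ T = h := by funext M; exact hs M
  have h3 := (congrArg (fun g : GramMat ℓ → ℝ => fderiv ℝ g B) h2).symm.trans h1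
  have h4 : fderiv ℝ h B (Matrix.single p q 1) = fderiv ℝ h Bᵀ (Matrix.single p q 1)ᵀ :=
    DFunLike.congr_fun h3 (Matrix.single p q 1)
  rw [hB, transpose_single] at h4
  exact h4

end MatGrad

/-! ### The drift of stochastic gradient descent -/

section Drift

variable {ℓ : ℕ} {Lhat : ℝ} {f : ObsPlus ℓ → Obs ℓ → ℝ} {α Lf Lh : ℝ} {h : GramMat ℓ → ℝ}
  {U : Set (GramMat ℓ)} {n : Type*} [Fintype n] [DecidableEq n]

/-- The outer function and the risk satisfy the standing assumptions. -/
structure Admissible (Lhat α Lf Lh : ℝ) (f : ObsPlus ℓ → Obs ℓ → ℝ) (h : GramMat ℓ → ℝ)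
    (U : Set (GramMat ℓ)) : Prop where
  hα : 0 ≤ α
  hL : 0 < Lhat
  meas : Measurable (fun p : ObsPlus ℓ × Obs ℓ => f p.1 p.2)
  int : Integrable (fun e : Obs ℓ => f 0 e) (stdGaussian (Obs ℓ))
  lip : PseudoLipschitzOuter α Lf f
  conv : ConvexSmoothOuter Lhat f
  isOpen : IsOpen U
  risk : RiskRepresentation α Lh f U h

/-- The derivative identity in the rank-one direction `v ⊗ e_q`. It has the form of Stein's lemma,
but no second derivative of `f` occurs. The factor `2` comes from the two transposed terms of the
derivative of the Gram matrix, which agree because the gradient of `h` is symmetric. -/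
lemma Admissible.integral_coeff_mul_gradX (A : Admissible Lhat α Lf Lh f h U)
    {K : Matrix n n ℝ} (hK : K.PosSemidef) (X V : Matrix n (Fin ℓ) ℝ)
    (hcrit : CriticalAE f (Vᵀ * K * V))
    (hmem : (Matrix.fromCols X V)ᵀ * K * Matrix.fromCols X V ∈ U)
    (v : n → ℝ) (lam : ℝ) (hv : K *ᵥ v = lam • v) (q : Fin ℓ) :
    ∫ p, (v ⬝ᵥ p.1.ofLp) * gradX f (applyT (Matrix.fromCols X V) p.1) p.2 q ∂modelLaw ℓ K
      = 2 * lam * ∑ p, ((Matrix.fromCols X V)ᵀ *ᵥ v) p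
        * matGrad h ((Matrix.fromCols X V)ᵀ * K * Matrix.fromCols X V) p (Sum.inl q) := by
  have key := integral_inner_gradX_eq_fderiv A.hα A.hL A.meas A.int A.lip A.conv A.isOpen A.risk
    hK X V (vecMulVec v (Pi.single q 1)) hcrit hmem
  have e1 : ∀ p : EuclideanSpace ℝ n × Obs ℓ,
      inner ℝ (gradX f (applyT (Matrix.fromCols X V) p.1) p.2)
        (applyT (vecMulVec v (Pi.single q 1)) p.1)
      = (v ⬝ᵥ p.1.ofLp) * gradX f (applyT (Matrix.fromCols X V) p.1) p.2 q := by
    intro p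
    have : applyT (vecMulVec v (Pi.single q (1 : ℝ))) p.1
        = (v ⬝ᵥ p.1.ofLp) • EuclideanSpace.single q (1 : ℝ) := by
      ext j
      simp only [applyT, transpose_vecMulVec, vecMulVec_mulVec]
      simp [Pi.single_apply]
    rw [this, real_inner_smul_right, EuclideanSpace.inner_single_right]
    simp
  simp_rw [e1] at key
  rw [key]
  set W := Matrix.fromCols X V
  set w := Wᵀ *ᵥ v with hw
  have hKt : Kᵀ = K := by simpa using hK.isHermitian.eq
  have e2 : Matrix.fromCols (vecMulVec v (Pi.single q (1 : ℝ))) (0 : Matrix n (Fin ℓ) ℝ)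
      = vecMulVec v (Pi.single (Sum.inl q) 1 : Fin ℓ ⊕ Fin ℓ → ℝ) := by
    ext i j
    rcases j with j | j <;> simp [vecMulVec_apply, Pi.single_apply]
  have e3 : Wᵀ * K * vecMulVec v (Pi.single (Sum.inl q) 1 : Fin ℓ ⊕ Fin ℓ → ℝ)
      = lam • vecMulVec w (Pi.single (Sum.inl q) 1 : Fin ℓ ⊕ Fin ℓ → ℝ) := by
    rw [mul_vecMulVec, ← mulVec_mulVec, hv, mulVec_smul, smul_vecMulVec]
  have e4 : (vecMulVec v (Pi.single (Sum.inl q) 1 : Fin ℓ ⊕ Fin ℓ → ℝ))ᵀ * K * W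
      = lam • vecMulVec (Pi.single (Sum.inl q) 1 : Fin ℓ ⊕ Fin ℓ → ℝ) w := by
    have := congrArg Matrix.transpose e3
    rw [transpose_mul, transpose_mul, transpose_transpose, hKt, transpose_smul,
      transpose_vecMulVec, ← Matrix.mul_assoc] at this
    rw [transpose_vecMulVec] at this ⊢
    exact this
  rw [e2, e3, e4, fderiv_eq_sum_matGrad]
  have hsym : (Wᵀ * K * W)ᵀ = Wᵀ * K * W := by
    rw [transpose_mul, transpose_mul, transpose_transpose, hKt, Matrix.mul_assoc]
  simp only [Matrix.add_apply, Matrix.smul_apply, smul_eq_mul, vecMulVec_apply, add_mul,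
    Finset.sum_add_distrib]
  have s1 : ∑ x, ∑ y, lam * ((Pi.single (Sum.inl q) (1 : ℝ) : Fin ℓ ⊕ Fin ℓ → ℝ) x * w y)
        * matGrad h (Wᵀ * K * W) x y
      = lam * ∑ p, w p * matGrad h (Wᵀ * K * W) p (Sum.inl q) := by
    rw [Finset.sum_eq_single (Sum.inl q)]
    · rw [Finset.mul_sum]
      refine Finset.sum_congr rfl fun y _ => ?_
      rw [matGrad_transpose A.risk.symmetric hsym (Sum.inl q) y]
      simp; ring
    · intro b _ hb
      simp [hb]
    · simp
  have s2 : ∑ x, ∑ y, lam * (w x * (Pi.single (Sum.inl q) (1 : ℝ) : Fin ℓ ⊕ Fin ℓ → ℝ) y)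
        * matGrad h (Wᵀ * K * W) x y
      = lam * ∑ p, w p * matGrad h (Wᵀ * K * W) p (Sum.inl q) := by
    rw [Finset.mul_sum]
    refine Finset.sum_congr rfl fun x _ => ?_
    rw [Finset.sum_eq_single (Sum.inl q)]
    · simp; ring
    · intro b _ hb
      simp [hb]
    · simp
  rw [s1, s2]
  ring

/-- `tr (B₁₁ - 2 B₁₂ + B₂₂)`. -/
def blockDist (B : GramMat ℓ) : ℝ := (B.toBlocks₁₁ - 2 • B.toBlocks₁₂ + B.toBlocks₂₂).trace

lemma blockDist_eq_sum (B : GramMat ℓ) : blockDist B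
    = ∑ q, (B (Sum.inl q) (Sum.inl q) - 2 * B (Sum.inl q) (Sum.inr q) + B (Sum.inr q) (Sum.inr q)) := by
  simp [blockDist, Matrix.trace, toBlocks₁₁, toBlocks₁₂, toBlocks₂₂]

lemma blockDist_add (B B' : GramMat ℓ) : blockDist (B + B') = blockDist B + blockDist B' := by
  simp only [blockDist_eq_sum, ← Finset.sum_add_distrib, Matrix.add_apply]
  exact Finset.sum_congr rfl fun q _ => by ring

lemma blockDist_smul (c : ℝ) (B : GramMat ℓ) : blockDist (c • B) = c * blockDist B := by
  simp only [blockDist_eq_sum, Finset.mul_sum, Matrix.smul_apply, smul_eq_mul]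
  exact Finset.sum_congr rfl fun q _ => by ring

lemma blockDist_sum {I : Type*} (s : Finset I) (B : I → GramMat ℓ) :
    blockDist (∑ i ∈ s, B i) = ∑ i ∈ s, blockDist (B i) := by
  classical
  induction s using Finset.induction_on with
  | empty => simp [blockDist_eq_sum]
  | insert i s hi ih => rw [Finset.sum_insert hi, Finset.sum_insert hi, blockDist_add, ih]

/-- The matrix with `applyT` the second component. -/
abbrev sndRow (ℓ : ℕ) : Matrix (Fin ℓ ⊕ Fin ℓ) (Fin ℓ) ℝ := Matrix.fromRows 0 1

/-- The matrix with `applyT` the difference of the components. -/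
abbrev diffRow (ℓ : ℕ) : Matrix (Fin ℓ ⊕ Fin ℓ) (Fin ℓ) ℝ := Matrix.fromRows 1 (-1)

/-- `diffRow`, padded by zero columns. -/
abbrev diffMat (ℓ : ℕ) : GramMat ℓ := Matrix.fromCols (diffRow ℓ) 0

lemma fromCols_fromRows_eq_one :
    (Matrix.fromCols (Matrix.fromRows 1 0) (sndRow ℓ) : GramMat ℓ) = 1 := by
  ext i j
  rcases i with i | i <;> rcases j with j | j <;> simp [Matrix.one_apply]

lemma applyT_one (r : ObsPlus ℓ) : applyT (1 : GramMat ℓ) r = r := by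
  ext i; simp [applyT]

lemma applyT_one_neg_one (r : ObsPlus ℓ) :
    applyT (diffRow ℓ) r
      = fstPart r - sndPart r := by
  ext i
  simp [applyT, mulVec, dotProduct, fstPart, sndPart, Matrix.one_apply, sub_eq_add_neg]

lemma transpose_mul_mul_sndRow (B : GramMat ℓ) :
    (sndRow ℓ)ᵀ * B * sndRow ℓ
      = B.toBlocks₂₂ := by
  ext i j
  rw [Matrix.mul_apply]
  simp only [Fintype.sum_sum_type, Matrix.mul_apply, transpose_apply]
  simp [toBlocks₂₂, Matrix.one_apply]

lemma applyT_sndRow (r : ObsPlus ℓ) :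
    applyT (sndRow ℓ) r = sndPart r := by
  ext i
  simp [applyT, mulVec, dotProduct, sndPart, Matrix.one_apply]

/-- The vector `r` is itself a Gaussian sample with covariance `B`, of which `sndRow` extracts `x⋆`;
so the bounds for samples apply with `K = B`. -/
lemma Admissible.ae_bounds_jointLaw (A : Admissible Lhat α Lf Lh f h U)
    {B : GramMat ℓ} (hB : B.PosSemidef) (hcrit : CriticalAE f B.toBlocks₂₂) :
    ∀ᵐ p ∂jointLaw B, ‖gradX f p.1 p.2‖ ≤ 2 * Lhat * ‖fstPart p.1 - sndPart p.1‖ ∧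
      1 / (2 * Lhat) * ‖gradX f p.1 p.2‖ ^ 2
        ≤ inner ℝ (fstPart p.1 - sndPart p.1) (gradX f p.1 p.2) := by
  rw [← transpose_mul_mul_sndRow] at hcrit
  rw [jointLaw_eq_modelLaw]
  filter_upwards [A.conv.ae_bounds A.hL A.meas hB hcrit] with p hp
  have := hp (fstPart p.1)
  simpa only [applyT_sndRow, join_fstPart_sndPart] using this

lemma integrable_norm_sub_sq {B : GramMat ℓ} (hB : B.PosSemidef) :
    Integrable (fun p : ObsPlus ℓ × Obs ℓ => ‖fstPart p.1 - sndPart p.1‖ ^ 2) (jointLaw B) := by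
  have := integrable_norm_applyT_pow (ℓ := ℓ) hB
    (diffRow ℓ) 1
  rw [jointLaw_eq_modelLaw]
  simp only [pow_one, applyT_one_neg_one] at this
  exact this

lemma measurable_fst_sub_snd :
    Measurable (fun p : ObsPlus ℓ × Obs ℓ => fstPart p.1 - sndPart p.1) :=
  ((continuous_fstPart.sub continuous_sndPart).measurable).comp measurable_fst

/-- The pointwise descent inequality is integrated. By the growth bound both sides are dominated by
multiples of `‖x - x⋆‖²`. -/
lemma Admissible.descentCondition (A : Admissible Lhat α Lf Lh f h U)
    {B : GramMat ℓ} (hB : B.PosSemidef) (hcrit : CriticalAE f B.toBlocks₂₂) :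
    DescentCondition f (1 / (2 * Lhat)) B := by
  have hL := A.hL
  have hm := A.conv.measurable_gradX A.meas
  have hi := integrable_norm_sub_sq hB
  have hb := A.ae_bounds_jointLaw hB hcrit
  have h1 : Integrable (fun p : ObsPlus ℓ × Obs ℓ => ‖gradX f p.1 p.2‖ ^ 2) (jointLaw B) := by
    refine Integrable.mono' (hi.const_mul ((2 * Lhat) ^ 2)) (hm.norm.pow_const 2).aestronglyMeasurable ?_
    filter_upwards [hb] with p hp
    rw [Real.norm_of_nonneg (by positivity), ← mul_pow]
    exact pow_le_pow_left₀ (norm_nonneg _) hp.1 2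
  have h2 : Integrable (fun p : ObsPlus ℓ × Obs ℓ =>
      inner ℝ (fstPart p.1 - sndPart p.1) (gradX f p.1 p.2)) (jointLaw B) := by
    refine Integrable.mono' (hi.const_mul (2 * Lhat))
      (measurable_fst_sub_snd.inner hm).aestronglyMeasurable ?_
    filter_upwards [hb] with p hp
    refine (norm_inner_le_norm _ _).trans ?_
    have := norm_nonneg (fstPart p.1 - sndPart p.1)
    nlinarith [hp.1]
  refine ⟨h1, h2, ?_⟩
  rw [← integral_const_mul]
  refine integral_mono_ae (h1.const_mul _) h2 ?_
  filter_upwards [hb] with p hp using hp.2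

lemma trace_fisher (hc : ConvexSmoothOuter Lhat f)
    (hm : Measurable (fun p : ObsPlus ℓ × Obs ℓ => f p.1 p.2)) {B : GramMat ℓ}
    (hi : Integrable (fun p : ObsPlus ℓ × Obs ℓ => ‖gradX f p.1 p.2‖ ^ 2) (jointLaw B)) :
    (fisher f B).trace = ∫ p, ‖gradX f p.1 p.2‖ ^ 2 ∂jointLaw B := by
  simp_rw [EuclideanSpace.real_norm_sq_eq]
  have hm := hc.measurable_gradX hm
  rw [integral_finsetSum]
  · simp [Matrix.trace, fisher, pow_two]
  · intro q _
    have hq : Measurable (fun p : ObsPlus ℓ × Obs ℓ => gradX f p.1 p.2 q) := by fun_prop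
    refine Integrable.mono' hi (hq.pow_const 2).aestronglyMeasurable ?_
    filter_upwards with p
    rw [Real.norm_of_nonneg (by positivity), EuclideanSpace.real_norm_sq_eq]
    exact Finset.single_le_sum (f := fun i => gradX f p.1 p.2 i ^ 2)
      (fun i _ => sq_nonneg _) (Finset.mem_univ q)

/-- Moving `x` in the direction `x - x⋆` changes `B` by the symmetric expression on the right.
Pairing it with the symmetric matrix `∇h` gives the part of the drift seen by the squared distance.
-/
lemma blockDist_gradCol (B : GramMat ℓ) (hB : Bᵀ = B) (hs : ∀ B, h Bᵀ = h B) :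
    blockDist (B * gradCol h B + (gradCol h B)ᵀ * B)
      = fderiv ℝ h B ((diffMat ℓ)ᵀ * B * (1 : GramMat ℓ)
        + (1 : GramMat ℓ)ᵀ * B * diffMat ℓ) := by
  have hsym := matGrad_transpose hs hB
  have hB' : ∀ p q, B p q = B q p := fun p q => congrFun (congrFun hB q) p
  rw [fderiv_eq_sum_matGrad, blockDist_eq_sum]
  have e1 : ∀ p q, ((1 : GramMat ℓ)ᵀ * B * diffMat ℓ) p q
      = Sum.elim (fun q => B p (Sum.inl q) - B p (Sum.inr q)) (fun _ => 0) q := by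
    intro p q
    rw [transpose_one, Matrix.one_mul, Matrix.mul_apply]
    rcases q with q | q <;> simp [Matrix.one_apply, sub_eq_add_neg]
  have e2 : ∀ p q, ((diffMat ℓ)ᵀ * B * (1 : GramMat ℓ)) p q
      = Sum.elim (fun p => B (Sum.inl p) q - B (Sum.inr p) q) (fun _ => 0) p := by
    intro p q
    rw [Matrix.mul_one, Matrix.mul_apply]
    simp only [transpose_apply]
    rcases p with p | p <;> simp [Matrix.one_apply, sub_eq_add_neg]
  have e3 : ∀ p q, gradCol h B p q = Sum.elim (fun q => matGrad h B p (Sum.inl q)) (fun _ => 0) q := by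
    intro p q
    rcases p with p | p <;> rcases q with q | q <;> simp [gradCol, toBlocks₁₁, toBlocks₂₁]
  have s1 : ∑ p, ∑ q, ((1 : GramMat ℓ)ᵀ * B * diffMat ℓ) p q
      * matGrad h B p q = ∑ q, ∑ p, (B p (Sum.inl q) - B p (Sum.inr q)) * matGrad h B p (Sum.inl q) := by
    rw [Finset.sum_comm]
    simp only [e1, Fintype.sum_sum_type (fun q : Fin ℓ ⊕ Fin ℓ => ∑ _, _), Sum.elim_inl, Sum.elim_inr,
      zero_mul, Finset.sum_const_zero, add_zero]
  have s2 : ∑ p, ∑ q, ((diffMat ℓ)ᵀ * B * (1 : GramMat ℓ)) p q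
      * matGrad h B p q = ∑ q, ∑ p, (B p (Sum.inl q) - B p (Sum.inr q)) * matGrad h B p (Sum.inl q) := by
    simp only [e2, Fintype.sum_sum_type (fun q : Fin ℓ ⊕ Fin ℓ => ∑ _, _), Sum.elim_inl, Sum.elim_inr,
      zero_mul, Finset.sum_const_zero, add_zero]
    refine Finset.sum_congr rfl fun q _ => Finset.sum_congr rfl fun p _ => ?_
    rw [hsym (Sum.inl q) p, hB' (Sum.inl q) p, hB' (Sum.inr q) p]
  trans ∑ q, 2 * ∑ p, (B p (Sum.inl q) - B p (Sum.inr q)) * matGrad h B p (Sum.inl q)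
  swap
  · symm
    simp only [Matrix.add_apply, add_mul, Finset.sum_add_distrib]
    rw [s1, s2, ← Finset.mul_sum]
    ring
  refine Finset.sum_congr rfl fun q _ => ?_
  simp only [Matrix.add_apply, Matrix.mul_apply, transpose_apply, e3, Sum.elim_inl, Sum.elim_inr,
    mul_zero, zero_mul, Finset.sum_const_zero]
  have t1 : ∑ p, matGrad h B p (Sum.inl q) * B p (Sum.inl q)
      = ∑ p, B (Sum.inl q) p * matGrad h B p (Sum.inl q) :=
    Finset.sum_congr rfl fun p _ => by rw [hB' p]; ring
  have t2 : ∑ p, matGrad h B p (Sum.inl q) * B p (Sum.inr q)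
      = ∑ p, B p (Sum.inr q) * matGrad h B p (Sum.inl q) :=
    Finset.sum_congr rfl fun p _ => by ring
  have t3 : ∑ p, B (Sum.inl q) p * matGrad h B p (Sum.inl q)
      = ∑ p, B p (Sum.inl q) * matGrad h B p (Sum.inl q) :=
    Finset.sum_congr rfl fun p _ => by rw [hB' p]
  simp only [sub_mul, Finset.sum_sub_distrib, t1, t2, t3]
  ring

/-- The derivative identity for the sample `r` itself, with `K = B`, `W = 1` and direction `x - x⋆`.
This turns the drift of `𝓓²` into the right-hand side of the descent condition. -/
lemma Admissible.blockDist_gradCol_eq (A : Admissible Lhat α Lf Lh f h U)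
    {B : GramMat ℓ} (hB : B.PosSemidef) (hcrit : CriticalAE f B.toBlocks₂₂) (hmem : B ∈ U) :
    blockDist (B * gradCol h B + (gradCol h B)ᵀ * B)
      = ∫ p, inner ℝ (fstPart p.1 - sndPart p.1) (gradX f p.1 p.2) ∂jointLaw B := by
  have hBt : Bᵀ = B := by simpa using hB.isHermitian.eq
  rw [← transpose_mul_mul_sndRow] at hcrit
  have key := integral_inner_gradX_eq_fderiv A.hα A.hL A.meas A.int A.lip A.conv A.isOpen A.risk
    hB (Matrix.fromRows 1 0) (sndRow ℓ) (diffRow ℓ) hcrit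
    (by rw [fromCols_fromRows_eq_one]; simpa using hmem)
  rw [fromCols_fromRows_eq_one] at key
  have e : (1 : GramMat ℓ)ᵀ * B * 1 = B := by simp
  rw [e] at key
  rw [blockDist_gradCol B hBt A.risk.symmetric, ← key, jointLaw_eq_modelLaw]
  refine integral_congr_ae (ae_of_all _ fun p => ?_)
  simp only [applyT_one, applyT_one_neg_one]
  rw [real_inner_comm]

end Drift

/-! ### Frobenius norms -/

section Norms

variable {m n : Type*} [Fintype m] [Fintype n]

lemma frobenius_norm_sq (B : Matrix m n ℝ) : ‖B‖ ^ 2 = ∑ p, ∑ q, B p q ^ 2 := by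
  rw [frobenius_norm_def, ← Real.sqrt_eq_rpow, Real.sq_sqrt (by positivity)]
  simp

lemma abs_entry_le_norm (B : Matrix m n ℝ) (p : m) (q : n) : |B p q| ≤ ‖B‖ := by
  rw [← abs_of_nonneg (norm_nonneg B), ← sq_le_sq, frobenius_norm_sq]
  refine (Finset.single_le_sum (f := fun q => B p q ^ 2) (fun _ _ => sq_nonneg _)
    (Finset.mem_univ q)).trans ?_
  exact Finset.single_le_sum (f := fun p => ∑ q, B p q ^ 2)
    (fun _ _ => Finset.sum_nonneg fun _ _ => sq_nonneg _) (Finset.mem_univ p)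

lemma norm_le_of_entry_le (B : Matrix m n ℝ) {c : ℝ} (hB : ∀ p q, |B p q| ≤ c) (hc : 0 ≤ c) :
    ‖B‖ ≤ (Fintype.card m * Fintype.card n : ℝ) * c := by
  have h1 : ‖B‖ ^ 2 ≤ (Fintype.card m * Fintype.card n : ℝ) * c ^ 2 := by
    rw [frobenius_norm_sq]
    calc ∑ p, ∑ q, B p q ^ 2 ≤ ∑ _p : m, ∑ _q : n, c ^ 2 := by
          refine Finset.sum_le_sum fun p _ => Finset.sum_le_sum fun q _ => ?_
          exact sq_le_sq' (by linarith [neg_abs_le (B p q), hB p q]) ((le_abs_self _).trans (hB p q))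
      _ = _ := by simp; ring
  have h2 : ((Fintype.card m * Fintype.card n : ℕ) : ℝ) ≤ ((Fintype.card m * Fintype.card n : ℕ) : ℝ) ^ 2 := by
    exact_mod_cast Nat.le_self_pow two_ne_zero _
  push_cast at h2
  refine le_of_sq_le_sq ?_ (by positivity)
  rw [mul_pow]
  exact h1.trans (mul_le_mul_of_nonneg_right h2 (sq_nonneg c))

lemma norm_gradCol_le {ℓ : ℕ} (h : GramMat ℓ → ℝ) (B B' : GramMat ℓ) :
    ‖gradCol h B - gradCol h B'‖ ≤ ‖matGrad h B - matGrad h B'‖ := by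
  refine le_of_sq_le_sq ?_ (norm_nonneg _)
  rw [frobenius_norm_sq, frobenius_norm_sq]
  refine Finset.sum_le_sum fun p _ => Finset.sum_le_sum fun q _ => ?_
  rcases p with p | p <;> rcases q with q | q <;>
    simp [gradCol, toBlocks₁₁, toBlocks₂₁, sq_nonneg]

lemma norm_fromBlocks_le {ℓ : ℕ} (F : Matrix (Fin ℓ) (Fin ℓ) ℝ) :
    ‖(Matrix.fromBlocks F 0 0 0 : GramMat ℓ)‖ ≤ ‖F‖ := by
  refine le_of_sq_le_sq ?_ (norm_nonneg _)
  rw [frobenius_norm_sq, frobenius_norm_sq]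
  simp

lemma abs_entry_le_trace [DecidableEq n] {B : Matrix n n ℝ} (hB : B.PosSemidef) (p q : n) :
    |B p q| ≤ B.trace := by
  have hd : ∀ i, 0 ≤ B i i := fun _ => hB.diag_nonneg
  have htr : ∀ i, B i i ≤ B.trace := fun i =>
    Finset.single_le_sum (f := fun i => B i i) (fun _ _ => hd _) (Finset.mem_univ i)
  have hs : B q p = B p q := by simpa using hB.isHermitian.apply p q
  -- Testing the form on `e_p ± e_q` gives `2 |B p q| ≤ B p p + B q q`.
  have h1 := hB.dotProduct_mulVec_nonneg (Pi.single p 1 + Pi.single q 1)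
  have h2 := hB.dotProduct_mulVec_nonneg (Pi.single p 1 - Pi.single q 1)
  simp [mulVec_add, mulVec_sub, add_dotProduct, sub_dotProduct, hs] at h1 h2
  rw [abs_le]
  constructor <;> linarith [htr p, htr q]

lemma norm_le_trace [DecidableEq n] {B : Matrix n n ℝ} (hB : B.PosSemidef) :
    ‖B‖ ≤ (Fintype.card n * Fintype.card n : ℝ) * B.trace :=
  norm_le_of_entry_le B (abs_entry_le_trace hB)
    (Finset.sum_nonneg fun _ _ => hB.diag_nonneg)

end Norms

/-! ### The deterministic system -/

section Curve

variable {ℓ d : ℕ} {Lhat : ℝ} {f : ObsPlus ℓ → Obs ℓ → ℝ} {α Lf Lh : ℝ} {h : GramMat ℓ → ℝ}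
  {U : Set (GramMat ℓ)} {S : Setup ℓ d} {γ : ℝ → ℝ} {τ : ℝ} {𝓑 : Fin d → ℝ → GramMat ℓ}

lemma distSq_eq (𝓑 : Fin d → ℝ → GramMat ℓ) (t : ℝ) :
    distSq 𝓑 t = 1 / (d : ℝ) * ∑ i, blockDist (𝓑 i t) := rfl

/-- The second block column of `gradCol` vanishes, so the covariance of `x⋆` is conserved along the
curve. Criticality of `x⋆`, and with it the descent condition, thus persists for all times. -/
lemma Setup.field_inr_inr (𝓑 : Fin d → ℝ → GramMat ℓ) (i : Fin d) (t : ℝ) (p q : Fin ℓ) :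
    S.field f h γ 𝓑 i t (Sum.inr p) (Sum.inr q) = 0 := by
  simp [Setup.field, gradCol, Matrix.mul_apply]

lemma Setup.IsSolution.intervalIntegrable (sol : S.IsSolution f h U γ τ 𝓑) (i p q) {s t : ℝ}
    (hs : s ∈ Set.Icc 0 τ) (ht : t ∈ Set.Icc 0 τ) :
    IntervalIntegrable (fun s => S.field f h γ 𝓑 i s p q) volume s t := by
  refine (sol.integrable i p q).mono_set ?_
  rw [Set.uIcc_of_le (hs.1.trans hs.2)]
  exact Set.uIcc_subset_Icc hs ht

lemma Setup.IsSolution.sub_eq (sol : S.IsSolution f h U γ τ 𝓑) (i p q) {s t : ℝ}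
    (hs : s ∈ Set.Icc 0 τ) (ht : t ∈ Set.Icc 0 τ) :
    𝓑 i t p q - 𝓑 i s p q = ∫ u in s..t, S.field f h γ 𝓑 i u p q := by
  have h0 : (0 : ℝ) ∈ Set.Icc 0 τ := ⟨le_rfl, hs.1.trans hs.2⟩
  rw [sol.equation i t ht, sol.equation i s hs, add_sub_add_left_eq_sub,
    intervalIntegral.integral_interval_sub_left (sol.intervalIntegrable i p q h0 ht)
      (sol.intervalIntegrable i p q h0 hs)]

lemma Setup.IsSolution.nonneg_of_mem (sol : S.IsSolution f h U γ τ 𝓑) {t : ℝ}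
    (ht : t ∈ Set.Icc 0 τ) : (S.avg 𝓑 t).PosSemidef := by
  unfold Setup.avg
  refine PosSemidef.smul (posSemidef_sum _ fun i _ => ?_) (by positivity)
  exact (sol.posSemidef i t ht).smul (S.eigval_nonneg i)

lemma Setup.IsSolution.apply_inr_inr (sol : S.IsSolution f h U γ τ 𝓑) (i) {t : ℝ}
    (ht : t ∈ Set.Icc 0 τ) (p q : Fin ℓ) :
    𝓑 i t (Sum.inr p) (Sum.inr q) = S.init i (Sum.inr p) (Sum.inr q) := by
  rw [sol.equation i t ht]
  simp [Setup.field_inr_inr]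

lemma Setup.avg_init (hd : 1 ≤ d) (𝓑 : Fin d → ℝ → GramMat ℓ) (t : ℝ)
    (h𝓑 : ∀ i, 𝓑 i t = S.init i) : S.avg 𝓑 t = S.gram S.X₀ := by
  have hd' : (d : ℝ) ≠ 0 := by positivity
  unfold Setup.avg
  simp_rw [h𝓑, S.init_eq, smul_comm _ (d : ℝ), ← Finset.smul_sum]
  rw [smul_smul, one_div, inv_mul_cancel₀ hd', one_smul, S.gram_eq_sum]

lemma Setup.IsSolution.avg_toBlocks₂₂ (sol : S.IsSolution f h U γ τ 𝓑) (hd : 1 ≤ d) {t : ℝ}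
    (ht : t ∈ Set.Icc 0 τ) : (S.avg 𝓑 t).toBlocks₂₂ = S.Xstarᵀ * S.K * S.Xstar := by
  have h1 := S.avg_init hd (fun i _ => S.init i) t (fun i => rfl)
  rw [← S.gram_toBlocks₂₂ S.X₀, ← h1]
  ext p q
  simp [toBlocks₂₂, Setup.avg, Matrix.sum_apply, sol.apply_inr_inr _ ht]

lemma blockDist_field (i : Fin d) (t : ℝ) :
    blockDist (S.field f h γ 𝓑 i t) = -(2 * S.eigval i * γ t) *
      blockDist (𝓑 i t * gradCol h (S.avg 𝓑 t) + (gradCol h (S.avg 𝓑 t))ᵀ * 𝓑 i t)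
      + S.eigval i * γ t ^ 2 * (fisher f (S.avg 𝓑 t)).trace := by
  have : blockDist (Matrix.fromBlocks (fisher f (S.avg 𝓑 t)) 0 0 0)
      = (fisher f (S.avg 𝓑 t)).trace := by simp [blockDist]
  rw [Setup.field, blockDist_add, blockDist_smul, blockDist_smul, this]

/-- With `I = 𝔼‖∇ₓf‖²` and `J = 𝔼⟨x - x⋆, ∇ₓf⟩` the derivative of `𝓓²` is `-2γJ + γ² (tr K / d) I`.
The step size bound gives `γ² tr K / d ≤ γ/L̂`, and the descent condition gives `I ≤ 2L̂J`. -/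
lemma Admissible.sum_blockDist_field_nonpos (A : Admissible Lhat α Lf Lh f h U) (hd : 1 ≤ d)
    (hcrit : CriticalAE f (S.Xstarᵀ * S.K * S.Xstar))
    (hγ0 : ∀ t, 0 ≤ t → 0 ≤ γ t)
    (hγ : ∀ t, 0 ≤ t → γ t * (Lhat * ((1 / (d : ℝ)) * S.K.trace)) ≤ 1)
    (sol : S.IsSolution f h U γ τ 𝓑) {t : ℝ} (ht : t ∈ Set.Icc 0 τ) :
    1 / (d : ℝ) * ∑ i, blockDist (S.field f h γ 𝓑 i t) ≤ 0 := by
  set B := S.avg 𝓑 t with hB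
  have hBp := sol.nonneg_of_mem ht
  rw [← sol.avg_toBlocks₂₂ hd ht] at hcrit
  have hmem := sol.mem t ht
  rw [← hB] at hBp hcrit hmem
  have hdc := A.descentCondition hBp hcrit
  have e1 : 1 / (d : ℝ) * ∑ i, blockDist (S.field f h γ 𝓑 i t)
      = -(2 * γ t) * blockDist (B * gradCol h B + (gradCol h B)ᵀ * B)
        + γ t ^ 2 * (1 / (d : ℝ) * S.K.trace) * (fisher f B).trace := by
    -- The drift is linear in each `𝓑 i` with a common matrix `H`, so averaging with weights `λᵢ`
    -- leaves only `B`.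
    have : B * gradCol h B + (gradCol h B)ᵀ * B = (1 / (d : ℝ)) • ∑ i, S.eigval i •
        (𝓑 i t * gradCol h B + (gradCol h B)ᵀ * 𝓑 i t) := by
      generalize gradCol h B = H
      simp only [smul_add, Finset.sum_add_distrib]
      conv_lhs => rw [hB, Setup.avg]
      simp only [Matrix.smul_mul, Matrix.mul_smul, Matrix.sum_mul, Matrix.mul_sum]
    rw [this, blockDist_smul, blockDist_sum]
    simp_rw [blockDist_smul, blockDist_field, ← hB, S.trace_K]
    rw [Finset.sum_add_distrib, mul_add]
    simp only [Finset.mul_sum, Finset.sum_mul]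
    congr 1 <;> refine Finset.sum_congr rfl fun i _ => ?_ <;> ring
  rw [e1, A.blockDist_gradCol_eq hBp hcrit hmem, trace_fisher A.conv A.meas hdc.1]
  set I := ∫ p, ‖gradX f p.1 p.2‖ ^ 2 ∂jointLaw B
  set J := ∫ p, inner ℝ (fstPart p.1 - sndPart p.1) (gradX f p.1 p.2) ∂jointLaw B
  have hI : 0 ≤ I := integral_nonneg fun p => by positivity
  have hL := A.hL
  have h1 : I ≤ 2 * Lhat * J := by
    have := hdc.2.2
    rwa [one_div, inv_mul_le_iff₀ (by positivity)] at this
  have h2 := hγ t ht.1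
  have h3 := hγ0 t ht.1
  have h4 : γ t ^ 2 * (1 / (d : ℝ) * S.K.trace) * I ≤ γ t / Lhat * I := by
    refine mul_le_mul_of_nonneg_right ?_ hI
    rw [le_div_iff₀ hL]
    nlinarith
  have h5 : γ t / Lhat * I ≤ γ t / Lhat * (2 * Lhat * J) :=
    mul_le_mul_of_nonneg_left h1 (by positivity)
  have h6 : γ t / Lhat * (2 * Lhat * J) = 2 * γ t * J := by field_simp
  linarith

lemma Admissible.antitoneOn_distSq (A : Admissible Lhat α Lf Lh f h U) (hd : 1 ≤ d)
    (hcrit : CriticalAE f (S.Xstarᵀ * S.K * S.Xstar))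
    (hγ0 : ∀ t, 0 ≤ t → 0 ≤ γ t)
    (hγ : ∀ t, 0 ≤ t → γ t * (Lhat * ((1 / (d : ℝ)) * S.K.trace)) ≤ 1)
    (sol : S.IsSolution f h U γ τ 𝓑) :
    AntitoneOn (distSq 𝓑) (Set.Icc 0 τ) := by
  intro s hs t ht hst
  have hint := fun i p q => sol.intervalIntegrable i p q hs ht
  have e : distSq 𝓑 t - distSq 𝓑 s
      = ∫ u in s..t, 1 / (d : ℝ) * ∑ i, blockDist (S.field f h γ 𝓑 i u) := by
    have hb : ∀ i, IntervalIntegrable (fun u => blockDist (S.field f h γ 𝓑 i u)) volume s t := by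
      intro i
      simp_rw [blockDist_eq_sum]
      have := IntervalIntegrable.sum (Finset.univ : Finset (Fin ℓ)) fun q _ =>
        ((hint i (Sum.inl q) (Sum.inl q)).sub ((hint i (Sum.inl q) (Sum.inr q)).const_mul 2)).add
          (hint i (Sum.inr q) (Sum.inr q))
      rwa [Finset.sum_fn] at this
    rw [intervalIntegral.integral_const_mul, intervalIntegral.integral_finsetSum fun i _ => hb i,
      distSq_eq, distSq_eq, ← mul_sub, ← Finset.sum_sub_distrib]
    congr 1
    refine Finset.sum_congr rfl fun i _ => ?_
    simp_rw [blockDist_eq_sum]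
    rw [intervalIntegral.integral_finsetSum fun q _ =>
        ((hint i _ _).sub ((hint i _ _).const_mul 2)).add (hint i _ _), ← Finset.sum_sub_distrib]
    refine Finset.sum_congr rfl fun q _ => ?_
    rw [intervalIntegral.integral_add ((hint i _ _).sub ((hint i _ _).const_mul 2)) (hint i _ _),
      intervalIntegral.integral_sub (hint i _ _) ((hint i _ _).const_mul 2),
      intervalIntegral.integral_const_mul, ← sol.sub_eq i _ _ hs ht, ← sol.sub_eq i _ _ hs ht,
      ← sol.sub_eq i _ _ hs ht]
    ring
  have : ∫ u in s..t, 1 / (d : ℝ) * ∑ i, blockDist (S.field f h γ 𝓑 i u) ≤ 0 := by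
    rw [← neg_nonneg, ← intervalIntegral.integral_neg]
    refine intervalIntegral.integral_nonneg hst fun u hu => neg_nonneg.2 ?_
    exact A.sum_blockDist_field_nonpos hd hcrit hγ0 hγ sol ⟨hs.1.trans hu.1, hu.2.trans ht.2⟩
  linarith

lemma blockDist_transpose_mul (X Y : Matrix (Fin d) (Fin ℓ) ℝ) :
    blockDist ((Matrix.fromCols X Y)ᵀ * Matrix.fromCols X Y) = ‖X - Y‖ ^ 2 := by
  rw [frobenius_norm_sq, blockDist_eq_sum, Finset.sum_comm]
  refine Finset.sum_congr rfl fun q _ => ?_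
  simp only [Matrix.mul_apply, transpose_apply, fromCols_apply_inl, fromCols_apply_inr,
    Finset.mul_sum, ← Finset.sum_sub_distrib, ← Finset.sum_add_distrib, Matrix.sub_apply]
  exact Finset.sum_congr rfl fun i _ => by ring

lemma trace_le_blockDist {B : GramMat ℓ} (hB : B.PosSemidef) :
    B.trace ≤ 2 * blockDist B + 3 * ∑ q, B (Sum.inr q) (Sum.inr q) := by
  rw [blockDist_eq_sum, Finset.mul_sum, Finset.mul_sum, ← Finset.sum_add_distrib]
  simp only [Matrix.trace, diag_apply, Fintype.sum_sum_type]
  rw [← Finset.sum_add_distrib]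
  refine Finset.sum_le_sum fun q _ => ?_
  have hs : B (Sum.inr q) (Sum.inl q) = B (Sum.inl q) (Sum.inr q) := by
    simpa using hB.isHermitian.apply (Sum.inl q) (Sum.inr q)
  -- Positivity on `e_q - 2 e_q⋆` is the quadratic form version of `x² + y² ≤ 2 (x - y)² + 3 y²`,
  -- whose two sides differ by `(x - 2 y)²`.
  have h1 := hB.dotProduct_mulVec_nonneg (Pi.single (Sum.inl q) 1 - (2 : ℝ) • Pi.single (Sum.inr q) 1)
  simp [mulVec_sub, mulVec_smul, sub_dotProduct, hs] at h1
  linarith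

/-- The a priori bound of the total trace of a solution. -/
lemma Admissible.sum_trace_le (A : Admissible Lhat α Lf Lh f h U) (hd : 1 ≤ d)
    (hcrit : CriticalAE f (S.Xstarᵀ * S.K * S.Xstar))
    (hγ0 : ∀ t, 0 ≤ t → 0 ≤ γ t)
    (hγ : ∀ t, 0 ≤ t → γ t * (Lhat * ((1 / (d : ℝ)) * S.K.trace)) ≤ 1)
    (sol : S.IsSolution f h U γ τ 𝓑) {t : ℝ} (ht : t ∈ Set.Icc 0 τ) :
    1 / (d : ℝ) * ∑ i, (𝓑 i t).trace ≤ 2 * ‖S.X₀ - S.Xstar‖ ^ 2 + 3 * ‖S.Xstar‖ ^ 2 := by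
  have hd' : (d : ℝ) ≠ 0 := by positivity
  have h0 : (0 : ℝ) ∈ Set.Icc 0 τ := ⟨le_rfl, ht.1.trans ht.2⟩
  have h1 := A.antitoneOn_distSq hd hcrit hγ0 hγ sol h0 ht ht.1
  have hsum : 1 / (d : ℝ) * ∑ i, blockDist (S.init i) = ‖S.X₀ - S.Xstar‖ ^ 2 := by
    rw [← blockDist_transpose_mul, S.transpose_mul_eq_sum, blockDist_sum, Finset.mul_sum]
    refine Finset.sum_congr rfl fun i _ => ?_
    rw [S.init_eq, blockDist_smul, ← mul_assoc, one_div, inv_mul_cancel₀ hd', one_mul]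
  have h2 : distSq 𝓑 0 = ‖S.X₀ - S.Xstar‖ ^ 2 := by
    rw [distSq_eq, ← hsum]
    congr 1
    refine Finset.sum_congr rfl fun i _ => ?_
    congr 1
    ext p q
    rw [sol.equation i 0 h0]; simp
  have h3 : 1 / (d : ℝ) * ∑ i, ∑ q, 𝓑 i t (Sum.inr q) (Sum.inr q) = ‖S.Xstar‖ ^ 2 := by
    have := congrArg (fun M : GramMat ℓ => ∑ q, M (Sum.inr q) (Sum.inr q))
      (S.transpose_mul_eq_sum S.X₀)
    simp only [Matrix.sum_apply] at this
    rw [Finset.sum_comm, frobenius_norm_sq, Finset.sum_comm (γ := Fin d)]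
    rw [Finset.mul_sum]
    refine Eq.trans ?_ (this.symm.trans ?_)
    · refine Finset.sum_congr rfl fun q _ => ?_
      rw [Finset.mul_sum]
      refine Finset.sum_congr rfl fun i _ => ?_
      rw [sol.apply_inr_inr i ht, S.init_eq, Matrix.smul_apply, smul_eq_mul, ← mul_assoc, one_div,
        inv_mul_cancel₀ hd', one_mul]
    · refine Finset.sum_congr rfl fun q _ => ?_
      simp only [Matrix.mul_apply, transpose_apply, fromCols_apply_inr]
      exact Finset.sum_congr rfl fun i _ => by ring
  calc 1 / (d : ℝ) * ∑ i, (𝓑 i t).trace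
      ≤ 1 / (d : ℝ) * ∑ i, (2 * blockDist (𝓑 i t) + 3 * ∑ q, 𝓑 i t (Sum.inr q) (Sum.inr q)) := by
        gcongr with i
        exact trace_le_blockDist (sol.posSemidef i t ht)
    _ = 2 * distSq 𝓑 t + 3 * ‖S.Xstar‖ ^ 2 := by
        rw [Finset.sum_add_distrib, ← Finset.mul_sum, ← Finset.mul_sum, ← h3, distSq_eq]; ring
    _ ≤ _ := by rw [← h2]; linarith

end Curve

/-! ### Differential equations with measurable coefficients -/

section Caratheodory

variable {E : Type*} [NormedAddCommGroup E] [NormedSpace ℝ E] [CompleteSpace E]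

/-- Existence for `y' = F(t, y)`, in integrated form, where `F` is Lipschitz in `y` but only
measurable in time. -/
lemma exists_integral_solution {F : ℝ → E → E} {T L : ℝ} (hT : 0 ≤ T) (hL : 0 ≤ L) (y₀ : E)
    (hint : ∀ y : ℝ → E, Continuous y → IntervalIntegrable (fun s => F s (y s)) volume 0 T)
    (hF : ∀ s ∈ Set.Icc 0 T, ∀ x x', ‖F s x - F s x'‖ ≤ L * ‖x - x'‖) :
    ∃ y : ℝ → E, Continuous y ∧ ∀ t ∈ Set.Icc 0 T, y t = y₀ + ∫ s in (0 : ℝ)..t, F s (y s) := by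
  -- In the norm weighted by `e^{-ct}` the Picard map has Lipschitz constant at most `L/c ≤ 1/2` on
  -- all of `[0, T]`, so no subdivision of the interval is needed. The added `1` keeps `c` positive
  -- when `L = 0`.
  set c : ℝ := 2 * L + 1 with hc
  have hc0 : 0 < c := by positivity
  -- The unknown `v` is the path multiplied by `e^{-cs}`. The map `ext` removes the weight, with `v`
  -- frozen at its end values outside `[0, T]`.
  let ext : C(Set.Icc 0 T, E) → ℝ → E := fun v s => Real.exp (c * s) • v (Set.projIcc 0 T hT s)
  have hext : ∀ v, Continuous (ext v) := fun v => by
    have := v.continuous.comp (continuous_projIcc (h := hT))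
    exact (by fun_prop : Continuous fun s : ℝ => Real.exp (c * s)).smul this
  have hii : ∀ v, ∀ t ∈ Set.Icc 0 T, IntervalIntegrable (fun s => F s (ext v s)) volume 0 t := by
    intro v t ht
    refine (hint _ (hext v)).mono_set ?_
    rw [Set.uIcc_of_le hT]
    exact Set.uIcc_subset_Icc ⟨le_rfl, hT⟩ ht
  have hcont : ∀ v, ContinuousOn (fun t => Real.exp (-(c * t)) • (y₀ + ∫ s in (0 : ℝ)..t, F s (ext v s)))
      (Set.Icc 0 T) := by
    intro v
    have := intervalIntegral.continuousOn_primitive_interval' (hint _ (hext v))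
      (Set.left_mem_uIcc)
    rw [Set.uIcc_of_le hT] at this
    exact (by fun_prop : Continuous fun t : ℝ => Real.exp (-(c * t))).continuousOn.smul
      (continuousOn_const.add this)
  let Φ : C(Set.Icc 0 T, E) → C(Set.Icc 0 T, E) := fun v =>
    ⟨fun t => Real.exp (-(c * t)) • (y₀ + ∫ s in (0 : ℝ)..t, F s (ext v s)),
      continuousOn_iff_continuous_domRestrict.1 (hcont v)⟩
  have hlip : ∀ v w, dist (Φ v) (Φ w) ≤ 1 / 2 * dist v w := by
    intro v w
    rw [ContinuousMap.dist_le (by positivity)]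
    rintro ⟨t, ht⟩
    change dist (Real.exp (-(c * t)) • (y₀ + ∫ s in (0 : ℝ)..t, F s (ext v s)))
      (Real.exp (-(c * t)) • (y₀ + ∫ s in (0 : ℝ)..t, F s (ext w s))) ≤ _
    rw [dist_eq_norm, ← smul_sub, add_sub_add_left_eq_sub,
      ← intervalIntegral.integral_sub (hii v t ht) (hii w t ht), norm_smul, Real.norm_eq_abs,
      Real.abs_exp]
    have hb : ∀ s ∈ Set.Icc 0 t, ‖F s (ext v s) - F s (ext w s)‖
        ≤ L * dist v w * Real.exp (c * s) := by
      intro s hs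
      refine (hF s ⟨hs.1, hs.2.trans ht.2⟩ _ _).trans ?_
      simp only [ext]
      rw [← smul_sub, norm_smul, Real.norm_eq_abs, Real.abs_exp, ← dist_eq_norm]
      have := v.dist_apply_le_dist (g := w) (Set.projIcc 0 T hT s)
      have h2 := Real.exp_pos (c * s)
      calc _ ≤ L * (Real.exp (c * s) * dist v w) := by gcongr
        _ = _ := by ring
    have h1 : ‖∫ s in (0 : ℝ)..t, (F s (ext v s) - F s (ext w s))‖
        ≤ ∫ s in (0 : ℝ)..t, L * dist v w * Real.exp (c * s) := by
      refine intervalIntegral.norm_integral_le_of_norm_le ht.1 ?_ ?_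
      · exact ae_of_all _ fun s hs => hb s ⟨hs.1.le, hs.2⟩
      · exact (by fun_prop : Continuous fun s : ℝ => L * dist v w * Real.exp (c * s)).intervalIntegrable _ _
    have h2 : ∫ s in (0 : ℝ)..t, L * dist v w * Real.exp (c * s)
        = L * dist v w * ((Real.exp (c * t) - 1) / c) := by
      rw [intervalIntegral.integral_const_mul]
      congr 1
      rw [intervalIntegral.integral_comp_mul_left (fun x => Real.exp x) hc0.ne', integral_exp]
      simp [div_eq_inv_mul]
    rw [h2] at h1
    have h3 : Real.exp (-(c * t)) * (L * dist v w * ((Real.exp (c * t) - 1) / c))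
        = L / c * dist v w * (1 - Real.exp (-(c * t))) := by
      rw [Real.exp_neg]
      have := (Real.exp_pos (c * t)).ne'
      field_simp
    refine (mul_le_mul_of_nonneg_left h1 (Real.exp_pos _).le).trans ?_
    rw [h3]
    have h4 : L / c ≤ 1 / 2 := by rw [div_le_iff₀ hc0]; linarith
    have h5 : 0 ≤ 1 - Real.exp (-(c * t)) := by
      have : Real.exp (-(c * t)) ≤ 1 := Real.exp_le_one_iff.2 (by nlinarith [ht.1])
      linarith
    have h6 : 1 - Real.exp (-(c * t)) ≤ 1 := by linarith [Real.exp_pos (-(c * t))]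
    calc L / c * dist v w * (1 - Real.exp (-(c * t))) ≤ 1 / 2 * dist v w * 1 := by gcongr
      _ = _ := mul_one _
  have hΦ : ContractingWith (1 / 2 : NNReal) Φ := by
    refine ⟨by rw [← NNReal.coe_lt_coe]; norm_num, LipschitzWith.of_dist_le_mul fun v w => ?_⟩
    simpa using hlip v w
  have : Nonempty C(Set.Icc 0 T, E) := ⟨0⟩
  set v := ContractingWith.fixedPoint Φ hΦ
  have hv : Φ v = v := hΦ.fixedPoint_isFixedPt
  refine ⟨ext v, hext v, fun t ht => ?_⟩
  have h1 : v ⟨t, ht⟩ = Real.exp (-(c * t)) • (y₀ + ∫ s in (0 : ℝ)..t, F s (ext v s)) := by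
    conv_lhs => rw [← hv]
    rfl
  change Real.exp (c * t) • v (Set.projIcc 0 T hT t) = _
  rw [Set.projIcc_of_mem hT ht, h1, smul_smul, ← Real.exp_add]
  simp

end Caratheodory

/-! ### The cone of positive semidefinite matrices -/

section PosSemidefCone

set_option linter.unusedSectionVars false

variable {n : Type*} [Fintype n] [DecidableEq n]

/-- The nearest point projection onto a closed convex set is Lipschitz. -/
lemma exists_lipschitz_projection {F : Type*} [NormedAddCommGroup F] [InnerProductSpace ℝ F]
    [CompleteSpace F] {C : Set F} (hne : C.Nonempty) (hcl : IsClosed C) (hcv : Convex ℝ C) :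
    ∃ π : F → F, LipschitzWith 1 π ∧ (∀ x, π x ∈ C) ∧ ∀ x ∈ C, π x = x := by
  choose π hπ hn using exists_norm_eq_iInf_of_complete_convex hne hcl.isComplete hcv
  have hin : ∀ x, ∀ w ∈ C, inner ℝ (x - π x) (w - π x) ≤ 0 := fun x =>
    (norm_eq_iInf_iff_real_inner_le_zero hcv (hπ x)).1 (hn x)
  refine ⟨π, LipschitzWith.of_dist_le_mul fun x y => ?_, hπ, fun x hx => ?_⟩
  · rw [NNReal.coe_one, one_mul, dist_eq_norm, dist_eq_norm]
    have h1 := hin x (π y) (hπ y)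
    have h2 := hin y (π x) (hπ x)
    have h3 : ‖π x - π y‖ ^ 2 ≤ inner ℝ (x - y) (π x - π y) := by
      rw [← real_inner_self_eq_norm_sq]
      have e1 : inner ℝ (x - π x) (π y - π x) = - inner ℝ (x - π x) (π x - π y) := by
        rw [← inner_neg_right, neg_sub]
      have e2 : inner ℝ (x - y) (π x - π y) = inner ℝ (x - π x) (π x - π y)
          - inner ℝ (y - π y) (π x - π y) + inner ℝ (π x - π y) (π x - π y) := by
        rw [← inner_sub_left, ← inner_add_left]; congr 1; abel
      linarith
    have h4 := h3.trans (real_inner_le_norm _ _)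
    by_contra! hlt
    nlinarith [norm_nonneg (x - y), norm_nonneg (π x - π y)]
  · have h := hin x x hx
    rw [real_inner_self_eq_norm_sq] at h
    have : ‖x - π x‖ = 0 := by nlinarith [norm_nonneg (x - π x), sq_nonneg ‖x - π x‖]
    exact (sub_eq_zero.1 (norm_eq_zero.1 this)).symm

lemma isClosed_posSemidef : IsClosed {B : Matrix n n ℝ | B.PosSemidef} := by
  have : {B : Matrix n n ℝ | B.PosSemidef} = {B | Bᵀ = B} ∩ ⋂ x : n → ℝ, {B | 0 ≤ x ⬝ᵥ B *ᵥ x} := by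
    ext B
    simp [Matrix.posSemidef_iff_dotProduct_mulVec, IsHermitian, conjTranspose_eq_transpose_of_trivial]
  rw [this]
  refine IsClosed.inter ?_ (isClosed_iInter fun x => ?_)
  · exact isClosed_eq (by fun_prop) (by fun_prop)
  · refine isClosed_le continuous_const ?_
    exact Continuous.dotProduct continuous_const (Continuous.matrix_mulVec continuous_id continuous_const)

lemma convex_posSemidef : Convex ℝ {B : Matrix n n ℝ | B.PosSemidef} := by
  intro x hx y hy a b ha hb _
  exact (PosSemidef.smul hx ha).add (PosSemidef.smul hy hb)

/-- The nearest point projection is taken in Euclidean coordinates and carried back by a linear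
equivalence, whose operator norms enter the constant. Only some finite Lipschitz constant is needed.
-/
lemma exists_posSemidef_projection : ∃ (c : NNReal) (π : Matrix n n ℝ → Matrix n n ℝ),
    LipschitzWith c π ∧ (∀ B, (π B).PosSemidef) ∧ ∀ B, B.PosSemidef → π B = B := by
  let e : Matrix n n ℝ ≃L[ℝ] EuclideanSpace ℝ (n × n) :=
    ((LinearEquiv.curry ℝ ℝ n n).symm.trans (WithLp.linearEquiv 2 ℝ (n × n → ℝ)).symm).toContinuousLinearEquiv
  obtain ⟨π, h1, h2, h3⟩ := exists_lipschitz_projection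
    (C := e.symm ⁻¹' {B : Matrix n n ℝ | B.PosSemidef}) ⟨0, by simpa using PosSemidef.zero⟩
    (isClosed_posSemidef.preimage e.symm.continuous)
    (convex_posSemidef.linear_preimage e.symm.toLinearEquiv.toLinearMap)
  refine ⟨_, fun B => e.symm (π (e B)), e.symm.lipschitz.comp (h1.comp e.lipschitz), fun B => h2 _,
    fun B hB => ?_⟩
  change e.symm (π (e B)) = B
  rw [h3 _ (by simpa using hB)]
  simp

end PosSemidefCone

/-! ### Invariance of the positive semidefinite cone under the matrix equation. -/

section PosSemidefInvariance

set_option linter.unusedSectionVars false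

/-- The topology of the Frobenius norm. -/
abbrev frobeniusTopology {m n : Type*} [Fintype m] [Fintype n] : TopologicalSpace (Matrix m n ℝ) :=
  (Matrix.frobeniusNormedAddCommGroup (m := m) (n := n)
    (α := ℝ)).toMetricSpace.toPseudoMetricSpace.toUniformSpace.toTopologicalSpace

attribute [local instance] frobeniusTopology

variable {n : Type*} [Fintype n] [DecidableEq n]

lemma intervalIntegral_posSemidef {Q : ℝ → Matrix n n ℝ} {s t : ℝ} (hst : s ≤ t)
    (hQ : IntervalIntegrable Q volume s t) (hp : ∀ u ∈ Set.Icc s t, (Q u).PosSemidef) :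
    (∫ u in s..t, Q u).PosSemidef := by
  rw [Matrix.posSemidef_iff_dotProduct_mulVec]
  constructor
  · let T : Matrix n n ℝ →L[ℝ] Matrix n n ℝ :=
      LinearMap.toContinuousLinearMap (Matrix.transposeLinearEquiv n n ℝ ℝ).toLinearMap
    have hT : ∀ M, T M = Mᵀ := fun M => rfl
    rw [IsHermitian, conjTranspose_eq_transpose_of_trivial, ← hT,
      ← T.intervalIntegral_comp_comm hQ]
    refine intervalIntegral.integral_congr fun u hu => ?_
    rw [Set.uIcc_of_le hst] at hu
    have := (hp u hu).isHermitian.eq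
    rwa [conjTranspose_eq_transpose_of_trivial] at this
  · intro x
    let T : Matrix n n ℝ →L[ℝ] ℝ := LinearMap.toContinuousLinearMap
      { toFun := fun M => star x ⬝ᵥ M *ᵥ x
        map_add' := fun M N => by simp [add_mulVec]
        map_smul' := fun c M => by simp [smul_mulVec] }
    have hT : ∀ M, T M = star x ⬝ᵥ M *ᵥ x := fun M => rfl
    rw [← hT, ← T.intervalIntegral_comp_comm hQ]
    exact intervalIntegral.integral_nonneg hst fun u hu => (hp u hu).dotProduct_mulVec_nonneg x

/-- One time step of the equation, compared with a step that preserves positivity. -/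
lemma exists_posSemidef_near_step {y A Q : ℝ → Matrix n n ℝ} {a b R s t : ℝ} (hst : s ≤ t)
    (ha : 0 ≤ a) (hR : 0 ≤ R) (hb : 0 ≤ b)
    (hyR : ∀ u ∈ Set.Icc s t, ‖y u‖ ≤ R)
    (hA : IntervalIntegrable A volume s t) (hAb : ∀ u ∈ Set.Icc s t, ‖A u‖ ≤ a)
    (hQ : IntervalIntegrable Q volume s t) (hQb : ∀ u ∈ Set.Icc s t, ‖Q u‖ ≤ b)
    (hQp : ∀ u ∈ Set.Icc s t, (Q u).PosSemidef)
    (hint : IntervalIntegrable (fun u => -(y u * A u + (A u)ᵀ * y u) + Q u) volume s t)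
    (heq : ∀ u ∈ Set.Icc s t, y u = y s + ∫ v in s..u, (-(y v * A v + (A v)ᵀ * y v) + Q v))
    {P : Matrix n n ℝ} (hP : P.PosSemidef) :
    ∃ P' : Matrix n n ℝ, P'.PosSemidef ∧ ‖y t - P'‖ ≤ (1 + a * (t - s)) ^ 2 * ‖y s - P‖
      + (2 * a * (2 * a * R + b) + a ^ 2 * R) * (t - s) ^ 2 := by
  set δ := t - s with hδ
  have hδ0 : 0 ≤ δ := sub_nonneg.2 hst
  set G := 2 * a * R + b with hG
  have hG0 : 0 ≤ G := by positivity
  have hAy : ∀ (M N : Matrix n n ℝ), ‖M * N + Nᵀ * M‖ ≤ 2 * ‖N‖ * ‖M‖ := by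
    intro M N
    refine (norm_add_le _ _).trans ?_
    have h1 := frobenius_norm_mul M N
    have h2 := frobenius_norm_mul Nᵀ M
    rw [frobenius_norm_transpose] at h2
    linarith
  have hg : ∀ v ∈ Set.Icc s t, ‖-(y v * A v + (A v)ᵀ * y v) + Q v‖ ≤ G := by
    intro v hv
    refine (norm_add_le _ _).trans (add_le_add ?_ (hQb v hv))
    rw [norm_neg]
    refine (hAy _ _).trans ?_
    have := hAb v hv; have := hyR v hv
    gcongr
  have hyLip : ∀ u ∈ Set.Icc s t, ‖y u - y s‖ ≤ G * δ := by
    intro u hu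
    rw [heq u hu, add_sub_cancel_left]
    refine (intervalIntegral.norm_integral_le_of_norm_le_const (C := G) fun v hv => ?_).trans ?_
    · rw [Set.uIoc_of_le hu.1] at hv
      exact hg v ⟨hv.1.le, hv.2.trans hu.2⟩
    · rw [abs_of_nonneg (sub_nonneg.2 hu.1)]
      have : u - s ≤ δ := by simp only [hδ]; linarith [hu.2]
      gcongr
  set Ab := ∫ u in s..t, A u with hAbdef
  set Qb := ∫ u in s..t, Q u with hQbdef
  have hAbn : ‖Ab‖ ≤ a * δ := by
    refine (intervalIntegral.norm_integral_le_of_norm_le_const (C := a) fun v hv => ?_).trans ?_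
    · rw [Set.uIoc_of_le hst] at hv
      exact hAb v ⟨hv.1.le, hv.2⟩
    · rw [abs_of_nonneg hδ0]
  let Lm : Matrix n n ℝ →L[ℝ] Matrix n n ℝ := LinearMap.toContinuousLinearMap
    { toFun := fun M => y s * M + Mᵀ * y s
      map_add' := fun M N => by rw [Matrix.mul_add, transpose_add, Matrix.add_mul]; abel
      map_smul' := fun c M => by
        rw [Matrix.mul_smul, transpose_smul, Matrix.smul_mul, RingHom.id_apply, smul_add] }
  have hLm : ∀ M, Lm M = y s * M + Mᵀ * y s := fun M => rfl
  have hLi : IntervalIntegrable (fun u => Lm (A u)) volume s t :=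
    ⟨Lm.integrable_comp hA.1, Lm.integrable_comp hA.2⟩
  have hLA : y s * Ab + Abᵀ * y s = ∫ u in s..t, Lm (A u) := by
    rw [Lm.intervalIntegral_comp_comm hA, hLm]
  -- Freezing `y` at its initial value gives an Euler step. As `y` moves by at most `G δ`, the error
  -- is of second order in the step length.
  have herr : ‖y t - (y s - (y s * Ab + Abᵀ * y s) + Qb)‖ ≤ 2 * a * G * δ ^ 2 := by
    have e : y t - (y s - (y s * Ab + Abᵀ * y s) + Qb)
        = ∫ u in s..t, (-(y u * A u + (A u)ᵀ * y u) + Q u + Lm (A u) - Q u) := by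
      rw [intervalIntegral.integral_sub (hint.add hLi) hQ, intervalIntegral.integral_add hint hLi,
        ← hLA, heq t ⟨hst, le_rfl⟩, ← hQbdef]
      abel
    rw [e]
    refine (intervalIntegral.norm_integral_le_of_norm_le_const (C := 2 * a * (G * δ))
      fun v hv => ?_).trans ?_
    · rw [Set.uIoc_of_le hst] at hv
      have hv' : v ∈ Set.Icc s t := ⟨hv.1.le, hv.2⟩
      have e2 : -(y v * A v + (A v)ᵀ * y v) + Q v + Lm (A v) - Q v
          = -((y v - y s) * A v + (A v)ᵀ * (y v - y s)) := by
        rw [hLm, Matrix.sub_mul, Matrix.mul_sub]; abel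
      rw [e2, norm_neg]
      refine (hAy _ _).trans ?_
      have := hAb v hv'; have := hyLip v hv'
      gcongr
    · rw [abs_of_nonneg hδ0]
      exact le_of_eq (by ring)
  -- A congruence of `P` plus a positive semidefinite matrix. It differs from the Euler step started
  -- at `P` only by the second order term `Abᵀ P Ab`.
  refine ⟨(1 - Ab)ᵀ * P * (1 - Ab) + Qb,
    (HighDimSGD.posSemidef_gram hP _).add (intervalIntegral_posSemidef hst hQ hQp), ?_⟩
  have e3 : y t - ((1 - Ab)ᵀ * P * (1 - Ab) + Qb)
      = (y t - (y s - (y s * Ab + Abᵀ * y s) + Qb)) - Abᵀ * y s * Ab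
        + ((y s - P) - ((y s - P) * Ab + Abᵀ * (y s - P)) + Abᵀ * (y s - P) * Ab) := by
    simp only [transpose_sub, transpose_one, Matrix.sub_mul, Matrix.mul_sub, Matrix.one_mul,
      Matrix.mul_one]
    abel
  have hcub : ∀ M : Matrix n n ℝ, ‖Abᵀ * M * Ab‖ ≤ (a * δ) ^ 2 * ‖M‖ := by
    intro M
    have h1 := frobenius_norm_mul (Abᵀ * M) Ab
    have h2 := frobenius_norm_mul Abᵀ M
    rw [frobenius_norm_transpose] at h2
    calc _ ≤ ‖Abᵀ * M‖ * ‖Ab‖ := h1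
      _ ≤ ‖Ab‖ * ‖M‖ * ‖Ab‖ := by gcongr
      _ ≤ (a * δ) * ‖M‖ * (a * δ) := by gcongr
      _ = _ := by ring
  rw [e3]
  refine (norm_add_le _ _).trans ?_
  have n1 := norm_sub_le (y t - (y s - (y s * Ab + Abᵀ * y s) + Qb)) (Abᵀ * y s * Ab)
  have n2 := norm_add_le ((y s - P) - ((y s - P) * Ab + Abᵀ * (y s - P))) (Abᵀ * (y s - P) * Ab)
  have n3 := norm_sub_le (y s - P) ((y s - P) * Ab + Abᵀ * (y s - P))
  have n4 : ‖(y s - P) * Ab + Abᵀ * (y s - P)‖ ≤ 2 * (a * δ) * ‖y s - P‖ :=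
    (hAy _ _).trans (by gcongr)
  have n5 := hcub (y s)
  have n6 := hcub (y s - P)
  have n7 : (a * δ) ^ 2 * ‖y s‖ ≤ (a * δ) ^ 2 * R := by
    gcongr; exact hyR s ⟨le_rfl, hst⟩
  nlinarith

/-- Over `N` steps of length `t/N` the second order errors add up to `O(1/N)`, amplified by at most
`exp (2 a t)`. So `y t` is a limit of positive semidefinite matrices, and the cone is closed. -/
lemma posSemidef_of_integral_eq {y A Q : ℝ → Matrix n n ℝ} {a b R τ : ℝ}
    (ha : 0 ≤ a) (hR : 0 ≤ R) (hb : 0 ≤ b)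
    (hyR : ∀ u ∈ Set.Icc 0 τ, ‖y u‖ ≤ R)
    (hA : IntervalIntegrable A volume 0 τ) (hAb : ∀ u ∈ Set.Icc 0 τ, ‖A u‖ ≤ a)
    (hQ : IntervalIntegrable Q volume 0 τ) (hQb : ∀ u ∈ Set.Icc 0 τ, ‖Q u‖ ≤ b)
    (hQp : ∀ u ∈ Set.Icc 0 τ, (Q u).PosSemidef) (h0 : (y 0).PosSemidef)
    (hint : IntervalIntegrable (fun u => -(y u * A u + (A u)ᵀ * y u) + Q u) volume 0 τ)
    (heq : ∀ u ∈ Set.Icc 0 τ, y u = y 0 + ∫ v in (0 : ℝ)..u, (-(y v * A v + (A v)ᵀ * y v) + Q v))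
    {t : ℝ} (ht : t ∈ Set.Icc 0 τ) : (y t).PosSemidef := by
  set c := 2 * a * (2 * a * R + b) + a ^ 2 * R with hc
  have hc0 : 0 ≤ c := by positivity
  have hτ : 0 ≤ τ := ht.1.trans ht.2
  have hsub : ∀ {s u : ℝ}, s ∈ Set.Icc 0 τ → u ∈ Set.Icc 0 τ → Set.uIcc s u ⊆ Set.uIcc 0 τ := by
    intro s u hs hu
    rw [Set.uIcc_of_le hτ]
    exact Set.uIcc_subset_Icc hs hu
  have h0m : (0 : ℝ) ∈ Set.Icc 0 τ := ⟨le_rfl, hτ⟩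
  have key : ∀ N : ℕ, 0 < N → ∃ P : Matrix n n ℝ, P.PosSemidef ∧
      ‖y t - P‖ ≤ c * t ^ 2 / N * Real.exp (2 * a * t) := by
    intro N hN
    have hN' : (0 : ℝ) < N := by exact_mod_cast hN
    set δ := t / N with hδ
    have hδ0 : 0 ≤ δ := div_nonneg ht.1 hN'.le
    have hmem : ∀ k : ℕ, k ≤ N → (k : ℝ) * δ ∈ Set.Icc 0 τ := by
      intro k hk
      have hk' : (k : ℝ) ≤ N := by exact_mod_cast hk
      refine ⟨by positivity, le_trans ?_ ht.2⟩
      calc (k : ℝ) * δ ≤ N * δ := by gcongr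
        _ = t := by rw [hδ]; field_simp
    have step : ∀ k : ℕ, k ≤ N → ∃ P : Matrix n n ℝ, P.PosSemidef ∧
        ‖y (k * δ) - P‖ ≤ k * (c * δ ^ 2) * ((1 + a * δ) ^ 2) ^ k := by
      intro k
      induction k with
      | zero => intro _; exact ⟨y 0, h0, by simp⟩
      | succ k ih =>
        intro hk
        obtain ⟨P, hP, hPn⟩ := ih (Nat.le_of_succ_le hk)
        have hs := hmem k (Nat.le_of_succ_le hk)
        have ht' := hmem (k + 1) hk
        have hle : (k : ℝ) * δ ≤ ((k + 1 : ℕ) : ℝ) * δ := by push_cast; nlinarith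
        have hI : ∀ u ∈ Set.Icc ((k : ℝ) * δ) (((k + 1 : ℕ) : ℝ) * δ), u ∈ Set.Icc 0 τ :=
          fun u hu => ⟨hs.1.trans hu.1, hu.2.trans ht'.2⟩
        obtain ⟨P', hP', hPn'⟩ := exists_posSemidef_near_step hle ha hR hb
          (fun u hu => hyR u (hI u hu)) (hA.mono_set (hsub hs ht')) (fun u hu => hAb u (hI u hu))
          (hQ.mono_set (hsub hs ht')) (fun u hu => hQb u (hI u hu)) (fun u hu => hQp u (hI u hu))
          (hint.mono_set (hsub hs ht')) (fun u hu => by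
            rw [heq u (hI u hu), heq _ hs, add_assoc,
              intervalIntegral.integral_add_adjacent_intervals (hint.mono_set (hsub h0m hs))
                (hint.mono_set (hsub hs (hI u hu)))]) hP
        refine ⟨P', hP', hPn'.trans ?_⟩
        have e : ((k + 1 : ℕ) : ℝ) * δ - k * δ = δ := by push_cast; ring
        rw [e, ← hc]
        have h1 : 1 ≤ (1 + a * δ) ^ 2 := one_le_pow₀ (by nlinarith [mul_nonneg ha hδ0])
        have h2 : 1 ≤ ((1 + a * δ) ^ 2) ^ (k + 1) := one_le_pow₀ h1
        calc (1 + a * δ) ^ 2 * ‖y (k * δ) - P‖ + c * δ ^ 2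
            ≤ (1 + a * δ) ^ 2 * (k * (c * δ ^ 2) * ((1 + a * δ) ^ 2) ^ k)
              + c * δ ^ 2 * ((1 + a * δ) ^ 2) ^ (k + 1) :=
              add_le_add (by gcongr) (le_mul_of_one_le_right (by positivity) h2)
          _ = _ := by push_cast; ring
    obtain ⟨P, hP, hPn⟩ := step N le_rfl
    have e1 : (N : ℝ) * δ = t := by rw [hδ]; field_simp
    rw [e1] at hPn
    refine ⟨P, hP, hPn.trans ?_⟩
    have e2 : (N : ℝ) * (c * δ ^ 2) = c * t ^ 2 / N := by rw [hδ]; field_simp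
    have e3 : ((1 + a * δ) ^ 2) ^ N ≤ Real.exp (2 * a * t) := by
      have h1 : 1 + a * δ ≤ Real.exp (a * δ) := by linarith [Real.add_one_le_exp (a * δ)]
      calc ((1 + a * δ) ^ 2) ^ N ≤ ((Real.exp (a * δ)) ^ 2) ^ N := by
            gcongr
        _ = Real.exp (2 * a * t) := by
            rw [← pow_mul, ← Real.exp_nat_mul]; congr 1; push_cast; rw [← e1]; ring
    rw [e2]
    gcongr
  have hcl := isClosed_posSemidef (n := n)
  have : y t ∈ closure {B : Matrix n n ℝ | B.PosSemidef} := by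
    rw [Metric.mem_closure_iff]
    intro ε hε
    have hlim : Tendsto (fun N : ℕ => c * t ^ 2 / N * Real.exp (2 * a * t)) atTop (𝓝 0) := by
      have := (tendsto_const_div_atTop_nhds_zero_nat (c * t ^ 2)).mul_const (Real.exp (2 * a * t))
      simpa using this
    obtain ⟨N, hN, hN0⟩ := ((hlim.eventually_lt_const hε).and (eventually_gt_atTop 0)).exists
    obtain ⟨P, hP, hPn⟩ := key N hN0
    exact ⟨P, hP, by rw [dist_eq_norm]; exact hPn.trans_lt hN⟩
  exact hcl.closure_subset this

end PosSemidefInvariance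

/-! ### Existence of the deterministic curve -/

section Existence

attribute [local instance] frobeniusTopology

variable {ℓ d : ℕ} {Lhat : ℝ} {f : ObsPlus ℓ → Obs ℓ → ℝ} {α Lf Lh LI : ℝ} {h : GramMat ℓ → ℝ}
  {U : Set (GramMat ℓ)} {S : Setup ℓ d} {γ : ℝ → ℝ}

/-- On a ball a pseudo-Lipschitz bound is a Lipschitz bound. The absolute value covers a constant
`L` of unknown sign. -/
lemma pseudoLipschitz_factor_le {V : Type*} [SeminormedAddCommGroup V] {α L R : ℝ} (hα : 0 ≤ α)
    {B B' : V} (hB : ‖B‖ ≤ R) (hB' : ‖B'‖ ≤ R) :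
    L * ‖B - B'‖ * (1 + ‖B‖ ^ α + ‖B'‖ ^ α) ≤ |L| * (1 + 2 * R ^ α) * ‖B - B'‖ := by
  have h1 := Real.rpow_le_rpow (norm_nonneg B) hB hα
  have h2 := Real.rpow_le_rpow (norm_nonneg B') hB' hα
  have h3 := Real.rpow_nonneg (norm_nonneg B) α
  have h4 := Real.rpow_nonneg (norm_nonneg B') α
  calc L * ‖B - B'‖ * (1 + ‖B‖ ^ α + ‖B'‖ ^ α)
      ≤ |L| * ‖B - B'‖ * (1 + R ^ α + R ^ α) := by gcongr; exact le_abs_self L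
    _ = _ := by ring

/-- The average `(1/d) ∑ᵢ λᵢ yᵢ`. -/
def Setup.avgMap (S : Setup ℓ d) (y : Fin d → GramMat ℓ) : GramMat ℓ :=
  (1 / (d : ℝ)) • ∑ i, S.eigval i • y i

lemma Setup.norm_avgMap_le (S : Setup ℓ d) (y : Fin d → GramMat ℓ) {R : ℝ} (hy : ∀ i, ‖y i‖ ≤ R) :
    ‖S.avgMap y‖ ≤ (1 / (d : ℝ) * ∑ i, S.eigval i) * R := by
  unfold Setup.avgMap
  rw [norm_smul, Real.norm_of_nonneg (by positivity), mul_assoc, Finset.sum_mul]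
  gcongr
  refine (norm_sum_le _ _).trans (Finset.sum_le_sum fun i _ => ?_)
  rw [norm_smul, Real.norm_of_nonneg (S.eigval_nonneg i)]
  exact mul_le_mul_of_nonneg_left (hy i) (S.eigval_nonneg i)

lemma Setup.avgMap_sub (S : Setup ℓ d) (y y' : Fin d → GramMat ℓ) :
    S.avgMap (y - y') = S.avgMap y - S.avgMap y' := by
  simp [Setup.avgMap, smul_sub, Finset.sum_sub_distrib]

/-- The drift of the coupled system, without the factor `γ`. -/
def Setup.driftMap (S : Setup ℓ d) (h : GramMat ℓ → ℝ) (y : Fin d → GramMat ℓ) :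
    Fin d → GramMat ℓ := fun i =>
  -(2 * S.eigval i) • (y i * gradCol h (S.avgMap y) + (gradCol h (S.avgMap y))ᵀ * y i)

lemma norm_mul_add_transpose_mul_le {n : Type*} [Fintype n] (M N : Matrix n n ℝ) :
    ‖M * N + Nᵀ * M‖ ≤ 2 * ‖N‖ * ‖M‖ := by
  refine (norm_add_le _ _).trans ?_
  have h1 := frobenius_norm_mul M N
  have h2 := frobenius_norm_mul Nᵀ M
  rw [frobenius_norm_transpose] at h2
  linarith

lemma norm_driftMap_sub_le {R LH b : ℝ} (hR : 0 ≤ R) (hLH : 0 ≤ LH)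
    {y y' : Fin d → GramMat ℓ} (hy' : ∀ i, ‖y' i‖ ≤ R)
    (hH : ‖gradCol h (S.avgMap y) - gradCol h (S.avgMap y')‖ ≤ LH * ‖S.avgMap y - S.avgMap y'‖)
    (hb : ‖gradCol h (S.avgMap y)‖ ≤ b) :
    ‖S.driftMap h y - S.driftMap h y'‖
      ≤ (2 * ∑ i, S.eigval i) * (2 * b + 2 * (LH * (1 / (d : ℝ) * ∑ i, S.eigval i)) * R) * ‖y - y'‖ := by
  have hb0 : 0 ≤ b := (norm_nonneg _).trans hb
  have hs0 : 0 ≤ ∑ i, S.eigval i := Finset.sum_nonneg fun i _ => S.eigval_nonneg i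
  have ha : ‖S.avgMap y - S.avgMap y'‖ ≤ (1 / (d : ℝ) * ∑ i, S.eigval i) * ‖y - y'‖ := by
    rw [← S.avgMap_sub]
    exact S.norm_avgMap_le _ fun i => norm_le_pi_norm (y - y') i
  refine (pi_norm_le_iff_of_nonneg (by positivity)).2 fun i => ?_
  set H := gradCol h (S.avgMap y)
  set H' := gradCol h (S.avgMap y')
  have e : (S.driftMap h y - S.driftMap h y') i
      = -(2 * S.eigval i) • (((y i - y' i) * H + Hᵀ * (y i - y' i))
        + (y' i * (H - H') + (H - H')ᵀ * y' i)) := by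
    simp only [Pi.sub_apply, Setup.driftMap]
    rw [← smul_sub]
    congr 1
    rw [Matrix.sub_mul, Matrix.mul_sub, Matrix.mul_sub, transpose_sub, Matrix.sub_mul]
    abel
  have h0 := S.eigval_nonneg i
  rw [e, norm_smul, norm_neg, Real.norm_of_nonneg (by positivity), mul_assoc (2 * ∑ i, S.eigval i)]
  have hle : S.eigval i ≤ ∑ i, S.eigval i :=
    Finset.single_le_sum (f := S.eigval) (fun i _ => S.eigval_nonneg i) (Finset.mem_univ i)
  refine mul_le_mul (by linarith) ?_ (norm_nonneg _) (by positivity)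
  refine (norm_add_le _ _).trans ?_
  have n1 := norm_mul_add_transpose_mul_le (y i - y' i) H
  have n2 := norm_mul_add_transpose_mul_le (y' i) (H - H')
  have n3 : ‖y i - y' i‖ ≤ ‖y - y'‖ := norm_le_pi_norm (y - y') i
  have n4 : 2 * ‖H‖ * ‖y i - y' i‖ ≤ 2 * b * ‖y - y'‖ := by gcongr
  have n5 : 2 * ‖H - H'‖ * ‖y' i‖
      ≤ 2 * (LH * ((1 / (d : ℝ) * ∑ i, S.eigval i) * ‖y - y'‖)) * R := by
    have := hH.trans (mul_le_mul_of_nonneg_left ha hLH)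
    gcongr
    exact hy' i
  nlinarith

/-- The matrix entry as a continuous linear functional of a matrix. -/
def entryCLM (ℓ : ℕ) (p q : Fin ℓ ⊕ Fin ℓ) : GramMat ℓ →L[ℝ] ℝ :=
  LinearMap.toContinuousLinearMap (Matrix.entryLinearMap ℝ ℝ p q)

lemma entryCLM_apply (p q : Fin ℓ ⊕ Fin ℓ) (M : GramMat ℓ) : entryCLM ℓ p q M = M p q := rfl

/-- A path that solves an extended system, and stays in the region where the extension agrees with
the coupled system, is a solution. -/
lemma isSolution_of_extension {τ R γmax a : ℝ} (hτ : 0 ≤ τ) (hR : 0 ≤ R)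
    (hγ_bdd : ∀ t, 0 ≤ t → 0 ≤ γ t ∧ γ t ≤ γmax) (hγ_meas : Measurable γ)
    {y : ℝ → Fin d → GramMat ℓ} (hy : Continuous y)
    {G₁ : (Fin d → GramMat ℓ) → Fin d → GramMat ℓ} (hG₁ : Continuous G₁)
    {Q : GramMat ℓ → Matrix (Fin ℓ) (Fin ℓ) ℝ} (hQp : ∀ B, (Q B).PosSemidef)
    {G₂ : (Fin d → GramMat ℓ) → Fin d → GramMat ℓ} (hG₂ : Continuous G₂)
    (hG₂Q : ∀ x i, G₂ x i = S.eigval i • Matrix.fromBlocks (Q (S.avgMap x)) 0 0 0)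
    (heq : ∀ t ∈ Set.Icc 0 τ, y t = S.init
      + ∫ s in (0 : ℝ)..t, (γ s • G₁ (y s) + γ s ^ 2 • G₂ (y s)))
    (hyR : ∀ t ∈ Set.Icc 0 τ, ∀ i, ‖y t i‖ ≤ R)
    (hyU : ∀ t ∈ Set.Icc 0 τ, S.avgMap (y t) ∈ U)
    (hHc : ContinuousOn (fun t => gradCol h (S.avgMap (y t))) (Set.Icc 0 τ))
    (hHa : ∀ t ∈ Set.Icc 0 τ, ‖gradCol h (S.avgMap (y t))‖ ≤ a)
    (hG₁y : ∀ t ∈ Set.Icc 0 τ, G₁ (y t) = S.driftMap h (y t))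
    (hd : 1 ≤ d)
    (hQy : ∀ t ∈ Set.Icc 0 τ, (S.avgMap (y t)).PosSemidef →
      (S.avgMap (y t)).toBlocks₂₂ = S.Xstarᵀ * S.K * S.Xstar →
      Q (S.avgMap (y t)) = fisher f (S.avgMap (y t))) :
    S.IsSolution f h U γ τ (fun i t => y t i) := by
  have ha : 0 ≤ a := (norm_nonneg _).trans (hHa 0 ⟨le_rfl, hτ⟩)
  have hγ0 : 0 ≤ γmax := (hγ_bdd 0 le_rfl).1.trans (hγ_bdd 0 le_rfl).2
  have hγi : ∀ k : ℕ, IntervalIntegrable (fun s => γ s ^ k) volume 0 τ := by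
    intro k
    rw [intervalIntegrable_iff_integrableOn_Ioc_of_le hτ]
    refine IntegrableOn.of_bound (by simp) (hγ_meas.pow_const k).aestronglyMeasurable (γmax ^ k) ?_
    filter_upwards [ae_restrict_mem measurableSet_Ioc] with s hs
    have := hγ_bdd s hs.1.le
    rw [Real.norm_of_nonneg (pow_nonneg this.1 k)]
    exact pow_le_pow_left₀ this.1 this.2 k
  have hi1 : IntervalIntegrable (fun s => γ s • G₁ (y s)) volume 0 τ := by
    have := hγi 1
    simp only [pow_one] at this
    exact this.smul_continuousOn (hG₁.comp hy).continuousOn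
  have hi2 : IntervalIntegrable (fun s => γ s ^ 2 • G₂ (y s)) volume 0 τ :=
    (hγi 2).smul_continuousOn (hG₂.comp hy).continuousOn
  have hi := hi1.add hi2
  have hsub : ∀ t ∈ Set.Icc 0 τ, Set.uIcc 0 t ⊆ Set.uIcc 0 τ := by
    intro t ht
    rw [Set.uIcc_of_le hτ]
    exact Set.uIcc_subset_Icc ⟨le_rfl, hτ⟩ ht
  let A : Fin d → ℝ → GramMat ℓ := fun i s => (2 * S.eigval i * γ s) • gradCol h (S.avgMap (y s))
  let Qt : Fin d → ℝ → GramMat ℓ := fun i s => γ s ^ 2 • G₂ (y s) i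
  -- Each component has the form `-(y A + Aᵀ y) + Q` required for the invariance of the cone.
  have hform : ∀ i, ∀ s ∈ Set.Icc 0 τ, (γ s • G₁ (y s) + γ s ^ 2 • G₂ (y s)) i
      = -(y s i * A i s + (A i s)ᵀ * y s i) + Qt i s := by
    intro i s hs
    simp only [Pi.add_apply, Pi.smul_apply, A, Qt, hG₁y s hs, Setup.driftMap]
    rw [transpose_smul, Matrix.mul_smul, Matrix.smul_mul, ← smul_add, smul_smul, ← neg_smul]
    congr 2
    ring
  have hpi : ∀ i, IntervalIntegrable (fun s => (γ s • G₁ (y s) + γ s ^ 2 • G₂ (y s)) i) volume 0 τ := by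
    intro i
    let P : (Fin d → GramMat ℓ) →L[ℝ] GramMat ℓ := ContinuousLinearMap.proj i
    exact ⟨P.integrable_comp hi.1, P.integrable_comp hi.2⟩
  have hyi : ∀ i, ∀ t ∈ Set.Icc 0 τ, y t i = S.init i
      + ∫ s in (0 : ℝ)..t, (γ s • G₁ (y s) + γ s ^ 2 • G₂ (y s)) i := by
    intro i t ht
    let P : (Fin d → GramMat ℓ) →L[ℝ] GramMat ℓ := ContinuousLinearMap.proj i
    have := congrArg P (heq t ht)
    rw [map_add, ← P.intervalIntegral_comp_comm (hi.mono_set (hsub t ht))] at this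
    exact this
  have hcongr : ∀ i, ∀ t ∈ Set.Icc 0 τ,
      ∫ s in (0 : ℝ)..t, (γ s • G₁ (y s) + γ s ^ 2 • G₂ (y s)) i
      = ∫ s in (0 : ℝ)..t, (-(y s i * A i s + (A i s)ᵀ * y s i) + Qt i s) := by
    intro i t ht
    refine intervalIntegral.integral_congr fun s hs => ?_
    exact hform i s (by have := hsub t ht hs; rwa [Set.uIcc_of_le hτ] at this)
  have hy0 : ∀ i, y 0 i = S.init i := fun i => by
    rw [hyi i 0 ⟨le_rfl, hτ⟩]; simp
  have hd0 : (0 : ℝ) ≤ d := Nat.cast_nonneg d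
  have hinit : ∀ i, (S.init i).PosSemidef := fun i =>
    (Matrix.posSemidef_vecMulVec_self_star _).smul hd0
  obtain ⟨b, hb⟩ : ∃ b, ∀ s ∈ Set.Icc 0 τ, ‖G₂ (y s)‖ ≤ b :=
    isCompact_Icc.exists_bound_of_continuousOn (hG₂.comp hy).continuousOn
  have hb0 : 0 ≤ b := (norm_nonneg _).trans (hb 0 ⟨le_rfl, hτ⟩)
  have hqi : ∀ i, IntervalIntegrable (Qt i) volume 0 τ := by
    intro i
    let P : (Fin d → GramMat ℓ) →L[ℝ] GramMat ℓ := ContinuousLinearMap.proj i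
    exact ⟨P.integrable_comp hi2.1, P.integrable_comp hi2.2⟩
  have hpsd : ∀ i, ∀ t ∈ Set.Icc 0 τ, (y t i).PosSemidef := by
    intro i t ht
    have hl := S.eigval_nonneg i
    refine posSemidef_of_integral_eq (y := fun t => y t i) (A := A i) (Q := Qt i)
      (a := 2 * S.eigval i * γmax * a) (b := γmax ^ 2 * b) (by positivity) hR (by positivity)
      (fun u hu => hyR u hu i) ?_ ?_ (hqi i) ?_ ?_ (by rw [hy0]; exact hinit i) ?_ ?_ ht
    · have := hγi 1
      simp only [pow_one] at this
      have h2 := (this.const_mul (2 * S.eigval i))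
      refine h2.smul_continuousOn ?_
      rwa [Set.uIcc_of_le hτ]
    · intro u hu
      simp only [A]
      have := hγ_bdd u hu.1
      rw [norm_smul, Real.norm_of_nonneg (by have := this.1; positivity)]
      have h2 := hHa u hu
      have h3 := this.1
      gcongr
      exact this.2
    · intro u hu
      simp only [Qt]
      have := hγ_bdd u hu.1
      rw [norm_smul, Real.norm_of_nonneg (by positivity)]
      have h2 := (norm_le_pi_norm (G₂ (y u)) i).trans (hb u hu)
      have h3 := this.1
      gcongr
      exact this.2
    · intro u hu
      simp only [Qt, hG₂Q]
      refine (PosSemidef.smul ?_ hl).smul (by positivity)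
      have hz : (Matrix.fromBlocks (Q (S.avgMap (y u))) 0 0 0 : GramMat ℓ)
          = (Matrix.fromCols 1 0 : Matrix (Fin ℓ) (Fin ℓ ⊕ Fin ℓ) ℝ)ᵀ * Q (S.avgMap (y u))
            * (Matrix.fromCols 1 0 : Matrix (Fin ℓ) (Fin ℓ ⊕ Fin ℓ) ℝ) := by
        ext p q
        rw [Matrix.mul_apply]
        simp only [Matrix.mul_apply, transpose_apply]
        rcases p with p | p <;> rcases q with q | q <;> simp [Matrix.one_apply]
      rw [hz]
      exact HighDimSGD.posSemidef_gram (hQp _) _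
    · refine (hpi i).congr fun s hs => ?_
      rw [Set.uIoc_of_le hτ] at hs
      exact hform i s ⟨hs.1.le, hs.2⟩
    · intro u hu
      change y u i = y 0 i + _
      rw [hyi i u hu, hy0, hcongr i u hu]
  have havg : ∀ t ∈ Set.Icc 0 τ, (S.avgMap (y t)).PosSemidef := by
    intro t ht
    refine PosSemidef.smul (posSemidef_sum _ fun i _ => ?_) (by positivity)
    exact (hpsd i t ht).smul (S.eigval_nonneg i)
  have hrr : ∀ i, ∀ t ∈ Set.Icc 0 τ, ∀ p q : Fin ℓ,
      y t i (Sum.inr p) (Sum.inr q) = S.init i (Sum.inr p) (Sum.inr q) := by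
    intro i t ht p q
    have h1 := congrArg (entryCLM ℓ (Sum.inr p) (Sum.inr q)) (hyi i t ht)
    rw [map_add, hcongr i t ht,
      ← (entryCLM ℓ (Sum.inr p) (Sum.inr q)).intervalIntegral_comp_comm] at h1
    · have h2 : ∫ s in (0 : ℝ)..t, entryCLM ℓ (Sum.inr p) (Sum.inr q)
          (-(y s i * A i s + (A i s)ᵀ * y s i) + Qt i s) = 0 := by
        refine intervalIntegral.integral_zero_ae (Eventually.of_forall fun s _ => ?_)
        simp [entryCLM_apply, A, Qt, hG₂Q, gradCol, Matrix.mul_apply]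
      rw [h2, add_zero] at h1
      exact h1
    · exact ((hpi i).mono_set (hsub t ht)).congr fun s hs => hform i s (by
        rw [Set.uIoc_of_le ht.1] at hs; exact ⟨hs.1.le, hs.2.trans ht.2⟩)
  have hblock : ∀ t ∈ Set.Icc 0 τ, (S.avgMap (y t)).toBlocks₂₂ = S.Xstarᵀ * S.K * S.Xstar := by
    intro t ht
    have h1 := S.avg_init hd (fun i _ => S.init i) t (fun i => rfl)
    rw [← S.gram_toBlocks₂₂ S.X₀, ← h1]
    ext p q
    simp [toBlocks₂₂, Setup.avgMap, Setup.avg, Matrix.sum_apply, hrr _ t ht]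
  -- The source term `Q` agrees with the Fisher matrix only at positive semidefinite covariances
  -- with the right lower block. Positivity therefore had to be shown first for the extended
  -- equation, which is why `Q` is positive semidefinite everywhere.
  have hfield : ∀ i, ∀ s ∈ Set.Icc 0 τ, (γ s • G₁ (y s) + γ s ^ 2 • G₂ (y s)) i
      = S.field f h γ (fun i t => y t i) i s := by
    intro i s hs
    rw [Pi.add_apply, Pi.smul_apply, Pi.smul_apply, hG₁y s hs, hG₂Q, hQy s hs (havg s hs) (hblock s hs)]
    change γ s • (-(2 * S.eigval i) • (y s i * gradCol h (S.avgMap (y s))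
      + (gradCol h (S.avgMap (y s)))ᵀ * y s i)) + _ = -(2 * S.eigval i * γ s) •
      (y s i * gradCol h (S.avgMap (y s)) + (gradCol h (S.avgMap (y s)))ᵀ * y s i)
      + (S.eigval i * γ s ^ 2) • Matrix.fromBlocks (fisher f (S.avgMap (y s))) 0 0 0
    rw [smul_smul, smul_smul]
    congr 2 <;> ring
  refine ⟨fun i => ((continuous_apply i).comp hy).continuousOn, hpsd, hyU, fun i p q => ?_,
    fun i t ht p q => ?_⟩
  · have h1 : IntervalIntegrable (fun s => entryCLM ℓ p q
        ((γ s • G₁ (y s) + γ s ^ 2 • G₂ (y s)) i)) volume 0 τ :=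
      ⟨(entryCLM ℓ p q).integrable_comp (hpi i).1, (entryCLM ℓ p q).integrable_comp (hpi i).2⟩
    refine h1.congr fun s hs => ?_
    rw [Set.uIoc_of_le hτ] at hs
    simp only [entryCLM_apply]
    rw [hfield i s ⟨hs.1.le, hs.2⟩]
  · have h1 := congrArg (entryCLM ℓ p q) (hyi i t ht)
    rw [map_add, ← (entryCLM ℓ p q).intervalIntegral_comp_comm ((hpi i).mono_set (hsub t ht))] at h1
    refine h1.trans (congrArg (S.init i p q + ·) ?_)
    refine intervalIntegral.integral_congr fun s hs => ?_
    have hs' : s ∈ Set.Icc 0 τ := by have := hsub t ht hs; rwa [Set.uIcc_of_le hτ] at this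
    exact congrArg (entryCLM ℓ p q) (hfield i s hs')

end Existence

/-! ### Existence up to time `T` by truncation and continuation. -/

section Existence

attribute [local instance] frobeniusTopology

variable {ℓ d : ℕ} {Lhat : ℝ} {f : ObsPlus ℓ → Obs ℓ → ℝ} {α Lf Lh LI : ℝ} {h : GramMat ℓ → ℝ}
  {U : Set (GramMat ℓ)} {S : Setup ℓ d} {γ : ℝ → ℝ}

/-- Its quadratic form at `x` is the second moment of the inner product of `x` with the gradient. -/
lemma Admissible.posSemidef_fisher (A : Admissible Lhat α Lf Lh f h U)
    {B : GramMat ℓ} (hB : B.PosSemidef) (hcrit : CriticalAE f B.toBlocks₂₂) :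
    (fisher f B).PosSemidef := by
  have hi := (A.descentCondition hB hcrit).1
  have hm := A.conv.measurable_gradX A.meas
  have hint : ∀ i j, Integrable (fun p : ObsPlus ℓ × Obs ℓ => gradX f p.1 p.2 i * gradX f p.1 p.2 j)
      (jointLaw B) := by
    intro i j
    have hi' : Measurable (fun p : ObsPlus ℓ × Obs ℓ => gradX f p.1 p.2 i) := by fun_prop
    have hj' : Measurable (fun p : ObsPlus ℓ × Obs ℓ => gradX f p.1 p.2 j) := by fun_prop
    refine Integrable.mono' hi (hi'.mul hj').aestronglyMeasurable (Eventually.of_forall fun p => ?_)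
    rw [norm_mul, pow_two]
    exact mul_le_mul (PiLp.norm_apply_le _ _) (PiLp.norm_apply_le _ _) (norm_nonneg _) (norm_nonneg _)
  rw [Matrix.posSemidef_iff_dotProduct_mulVec]
  constructor
  · ext i j
    simp [fisher, mul_comm]
  · intro x
    have e : star x ⬝ᵥ fisher f B *ᵥ x = ∫ p, (∑ i, x i * gradX f p.1 p.2 i) ^ 2 ∂jointLaw B := by
      have e1 : ∀ p : ObsPlus ℓ × Obs ℓ, (∑ i, x i * gradX f p.1 p.2 i) ^ 2
          = ∑ i, ∑ j, (x i * x j) * (gradX f p.1 p.2 i * gradX f p.1 p.2 j) := by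
        intro p
        rw [pow_two, Finset.sum_mul_sum]
        exact Finset.sum_congr rfl fun i _ => Finset.sum_congr rfl fun j _ => by ring
      simp_rw [e1]
      rw [integral_finsetSum _ fun i _ => integrable_finsetSum _ fun j _ => (hint i j).const_mul _]
      simp_rw [integral_finsetSum _ fun j _ => (hint _ j).const_mul _, integral_const_mul]
      simp only [dotProduct, mulVec, fisher, Matrix.of_apply, star_trivial, Finset.mul_sum]
      exact Finset.sum_congr rfl fun i _ => Finset.sum_congr rfl fun j _ => by ring
    rw [e]
    exact integral_nonneg fun p => sq_nonneg _

/-- Existence of the deterministic curve, from the a priori bound and the margin to the complement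
of `U`. -/
theorem Admissible.exists_isSolution (A : Admissible Lhat α Lf Lh f h U)
    (hI : PseudoLipschitzFisher α LI f U) (hd : 1 ≤ d)
    (hcrit : CriticalAE f (S.Xstarᵀ * S.K * S.Xstar)) (hinit : S.gram S.X₀ ∈ U) {γmax : ℝ}
    (hγ_meas : Measurable γ) (hγ_bdd : ∀ t, 0 ≤ t → 0 ≤ γ t ∧ γ t ≤ γmax)
    (hγ : ∀ t, 0 ≤ t → γ t * (Lhat * ((1 / (d : ℝ)) * S.K.trace)) ≤ 1)
    {T η : ℝ} (hT : 0 ≤ T) (hη : 0 < η)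
    (hmargin : ∀ τ ∈ Set.Icc 0 T, ∀ 𝓑, S.IsSolution f h U γ τ 𝓑 →
      ∀ t ∈ Set.Icc 0 τ, ∀ V ∉ U, η ≤ ‖S.avg 𝓑 t - V‖) :
    ∃ 𝓑, S.IsSolution f h U γ T 𝓑 := by
  have hγ0 : 0 ≤ γmax := (hγ_bdd 0 le_rfl).1.trans (hγ_bdd 0 le_rfl).2
  have hd0 : (0 : ℝ) < d := by positivity
  set Ctr : ℝ := 2 * ‖S.X₀ - S.Xstar‖ ^ 2 + 3 * ‖S.Xstar‖ ^ 2 with hCtr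
  set N2 : ℝ := (Fintype.card (Fin ℓ ⊕ Fin ℓ) * Fintype.card (Fin ℓ ⊕ Fin ℓ) : ℝ) with hN2
  -- The a priori bound controls the average of the traces, so a single trace is at most `d * Ctr`;
  -- this depends on `d`, which is harmless for existence in one dimension at a time.
  set R0 : ℝ := N2 * (d * Ctr) with hR0
  have hR00 : 0 ≤ R0 := by positivity
  -- The coefficients are kept on a ball strictly larger than the a priori bound, which leaves room
  -- to continue a solution.
  set R : ℝ := R0 + 1 with hR
  set k : ℝ := 1 / (d : ℝ) * ∑ i, S.eigval i with hk
  have hk0 : 0 ≤ k := mul_nonneg (by positivity) (Finset.sum_nonneg fun i _ => S.eigval_nonneg i)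
  set Ra : ℝ := k * R with hRa
  have hbound : ∀ τ 𝓑, S.IsSolution f h U γ τ 𝓑 → ∀ t ∈ Set.Icc 0 τ, ∀ i, ‖𝓑 i t‖ ≤ R0 := by
    intro τ 𝓑 sol t ht i
    refine (norm_le_trace (sol.posSemidef i t ht)).trans ?_
    refine mul_le_mul_of_nonneg_left ?_ (by positivity)
    have h1 := A.sum_trace_le hd hcrit (fun t ht => (hγ_bdd t ht).1) hγ sol ht
    rw [one_div, inv_mul_le_iff₀ hd0] at h1
    refine le_trans ?_ h1
    exact Finset.single_le_sum (f := fun i => (𝓑 i t).trace)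
      (fun i _ => Finset.sum_nonneg fun _ _ => (sol.posSemidef i t ht).diag_nonneg)
      (Finset.mem_univ i)
  -- the initial value
  have hinit_avg : S.avgMap S.init = S.gram S.X₀ :=
    S.avg_init hd (fun i _ => S.init i) 0 (fun i => rfl)
  have hsol0 : S.IsSolution f h U γ 0 (fun i _ => S.init i) := by
    refine ⟨fun i => continuousOn_const, fun i t _ =>
      (Matrix.posSemidef_vecMulVec_self_star _).smul hd0.le, fun t _ => ?_, fun i p q => ?_,
      fun i t ht p q => ?_⟩
    · rw [S.avg_init hd _ t (fun i => rfl)]; exact hinit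
    · exact IntervalIntegrable.refl
    · have : t = 0 := le_antisymm ht.2 ht.1
      simp [this]
  have hinitR : ∀ i, ‖S.init i‖ ≤ R0 := hbound 0 _ hsol0 0 ⟨le_rfl, le_rfl⟩
  have havgR : ∀ x : Fin d → GramMat ℓ, (∀ i, ‖x i‖ ≤ R) → ‖S.avgMap x‖ ≤ Ra :=
    fun x hx => S.norm_avgMap_le x hx
  have hB0R : ‖S.gram S.X₀‖ ≤ Ra := by
    rw [← hinit_avg]
    exact havgR _ fun i => (hinitR i).trans (by linarith)
  have hRa0 : 0 ≤ Ra := (norm_nonneg _).trans hB0R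
  set S1 : Set (Fin d → GramMat ℓ) := {x | (∀ i, ‖x i‖ ≤ R) ∧ S.avgMap x ∈ U} with hS1
  set LH : ℝ := |Lh| * (1 + 2 * Ra ^ α) with hLH
  have hLH0 : 0 ≤ LH := by positivity
  have hHlip : ∀ x ∈ S1, ∀ B ∈ U, ‖B‖ ≤ Ra →
      ‖gradCol h (S.avgMap x) - gradCol h B‖ ≤ LH * ‖S.avgMap x - B‖ := by
    intro x hx B hB hBR
    exact (norm_gradCol_le _ _ _).trans ((A.risk.pseudoLipschitz _ hx.2 _ hB).trans
      (pseudoLipschitz_factor_le A.hα (havgR x hx.1) hBR))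
  set b : ℝ := ‖gradCol h (S.gram S.X₀)‖ + LH * (2 * Ra) with hb
  have hHb : ∀ x ∈ S1, ‖gradCol h (S.avgMap x)‖ ≤ b := by
    intro x hx
    have h1 := hHlip x hx _ hinit hB0R
    have h2 := norm_le_insert' (gradCol h (S.avgMap x)) (gradCol h (S.gram S.X₀))
    have h3 : ‖S.avgMap x - S.gram S.X₀‖ ≤ 2 * Ra := by
      have := norm_sub_le (S.avgMap x) (S.gram S.X₀)
      linarith [havgR x hx.1]
    have := mul_le_mul_of_nonneg_left h3 hLH0
    linarith
  set c1 : ℝ := (2 * ∑ i, S.eigval i) * (2 * b + 2 * (LH * k) * R) with hc1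
  have hc10 : 0 ≤ c1 := by
    have : 0 ≤ ∑ i, S.eigval i := Finset.sum_nonneg fun i _ => S.eigval_nonneg i
    have : 0 ≤ b := by positivity
    positivity
  have hlip1 : LipschitzOnWith c1.toNNReal (S.driftMap h) S1 := by
    refine LipschitzOnWith.of_dist_le_mul fun x hx x' hx' => ?_
    rw [dist_eq_norm, dist_eq_norm, Real.coe_toNNReal _ hc10]
    exact norm_driftMap_sub_le (by positivity) hLH0 hx'.1 (hHlip x hx _ hx'.2 (havgR _ hx'.1))
      (hHb x hx)
  obtain ⟨G₁, hG₁, hG₁e⟩ := hlip1.extend_finite_dimension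
  set S2 : Set (GramMat ℓ) := {B | B ∈ U ∧ B.PosSemidef ∧ ‖B‖ ≤ Ra} with hS2
  set c2 : ℝ := |LI| * (1 + 2 * Ra ^ α) with hc2
  have hc20 : 0 ≤ c2 := by positivity
  have hlip2 : LipschitzOnWith c2.toNNReal (fisher f) S2 := by
    refine LipschitzOnWith.of_dist_le_mul fun x hx x' hx' => ?_
    rw [dist_eq_norm, dist_eq_norm, Real.coe_toNNReal _ hc20]
    exact (hI x hx.1 x' hx'.1 hx.2.1 hx'.2.1).trans
      (pseudoLipschitz_factor_le A.hα hx.2.2 hx'.2.2)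
  obtain ⟨g, hg, hge⟩ := hlip2.extend_finite_dimension
  obtain ⟨cπ, π, hπ, hπp, hπe⟩ := exists_posSemidef_projection (n := Fin ℓ)
  -- A Lipschitz extension of the Fisher matrix need not be positive semidefinite. Projecting onto
  -- the cone repairs this and keeps the values that are Fisher matrices of critical covariances.
  set Q : GramMat ℓ → Matrix (Fin ℓ) (Fin ℓ) ℝ := fun B => π (g B) with hQ
  have hQl : LipschitzWith _ Q := hπ.comp hg
  set G₂ : (Fin d → GramMat ℓ) → Fin d → GramMat ℓ :=
    fun x i => S.eigval i • Matrix.fromBlocks (Q (S.avgMap x)) 0 0 0 with hG₂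
  obtain ⟨cQ, hcQ⟩ : ∃ c : NNReal, LipschitzWith c Q := ⟨_, hQl⟩
  have hG₂l : ∀ x x', ‖G₂ x - G₂ x'‖ ≤ (∑ i, S.eigval i) * (cQ * k) * ‖x - x'‖ := by
    intro x x'
    have hs0 : 0 ≤ ∑ i, S.eigval i := Finset.sum_nonneg fun i _ => S.eigval_nonneg i
    refine (pi_norm_le_iff_of_nonneg (by positivity)).2 fun i => ?_
    have e : (G₂ x - G₂ x') i = S.eigval i • (Matrix.fromBlocks
        (Q (S.avgMap x) - Q (S.avgMap x')) 0 0 0 : GramMat ℓ) := by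
      rw [Pi.sub_apply]
      simp only [G₂]
      rw [← smul_sub, sub_eq_add_neg, fromBlocks_neg, fromBlocks_add]
      simp [sub_eq_add_neg]
    rw [e, norm_smul, Real.norm_of_nonneg (S.eigval_nonneg i), mul_assoc]
    refine mul_le_mul (Finset.single_le_sum (f := S.eigval) (fun i _ => S.eigval_nonneg i)
      (Finset.mem_univ i)) ?_ (norm_nonneg _) hs0
    refine (norm_fromBlocks_le _).trans ?_
    have h1 := hcQ.dist_le_mul (S.avgMap x) (S.avgMap x')
    rw [dist_eq_norm, dist_eq_norm, ← S.avgMap_sub] at h1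
    refine h1.trans ?_
    rw [mul_assoc]
    exact mul_le_mul_of_nonneg_left
      (S.norm_avgMap_le _ fun i => norm_le_pi_norm (x - x') i) cQ.2
  have hG₁c : Continuous G₁ := hG₁.continuous
  have hG₂c : Continuous G₂ := by
    refine (LipschitzWith.of_dist_le_mul (K := ((∑ i, S.eigval i) * (cQ * k)).toNNReal)
      fun x x' => ?_).continuous
    rw [dist_eq_norm, dist_eq_norm, Real.coe_toNNReal _ (mul_nonneg
      (Finset.sum_nonneg fun i _ => S.eigval_nonneg i) (by positivity))]
    exact hG₂l x x'
  obtain ⟨cG, hcG⟩ : ∃ c : NNReal, LipschitzWith c G₁ := ⟨_, hG₁⟩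
  have hγi : ∀ j : ℕ, IntervalIntegrable (fun s => γ s ^ j) volume 0 T := by
    intro j
    rw [intervalIntegrable_iff_integrableOn_Ioc_of_le hT]
    refine IntegrableOn.of_bound (by simp) (hγ_meas.pow_const j).aestronglyMeasurable (γmax ^ j) ?_
    filter_upwards [ae_restrict_mem measurableSet_Ioc] with s hs
    have := hγ_bdd s hs.1.le
    rw [Real.norm_of_nonneg (pow_nonneg this.1 j)]
    exact pow_le_pow_left₀ this.1 this.2 j
  have hs0 : 0 ≤ ∑ i, S.eigval i := Finset.sum_nonneg fun i _ => S.eigval_nonneg i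
  obtain ⟨y, hy, hyeq⟩ := exists_integral_solution
    (F := fun s x => γ s • G₁ x + γ s ^ 2 • G₂ x) hT
    (L := γmax * cG + γmax ^ 2 * ((∑ i, S.eigval i) * (cQ * k))) (by positivity) S.init
    (fun y hy => by
      have h1 := hγi 1
      simp only [pow_one] at h1
      exact (h1.smul_continuousOn (hG₁c.comp hy).continuousOn).add
        ((hγi 2).smul_continuousOn (hG₂c.comp hy).continuousOn))
    (fun s hs x x' => by
      have h1 := hγ_bdd s hs.1
      have e : γ s • G₁ x + γ s ^ 2 • G₂ x - (γ s • G₁ x' + γ s ^ 2 • G₂ x')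
          = γ s • (G₁ x - G₁ x') + γ s ^ 2 • (G₂ x - G₂ x') := by
        rw [smul_sub, smul_sub]; abel
      rw [e, add_mul]
      refine (norm_add_le _ _).trans (add_le_add ?_ ?_)
      · have h2 := hcG.dist_le_mul x x'
        rw [dist_eq_norm, dist_eq_norm] at h2
        rw [norm_smul, Real.norm_of_nonneg h1.1, mul_assoc]
        exact mul_le_mul h1.2 h2 (norm_nonneg _) hγ0
      · rw [norm_smul, Real.norm_of_nonneg (by positivity), mul_assoc]
        exact mul_le_mul (pow_le_pow_left₀ h1.1 h1.2 2) (hG₂l x x') (norm_nonneg _) (by positivity))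
  have hyavg : Continuous fun t => S.avgMap (y t) := by
    unfold Setup.avgMap
    exact (continuous_finsetSum _ fun i _ =>
      ((continuous_apply i).comp hy).const_smul (S.eigval i)).const_smul (1 / (d : ℝ))
  have hsolve : ∀ τ ∈ Set.Icc 0 T, (∀ u ∈ Set.Icc 0 τ, y u ∈ S1) →
      S.IsSolution f h U γ τ (fun i t => y t i) := by
    intro τ hτ hyS
    refine isSolution_of_extension (R := R) (a := b) hτ.1 (by positivity) hγ_bdd hγ_meas hy hG₁c
      (fun B => hπp (g B)) hG₂c (fun x i => rfl) (fun t ht => hyeq t ⟨ht.1, ht.2.trans hτ.2⟩)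
      (fun t ht => (hyS t ht).1) (fun t ht => (hyS t ht).2) ?_ (fun t ht => hHb _ (hyS t ht))
      (fun t ht => (hG₁e (hyS t ht)).symm) hd ?_
    · have h1 : LipschitzOnWith LH.toNNReal (gradCol h) {B | B ∈ U ∧ ‖B‖ ≤ Ra} := by
        refine LipschitzOnWith.of_dist_le_mul fun x hx x' hx' => ?_
        rw [dist_eq_norm, dist_eq_norm, Real.coe_toNNReal _ hLH0]
        exact (norm_gradCol_le _ _ _).trans ((A.risk.pseudoLipschitz _ hx.1 _ hx'.1).trans
          (pseudoLipschitz_factor_le A.hα hx.2 hx'.2))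
      exact h1.continuousOn.comp hyavg.continuousOn
        fun t ht => ⟨(hyS t ht).2, havgR _ (hyS t ht).1⟩
    · intro t ht hp h22
      have hmem : S.avgMap (y t) ∈ S2 := ⟨(hyS t ht).2, hp, havgR _ (hyS t ht).1⟩
      refine (congrArg π (hge hmem).symm).trans ?_
      exact hπe _ (A.posSemidef_fisher hp (by rw [h22]; exact hcrit))
  -- The closed conditions that the a priori bound and the margin impose on true solutions. They put
  -- `y u` in the interior of the region `S1` in which the coefficients are unchanged.
  set good : ℝ → Prop := fun u => (∀ i, ‖y u i‖ ≤ R0) ∧ ∀ V ∉ U, η ≤ ‖S.avgMap (y u) - V‖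
    with hgood
  have hgoodS : ∀ u, good u → y u ∈ S1 := by
    intro u hu
    refine ⟨fun i => (hu.1 i).trans (by linarith), ?_⟩
    by_contra hV
    have := hu.2 _ hV
    rw [sub_self, norm_zero] at this
    linarith
  have hsg : ∀ τ ∈ Set.Icc 0 T, S.IsSolution f h U γ τ (fun i t => y t i) →
      ∀ u ∈ Set.Icc 0 τ, good u := fun τ hτ sol u hu =>
    ⟨hbound τ _ sol u hu, hmargin τ hτ _ sol u hu⟩
  have hclosed : IsClosed {u | good u} := by
    have : {u | good u} = (⋂ i, {u | ‖y u i‖ ≤ R0}) ∩ ⋂ V ∈ Uᶜ, {u | η ≤ ‖S.avgMap (y u) - V‖} := by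
      ext u; simp [hgood]
    rw [this]
    refine (isClosed_iInter fun i => isClosed_le ?_ continuous_const).inter
      (isClosed_biInter fun V _ => isClosed_le continuous_const ?_)
    · exact ((continuous_apply i).comp hy).norm
    · exact (hyavg.sub continuous_const).norm
  have hy0 : y 0 = S.init := by rw [hyeq 0 ⟨le_rfl, hT⟩]; simp
  -- Continuation: the times up to which `good` holds form a closed set. Wherever it holds the path
  -- stays in `S1` a little longer, hence solves the original equation there, and the a priori
  -- bounds make these further times good as well.
  have hall : Set.Icc 0 T ⊆ {t | ∀ u ∈ Set.Icc 0 t, good u} := by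
    have hg0 : good 0 := by
      refine ⟨fun i => by rw [hy0]; exact hinitR i, fun V hV => ?_⟩
      rw [hy0]
      exact hmargin 0 ⟨le_rfl, hT⟩ _ hsol0 0 ⟨le_rfl, le_rfl⟩ V hV
    refine IsClosed.Icc_subset_of_forall_exists_gt ?_ ?_ ?_
    · refine IsClosed.inter ?_ isClosed_Icc
      refine isClosed_of_closure_subset fun t ht u hu => ?_
      rcases hu.2.lt_or_eq with hlt | heq
      · obtain ⟨v, hv1, hv2⟩ := mem_closure_iff.1 ht (Set.Ioi u) isOpen_Ioi hlt
        exact hv2 u ⟨hu.1, le_of_lt hv1⟩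
      · subst heq
        rcases hu.1.lt_or_eq with hlt | heq
        · have hsub : Set.Ico 0 u ⊆ {u | good u} := fun v hv => ?_
          · exact hclosed.closure_subset_iff.2 hsub (by
              rw [closure_Ico hlt.ne]; exact ⟨hu.1, le_rfl⟩)
          obtain ⟨w, hw1, hw2⟩ := mem_closure_iff.1 ht (Set.Ioi v) isOpen_Ioi hv.2
          exact hw2 v ⟨hv.1, le_of_lt hw1⟩
        · rw [← heq]; exact hg0
    · intro u hu
      rw [show u = 0 from le_antisymm hu.2 hu.1]
      exact hg0
    · rintro x ⟨hx, hx0, hxT⟩ z hz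
      have hgx := hx x ⟨hx0, le_rfl⟩
      have hev : ∀ᶠ u in 𝓝 x, y u ∈ S1 := by
        have h1 : ∀ᶠ u in 𝓝 x, ∀ i, ‖y u i‖ < R := by
          rw [eventually_all]
          intro i
          exact (((continuous_apply i).comp hy).norm.tendsto x).eventually_lt_const
            (by have := hgx.1 i; exact this.trans_lt (by linarith))
        have h2 : ∀ᶠ u in 𝓝 x, S.avgMap (y u) ∈ U := hyavg.continuousAt.eventually_mem
          (A.isOpen.mem_nhds (hgoodS x hgx).2)
        filter_upwards [h1, h2] with u hu1 hu2 using ⟨fun i => (hu1 i).le, hu2⟩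
      obtain ⟨δ, hδ, hball⟩ := Metric.eventually_nhds_iff.1 hev
      set x' := min (x + δ / 2) (min z T) with hx'
      have hz' : x < z := hz
      have hxx' : x < x' := lt_min (by linarith) (lt_min hz' hxT)
      have hx'T : x' ≤ T := (min_le_right _ _).trans (min_le_right _ _)
      refine ⟨x', ?_, hxx', (min_le_right _ _).trans (min_le_left _ _)⟩
      have hmem' : x' ∈ Set.Icc 0 T := ⟨hx0.trans hxx'.le, hx'T⟩
      refine hsg x' hmem' (hsolve x' hmem' fun u hu => ?_)
      rcases le_or_gt u x with hux | hux
      · exact hgoodS u (hx u ⟨hu.1, hux⟩)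
      · refine hball ?_
        rw [Real.dist_eq, abs_of_pos (by linarith)]
        have : u ≤ x + δ / 2 := hu.2.trans (min_le_left _ _)
        linarith
  exact ⟨_, hsolve T ⟨hT, le_rfl⟩ fun u hu => hgoodS u (hall ⟨hT, le_rfl⟩ u hu)⟩

end Existence

/-! ### Recursions driven by independent samples -/

section Chain

set_option linter.unusedSectionVars false

open scoped ENNReal

variable {Ω E Sp : Type*} [MeasurableSpace Ω] {P : Measure Ω} [IsProbabilityMeasure P]
  [MeasurableSpace E] [mSp : MeasurableSpace Sp] {ν : Measure Sp} [IsProbabilityMeasure ν]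
  {ξ : ℕ → Ω → Sp} {Φ : ℕ → E → Sp → E} {x₀ : E} {X : ℕ → Ω → E}

/-- The `σ`-algebra of the first `k` samples. -/
@[reducible] def pastSamples (ξ : ℕ → Ω → Sp) (k : ℕ) : MeasurableSpace Ω :=
  ⨆ i ∈ Set.Iio k, mSp.comap (ξ i)

lemma pastSamples_mono {j k : ℕ} (hjk : j ≤ k) : pastSamples ξ j ≤ pastSamples ξ k :=
  biSup_mono fun _ hi => lt_of_lt_of_le hi hjk

lemma measurable_sample_pastSamples (k : ℕ) : Measurable[pastSamples ξ (k + 1)] (ξ k) := by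
  have h : mSp.comap (ξ k) ≤ pastSamples ξ (k + 1) :=
    le_iSup₂_of_le (f := fun i (_ : i ∈ Set.Iio (k + 1)) => mSp.comap (ξ i)) k (Nat.lt_succ_self k)
      le_rfl
  exact (comap_measurable (ξ k)).mono h le_rfl

lemma measurable_chain (hΦ : ∀ k, Measurable (Function.uncurry (Φ k)))
    (hX0 : ∀ ω, X 0 ω = x₀) (hXs : ∀ k ω, X (k + 1) ω = Φ k (X k ω) (ξ k ω)) (k : ℕ) :
    Measurable[pastSamples ξ k] (X k) := by
  induction k with
  | zero =>
    have : X 0 = fun _ => x₀ := funext hX0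
    rw [this]
    exact @measurable_const _ _ _ (pastSamples ξ 0) _
  | succ k ih =>
    have : X (k + 1) = Function.uncurry (Φ k) ∘ fun ω => (X k ω, ξ k ω) := funext (hXs k)
    rw [this]
    exact (hΦ k).comp ((ih.mono (pastSamples_mono k.le_succ) le_rfl).prodMk
      (measurable_sample_pastSamples k))

lemma indepFun_pastSamples {F : Type*} [mF : MeasurableSpace F] (hm : ∀ k, Measurable (ξ k))
    (hind : iIndepFun ξ P) {k : ℕ} {Y : Ω → F} (hY : Measurable[pastSamples ξ k] Y) :
    IndepFun Y (ξ k) P := by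
  have h1 := indep_iSup_of_disjoint (S := Set.Iio k) (T := {k}) (fun i => (hm i).comap_le)
    hind (by simp)
  rw [IndepFun_iff_Indep]
  refine indep_of_indep_of_le_left (indep_of_indep_of_le_right h1 ?_) hY.comap_le
  exact le_iSup₂_of_le (f := fun i (_ : i ∈ ({k} : Set ℕ)) => mSp.comap (ξ i)) k rfl le_rfl

lemma pastSamples_le (hm : ∀ k, Measurable (ξ k)) (k : ℕ) : pastSamples ξ k ≤ ‹MeasurableSpace Ω› :=
  iSup₂_le fun i _ => (hm i).comap_le

/-- A maximal inequality: if `W` is, up to factors `b k`, a supermartingale along the recursion as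
long as it stays in the sets `A k`, and is large off these sets, then an exit is unlikely. -/
lemma measure_exit_mul_le (hm : ∀ k, Measurable (ξ k)) (hlaw : ∀ k, P.map (ξ k) = ν)
    (hind : iIndepFun ξ P) (hΦ : ∀ k, Measurable (Function.uncurry (Φ k)))
    (hX0 : ∀ ω, X 0 ω = x₀) (hXs : ∀ k ω, X (k + 1) ω = Φ k (X k ω) (ξ k ω))
    {A : ℕ → Set E} (hA : ∀ k, MeasurableSet (A k)) {W : ℕ → E → ℝ≥0∞}
    (hW : ∀ k, Measurable (W k)) {b : ℕ → ℝ≥0∞} {c D : ℝ≥0∞} {n : ℕ}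
    (hstep : ∀ k < n, ∀ x ∈ A k, ∫⁻ s, W (k + 1) (Φ k x s) ∂ν ≤ b k * W k x)
    (hexit : ∀ k ≤ n, ∀ x ∉ A k, c ≤ W k x)
    (hD : ∀ k ≤ n, ∏ j ∈ Finset.range k, b j ≤ D) :
    c * P {ω | ∃ k ≤ n, X k ω ∉ A k} ≤ (n + 1) * (D * W 0 x₀) := by
  classical
  -- The inequality `j < k` is strict: `H k` says nothing about the `k`-th iterate, so `H k` without
  -- `A k` is the event of a first exit at time `k`, and `H k` depends only on the first `k`
  -- samples.
  set H : ℕ → Set Ω := fun k => {ω | ∀ j < k, X j ω ∈ A j} with hH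
  have hXm := measurable_chain hΦ hX0 hXs
  have hXmeas : ∀ k, Measurable (X k) := fun k => (hXm k).mono (pastSamples_le hm k) le_rfl
  have hHm : ∀ k, MeasurableSet[pastSamples ξ k] (H k) := by
    intro k
    have : H k = ⋂ j ∈ Set.Iio k, X j ⁻¹' A j := by ext ω; simp [hH]
    rw [this]
    refine MeasurableSet.biInter (Set.to_countable _) fun j hj => ?_
    exact pastSamples_mono (le_of_lt hj) _ (hXm j (hA j))
  have hHmeas : ∀ k, MeasurableSet (H k) := fun k => pastSamples_le hm k _ (hHm k)
  set u : ℕ → ℝ≥0∞ := fun k => ∫⁻ ω, (H k).indicator 1 ω * W k (X k ω) ∂P with hu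
  have hustep : ∀ k < n, u (k + 1) ≤ b k * u k := by
    intro k hk
    -- The state and the indicator of no earlier exit are functions of the past, hence jointly
    -- independent of the next sample. The one-step bound can then be integrated by Tonelli.
    set Y : Ω → E × ℝ≥0∞ := fun ω => (X k ω, (H k).indicator 1 ω) with hY
    have hYm : Measurable[pastSamples ξ k] Y :=
      (hXm k).prodMk (Measurable.indicator (@measurable_const _ _ _ (pastSamples ξ k) _) (hHm k))
    have hYmeas : Measurable Y := hYm.mono (pastSamples_le hm k) le_rfl
    have hI := indepFun_pastSamples hm hind hYm
    rw [indepFun_iff_map_prod_eq_prod_map_map hYmeas.aemeasurable (hm k).aemeasurable, hlaw] at hI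
    set F : (E × ℝ≥0∞) × Sp → ℝ≥0∞ := fun z => z.1.2 * (A k).indicator 1 z.1.1
      * W (k + 1) (Φ k z.1.1 z.2) with hF
    have hFm : Measurable F := by
      refine (measurable_fst.snd.mul ?_).mul ?_
      · exact (measurable_one.indicator (hA k)).comp measurable_fst.fst
      · exact (hW (k + 1)).comp ((hΦ k).comp (measurable_fst.fst.prodMk measurable_snd))
    calc u (k + 1) = ∫⁻ ω, F (Y ω, ξ k ω) ∂P := by
          refine lintegral_congr fun ω => ?_
          simp only [hF, hY, hXs]
          congr 1
          by_cases h1 : ω ∈ H k <;> by_cases h2 : X k ω ∈ A k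
          · have : ω ∈ H (k + 1) := fun j hj => by
              rcases Nat.lt_succ_iff_lt_or_eq.1 hj with h | h
              · exact h1 j h
              · rw [h]; exact h2
            simp [h1, h2, this]
          · have : ω ∉ H (k + 1) := fun h => h2 (h k (Nat.lt_succ_self k))
            simp [h2, this]
          all_goals
            have : ω ∉ H (k + 1) := fun h => h1 fun j hj => h j (hj.trans (Nat.lt_succ_self k))
            simp [h1, this]
      _ = ∫⁻ z, F z ∂((P.map Y).prod ν) := by
          rw [← hI, lintegral_map hFm (hYmeas.prodMk (hm k))]
      _ = ∫⁻ y, ∫⁻ s, F (y, s) ∂ν ∂(P.map Y) := lintegral_prod _ hFm.aemeasurable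
      _ ≤ ∫⁻ y, b k * (y.2 * W k y.1) ∂(P.map Y) := by
          refine lintegral_mono fun y => ?_
          simp only [hF]
          by_cases h2 : y.1 ∈ A k
          · have hmeas : Measurable fun s => W (k + 1) (Φ k y.1 s) :=
              (hW (k + 1)).comp ((hΦ k).comp (measurable_const.prodMk measurable_id))
            rw [lintegral_const_mul _ hmeas]
            simp only [h2, Set.indicator_of_mem, Pi.one_apply, mul_one]
            calc y.2 * ∫⁻ s, W (k + 1) (Φ k y.1 s) ∂ν ≤ y.2 * (b k * W k y.1) := by
                  gcongr; exact hstep k hk _ h2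
              _ = _ := by ring
          · simp [h2]
      _ = b k * u k := by
          have hmeas : Measurable fun y : E × ℝ≥0∞ => y.2 * W k y.1 :=
            measurable_snd.mul ((hW k).comp measurable_fst)
          rw [lintegral_const_mul _ hmeas, lintegral_map hmeas hYmeas]
  have hubound : ∀ k ≤ n, u k ≤ (∏ j ∈ Finset.range k, b j) * W 0 x₀ := by
    intro k
    induction k with
    | zero => intro _; simp [hu, hH, hX0]
    | succ k ih =>
      intro hk
      refine (hustep k hk).trans ?_
      rw [Finset.prod_range_succ, mul_comm _ (b k), mul_assoc]
      gcongr
      exact ih (by omega)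
  have hsub : {ω | ∃ k ≤ n, X k ω ∉ A k}
      ⊆ ⋃ k ∈ Finset.range (n + 1), (H k ∩ (X k ⁻¹' A k)ᶜ) := by
    rintro ω ⟨k, hk, hkA⟩
    have hex : ∃ k, X k ω ∉ A k := ⟨k, hkA⟩
    have hle := Nat.find_min' hex hkA
    simp only [Set.mem_iUnion, Finset.mem_range]
    refine ⟨Nat.find hex, by omega, fun j hj => ?_, Nat.find_spec hex⟩
    exact not_not.1 (Nat.find_min hex hj)
  -- A union bound over the possible first exit times; the factor `n + 1` is harmless against
  -- arbitrarily high moments.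
  calc c * P {ω | ∃ k ≤ n, X k ω ∉ A k}
      ≤ c * ∑ k ∈ Finset.range (n + 1), P (H k ∩ (X k ⁻¹' A k)ᶜ) := by
        gcongr
        exact (measure_mono hsub).trans (measure_biUnion_finset_le _ _)
    _ = ∑ k ∈ Finset.range (n + 1), c * P (H k ∩ (X k ⁻¹' A k)ᶜ) := Finset.mul_sum _ _ _
    _ ≤ ∑ k ∈ Finset.range (n + 1), D * W 0 x₀ := by
        refine Finset.sum_le_sum fun k hk => ?_
        have hk' : k ≤ n := by simpa [Nat.lt_succ_iff] using hk
        have hms : MeasurableSet (H k ∩ (X k ⁻¹' A k)ᶜ) :=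
          (hHmeas k).inter (hXmeas k (hA k)).compl
        calc c * P (H k ∩ (X k ⁻¹' A k)ᶜ)
            = ∫⁻ ω, (H k ∩ (X k ⁻¹' A k)ᶜ).indicator (fun _ => c) ω ∂P := by
              rw [lintegral_indicator_const hms]
          _ ≤ u k := by
              refine lintegral_mono fun ω => ?_
              by_cases hω : ω ∈ H k ∩ (X k ⁻¹' A k)ᶜ
              · simp only [Set.indicator_of_mem hω, Set.indicator_of_mem hω.1, Pi.one_apply, one_mul]
                exact hexit k hk' _ hω.2
              · simp [Set.indicator_of_notMem hω]
          _ ≤ (∏ j ∈ Finset.range k, b j) * W 0 x₀ := hubound k hk'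
          _ ≤ D * W 0 x₀ := by gcongr; exact hD k hk'
    _ = _ := by simp

end Chain

/-! ### One step of a high moment -/

section HighMoment

variable {Ω E : Type*} [MeasurableSpace Ω] {μ : Measure Ω} [IsProbabilityMeasure μ]
  [NormedAddCommGroup E] [InnerProductSpace ℝ E] [CompleteSpace E]

/-- The first order term is kept exactly, so that a small mean of `z` can be exploited later. All
higher powers lie between `z²` and `|z|^(2p)` and are absorbed by their sum. -/
lemma one_add_pow_le {z : ℝ} (p : ℕ) :
    (1 + z) ^ p ≤ 1 + p * z + 2 ^ p * (z ^ 2 + |z| ^ (2 * p)) := by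
  have hk : ∀ k ∈ Finset.range (p + 1), z ^ k * (p.choose k : ℝ)
      ≤ (if k = 0 then 1 else 0) + (if k = 1 then p * z else 0)
        + (z ^ 2 + |z| ^ (2 * p)) * p.choose k := by
    intro k hk
    have hk' : k ≤ p := by simpa [Nat.lt_succ_iff] using hk
    have h0 : 0 ≤ (z ^ 2 + |z| ^ (2 * p)) * p.choose k := by positivity
    rcases k with _ | _ | k
    · simpa using h0
    · simp only [zero_add, pow_one, Nat.choose_one_right] at h0 ⊢
      simp only [one_ne_zero, if_false, if_true]
      linarith
    · simp only [Nat.add_eq_zero_iff, one_ne_zero, and_false, if_false, zero_add,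
        show ¬ (k + 1 + 1 = 1) by omega]
      gcongr
      calc z ^ (k + 1 + 1) ≤ |z| ^ (k + 1 + 1) := (le_abs_self _).trans_eq (abs_pow _ _)
        _ ≤ |z| ^ 2 + |z| ^ (2 * p) := by
            rcases le_total |z| 1 with h | h
            · have := pow_le_pow_of_le_one (abs_nonneg z) h (show 2 ≤ k + 1 + 1 by omega)
              have := pow_nonneg (abs_nonneg z) (2 * p)
              linarith
            · have := pow_le_pow_right₀ h (show k + 1 + 1 ≤ 2 * p by omega)
              have := pow_nonneg (abs_nonneg z) 2
              linarith
        _ = _ := by rw [sq_abs]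
  calc (1 + z) ^ p = ∑ k ∈ Finset.range (p + 1), z ^ k * (p.choose k : ℝ) := by
        rw [add_comm, add_pow]; simp
    _ ≤ _ := Finset.sum_le_sum hk
    _ ≤ _ := by
        rw [Finset.sum_add_distrib, Finset.sum_add_distrib, ← Finset.mul_sum]
        have h2 : (∑ k ∈ Finset.range (p + 1), (p.choose k : ℝ)) = 2 ^ p := by
          exact_mod_cast Nat.sum_range_choose p
        rw [h2]
        have h3 : ∑ k ∈ Finset.range (p + 1), (if k = 1 then p * z else 0) ≤ p * z := by
          rw [Finset.sum_ite_eq']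
          split_ifs with h
          · exact le_rfl
          · have : p = 0 := by simpa using h
            simp [this]
        have h4 : ∑ k ∈ Finset.range (p + 1), (if k = 0 then (1 : ℝ) else 0) = 1 := by simp
        rw [h4]
        linarith

/-- The constant in `lintegral_moment_step_le`. -/
def stepConst (p : ℕ) (c : ℝ) (m : ℕ → ℝ) : ℝ :=
  p * (2 * c + m 1) + 2 ^ p * (2 * (m 1 + m 2) + 2 ^ (2 * p) * (m p + m (2 * p)))

/-- The `p`-th moment of `‖Δ‖² + ρ²` grows, in one step with small variance and small mean, by a
factor close to one. -/
lemma lintegral_moment_step_le {p : ℕ} (hp : 1 ≤ p) {s ρ c e : ℝ} (hs0 : 0 ≤ s) (hs1 : s ≤ 1)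
    (hρ : 0 < ρ) (hc : 0 ≤ c) (he : 0 ≤ e) {m : ℕ → ℝ} {Δ : E} {G : Ω → E} {Ψ : Ω → ℝ}
    (hG : AEStronglyMeasurable G μ) (hΨ0 : ∀ ω, 0 ≤ Ψ ω)
    (hGΨ : ∀ᵐ ω ∂μ, ‖G ω‖ ^ 2 ≤ s * ρ ^ 2 * Ψ ω)
    (hΨi : ∀ q, Integrable (fun ω => Ψ ω ^ q) μ) (hΨm : ∀ q, ∫ ω, Ψ ω ^ q ∂μ ≤ m q)
    (hmean : ‖∫ ω, G ω ∂μ‖ ≤ c * (s * ‖Δ‖ + e)) :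
    ∫⁻ ω, ENNReal.ofReal ((‖Δ + G ω‖ ^ 2 + ρ ^ 2) ^ p) ∂μ
      ≤ ENNReal.ofReal (1 + stepConst p c m * (s + e / ρ))
        * ENNReal.ofReal ((‖Δ‖ ^ 2 + ρ ^ 2) ^ p) := by
  set V : ℝ := ‖Δ‖ ^ 2 + ρ ^ 2 with hV
  have hV0 : 0 < V := by positivity
  -- The relative increment: the new value of `‖Δ‖² + ρ²` is `V (1 + ζ)`.
  set ζ : Ω → ℝ := fun ω => (2 * inner ℝ Δ (G ω) + ‖G ω‖ ^ 2) / V with hζ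
  have hm0 : ∀ q, 0 ≤ m q := fun q => (integral_nonneg fun ω => pow_nonneg (hΨ0 ω) q).trans (hΨm q)
  have hΨ1 : Integrable Ψ μ := by simpa using hΨi 1
  have hGsq : Integrable (fun ω => ‖G ω‖ ^ 2) μ := by
    refine Integrable.mono' (hΨ1.const_mul (s * ρ ^ 2)) (hG.norm.pow 2) ?_
    filter_upwards [hGΨ] with ω hω
    rwa [Real.norm_of_nonneg (by positivity)]
  have hGi : Integrable G μ := ((memLp_two_iff_integrable_sq_norm hG).2 hGsq).integrable one_le_two
  have hid : ∀ ω, ‖Δ + G ω‖ ^ 2 + ρ ^ 2 = V * (1 + ζ ω) := by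
    intro ω
    rw [norm_add_sq_real]
    simp only [hζ]
    field_simp
    rw [hV]; ring
  have hζb : ∀ ω, |ζ ω| ≤ ‖G ω‖ / ρ + (‖G ω‖ / ρ) ^ 2 := by
    intro ω
    have h1 := abs_real_inner_le_norm Δ (G ω)
    -- This is where `ρ` enters: it bounds the relative increment by `r + r²` with `r = ‖G‖/ρ`,
    -- uniformly in `Δ`.
    have h2 : 2 * ‖Δ‖ * ρ ≤ V := by nlinarith [sq_nonneg (‖Δ‖ - ρ)]
    have h3 : ρ ^ 2 ≤ V := by have := sq_nonneg ‖Δ‖; linarith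
    simp only [hζ]
    rw [abs_div, abs_of_pos hV0]
    have h4 : |2 * inner ℝ Δ (G ω) + ‖G ω‖ ^ 2| ≤ 2 * (‖Δ‖ * ‖G ω‖) + ‖G ω‖ ^ 2 := by
      refine (abs_add_le _ _).trans ?_
      rw [abs_mul, abs_two, abs_of_nonneg (sq_nonneg ‖G ω‖)]
      linarith
    rw [div_le_iff₀ hV0]
    refine h4.trans ?_
    have h5 : 2 * (‖Δ‖ * ‖G ω‖) ≤ ‖G ω‖ / ρ * V := by
      rw [div_mul_eq_mul_div, le_div_iff₀ hρ]
      nlinarith [norm_nonneg (G ω)]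
    have h6 : ‖G ω‖ ^ 2 ≤ (‖G ω‖ / ρ) ^ 2 * V := by
      rw [div_pow, div_mul_eq_mul_div, le_div_iff₀ (by positivity)]
      nlinarith [sq_nonneg ‖G ω‖]
    linarith
  -- An integrable majorant of the second order terms. It carries only one factor `s`, because `s ^
  -- q ≤ s` for `s ≤ 1`.
  set Q : Ω → ℝ := fun ω => s * (2 * (Ψ ω ^ 1 + Ψ ω ^ 2)
    + 2 ^ (2 * p) * (Ψ ω ^ p + Ψ ω ^ (2 * p))) with hQ
  have hζQ : ∀ᵐ ω ∂μ, ζ ω ^ 2 + |ζ ω| ^ (2 * p) ≤ Q ω := by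
    filter_upwards [hGΨ] with ω hω
    set r := ‖G ω‖ / ρ with hr
    have hr0 : 0 ≤ r := by positivity
    have hr2 : r ^ 2 ≤ s * Ψ ω := by
      rw [hr, div_pow, div_le_iff₀ (by positivity)]
      linarith
    have hΨω := hΨ0 ω
    have hpow : ∀ q, 1 ≤ q → r ^ (2 * q) ≤ s * Ψ ω ^ q := by
      intro q hq
      rw [pow_mul]
      calc (r ^ 2) ^ q ≤ (s * Ψ ω) ^ q := pow_le_pow_left₀ (sq_nonneg r) hr2 q
        _ = s ^ q * Ψ ω ^ q := mul_pow _ _ _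
        _ ≤ s * Ψ ω ^ q := by
            gcongr
            exact pow_le_of_le_one hs0 hs1 (by omega)
    have h1 : ζ ω ^ 2 ≤ 2 * (s * Ψ ω ^ 1 + s * Ψ ω ^ 2) := by
      calc ζ ω ^ 2 = |ζ ω| ^ 2 := (sq_abs _).symm
        _ ≤ (r + r ^ 2) ^ 2 := pow_le_pow_left₀ (abs_nonneg _) (hζb ω) 2
        _ ≤ 2 * (r ^ (2 * 1) + r ^ (2 * 2)) := by
            rw [pow_mul r 2 1, pow_mul r 2 2, pow_one]; nlinarith [sq_nonneg (r - r ^ 2)]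
        _ ≤ _ := by gcongr <;> exact hpow _ (by norm_num)
    have h2 : |ζ ω| ^ (2 * p) ≤ 2 ^ (2 * p) * (s * Ψ ω ^ p + s * Ψ ω ^ (2 * p)) := by
      calc |ζ ω| ^ (2 * p) ≤ (r + r ^ 2) ^ (2 * p) :=
            pow_le_pow_left₀ (abs_nonneg _) (hζb ω) _
        _ ≤ 2 ^ (2 * p - 1) * (r ^ (2 * p) + (r ^ 2) ^ (2 * p)) := add_pow_le hr0 (sq_nonneg r) _
        _ ≤ 2 ^ (2 * p) * (r ^ (2 * p) + r ^ (2 * (2 * p))) := by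
            rw [← pow_mul]
            gcongr
            · norm_num
            · omega
        _ ≤ _ := by gcongr <;> exact hpow _ (by omega)
    simp only [hQ]
    calc _ ≤ 2 * (s * Ψ ω ^ 1 + s * Ψ ω ^ 2)
          + 2 ^ (2 * p) * (s * Ψ ω ^ p + s * Ψ ω ^ (2 * p)) := add_le_add h1 h2
      _ = _ := by ring
  have hi1 : Integrable (fun ω => 2 * (Ψ ω ^ 1 + Ψ ω ^ 2)) μ :=
    ((hΨi 1).add (hΨi 2)).const_mul 2
  have hi2 : Integrable (fun ω => (2 : ℝ) ^ (2 * p) * (Ψ ω ^ p + Ψ ω ^ (2 * p))) μ :=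
    ((hΨi p).add (hΨi (2 * p))).const_mul (2 ^ (2 * p))
  have hQi : Integrable Q μ := (hi1.add hi2).const_mul s
  have hinner : Integrable (fun ω => inner ℝ Δ (G ω)) μ := hGi.const_inner Δ
  have hζi : Integrable ζ μ := ((hinner.const_mul 2).add hGsq).div_const V
  have hQint : ∫ ω, Q ω ∂μ ≤ s * (2 * (m 1 + m 2) + 2 ^ (2 * p) * (m p + m (2 * p))) := by
    simp only [hQ]
    rw [integral_const_mul, integral_add hi1 hi2, integral_const_mul, integral_const_mul,
      integral_add (hΨi 1) (hΨi 2), integral_add (hΨi p) (hΨi (2 * p))]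
    have := hΨm 1; have := hΨm 2; have := hΨm p; have := hΨm (2 * p)
    gcongr
  -- Here the mean, not the size, of the increment is used. The part `s ‖Δ‖` contributes `s ‖Δ‖² ≤ s
  -- V`, and the part `e` contributes `‖Δ‖ e`, which is at most a multiple of `e V / ρ`.
  have hζint : ∫ ω, ζ ω ∂μ ≤ (2 * c + m 1) * (s + e / ρ) := by
    simp only [hζ]
    rw [integral_div, integral_add (hinner.const_mul 2) hGsq, integral_const_mul,
      integral_inner hGi, div_le_iff₀ hV0]
    have h1 : inner ℝ Δ (∫ ω, G ω ∂μ) ≤ ‖Δ‖ * (c * (s * ‖Δ‖ + e)) :=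
      (real_inner_le_norm _ _).trans (mul_le_mul_of_nonneg_left hmean (norm_nonneg _))
    have h2 : ∫ ω, ‖G ω‖ ^ 2 ∂μ ≤ s * ρ ^ 2 * m 1 := by
      calc ∫ ω, ‖G ω‖ ^ 2 ∂μ ≤ ∫ ω, s * ρ ^ 2 * Ψ ω ∂μ :=
            integral_mono_ae hGsq (hΨ1.const_mul _) hGΨ
        _ ≤ _ := by
            rw [integral_const_mul]
            have := hΨm 1
            simp only [pow_one] at this
            gcongr
    have h3 : 2 * ‖Δ‖ * ρ ≤ V := by nlinarith [sq_nonneg (‖Δ‖ - ρ)]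
    have h4 : 2 * ‖Δ‖ * e ≤ e / ρ * V := by
      rw [div_mul_eq_mul_div, le_div_iff₀ hρ]
      nlinarith
    have h5 : ‖Δ‖ ^ 2 ≤ V := by have := sq_nonneg ρ; linarith
    have h6 : ρ ^ 2 ≤ V := by have := sq_nonneg ‖Δ‖; linarith
    have h7 : 0 ≤ e / ρ * V := by positivity
    have h8 := hm0 1
    have t1 : c * s * ‖Δ‖ ^ 2 ≤ c * s * V := by gcongr
    have t2 : s * ρ ^ 2 * m 1 ≤ s * V * m 1 := by gcongr
    have t3 : c * (2 * ‖Δ‖ * e) ≤ c * (e / ρ * V) := by gcongr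
    have t4 : 0 ≤ c * (e / ρ * V) := by positivity
    have t5 : 0 ≤ m 1 * (e / ρ * V) := by positivity
    nlinarith
  set Rr : Ω → ℝ := fun ω => V ^ p * (1 + p * ζ ω + 2 ^ p * Q ω) with hRr
  have hi3 : Integrable (fun ω => 1 + p * ζ ω) μ := (integrable_const 1).add (hζi.const_mul p)
  have hRi : Integrable Rr μ := (hi3.add (hQi.const_mul (2 ^ p))).const_mul (V ^ p)
  have hle : ∀ᵐ ω ∂μ, (‖Δ + G ω‖ ^ 2 + ρ ^ 2) ^ p ≤ Rr ω := by
    filter_upwards [hζQ] with ω hω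
    rw [hid, mul_pow]
    simp only [hRr]
    gcongr
    refine (one_add_pow_le p).trans ?_
    gcongr
  have hR0 : 0 ≤ᵐ[μ] Rr := by
    filter_upwards [hle] with ω hω
    exact le_trans (by positivity) hω
  have hep : 0 ≤ e / ρ := by positivity
  have hcst : 0 ≤ stepConst p c m := by
    have := hm0 1; have := hm0 2; have := hm0 p; have := hm0 (2 * p)
    unfold stepConst; positivity
  calc ∫⁻ ω, ENNReal.ofReal ((‖Δ + G ω‖ ^ 2 + ρ ^ 2) ^ p) ∂μ
      ≤ ∫⁻ ω, ENNReal.ofReal (Rr ω) ∂μ := by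
        refine lintegral_mono_ae ?_
        filter_upwards [hle] with ω hω using ENNReal.ofReal_le_ofReal hω
    _ = ENNReal.ofReal (∫ ω, Rr ω ∂μ) := (ofReal_integral_eq_lintegral_ofReal hRi hR0).symm
    _ ≤ ENNReal.ofReal ((1 + stepConst p c m * (s + e / ρ)) * V ^ p) := by
        refine ENNReal.ofReal_le_ofReal ?_
        have hval : ∫ ω, Rr ω ∂μ = V ^ p * (1 + p * ∫ ω, ζ ω ∂μ + 2 ^ p * ∫ ω, Q ω ∂μ) := by
          simp only [hRr]
          rw [integral_const_mul, integral_add hi3 (hQi.const_mul (2 ^ p)), integral_add (integrable_const 1) (hζi.const_mul p),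
            integral_const_mul, integral_const_mul]
          simp
        rw [hval, mul_comm]
        refine mul_le_mul_of_nonneg_right ?_ (by positivity)
        have hB : 0 ≤ 2 * (m 1 + m 2) + 2 ^ (2 * p) * (m p + m (2 * p)) := by
          have := hm0 1; have := hm0 2; have := hm0 p; have := hm0 (2 * p)
          positivity
        have h1 : (p : ℝ) * ∫ ω, ζ ω ∂μ ≤ p * ((2 * c + m 1) * (s + e / ρ)) := by gcongr
        have h2 : (2 : ℝ) ^ p * ∫ ω, Q ω ∂μ ≤ 2 ^ p * ((s + e / ρ)
            * (2 * (m 1 + m 2) + 2 ^ (2 * p) * (m p + m (2 * p)))) := by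
          refine mul_le_mul_of_nonneg_left (hQint.trans ?_) (by positivity)
          exact mul_le_mul_of_nonneg_right (by linarith) hB
        unfold stepConst
        linarith
    _ = _ := ENNReal.ofReal_mul (by positivity)

end HighMoment

/-! ### Spectral moments of a family of matrices -/

section Stack

variable {ℓ d : ℕ}

/-- The Hilbert space of `J`-tuples of matrices. -/
abbrev StackSpace (ℓ J : ℕ) : Type :=
  EuclideanSpace ℝ (Fin J × (Fin ℓ ⊕ Fin ℓ) × (Fin ℓ ⊕ Fin ℓ))

/-- The first `J` matrices of a sequence, as a point of a Hilbert space. -/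
def stack (J : ℕ) (v : ℕ → GramMat ℓ) : StackSpace ℓ J :=
  WithLp.toLp 2 fun x => v x.1 x.2.1 x.2.2

lemma stack_apply (J : ℕ) (v : ℕ → GramMat ℓ) (x) : stack J v x = v x.1 x.2.1 x.2.2 := rfl

lemma norm_stack_sq (J : ℕ) (v : ℕ → GramMat ℓ) :
    ‖stack J v‖ ^ 2 = ∑ j ∈ Finset.range J, ‖v j‖ ^ 2 := by
  rw [EuclideanSpace.real_norm_sq_eq, Fintype.sum_prod_type, Finset.sum_range]
  refine Finset.sum_congr rfl fun j _ => ?_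
  rw [Fintype.sum_prod_type, frobenius_norm_sq]
  rfl

lemma norm_le_norm_stack {J : ℕ} (v : ℕ → GramMat ℓ) {j : ℕ} (hj : j < J) :
    ‖v j‖ ≤ ‖stack J v‖ := by
  refine le_of_sq_le_sq ?_ (norm_nonneg _)
  rw [norm_stack_sq]
  exact Finset.single_le_sum (f := fun j => ‖v j‖ ^ 2) (fun _ _ => sq_nonneg _)
    (Finset.mem_range.2 hj)

lemma sum_half_pow_le (J : ℕ) : ∑ j ∈ Finset.range J, ((1 : ℝ) / 2) ^ j ≤ 2 :=
  (Summable.sum_le_tsum _ (fun _ _ => by positivity) summable_geometric_two).trans_eq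
    tsum_geometric_two

lemma sum_sq_half_pow_le (J : ℕ) : ∑ j ∈ Finset.range J, (((1 : ℝ) / 2) ^ j) ^ 2 ≤ 2 := by
  refine (Finset.sum_le_sum fun j _ => ?_).trans (sum_half_pow_le J)
  have h1 : ((1 : ℝ) / 2) ^ j ≤ 1 := pow_le_one₀ (by norm_num) (by norm_num)
  have h0 : (0 : ℝ) ≤ (1 / 2) ^ j := by positivity
  nlinarith

/-- Each matrix is bounded by a square summable part and a geometrically decaying part. The latter
has total size independent of `J`. -/
lemma norm_stack_le {J : ℕ} {v : ℕ → GramMat ℓ} {u : ℕ → ℝ} {c : ℝ}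
    (hv : ∀ j < J, ‖v j‖ ≤ u j + c * (1 / 2) ^ j) :
    ‖stack J v‖ ^ 2 ≤ 2 * ∑ j ∈ Finset.range J, u j ^ 2 + 4 * c ^ 2 := by
  rw [norm_stack_sq]
  calc ∑ j ∈ Finset.range J, ‖v j‖ ^ 2
      ≤ ∑ j ∈ Finset.range J, (2 * u j ^ 2 + 2 * c ^ 2 * ((1 / 2 : ℝ) ^ j) ^ 2) := by
        refine Finset.sum_le_sum fun j hj => ?_
        calc ‖v j‖ ^ 2 ≤ (u j + c * (1 / 2) ^ j) ^ 2 :=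
              pow_le_pow_left₀ (norm_nonneg _) (hv j (Finset.mem_range.1 hj)) 2
          _ ≤ _ := by nlinarith [sq_nonneg (u j - c * (1 / 2) ^ j)]
    _ = 2 * ∑ j ∈ Finset.range J, u j ^ 2
        + 2 * c ^ 2 * ∑ j ∈ Finset.range J, (((1 : ℝ) / 2) ^ j) ^ 2 := by
        rw [Finset.sum_add_distrib, ← Finset.mul_sum, ← Finset.mul_sum]
    _ ≤ 2 * ∑ j ∈ Finset.range J, u j ^ 2 + 2 * c ^ 2 * 2 := by
        gcongr; exact sum_sq_half_pow_le J
    _ = _ := by ring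

/-- The moment `∑ᵢ μᵢʲ xᵢ`. -/
def specMoment (μ : Fin d → ℝ) (x : Fin d → GramMat ℓ) (j : ℕ) : GramMat ℓ :=
  ∑ i, μ i ^ j • x i

lemma norm_specMoment_le {μ : Fin d → ℝ} (hμ0 : ∀ i, 0 ≤ μ i) (hμ : ∀ i, μ i ≤ 1 / 2)
    (x : Fin d → GramMat ℓ) (j : ℕ) : ‖specMoment μ x j‖ ≤ (1 / 2) ^ j * ∑ i, ‖x i‖ := by
  unfold specMoment
  rw [Finset.mul_sum]
  refine (norm_sum_le _ _).trans (Finset.sum_le_sum fun i _ => ?_)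
  rw [norm_smul, Real.norm_of_nonneg (pow_nonneg (hμ0 i) j)]
  gcongr
  · exact hμ0 i
  · exact hμ i

lemma norm_vecMulVec_sq {m n : Type*} [Fintype m] [Fintype n] (u : m → ℝ) (v : n → ℝ) :
    ‖vecMulVec u v‖ ^ 2 = (∑ i, u i ^ 2) * ∑ j, v j ^ 2 := by
  rw [frobenius_norm_sq, Finset.sum_mul_sum]
  simp only [vecMulVec_apply, mul_pow]

end Stack

/-! ### One step of SGD -/

section Step

variable {ℓ d : ℕ} {Lhat : ℝ} {f : ObsPlus ℓ → Obs ℓ → ℝ} {S : Setup ℓ d}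

/-- The update of SGD with step size `s`. -/
def Setup.update (S : Setup ℓ d) (f : ObsPlus ℓ → Obs ℓ → ℝ) (s : ℝ)
    (X : Matrix (Fin d) (Fin ℓ) ℝ) (p : EuclideanSpace ℝ (Fin d) × Obs ℓ) :
    Matrix (Fin d) (Fin ℓ) ℝ :=
  X - s • vecMulVec p.1.ofLp (gradX f (S.preact X p.1) p.2).ofLp

/-- The gradient at a sample, extended by zero. -/
def Setup.grad₀ (S : Setup ℓ d) (f : ObsPlus ℓ → Obs ℓ → ℝ)
    (X : Matrix (Fin d) (Fin ℓ) ℝ) (p : EuclideanSpace ℝ (Fin d) × Obs ℓ) : Fin ℓ ⊕ Fin ℓ → ℝ :=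
  Sum.elim (gradX f (S.preact X p.1) p.2).ofLp 0

lemma Setup.sum_grad₀_sq (X : Matrix (Fin d) (Fin ℓ) ℝ) (p : EuclideanSpace ℝ (Fin d) × Obs ℓ) :
    ∑ q, S.grad₀ f X p q ^ 2 = ‖gradX f (S.preact X p.1) p.2‖ ^ 2 := by
  simp [Setup.grad₀, EuclideanSpace.real_norm_sq_eq]

/-- The coordinate of `a` along an eigenvector. -/
def Setup.coord (S : Setup ℓ d) (a : EuclideanSpace ℝ (Fin d)) (i : Fin d) : ℝ :=
  (S.eigvec i).ofLp ⬝ᵥ a.ofLp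

/-- Only the `X`-half of a coefficient moves, which the zero padding in `grad₀` encodes. -/
lemma Setup.coeff_update (s : ℝ) (X : Matrix (Fin d) (Fin ℓ) ℝ)
    (p : EuclideanSpace ℝ (Fin d) × Obs ℓ) (i : Fin d) :
    S.coeff (S.update f s X p) i = S.coeff X i - (s * S.coord p.1 i) • S.grad₀ f X p := by
  ext q
  rcases q with q | q
  · simp only [Setup.coeff, Setup.update, Setup.grad₀, Setup.coord, mulVec, dotProduct,
      transpose_apply, fromCols_apply_inl, Pi.sub_apply, Pi.smul_apply, smul_eq_mul, Sum.elim_inl,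
      Matrix.sub_apply, Matrix.smul_apply, vecMulVec_apply, Finset.mul_sum, Finset.sum_mul,
      ← Finset.sum_sub_distrib]
    exact Finset.sum_congr rfl fun r _ => by ring
  · simp [Setup.coeff, Setup.grad₀, mulVec, dotProduct]

/-- The matrices `wᵢ ⊗ wᵢ` of an iterate, where `wᵢ` are the coefficients along the eigenvectors. -/
def Setup.outer (S : Setup ℓ d) (X : Matrix (Fin d) (Fin ℓ) ℝ) (i : Fin d) : GramMat ℓ :=
  vecMulVec (S.coeff X i) (S.coeff X i)

/-- The vector `∑ᵢ μᵢʲ ⟨ωᵢ, a⟩ wᵢ`. -/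
def Setup.linMoment (S : Setup ℓ d) (μ : Fin d → ℝ) (X : Matrix (Fin d) (Fin ℓ) ℝ)
    (a : EuclideanSpace ℝ (Fin d)) (j : ℕ) : Fin ℓ ⊕ Fin ℓ → ℝ :=
  ∑ i, (μ i ^ j * S.coord a i) • S.coeff X i

/-- The number `∑ᵢ μᵢʲ ⟨ωᵢ, a⟩²`. -/
def Setup.quadMoment (S : Setup ℓ d) (μ : Fin d → ℝ) (a : EuclideanSpace ℝ (Fin d)) (j : ℕ) : ℝ :=
  ∑ i, μ i ^ j * S.coord a i ^ 2

/-- An exact second order expansion in the step size. The sample enters only through the gradient,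
the vectors `linMoment` and the numbers `quadMoment`. -/
lemma Setup.specMoment_update_sub (μ : Fin d → ℝ) (s : ℝ) (X : Matrix (Fin d) (Fin ℓ) ℝ)
    (p : EuclideanSpace ℝ (Fin d) × Obs ℓ) (j : ℕ) :
    specMoment μ (S.outer (S.update f s X p)) j - specMoment μ (S.outer X) j
      = (s ^ 2 * S.quadMoment μ p.1 j) • vecMulVec (S.grad₀ f X p) (S.grad₀ f X p)
        - s • (vecMulVec (S.linMoment μ X p.1 j) (S.grad₀ f X p)
          + vecMulVec (S.grad₀ f X p) (S.linMoment μ X p.1 j)) := by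
  ext q r
  simp only [specMoment, Setup.outer, S.coeff_update, Setup.quadMoment, Setup.linMoment,
    Matrix.sub_apply, Matrix.add_apply, Matrix.sum_apply, Matrix.smul_apply, vecMulVec_apply,
    Finset.sum_apply, Pi.smul_apply, Pi.sub_apply, smul_eq_mul, Finset.mul_sum, Finset.sum_mul,
    ← Finset.sum_sub_distrib, ← Finset.sum_add_distrib]
  exact Finset.sum_congr rfl fun i _ => by ring

lemma Setup.sum_coord_sq (a : EuclideanSpace ℝ (Fin d)) : ∑ i, S.coord a i ^ 2 = ‖a‖ ^ 2 := by
  rw [← S.eigvec.sum_sq_norm_inner_right a]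
  refine Finset.sum_congr rfl fun i _ => ?_
  rw [Real.norm_eq_abs, sq_abs, EuclideanSpace.inner_eq_star_dotProduct, star_trivial,
    dotProduct_comm]
  rfl

lemma Setup.sum_coeff_sq (X : Matrix (Fin d) (Fin ℓ) ℝ) :
    ∑ i, ∑ p, S.coeff X i p ^ 2 = ‖X‖ ^ 2 + ‖S.Xstar‖ ^ 2 := by
  have h := congrArg Matrix.trace (S.transpose_mul_eq_sum X)
  rw [trace_sum] at h
  simp only [trace_vecMulVec, dotProduct, ← pow_two] at h
  rw [← h, frobenius_norm_sq, frobenius_norm_sq, Matrix.trace]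
  simp only [diag_apply, Matrix.mul_apply, transpose_apply, Fintype.sum_sum_type,
    fromCols_apply_inl, fromCols_apply_inr, ← pow_two]
  rw [Finset.sum_comm (γ := Fin d), Finset.sum_comm (γ := Fin d)]

lemma Setup.norm_outer (X : Matrix (Fin d) (Fin ℓ) ℝ) (i : Fin d) :
    ‖S.outer X i‖ = ∑ p, S.coeff X i p ^ 2 := by
  have h0 : 0 ≤ ∑ p, S.coeff X i p ^ 2 := Finset.sum_nonneg fun _ _ => sq_nonneg _
  have h := norm_vecMulVec_sq (S.coeff X i) (S.coeff X i)
  rw [← pow_two] at h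
  exact (pow_left_inj₀ (norm_nonneg _) h0 two_ne_zero).1 h

lemma Setup.sum_norm_outer (X : Matrix (Fin d) (Fin ℓ) ℝ) :
    ∑ i, ‖S.outer X i‖ = ‖X‖ ^ 2 + ‖S.Xstar‖ ^ 2 := by
  simp_rw [S.norm_outer, S.sum_coeff_sq]

lemma Setup.dotProduct_K_le {b : ℝ} (hb : ∀ i, S.eigval i ≤ b) (l : Fin d → ℝ) :
    l ⬝ᵥ S.K *ᵥ l ≤ b * ∑ k, l k ^ 2 := by
  have h1 : ∑ k, l k ^ 2 = ∑ i, S.coord (WithLp.toLp 2 l) i ^ 2 := by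
    rw [S.sum_coord_sq, EuclideanSpace.real_norm_sq_eq]
  have h2 : l ⬝ᵥ S.K *ᵥ l = ∑ i, S.eigval i * S.coord (WithLp.toLp 2 l) i ^ 2 := by
    conv_lhs => rw [← S.sum_eigval_vecMulVec]
    rw [Matrix.sum_mulVec, dotProduct_sum]
    refine Finset.sum_congr rfl fun i _ => ?_
    rw [smul_mulVec, dotProduct_smul, vecMulVec_mulVec]
    simp only [Setup.coord, smul_eq_mul, pow_two, op_smul_eq_smul, dotProduct_smul]
    rw [dotProduct_comm l]
  rw [h1, h2, Finset.mul_sum]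
  exact Finset.sum_le_sum fun i _ => mul_le_mul_of_nonneg_right (hb i) (sq_nonneg _)

/-- The linear functionals of `a` which control one step. -/
def Setup.stepForm (S : Setup ℓ d) (μ : Fin d → ℝ) (J : ℕ) (X : Matrix (Fin d) (Fin ℓ) ℝ) :
    (Fin J × (Fin ℓ ⊕ Fin ℓ)) ⊕ (Fin ℓ ⊕ Fin d) → Fin d → ℝ
  | Sum.inl (j, p) => ∑ i, (μ i ^ (j : ℕ) * S.coeff X i p) • (S.eigvec i).ofLp
  | Sum.inr (Sum.inl q) => fun i => (X - S.Xstar) i q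
  | Sum.inr (Sum.inr i) => (Real.sqrt d)⁻¹ • (S.eigvec i).ofLp

/-- The sum of squares of the functionals which control one step. -/
def Setup.stepSum (S : Setup ℓ d) (μ : Fin d → ℝ) (J : ℕ) (X : Matrix (Fin d) (Fin ℓ) ℝ)
    (a : EuclideanSpace ℝ (Fin d)) : ℝ :=
  ∑ k, (S.stepForm μ J X k ⬝ᵥ a.ofLp) ^ 2

/-- The functionals are chosen so that one sum of Gaussian squares controls at once the linear
moments, the distance `x - x⋆` that bounds the gradient, and `‖a‖² / d`. -/
lemma Setup.stepSum_eq (μ : Fin d → ℝ) (J : ℕ) (X : Matrix (Fin d) (Fin ℓ) ℝ)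
    (a : EuclideanSpace ℝ (Fin d)) :
    S.stepSum μ J X a = ∑ j ∈ Finset.range J, ∑ p, S.linMoment μ X a j p ^ 2
      + (‖contract X a - contract S.Xstar a‖ ^ 2 + (d : ℝ)⁻¹ * ‖a‖ ^ 2) := by
  rw [Setup.stepSum, Fintype.sum_sum_type, Fintype.sum_sum_type, Fintype.sum_prod_type,
    Finset.sum_range, contract_eq_applyT, contract_eq_applyT, ← applyT_sub, norm_applyT_sq,
    ← S.sum_coord_sq, Finset.mul_sum]
  congr 1
  · refine Finset.sum_congr rfl fun j _ => Finset.sum_congr rfl fun p _ => ?_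
    congr 1
    simp only [Setup.stepForm, Setup.linMoment, sum_dotProduct, smul_dotProduct, Finset.sum_apply,
      Pi.smul_apply, smul_eq_mul, Setup.coord]
    exact Finset.sum_congr rfl fun i _ => by ring
  · congr 1
    refine Finset.sum_congr rfl fun i _ => ?_
    simp only [Setup.stepForm, smul_dotProduct, smul_eq_mul, Setup.coord, mul_pow, inv_pow]
    rw [Real.sq_sqrt (Nat.cast_nonneg d)]

lemma Setup.stepSum_nonneg (μ : Fin d → ℝ) (J : ℕ) (X : Matrix (Fin d) (Fin ℓ) ℝ)
    (a : EuclideanSpace ℝ (Fin d)) : 0 ≤ S.stepSum μ J X a :=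
  Finset.sum_nonneg fun _ _ => sq_nonneg _

lemma Setup.integrable_stepSum_pow (μ : Fin d → ℝ) (J : ℕ) (X : Matrix (Fin d) (Fin ℓ) ℝ) (q : ℕ) :
    Integrable (fun p => S.stepSum μ J X p.1 ^ q) S.dataLaw :=
  (integrable_sum_sq_pow S.posSemidef (S.stepForm μ J X) q).comp_fst _

lemma Setup.integral_stepSum_pow_le {b : ℝ} (hb1 : 1 ≤ b) (hd : 1 ≤ d) (hb : ∀ i, S.eigval i ≤ b)
    {μ : Fin d → ℝ} (hμ0 : ∀ i, 0 ≤ μ i) (hμ : ∀ i, μ i ≤ 1 / 2) (J : ℕ)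
    {X : Matrix (Fin d) (Fin ℓ) ℝ} (hX : ‖X‖ ≤ b) (hXs : ‖S.Xstar‖ ≤ b) (q : ℕ) :
    ∫ p, S.stepSum μ J X p.1 ^ q ∂S.dataLaw
      ≤ ((12 * ℓ + 1) * b ^ 3) ^ q * normalMoment q := by
  have hd0 : (0 : ℝ) < d := by positivity
  -- Variance bounds for the three groups of functionals. Their totals are at most `8 ℓ b³` (a
  -- geometric series in the moment index), `4 ℓ b³` and `b`, so the sum is bounded independently of
  -- `d` and `J`.
  let w : (Fin J × (Fin ℓ ⊕ Fin ℓ)) ⊕ (Fin ℓ ⊕ Fin d) → ℝ :=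
    Sum.elim (fun x => 2 * b ^ 3 * (1 / 2) ^ (x.1 : ℕ)) (Sum.elim (fun _ => 4 * b ^ 3) (fun _ => b / d))
  have hw : ∀ k, 0 < w k := by
    rintro (k | k | k) <;> simp only [w, Sum.elim_inl, Sum.elim_inr] <;> positivity
  have hnorm : ∀ i, ∑ k, (S.eigvec i) k ^ 2 = 1 := by
    intro i
    rw [← EuclideanSpace.real_norm_sq_eq, S.eigvec.orthonormal.1 i, one_pow]
  have hl : ∀ k, S.stepForm μ J X k ⬝ᵥ S.K *ᵥ S.stepForm μ J X k ≤ w k := by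
    intro k
    refine (S.dotProduct_K_le hb _).trans ?_
    rcases k with ⟨j, p⟩ | k | k
    · have e : ∑ k, S.stepForm μ J X (Sum.inl (j, p)) k ^ 2
          = ∑ i, (μ i ^ (j : ℕ) * S.coeff X i p) ^ 2 := by
        have h1 := S.sum_coord_sq (WithLp.toLp 2 (S.stepForm μ J X (Sum.inl (j, p))))
        rw [EuclideanSpace.real_norm_sq_eq] at h1
        refine h1.symm.trans (Finset.sum_congr rfl fun i _ => ?_)
        congr 1
        have h2 : ∀ i', (S.eigvec i).ofLp ⬝ᵥ (S.eigvec i').ofLp = if i = i' then 1 else 0 := by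
          intro i'
          have := (orthonormal_iff_ite.1 S.eigvec.orthonormal) i i'
          rw [EuclideanSpace.inner_eq_star_dotProduct, star_trivial, dotProduct_comm] at this
          exact this
        simp only [Setup.coord, Setup.stepForm, dotProduct_sum, dotProduct_smul, h2]
        simp
      rw [e]
      have h1 : ∑ i, (μ i ^ (j : ℕ) * S.coeff X i p) ^ 2
          ≤ (1 / 2) ^ (j : ℕ) * (2 * b ^ 2) := by
        calc ∑ i, (μ i ^ (j : ℕ) * S.coeff X i p) ^ 2
            ≤ ∑ i, (1 / 2) ^ (j : ℕ) * ∑ p, S.coeff X i p ^ 2 := by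
              refine Finset.sum_le_sum fun i _ => ?_
              rw [mul_pow]
              have h2 : (μ i ^ (j : ℕ)) ^ 2 ≤ (1 / 2) ^ (j : ℕ) := by
                have h3 : μ i ^ (j : ℕ) ≤ (1 / 2) ^ (j : ℕ) := pow_le_pow_left₀ (hμ0 i) (hμ i) _
                have h4 : ((1 : ℝ) / 2) ^ (j : ℕ) ≤ 1 := pow_le_one₀ (by norm_num) (by norm_num)
                have h5 := pow_nonneg (hμ0 i) (j : ℕ)
                nlinarith
              refine mul_le_mul h2 ?_ (sq_nonneg _) (by positivity)
              exact Finset.single_le_sum (f := fun p => S.coeff X i p ^ 2)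
                (fun _ _ => sq_nonneg _) (Finset.mem_univ p)
          _ = (1 / 2) ^ (j : ℕ) * (‖X‖ ^ 2 + ‖S.Xstar‖ ^ 2) := by
              rw [← Finset.mul_sum, S.sum_coeff_sq]
          _ ≤ _ := by
              have := pow_le_pow_left₀ (norm_nonneg _) hX 2
              have := pow_le_pow_left₀ (norm_nonneg _) hXs 2
              gcongr
              linarith
      simp only [w, Sum.elim_inl]
      have := mul_le_mul_of_nonneg_left h1 (show 0 ≤ b by linarith)
      linarith
    · simp only [w, Sum.elim_inl, Sum.elim_inr, Setup.stepForm]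
      have h1 : ∑ i, (X - S.Xstar) i k ^ 2 ≤ ‖X - S.Xstar‖ ^ 2 := by
        rw [frobenius_norm_sq]
        exact Finset.sum_le_sum fun i _ => Finset.single_le_sum
          (f := fun k => (X - S.Xstar) i k ^ 2) (fun _ _ => sq_nonneg _) (Finset.mem_univ k)
      have h2 : ‖X - S.Xstar‖ ≤ 2 * b := (norm_sub_le _ _).trans (by linarith)
      have h3 := pow_le_pow_left₀ (norm_nonneg _) h2 2
      have := mul_le_mul_of_nonneg_left (h1.trans h3) (show 0 ≤ b by linarith)
      linarith
    · simp only [w, Sum.elim_inr, Setup.stepForm, Pi.smul_apply, smul_eq_mul, mul_pow, inv_pow]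
      rw [Real.sq_sqrt hd0.le, ← Finset.mul_sum, hnorm, mul_one, div_eq_mul_inv]
  have hmain := integral_sum_sq_pow_le S.posSemidef (S.stepForm μ J X) w hw hl q
  have hfst : ∫ p, S.stepSum μ J X p.1 ^ q ∂S.dataLaw
      = ∫ a, S.stepSum μ J X a ^ q ∂(multivariateGaussian 0 S.K) := by
    unfold Setup.dataLaw
    exact integral_fun_fst (μ := multivariateGaussian 0 S.K) (ν := stdGaussian (Obs ℓ))
      (fun a => S.stepSum μ J X a ^ q) |>.trans (by simp)
  rw [hfst]
  refine hmain.trans ?_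
  have hq := normalMoment_nonneg q
  have hb0 : 0 ≤ b := by linarith
  have hsum : ∑ k, w k ≤ (12 * ℓ + 1) * b ^ 3 := by
    rw [Fintype.sum_sum_type, Fintype.sum_sum_type, Fintype.sum_prod_type]
    simp only [w, Sum.elim_inl, Sum.elim_inr, Finset.sum_const, Finset.card_univ, Fintype.card_fin,
      Fintype.card_sum, nsmul_eq_mul]
    rw [← Finset.mul_sum, ← Finset.mul_sum, ← Finset.sum_range (fun j => ((1 : ℝ) / 2) ^ j),
      mul_div_cancel₀ _ hd0.ne']
    have h1 := sum_half_pow_le J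
    have h2 : ((ℓ + ℓ : ℕ) : ℝ) * (2 * b ^ 3 * ∑ j ∈ Finset.range J, ((1 : ℝ) / 2) ^ j)
        ≤ ((ℓ + ℓ : ℕ) : ℝ) * (2 * b ^ 3 * 2) := by gcongr
    have h3 : b ≤ b ^ 3 := le_self_pow₀ hb1 (by norm_num)
    push_cast at h2 ⊢
    linarith
  have hsum0 : 0 ≤ ∑ k, w k := Finset.sum_nonneg fun k _ => (hw k).le
  gcongr

lemma Setup.sum_linMoment_sq_le (μ : Fin d → ℝ) (J : ℕ) (X : Matrix (Fin d) (Fin ℓ) ℝ)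
    (a : EuclideanSpace ℝ (Fin d)) :
    ∑ j ∈ Finset.range J, ∑ p, S.linMoment μ X a j p ^ 2 ≤ S.stepSum μ J X a := by
  rw [S.stepSum_eq]
  have : 0 ≤ ‖contract X a - contract S.Xstar a‖ ^ 2 + (d : ℝ)⁻¹ * ‖a‖ ^ 2 := by positivity
  linarith

lemma Setup.norm_sq_le_stepSum (μ : Fin d → ℝ) (J : ℕ) (X : Matrix (Fin d) (Fin ℓ) ℝ)
    (a : EuclideanSpace ℝ (Fin d)) (hd : 1 ≤ d) : ‖a‖ ^ 2 ≤ d * S.stepSum μ J X a := by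
  have hd0 : (0 : ℝ) < d := by positivity
  rw [S.stepSum_eq, ← inv_mul_le_iff₀ hd0]
  have : 0 ≤ ∑ j ∈ Finset.range J, ∑ p, S.linMoment μ X a j p ^ 2 :=
    Finset.sum_nonneg fun _ _ => Finset.sum_nonneg fun _ _ => sq_nonneg _
  nlinarith [sq_nonneg ‖contract X a - contract S.Xstar a‖]

lemma Setup.norm_contract_sub_sq_le (μ : Fin d → ℝ) (J : ℕ) (X : Matrix (Fin d) (Fin ℓ) ℝ)
    (a : EuclideanSpace ℝ (Fin d)) :
    ‖contract X a - contract S.Xstar a‖ ^ 2 ≤ S.stepSum μ J X a := by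
  rw [S.stepSum_eq]
  have : 0 ≤ ∑ j ∈ Finset.range J, ∑ p, S.linMoment μ X a j p ^ 2 :=
    Finset.sum_nonneg fun _ _ => Finset.sum_nonneg fun _ _ => sq_nonneg _
  have : 0 ≤ (d : ℝ)⁻¹ * ‖a‖ ^ 2 := by positivity
  linarith

lemma Setup.abs_quadMoment_le {μ : Fin d → ℝ} (hμ0 : ∀ i, 0 ≤ μ i) (hμ : ∀ i, μ i ≤ 1 / 2)
    (a : EuclideanSpace ℝ (Fin d)) (j : ℕ) :
    |S.quadMoment μ a j| ≤ (1 / 2) ^ j * ‖a‖ ^ 2 := by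
  have h0 : 0 ≤ S.quadMoment μ a j :=
    Finset.sum_nonneg fun i _ => mul_nonneg (pow_nonneg (hμ0 i) j) (sq_nonneg _)
  rw [abs_of_nonneg h0, Setup.quadMoment, ← S.sum_coord_sq, Finset.mul_sum]
  refine Finset.sum_le_sum fun i _ => mul_le_mul_of_nonneg_right ?_ (sq_nonneg _)
  exact pow_le_pow_left₀ (hμ0 i) (hμ i) _

/-- Almost sure bound of the gradient at a sample. -/
lemma Setup.ae_norm_gradX_sq_le (hc : ConvexSmoothOuter Lhat f) (hL : 0 < Lhat)
    (hm : Measurable (fun p : ObsPlus ℓ × Obs ℓ => f p.1 p.2))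
    (hcrit : CriticalAE f (S.Xstarᵀ * S.K * S.Xstar)) {b : ℝ} (hLb : 2 * Lhat ≤ b)
    (μ : Fin d → ℝ) (J : ℕ) (X : Matrix (Fin d) (Fin ℓ) ℝ) :
    ∀ᵐ p ∂S.dataLaw, ‖gradX f (S.preact X p.1) p.2‖ ^ 2 ≤ b ^ 2 * S.stepSum μ J X p.1 := by
  filter_upwards [hc.ae_bounds hL hm S.posSemidef hcrit] with p hp
  have h1 := (hp (contract X p.1)).1
  have h2 := S.norm_contract_sub_sq_le μ J X p.1
  calc ‖gradX f (S.preact X p.1) p.2‖ ^ 2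
      ≤ (2 * Lhat * ‖contract X p.1 - contract S.Xstar p.1‖) ^ 2 :=
        pow_le_pow_left₀ (norm_nonneg _) h1 2
    _ = (2 * Lhat) ^ 2 * ‖contract X p.1 - contract S.Xstar p.1‖ ^ 2 := by ring
    _ ≤ _ := by gcongr

/-- The change of the spectral moments in one step is of order `1/d`. -/
lemma Setup.norm_stack_update_sub_sq_le {b s : ℝ} (hb1 : 1 ≤ b) (hd : 1 ≤ d)
    (hs0 : 0 ≤ s) (hs : s ≤ b / d)
    {μ : Fin d → ℝ} (hμ0 : ∀ i, 0 ≤ μ i) (hμ : ∀ i, μ i ≤ 1 / 2) (J : ℕ)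
    (X : Matrix (Fin d) (Fin ℓ) ℝ) (p : EuclideanSpace ℝ (Fin d) × Obs ℓ)
    (hg : ‖gradX f (S.preact X p.1) p.2‖ ^ 2 ≤ b ^ 2 * S.stepSum μ J X p.1) :
    ‖stack J fun j => specMoment μ (S.outer (S.update f s X p)) j - specMoment μ (S.outer X) j‖ ^ 2
      ≤ 12 * b ^ 8 / d ^ 2 * (1 + S.stepSum μ J X p.1) ^ 4 := by
  have hd0 : (0 : ℝ) < d := by positivity
  have hb0 : 0 ≤ b := by linarith
  set P := S.stepSum μ J X p.1 with hP
  have hP0 : 0 ≤ P := S.stepSum_nonneg μ J X p.1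
  set g2 := ‖gradX f (S.preact X p.1) p.2‖ ^ 2 with hg2
  have hg20 : 0 ≤ g2 := sq_nonneg _
  set l : ℕ → ℝ := fun j => ∑ q, S.linMoment μ X p.1 j q ^ 2 with hl
  have hl0 : ∀ j, 0 ≤ l j := fun j => Finset.sum_nonneg fun _ _ => sq_nonneg _
  have hn1 : ∀ j, ‖vecMulVec (S.linMoment μ X p.1 j) (S.grad₀ f X p)‖ = Real.sqrt (l j * g2) := by
    intro j
    rw [← Real.sqrt_sq (norm_nonneg _), norm_vecMulVec_sq, S.sum_grad₀_sq]
  have hn2 : ∀ j, ‖vecMulVec (S.grad₀ f X p) (S.linMoment μ X p.1 j)‖ = Real.sqrt (l j * g2) := by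
    intro j
    rw [← Real.sqrt_sq (norm_nonneg _), norm_vecMulVec_sq, S.sum_grad₀_sq, mul_comm]
  have hn3 : ‖vecMulVec (S.grad₀ f X p) (S.grad₀ f X p)‖ = g2 := by
    rw [← Real.sqrt_sq (norm_nonneg _), norm_vecMulVec_sq, S.sum_grad₀_sq, ← pow_two,
      Real.sqrt_sq hg20]
  have hsd : s * d ≤ b := by rwa [le_div_iff₀ hd0] at hs
  have hbound : ∀ j < J, ‖specMoment μ (S.outer (S.update f s X p)) j - specMoment μ (S.outer X) j‖
      ≤ 2 * s * Real.sqrt (l j * g2) + (s ^ 2 * (d * P) * g2) * (1 / 2) ^ j := by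
    intro j _
    rw [S.specMoment_update_sub]
    refine (norm_sub_le _ _).trans ?_
    rw [norm_smul, norm_smul, hn3, Real.norm_of_nonneg hs0, Real.norm_eq_abs, abs_mul,
      abs_of_nonneg (sq_nonneg s)]
    have h1 := S.abs_quadMoment_le hμ0 hμ p.1 j
    have h2 := S.norm_sq_le_stepSum μ J X p.1 hd
    have h3 : |S.quadMoment μ p.1 j| ≤ (1 / 2) ^ j * (d * P) :=
      h1.trans (mul_le_mul_of_nonneg_left h2 (by positivity))
    have h4 := norm_add_le (vecMulVec (S.linMoment μ X p.1 j) (S.grad₀ f X p))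
      (vecMulVec (S.grad₀ f X p) (S.linMoment μ X p.1 j))
    rw [hn1, hn2] at h4
    have h5 := mul_le_mul_of_nonneg_left h4 hs0
    have h6 : s ^ 2 * |S.quadMoment μ p.1 j| * g2 ≤ s ^ 2 * ((1 / 2) ^ j * (d * P)) * g2 := by
      gcongr
    linarith
  refine (norm_stack_le hbound).trans ?_
  have e1 : ∑ j ∈ Finset.range J, (2 * s * Real.sqrt (l j * g2)) ^ 2
      = 4 * s ^ 2 * g2 * ∑ j ∈ Finset.range J, l j := by
    rw [Finset.mul_sum]
    refine Finset.sum_congr rfl fun j _ => ?_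
    rw [mul_pow, Real.sq_sqrt (mul_nonneg (hl0 j) hg20)]
    ring
  rw [e1]
  have h7 := S.sum_linMoment_sq_le μ J X p.1
  have h8 : s ^ 2 ≤ b ^ 2 / d ^ 2 := by
    rw [← div_pow]; exact pow_le_pow_left₀ hs0 hs 2
  have hP1 : P ^ 2 ≤ (1 + P) ^ 4 := by nlinarith [sq_nonneg P, pow_nonneg hP0 3, pow_nonneg hP0 4]
  have hP2 : P ^ 4 ≤ (1 + P) ^ 4 := pow_le_pow_left₀ hP0 (by linarith) 4
  have hb48 : b ^ 4 ≤ b ^ 8 := pow_le_pow_right₀ hb1 (by norm_num)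
  have t1 : 2 * (4 * s ^ 2 * g2 * ∑ j ∈ Finset.range J, l j)
      ≤ 8 * b ^ 8 / d ^ 2 * (1 + P) ^ 4 := by
    calc 2 * (4 * s ^ 2 * g2 * ∑ j ∈ Finset.range J, l j)
        ≤ 2 * (4 * (b ^ 2 / d ^ 2) * (b ^ 2 * P) * P) := by
          have : 0 ≤ ∑ j ∈ Finset.range J, l j := Finset.sum_nonneg fun j _ => hl0 j
          gcongr
      _ = 8 * b ^ 4 / d ^ 2 * P ^ 2 := by ring
      _ ≤ _ := by gcongr
  have t2 : 4 * (s ^ 2 * (d * P) * g2) ^ 2 ≤ 4 * b ^ 8 / d ^ 2 * (1 + P) ^ 4 := by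
    calc 4 * (s ^ 2 * (d * P) * g2) ^ 2 ≤ 4 * (b ^ 2 / d ^ 2 * (d * P) * (b ^ 2 * P)) ^ 2 := by
          gcongr
      _ = 4 * b ^ 8 / d ^ 2 * P ^ 4 := by field_simp
      _ ≤ _ := by gcongr
  have e2 : 12 * b ^ 8 / d ^ 2 * (1 + P) ^ 4 = 8 * b ^ 8 / d ^ 2 * (1 + P) ^ 4
      + 4 * b ^ 8 / d ^ 2 * (1 + P) ^ 4 := by ring
  linarith

end Step

/-! ### The mean of one step -/

section MeanStep

variable {ℓ d : ℕ} {Lhat : ℝ} {f : ObsPlus ℓ → Obs ℓ → ℝ} {S : Setup ℓ d} {h : GramMat ℓ → ℝ}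
  {U : Set (GramMat ℓ)} {γ : ℝ → ℝ} {T : ℝ} {𝓑 : Fin d → ℝ → GramMat ℓ} {α Lf Lh : ℝ} {b : ℝ}

/-- The eigenvalues, rescaled to `[0, 1/2]`. -/
def Setup.weight (S : Setup ℓ d) (b : ℝ) (i : Fin d) : ℝ := S.eigval i / (2 * b)

/-- The weighted mean `(1/d) ∑ᵢ μᵢʲ λᵢ` of the eigenvalues. -/
def Setup.meanEig (S : Setup ℓ d) (b : ℝ) (j : ℕ) : ℝ :=
  1 / (d : ℝ) * ∑ i, S.weight b i ^ j * S.eigval i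

/-- The spectral moments of the deterministic curve. -/
def Setup.curveMoment (S : Setup ℓ d) (b : ℝ) (𝓑 : Fin d → ℝ → GramMat ℓ) (j : ℕ) (t : ℝ) :
    GramMat ℓ :=
  specMoment (S.weight b) (fun i => (1 / (d : ℝ)) • 𝓑 i t) j

/-- The spectral moments of an iterate. -/
def Setup.iterMoment (S : Setup ℓ d) (b : ℝ) (X : Matrix (Fin d) (Fin ℓ) ℝ) (j : ℕ) : GramMat ℓ :=
  specMoment (S.weight b) (S.outer X) j

/-- The drift of a spectral moment, as a function of the step size `g`, of the next spectral
moment `z`, and of the first column `H` of the gradient and the Fisher matrix `F`. -/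
def momentDrift (b κ g : ℝ) (z H : GramMat ℓ) (F : Matrix (Fin ℓ) (Fin ℓ) ℝ) : GramMat ℓ :=
  -(4 * b * g) • (z * H + Hᵀ * z) + (g ^ 2 * κ) • Matrix.fromBlocks F 0 0 0

lemma fromBlocks_sub_zero (F F' : Matrix (Fin ℓ) (Fin ℓ) ℝ) :
    (Matrix.fromBlocks (F - F') 0 0 0 : GramMat ℓ)
      = Matrix.fromBlocks F 0 0 0 - Matrix.fromBlocks F' 0 0 0 := by
  rw [sub_eq_add_neg (fromBlocks F 0 0 0), fromBlocks_neg, fromBlocks_add]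
  simp [sub_eq_add_neg]

lemma norm_momentDrift_le {κ g : ℝ} {z H : GramMat ℓ} {F : Matrix (Fin ℓ) (Fin ℓ) ℝ} (hb : 0 ≤ b)
    (hg0 : 0 ≤ g) (hg : g ≤ b) (hH : ‖H‖ ≤ b) (hF : ‖F‖ ≤ b) (hκ : 0 ≤ κ) :
    ‖momentDrift b κ g z H F‖ ≤ 8 * b ^ 3 * ‖z‖ + b ^ 3 * κ := by
  unfold momentDrift
  refine (norm_add_le _ _).trans (add_le_add ?_ ?_)
  · rw [norm_smul, norm_neg, Real.norm_of_nonneg (by positivity)]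
    calc 4 * b * g * ‖z * H + Hᵀ * z‖ ≤ 4 * b * b * (2 * b * ‖z‖) := by
          gcongr
          exact (norm_mul_add_transpose_mul_le z H).trans (by gcongr)
      _ = _ := by ring
  · rw [norm_smul, Real.norm_of_nonneg (by positivity)]
    calc g ^ 2 * κ * ‖(fromBlocks F 0 0 0 : GramMat ℓ)‖ ≤ b ^ 2 * κ * b := by
          gcongr
          exact (norm_fromBlocks_le F).trans hF
      _ = _ := by ring

/-- Telescoping in one argument at a time. The differences of `g` and `H` are multiplied by `z'` and
not by `z`; with `z'` a moment of the curve they inherit its geometric decay. -/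
lemma norm_momentDrift_sub_le {κ g g' : ℝ} {z z' H H' : GramMat ℓ}
    {F F' : Matrix (Fin ℓ) (Fin ℓ) ℝ} (hb : 0 ≤ b) (hg0 : 0 ≤ g) (hg : g ≤ b) (hg0' : 0 ≤ g')
    (hg' : g' ≤ b) (hH : ‖H‖ ≤ b) (hH' : ‖H'‖ ≤ b) (hF' : ‖F'‖ ≤ b) (hκ : 0 ≤ κ) :
    ‖momentDrift b κ g z H F - momentDrift b κ g' z' H' F'‖
      ≤ (8 * b ^ 2 * ‖z'‖ + 2 * b ^ 2 * κ) * |g - g'| + 8 * b ^ 3 * ‖z - z'‖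
        + 8 * b ^ 2 * ‖z'‖ * ‖H - H'‖ + b ^ 2 * κ * ‖F - F'‖ := by
  have e : momentDrift b κ g z H F - momentDrift b κ g' z' H' F'
      = -(4 * b * g) • ((z - z') * H + Hᵀ * (z - z'))
        + -(4 * b * g) • (z' * (H - H') + (H - H')ᵀ * z')
        + -(4 * b * (g - g')) • (z' * H' + H'ᵀ * z')
        + (g ^ 2 * κ) • Matrix.fromBlocks (F - F') 0 0 0
        + ((g ^ 2 - g' ^ 2) * κ) • Matrix.fromBlocks F' 0 0 0 := by
    unfold momentDrift
    rw [fromBlocks_sub_zero]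
    simp only [Matrix.sub_mul, Matrix.mul_sub, transpose_sub]
    module
  rw [e]
  have n1 : ‖-(4 * b * g) • ((z - z') * H + Hᵀ * (z - z'))‖ ≤ 8 * b ^ 3 * ‖z - z'‖ := by
    rw [norm_smul, norm_neg, Real.norm_of_nonneg (by positivity)]
    calc _ ≤ 4 * b * b * (2 * b * ‖z - z'‖) := by
          gcongr
          exact (norm_mul_add_transpose_mul_le _ H).trans (by gcongr)
      _ = _ := by ring
  have n2 : ‖-(4 * b * g) • (z' * (H - H') + (H - H')ᵀ * z')‖ ≤ 8 * b ^ 2 * ‖z'‖ * ‖H - H'‖ := by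
    rw [norm_smul, norm_neg, Real.norm_of_nonneg (by positivity)]
    calc _ ≤ 4 * b * b * (2 * ‖H - H'‖ * ‖z'‖) := by
          gcongr
          exact norm_mul_add_transpose_mul_le _ _
      _ = _ := by ring
  have n3 : ‖-(4 * b * (g - g')) • (z' * H' + H'ᵀ * z')‖ ≤ 8 * b ^ 2 * ‖z'‖ * |g - g'| := by
    rw [norm_smul, norm_neg, norm_mul, Real.norm_of_nonneg (by positivity), Real.norm_eq_abs]
    calc _ ≤ 4 * b * |g - g'| * (2 * b * ‖z'‖) := by
          gcongr
          exact (norm_mul_add_transpose_mul_le _ _).trans (by gcongr)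
      _ = _ := by ring
  have n4 : ‖(g ^ 2 * κ) • (Matrix.fromBlocks (F - F') 0 0 0 : GramMat ℓ)‖
      ≤ b ^ 2 * κ * ‖F - F'‖ := by
    rw [norm_smul, Real.norm_of_nonneg (by positivity)]
    gcongr
    exact norm_fromBlocks_le _
  have n5 : ‖((g ^ 2 - g' ^ 2) * κ) • (Matrix.fromBlocks F' 0 0 0 : GramMat ℓ)‖
      ≤ 2 * b ^ 2 * κ * |g - g'| := by
    rw [norm_smul, norm_mul, Real.norm_of_nonneg hκ, Real.norm_eq_abs,
      show g ^ 2 - g' ^ 2 = (g - g') * (g + g') by ring, abs_mul, abs_of_nonneg (add_nonneg hg0 hg0')]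
    calc _ ≤ |g - g'| * (b + b) * κ * b := by
          gcongr
          exact (norm_fromBlocks_le _).trans hF'
      _ = _ := by ring
  refine (norm_add_le _ _).trans ?_
  have m1 := norm_add_le (-(4 * b * g) • ((z - z') * H + Hᵀ * (z - z'))
        + -(4 * b * g) • (z' * (H - H') + (H - H')ᵀ * z')
        + -(4 * b * (g - g')) • (z' * H' + H'ᵀ * z'))
        ((g ^ 2 * κ) • (Matrix.fromBlocks (F - F') 0 0 0 : GramMat ℓ))
  have m2 := norm_add_le (-(4 * b * g) • ((z - z') * H + Hᵀ * (z - z'))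
        + -(4 * b * g) • (z' * (H - H') + (H - H')ᵀ * z'))
        (-(4 * b * (g - g')) • (z' * H' + H'ᵀ * z'))
  have m3 := norm_add_le (-(4 * b * g) • ((z - z') * H + Hᵀ * (z - z')))
        (-(4 * b * g) • (z' * (H - H') + (H - H')ᵀ * z'))
  linarith

/-- A solution on `[0, T]` in a dimension `d`, with all quantities bounded by `b`. -/
structure Setup.Controlled (S : Setup ℓ d) (Lhat : ℝ) (f : ObsPlus ℓ → Obs ℓ → ℝ)
    (h : GramMat ℓ → ℝ) (U : Set (GramMat ℓ)) (γ : ℝ → ℝ) (T : ℝ) (𝓑 : Fin d → ℝ → GramMat ℓ)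
    (b : ℝ) : Prop where
  one_le : 1 ≤ b
  dim : 1 ≤ d
  sol : S.IsSolution f h U γ T 𝓑
  crit : CriticalAE f (S.Xstarᵀ * S.K * S.Xstar)
  eig : ∀ i, S.eigval i ≤ b
  star : ‖S.Xstar‖ ≤ b
  lhat : 2 * Lhat ≤ b
  rate : ∀ t, 0 ≤ t → 0 ≤ γ t ∧ γ t ≤ b
  rate_meas : Measurable γ
  mass : ∀ t ∈ Set.Icc 0 T, 1 / (d : ℝ) * ∑ i, ‖𝓑 i t‖ ≤ b
  grad : ∀ t ∈ Set.Icc 0 T, ‖gradCol h (S.avg 𝓑 t)‖ ≤ b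
  fish : ∀ t ∈ Set.Icc 0 T, ‖fisher f (S.avg 𝓑 t)‖ ≤ b

/-- An iterate at which the gradient and the Fisher matrix are comparable with the curve. -/
structure Setup.Near (S : Setup ℓ d) (f : ObsPlus ℓ → Obs ℓ → ℝ)
    (h : GramMat ℓ → ℝ) (U : Set (GramMat ℓ)) (T : ℝ) (𝓑 : Fin d → ℝ → GramMat ℓ)
    (b : ℝ) (X : Matrix (Fin d) (Fin ℓ) ℝ) : Prop where
  mem : S.gram X ∈ U
  norm : ‖X‖ ≤ b
  grad : ‖gradCol h (S.gram X)‖ ≤ b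
  lip_grad : ∀ t ∈ Set.Icc 0 T,
    ‖gradCol h (S.gram X) - gradCol h (S.avg 𝓑 t)‖ ≤ b * ‖S.gram X - S.avg 𝓑 t‖
  lip_fish : ∀ t ∈ Set.Icc 0 T,
    ‖fisher f (S.gram X) - fisher f (S.avg 𝓑 t)‖ ≤ b * ‖S.gram X - S.avg 𝓑 t‖

section Weights

variable (hb : 1 ≤ b) (he : ∀ i, S.eigval i ≤ b)
include hb

lemma Setup.weight_nonneg (i : Fin d) : 0 ≤ S.weight b i :=
  div_nonneg (S.eigval_nonneg i) (by linarith)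

lemma Setup.eigval_eq (i : Fin d) : S.eigval i = 2 * b * S.weight b i := by
  unfold Setup.weight
  field_simp

lemma Setup.meanEig_nonneg (j : ℕ) : 0 ≤ S.meanEig b j :=
  mul_nonneg (by positivity) (Finset.sum_nonneg fun i _ =>
    mul_nonneg (pow_nonneg (S.weight_nonneg hb i) j) (S.eigval_nonneg i))

include he

lemma Setup.weight_le (i : Fin d) : S.weight b i ≤ 1 / 2 := by
  unfold Setup.weight
  rw [div_le_iff₀ (by linarith)]
  linarith [he i]

lemma Setup.meanEig_le (hd : 1 ≤ d) (j : ℕ) : S.meanEig b j ≤ b * (1 / 2) ^ j := by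
  have hd0 : (0 : ℝ) < d := by positivity
  unfold Setup.meanEig
  rw [one_div, inv_mul_le_iff₀ hd0]
  calc ∑ i, S.weight b i ^ j * S.eigval i ≤ ∑ _i : Fin d, (1 / 2) ^ j * b :=
        Finset.sum_le_sum fun i _ => mul_le_mul (pow_le_pow_left₀ (S.weight_nonneg hb i)
          (S.weight_le hb he i) j) (he i) (S.eigval_nonneg i) (by positivity)
    _ = _ := by rw [Finset.sum_const, Finset.card_univ, Fintype.card_fin, nsmul_eq_mul]; ring

end Weights

/-- The Gram matrix is a multiple of the first spectral moment, so the gradient of `h` and the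
Fisher matrix are functions of the stacked moments. -/
lemma Setup.gram_eq_iterMoment (hb : 1 ≤ b) (X : Matrix (Fin d) (Fin ℓ) ℝ) :
    S.gram X = (2 * b) • S.iterMoment b X 1 := by
  rw [S.gram_eq_sum, Setup.iterMoment, specMoment, Finset.smul_sum]
  refine Finset.sum_congr rfl fun i _ => ?_
  rw [pow_one, smul_smul, ← S.eigval_eq hb]
  rfl

lemma Setup.avg_eq_curveMoment (hb : 1 ≤ b) (t : ℝ) :
    S.avg 𝓑 t = (2 * b) • S.curveMoment b 𝓑 1 t := by
  rw [Setup.avg, Setup.curveMoment, specMoment, Finset.smul_sum, Finset.smul_sum]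
  refine Finset.sum_congr rfl fun i _ => ?_
  rw [pow_one, smul_smul, smul_smul, smul_smul, S.eigval_eq hb]
  congr 1
  ring

/-- Since `λᵢ = 2b μᵢ`, the factor `λᵢ` in the drift raises the index of the moment by one. The `d`
coupled equations become a hierarchy for the moments. -/
lemma Setup.specMoment_field (hb : 1 ≤ b) (j : ℕ) (t : ℝ) :
    specMoment (S.weight b) (fun i => (1 / (d : ℝ)) • S.field f h γ 𝓑 i t) j
      = momentDrift b (S.meanEig b j) (γ t) (S.curveMoment b 𝓑 (j + 1) t)
        (gradCol h (S.avg 𝓑 t)) (fisher f (S.avg 𝓑 t)) := by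
  unfold momentDrift Setup.curveMoment specMoment Setup.field Setup.meanEig
  rw [Matrix.sum_mul, Matrix.mul_sum, ← Finset.sum_add_distrib, Finset.smul_sum]
  rw [Finset.mul_sum, Finset.mul_sum, Finset.sum_smul, ← Finset.sum_add_distrib]
  refine Finset.sum_congr rfl fun i _ => ?_
  beta_reduce
  rw [S.eigval_eq hb i]
  simp only [smul_mul_assoc, mul_smul_comm]
  module

lemma Setup.IsSolution.curveMoment_sub_eq (hb : 1 ≤ b) (sol : S.IsSolution f h U γ T 𝓑) (j : ℕ)
    {s t : ℝ} (hs : s ∈ Set.Icc 0 T) (ht : t ∈ Set.Icc 0 T) (p q) :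
    IntervalIntegrable (fun u => momentDrift b (S.meanEig b j) (γ u) (S.curveMoment b 𝓑 (j + 1) u)
        (gradCol h (S.avg 𝓑 u)) (fisher f (S.avg 𝓑 u)) p q) volume s t ∧
    S.curveMoment b 𝓑 j t p q - S.curveMoment b 𝓑 j s p q
      = ∫ u in s..t, momentDrift b (S.meanEig b j) (γ u) (S.curveMoment b 𝓑 (j + 1) u)
        (gradCol h (S.avg 𝓑 u)) (fisher f (S.avg 𝓑 u)) p q := by
  simp_rw [← S.specMoment_field hb]
  have hI : ∀ i, IntervalIntegrable (fun u => S.weight b i ^ j * (1 / (d : ℝ)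
      * S.field f h γ 𝓑 i u p q)) volume s t :=
    fun i => ((sol.intervalIntegrable i p q hs ht).const_mul _).const_mul _
  simp only [specMoment, Matrix.sum_apply, Matrix.smul_apply, smul_eq_mul, Setup.curveMoment]
  refine ⟨⟨integrable_finsetSum _ fun i _ => (hI i).1,
    integrable_finsetSum _ fun i _ => (hI i).2⟩, ?_⟩
  rw [intervalIntegral.integral_finsetSum fun i _ => hI i, ← Finset.sum_sub_distrib]
  refine Finset.sum_congr rfl fun i _ => ?_
  rw [intervalIntegral.integral_const_mul, intervalIntegral.integral_const_mul,
    ← sol.sub_eq i p q hs ht]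
  ring

/-- The number of entries of a `2ℓ × 2ℓ` matrix. -/
abbrev entryCount (ℓ : ℕ) : ℝ :=
  (Fintype.card (Fin ℓ ⊕ Fin ℓ) : ℝ) * (Fintype.card (Fin ℓ ⊕ Fin ℓ) : ℝ)

namespace Setup.Controlled

variable (C : S.Controlled Lhat f h U γ T 𝓑 b)
include C

lemma norm_curveMoment_le (j : ℕ) {t : ℝ} (ht : t ∈ Set.Icc 0 T) :
    ‖S.curveMoment b 𝓑 j t‖ ≤ b * (1 / 2) ^ j := by
  refine (norm_specMoment_le (S.weight_nonneg C.one_le) (S.weight_le C.one_le C.eig) _ j).trans ?_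
  rw [mul_comm]
  refine mul_le_mul_of_nonneg_right ?_ (by positivity)
  refine le_trans (le_of_eq ?_) (C.mass t ht)
  rw [Finset.mul_sum]
  refine Finset.sum_congr rfl fun i _ => ?_
  rw [norm_smul, Real.norm_of_nonneg (by positivity)]

lemma norm_momentDrift_le (j : ℕ) {t : ℝ} (ht : t ∈ Set.Icc 0 T) :
    ‖momentDrift b (S.meanEig b j) (γ t) (S.curveMoment b 𝓑 (j + 1) t)
        (gradCol h (S.avg 𝓑 t)) (fisher f (S.avg 𝓑 t))‖ ≤ 5 * b ^ 4 * (1 / 2) ^ j := by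
  have hb0 : 0 ≤ b := zero_le_one.trans C.one_le
  have hr := C.rate t ht.1
  refine (HighDimSGD.norm_momentDrift_le hb0 hr.1 hr.2 (C.grad t ht) (C.fish t ht)
    (S.meanEig_nonneg C.one_le j)).trans ?_
  have h1 := C.norm_curveMoment_le (j + 1) ht
  have h2 := S.meanEig_le C.one_le C.eig C.dim j
  rw [pow_succ] at h1
  have h3 := mul_le_mul_of_nonneg_left h1 (show 0 ≤ 8 * b ^ 3 by positivity)
  have h4 := mul_le_mul_of_nonneg_left h2 (show 0 ≤ b ^ 3 by positivity)
  linarith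

/-- The equation is integrated entry by entry, so the drift bound is applied to each entry; this
costs the factor `entryCount`. -/
lemma norm_curveMoment_sub_le (j : ℕ) {s t : ℝ} (hs : s ∈ Set.Icc 0 T) (ht : t ∈ Set.Icc 0 T)
    (hst : s ≤ t) :
    ‖S.curveMoment b 𝓑 j t - S.curveMoment b 𝓑 j s‖
      ≤ entryCount ℓ * (5 * b ^ 4 * (t - s)) * (1 / 2) ^ j := by
  have hts : 0 ≤ t - s := sub_nonneg.2 hst
  refine (norm_le_of_entry_le (c := 5 * b ^ 4 * (1 / 2) ^ j * (t - s)) _ (fun p q => ?_)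
    (by positivity)).trans (le_of_eq (by unfold entryCount; ring))
  rw [Matrix.sub_apply, (C.sol.curveMoment_sub_eq C.one_le j hs ht p q).2, ← Real.norm_eq_abs,
    ← abs_of_nonneg hts]
  refine intervalIntegral.norm_integral_le_of_norm_le_const fun u hu => ?_
  rw [Set.uIoc_of_le hst] at hu
  exact (abs_entry_le_norm _ p q).trans (C.norm_momentDrift_le j ⟨hs.1.trans hu.1.le, hu.2.trans ht.2⟩)

end Setup.Controlled

lemma Setup.norm_iterMoment_le (hb : 1 ≤ b) (he : ∀ i, S.eigval i ≤ b) (hs : ‖S.Xstar‖ ≤ b)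
    {X : Matrix (Fin d) (Fin ℓ) ℝ} (hX : ‖X‖ ≤ b) (j : ℕ) :
    ‖S.iterMoment b X j‖ ≤ 2 * b ^ 2 * (1 / 2) ^ j := by
  refine (norm_specMoment_le (S.weight_nonneg hb) (S.weight_le hb he) _ j).trans ?_
  rw [mul_comm, S.sum_norm_outer]
  have := pow_le_pow_left₀ (norm_nonneg _) hX 2
  have := pow_le_pow_left₀ (norm_nonneg _) hs 2
  gcongr
  linarith

end MeanStep

/-! ### The expectation of one update of the spectral moments. -/

section MeanUpdate

variable {ℓ d : ℕ} {Lhat : ℝ} {f : ObsPlus ℓ → Obs ℓ → ℝ} {S : Setup ℓ d} {h : GramMat ℓ → ℝ}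
  {U : Set (GramMat ℓ)} {γ : ℝ → ℝ} {T : ℝ} {𝓑 : Fin d → ℝ → GramMat ℓ} {α Lf Lh : ℝ} {b : ℝ}

instance Setup.isProbabilityMeasure_dataLaw (S : Setup ℓ d) : IsProbabilityMeasure S.dataLaw := by
  unfold Setup.dataLaw; infer_instance

lemma integral_add_sub_sub {Ω : Type*} [MeasurableSpace Ω] {μ : Measure Ω} {F₁ F₂ F₃ F₄ : Ω → ℝ}
    (h₁ : Integrable F₁ μ) (h₂ : Integrable F₂ μ) (h₃ : Integrable F₃ μ) (h₄ : Integrable F₄ μ) :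
    ∫ p, (F₁ p + F₂ p - F₃ p - F₄ p) ∂μ
      = ∫ p, F₁ p ∂μ + ∫ p, F₂ p ∂μ - ∫ p, F₃ p ∂μ - ∫ p, F₄ p ∂μ := by
  have h12 : Integrable (fun p => F₁ p + F₂ p) μ := h₁.add h₂
  have h123 : Integrable (fun p => F₁ p + F₂ p - F₃ p) μ := h12.sub h₃
  rw [integral_sub h123 h₄, integral_sub h12 h₃, integral_add h₁ h₂]

lemma Setup.preact_eq_applyT (X : Matrix (Fin d) (Fin ℓ) ℝ) (a : EuclideanSpace ℝ (Fin d)) :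
    S.preact X a = applyT (Matrix.fromCols X S.Xstar) a := (applyT_fromCols _ _ _).symm

lemma Setup.measurable_gradX_preact (A : Admissible Lhat α Lf Lh f h U)
    (X : Matrix (Fin d) (Fin ℓ) ℝ) :
    Measurable (fun p : EuclideanSpace ℝ (Fin d) × Obs ℓ => gradX f (S.preact X p.1) p.2) := by
  simp_rw [S.preact_eq_applyT]
  exact A.conv.measurable_gradX_applyT A.meas _

lemma Setup.measurable_grad₀ (A : Admissible Lhat α Lf Lh f h U)
    (X : Matrix (Fin d) (Fin ℓ) ℝ) (q : Fin ℓ ⊕ Fin ℓ) :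
    Measurable (fun p => S.grad₀ f X p q) := by
  have h1 := S.measurable_gradX_preact A X
  rcases q with q | q
  · simp only [Setup.grad₀, Sum.elim_inl]; fun_prop
  · simp only [Setup.grad₀, Sum.elim_inr]; exact measurable_const

lemma Setup.measurable_coord (i : Fin d) : Measurable (fun a => S.coord a i) := by
  unfold Setup.coord dotProduct; fun_prop

lemma Setup.abs_grad₀_sq_le (X : Matrix (Fin d) (Fin ℓ) ℝ)
    (p : EuclideanSpace ℝ (Fin d) × Obs ℓ) (q : Fin ℓ ⊕ Fin ℓ) :
    S.grad₀ f X p q ^ 2 ≤ ‖gradX f (S.preact X p.1) p.2‖ ^ 2 := by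
  rw [← S.sum_grad₀_sq]
  exact Finset.single_le_sum (f := fun q => S.grad₀ f X p q ^ 2) (fun _ _ => sq_nonneg _)
    (Finset.mem_univ q)

lemma Setup.coord_sq_le (a : EuclideanSpace ℝ (Fin d)) (i : Fin d) : S.coord a i ^ 2 ≤ ‖a‖ ^ 2 := by
  rw [← S.sum_coord_sq]
  exact Finset.single_le_sum (f := fun i => S.coord a i ^ 2) (fun _ _ => sq_nonneg _)
    (Finset.mem_univ i)

lemma abs_mul_le_of_sq_le {x y c : ℝ} (hx : x ^ 2 ≤ c) (hy : y ^ 2 ≤ c) : |x * y| ≤ c := by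
  rw [abs_le]; constructor <;> nlinarith [sq_nonneg (x + y), sq_nonneg (x - y)]

lemma Setup.integral_grad₀_mul_grad₀ (A : Admissible Lhat α Lf Lh f h U)
    (X : Matrix (Fin d) (Fin ℓ) ℝ) (q r : Fin ℓ ⊕ Fin ℓ) :
    ∫ p, S.grad₀ f X p q * S.grad₀ f X p r ∂S.dataLaw
      = (Matrix.fromBlocks (fisher f (S.gram X)) 0 0 0 : GramMat ℓ) q r := by
  rcases q with q | q <;> rcases r with r | r
  · simp only [Setup.grad₀, Sum.elim_inl, S.preact_eq_applyT, fromBlocks_apply₁₁, fisher, of_apply]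
    rw [jointLaw_eq_modelLaw, Setup.gram,
      ← map_applyT_modelLaw S.posSemidef (Matrix.fromCols X S.Xstar), integral_map]
    · rfl
    · exact ((measurable_applyT_fst _).prodMk measurable_snd).aemeasurable
    · have := A.conv.measurable_gradX A.meas
      exact Measurable.aestronglyMeasurable (by fun_prop)
  all_goals simp [Setup.grad₀]

namespace Setup.Controlled

variable (C : S.Controlled Lhat f h U γ T 𝓑 b) (A : Admissible Lhat α Lf Lh f h U)
include C A

lemma ae_gradX_le (μ : Fin d → ℝ) (J : ℕ) (X : Matrix (Fin d) (Fin ℓ) ℝ) :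
    ∀ᵐ p ∂S.dataLaw, ‖gradX f (S.preact X p.1) p.2‖ ^ 2 ≤ b ^ 2 * S.stepSum μ J X p.1 :=
  S.ae_norm_gradX_sq_le A.conv A.hL A.meas C.crit C.lhat μ J X

lemma integrable_coord_mul_grad₀ (X : Matrix (Fin d) (Fin ℓ) ℝ) (i : Fin d) (q : Fin ℓ ⊕ Fin ℓ) :
    Integrable (fun p => S.coord p.1 i * S.grad₀ f X p q) S.dataLaw := by
  have hd0 : (0 : ℝ) < d := by have := C.dim; positivity
  have hI := (S.integrable_stepSum_pow (fun _ => 0) 0 X 1).const_mul (d + b ^ 2)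
  refine Integrable.mono' hI (((S.measurable_coord i).comp measurable_fst).mul
    (S.measurable_grad₀ A X q)).aestronglyMeasurable ?_
  filter_upwards [C.ae_gradX_le A (fun _ => 0) 0 X] with p hp
  have h1 := S.norm_sq_le_stepSum (fun _ => 0) 0 X p.1 C.dim
  have h2 := S.stepSum_nonneg (fun _ => 0) 0 X p.1
  rw [Real.norm_eq_abs, pow_one]
  refine abs_mul_le_of_sq_le (((S.coord_sq_le _ i).trans h1).trans ?_)
    (((S.abs_grad₀_sq_le X p q).trans hp).trans ?_) <;> nlinarith [sq_nonneg b]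

lemma integrable_grad₀_mul_grad₀ (X : Matrix (Fin d) (Fin ℓ) ℝ) (q r : Fin ℓ ⊕ Fin ℓ) :
    Integrable (fun p => S.grad₀ f X p q * S.grad₀ f X p r) S.dataLaw := by
  have hI := (S.integrable_stepSum_pow (fun _ => 0) 0 X 1).const_mul (b ^ 2)
  refine Integrable.mono' hI ((S.measurable_grad₀ A X q).mul
    (S.measurable_grad₀ A X r)).aestronglyMeasurable ?_
  filter_upwards [C.ae_gradX_le A (fun _ => 0) 0 X] with p hp
  rw [Real.norm_eq_abs, pow_one]
  exact abs_mul_le_of_sq_le ((S.abs_grad₀_sq_le X p q).trans hp)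
    ((S.abs_grad₀_sq_le X p r).trans hp)

lemma integrable_coord_sq_mul (X : Matrix (Fin d) (Fin ℓ) ℝ) (i : Fin d) (q r : Fin ℓ ⊕ Fin ℓ) :
    Integrable (fun p => S.coord p.1 i ^ 2 * (S.grad₀ f X p q * S.grad₀ f X p r)) S.dataLaw := by
  have hI := (S.integrable_stepSum_pow (fun _ => 0) 0 X 2).const_mul (d * b ^ 2)
  refine Integrable.mono' hI ((((S.measurable_coord i).comp measurable_fst).pow_const 2).mul
    ((S.measurable_grad₀ A X q).mul (S.measurable_grad₀ A X r))).aestronglyMeasurable ?_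
  filter_upwards [C.ae_gradX_le A (fun _ => 0) 0 X] with p hp
  have h1 := (S.coord_sq_le p.1 i).trans (S.norm_sq_le_stepSum (fun _ => 0) 0 X p.1 C.dim)
  have h2 := abs_mul_le_of_sq_le ((S.abs_grad₀_sq_le X p q).trans hp)
    ((S.abs_grad₀_sq_le X p r).trans hp)
  have h3 := S.stepSum_nonneg (fun _ => 0) 0 X p.1
  rw [norm_mul, Real.norm_of_nonneg (sq_nonneg _), Real.norm_eq_abs]
  calc _ ≤ (d * S.stepSum (fun _ => 0) 0 X p.1) * (b ^ 2 * S.stepSum (fun _ => 0) 0 X p.1) := by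
        gcongr
    _ = _ := by ring

lemma integral_coord_mul_grad₀ {X : Matrix (Fin d) (Fin ℓ) ℝ} (hX : S.gram X ∈ U) (i : Fin d)
    (q : Fin ℓ ⊕ Fin ℓ) :
    ∫ p, S.coord p.1 i * S.grad₀ f X p q ∂S.dataLaw
      = 2 * S.eigval i * ∑ r, S.coeff X i r * gradCol h (S.gram X) r q := by
  rcases q with q | q
  · have h1 := A.integral_coeff_mul_gradX S.posSemidef X S.Xstar C.crit hX (S.eigvec i).ofLp
      (S.eigval i) (S.eigen i) q
    simp only [Setup.grad₀, Sum.elim_inl, S.preact_eq_applyT]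
    refine h1.trans ?_
    congr 1
    refine Finset.sum_congr rfl fun r _ => ?_
    rcases r with r | r <;> simp [gradCol, toBlocks₁₁, toBlocks₂₁, Setup.coeff, Setup.gram]
  · have h1 : ∀ r, gradCol h (S.gram X) r (Sum.inr q) = 0 := by
      rintro (r | r) <;> simp [gradCol]
    simp [Setup.grad₀, h1]

/-- The mean of one step, up to the fluctuation of `∑ᵢ μᵢʲ ⟨ωᵢ, a⟩²`. -/
lemma integral_specMoment_update_sub {X : Matrix (Fin d) (Fin ℓ) ℝ} (hX : S.gram X ∈ U) (g : ℝ)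
    (j : ℕ) (q r : Fin ℓ ⊕ Fin ℓ) :
    Integrable (fun p => (S.iterMoment b (S.update f (g / d) X p) j - S.iterMoment b X j) q r)
      S.dataLaw ∧
    ∫ p, (S.iterMoment b (S.update f (g / d) X p) j - S.iterMoment b X j) q r ∂S.dataLaw
      = 1 / (d : ℝ) * momentDrift b (S.meanEig b j) g (S.iterMoment b X (j + 1))
          (gradCol h (S.gram X)) (fisher f (S.gram X)) q r
        + (g / d) ^ 2 * ∫ p, (∑ i, S.weight b i ^ j * (S.coord p.1 i ^ 2 - S.eigval i))
          * (S.grad₀ f X p q * S.grad₀ f X p r) ∂S.dataLaw := by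
  have hd0 : (d : ℝ) ≠ 0 := by have := C.dim; positivity
  set s := g / d with hs
  have hgg := C.integrable_grad₀_mul_grad₀ A X q r
  have hcg := C.integrable_coord_mul_grad₀ A X
  have hcc := fun i => C.integrable_coord_sq_mul A X i q r
  -- In the quadratic term `∑ᵢ μᵢʲ ⟨ωᵢ, a⟩²` is split into its mean and its fluctuation. The mean
  -- yields the Fisher part of the drift.
  have e : ∀ p, (S.iterMoment b (S.update f s X p) j - S.iterMoment b X j) q r
      = s ^ 2 * ((∑ i, S.weight b i ^ j * (S.coord p.1 i ^ 2 - S.eigval i))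
          * (S.grad₀ f X p q * S.grad₀ f X p r))
        + s ^ 2 * (∑ i, S.weight b i ^ j * S.eigval i) * (S.grad₀ f X p q * S.grad₀ f X p r)
        - ∑ i, (s * S.weight b i ^ j * S.coeff X i q) * (S.coord p.1 i * S.grad₀ f X p r)
        - ∑ i, (s * S.weight b i ^ j * S.coeff X i r) * (S.coord p.1 i * S.grad₀ f X p q) := by
    intro p
    unfold Setup.iterMoment
    rw [S.specMoment_update_sub]
    simp only [Setup.quadMoment, Setup.linMoment, Matrix.sub_apply, Matrix.add_apply,
      Matrix.smul_apply, vecMulVec_apply, smul_eq_mul, Finset.sum_apply, Pi.smul_apply, mul_sub,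
      Finset.sum_sub_distrib]
    have e1 : s * ((∑ i, S.weight b i ^ j * S.coord p.1 i * S.coeff X i q) * S.grad₀ f X p r
        + S.grad₀ f X p q * ∑ i, S.weight b i ^ j * S.coord p.1 i * S.coeff X i r)
        = ∑ i, (s * S.weight b i ^ j * S.coeff X i q) * (S.coord p.1 i * S.grad₀ f X p r)
        + ∑ i, (s * S.weight b i ^ j * S.coeff X i r) * (S.coord p.1 i * S.grad₀ f X p q) := by
      rw [mul_add, Finset.sum_mul, Finset.mul_sum, Finset.mul_sum, Finset.mul_sum]
      congr 1 <;> exact Finset.sum_congr rfl fun i _ => by ring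
    rw [e1]
    ring
  have i1 : Integrable (fun p => s ^ 2 * ((∑ i, S.weight b i ^ j * (S.coord p.1 i ^ 2 - S.eigval i))
          * (S.grad₀ f X p q * S.grad₀ f X p r))) S.dataLaw := by
    refine Integrable.const_mul ?_ _
    simp_rw [Finset.sum_mul]
    refine integrable_finsetSum _ fun i _ => ?_
    have := ((hcc i).sub (hgg.const_mul (S.eigval i))).const_mul (S.weight b i ^ j)
    refine this.congr (Eventually.of_forall fun p => ?_)
    simp only [Pi.sub_apply]
    ring
  have i2 : Integrable (fun p => s ^ 2 * (∑ i, S.weight b i ^ j * S.eigval i)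
      * (S.grad₀ f X p q * S.grad₀ f X p r)) S.dataLaw := hgg.const_mul _
  have i3 : ∀ q r, Integrable (fun p => ∑ i, (s * S.weight b i ^ j * S.coeff X i q)
      * (S.coord p.1 i * S.grad₀ f X p r)) S.dataLaw :=
    fun q r => integrable_finsetSum _ fun i _ => (hcg i r).const_mul _
  constructor
  · simp_rw [e]
    exact ((i1.add i2).sub (i3 q r)).sub (i3 r q)
  -- The integration by parts formula supplies a factor `2λᵢ = 4b μᵢ`, which turns the `j`-th moment
  -- into the next one.
  have e3 : ∀ q r, ∫ p, ∑ i, (s * S.weight b i ^ j * S.coeff X i q)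
      * (S.coord p.1 i * S.grad₀ f X p r) ∂S.dataLaw
      = s * (4 * b) * (S.iterMoment b X (j + 1) * gradCol h (S.gram X)) q r := by
    intro q r
    rw [integral_finsetSum _ fun i _ => (hcg i r).const_mul _]
    simp_rw [integral_const_mul, C.integral_coord_mul_grad₀ A hX]
    rw [Matrix.mul_apply]
    simp only [Setup.iterMoment, specMoment, Matrix.sum_apply, Matrix.smul_apply, Setup.outer,
      vecMulVec_apply, smul_eq_mul, Finset.sum_mul, Finset.mul_sum]
    rw [Finset.sum_comm]
    refine Finset.sum_congr rfl fun u _ => Finset.sum_congr rfl fun i _ => ?_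
    rw [S.eigval_eq C.one_le i]
    ring
  have hsymm : (S.iterMoment b X (j + 1))ᵀ = S.iterMoment b X (j + 1) := by
    simp [Setup.iterMoment, specMoment, Setup.outer, transpose_sum, transpose_vecMulVec]
  refine (integral_congr_ae (Eventually.of_forall e)).trans ?_
  refine (integral_add_sub_sub i1 i2 (i3 q r) (i3 r q)).trans ?_
  rw [integral_const_mul, integral_const_mul, e3, e3, S.integral_grad₀_mul_grad₀ A]
  have e4 : (S.iterMoment b X (j + 1) * gradCol h (S.gram X)) r q
      = ((gradCol h (S.gram X))ᵀ * S.iterMoment b X (j + 1)) q r := by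
    conv_rhs => rw [← hsymm, ← transpose_mul, transpose_apply]
  rw [e4]
  simp only [momentDrift, Matrix.add_apply, Matrix.smul_apply, smul_eq_mul, Setup.meanEig, hs]
  field_simp
  ring

/-- The constant in `abs_integral_fluctuation_le`. -/
def _root_.HighDimSGD.fluctConst (ℓ : ℕ) (b : ℝ) : ℝ :=
  (b ^ 2 + b ^ 4 * ((12 * ℓ + 1) * b ^ 3) ^ 2) * normalMoment 2

/-- The fluctuation is correlated with the gradient, so the product is bounded by a weighted
arithmetic-geometric mean. The fluctuation has second moment of order `d 4⁻ʲ`, and the factor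
`γ²/d²` of the quadratic term then makes the contribution to one step of order `d^(-3/2) 2⁻ʲ`. -/
lemma abs_integral_fluctuation_le {X : Matrix (Fin d) (Fin ℓ) ℝ} (hX : ‖X‖ ≤ b)
    (j : ℕ) (q r : Fin ℓ ⊕ Fin ℓ) :
    |∫ p, (∑ i, S.weight b i ^ j * (S.coord p.1 i ^ 2 - S.eigval i))
        * (S.grad₀ f X p q * S.grad₀ f X p r) ∂S.dataLaw|
      ≤ fluctConst ℓ b * Real.sqrt d * (1 / 2) ^ j := by
  have hd0 : (0 : ℝ) < d := by have := C.dim; positivity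
  have hb0 : 0 ≤ b := zero_le_one.trans C.one_le
  have hsd : 0 < Real.sqrt d := Real.sqrt_pos.2 hd0
  -- The weight matches the standard deviation of the fluctuation, so that both halves of the bound
  -- are of order `v`.
  set v : ℝ := Real.sqrt d * (1 / 2) ^ j with hv
  have hv0 : 0 < v := by positivity
  set Y : EuclideanSpace ℝ (Fin d) → ℝ :=
    fun a => ∑ i, S.weight b i ^ j * (S.coord a i ^ 2 - S.eigval i) with hY
  have hYm : Measurable Y := by
    have := S.measurable_coord (d := d)
    simp only [hY]; fun_prop
  have hfst : ∀ F : EuclideanSpace ℝ (Fin d) → ℝ, ∫ p, F p.1 ∂S.dataLaw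
      = ∫ a, F a ∂(multivariateGaussian 0 S.K) := by
    intro F
    unfold Setup.dataLaw
    exact integral_fun_fst (μ := multivariateGaussian 0 S.K) (ν := stdGaussian (Obs ℓ)) F
      |>.trans (by simp)
  have hw0 := S.weight_nonneg C.one_le
  have hw := S.weight_le C.one_le C.eig
  set P : EuclideanSpace ℝ (Fin d) × Obs ℓ → ℝ := fun p => S.stepSum (S.weight b) 0 X p.1 with hP
  have hP0 : ∀ p, 0 ≤ P p := fun p => S.stepSum_nonneg _ _ _ _
  have hPi := S.integrable_stepSum_pow (S.weight b) 0 X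
  have hYsq_i : Integrable (fun p : EuclideanSpace ℝ (Fin d) × Obs ℓ => Y p.1 ^ 2) S.dataLaw := by
    have h1 : Integrable (fun p => 2 * d ^ 2 * (P p ^ 2 + b ^ 2)) S.dataLaw :=
      ((hPi 2).add (integrable_const _)).const_mul _
    refine Integrable.mono' h1 ((hYm.comp measurable_fst).pow_const 2).aestronglyMeasurable
      (Eventually.of_forall fun p => ?_)
    have h2 : Y p.1 = S.quadMoment (S.weight b) p.1 j - d * S.meanEig b j := by
      simp only [hY, Setup.quadMoment, Setup.meanEig, mul_sub, Finset.sum_sub_distrib]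
      field_simp
    have h3 := (S.abs_quadMoment_le hw0 hw p.1 j).trans (mul_le_of_le_one_left (sq_nonneg _)
      (pow_le_one₀ (by norm_num) (by norm_num)))
    have h4 := h3.trans (S.norm_sq_le_stepSum (S.weight b) 0 X p.1 C.dim)
    have h5 := S.meanEig_nonneg C.one_le j
    have h6 : S.meanEig b j ≤ b := (S.meanEig_le C.one_le C.eig C.dim j).trans
      (mul_le_of_le_one_right hb0 (pow_le_one₀ (by norm_num) (by norm_num)))
    rw [Real.norm_of_nonneg (sq_nonneg _), h2]
    have h7 : S.quadMoment (S.weight b) p.1 j ^ 2 ≤ (d * P p) ^ 2 :=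
      sq_le_sq' (by linarith [(abs_le.1 h4).1]) (abs_le.1 h4).2
    have h8 : (d * S.meanEig b j) ^ 2 ≤ (d * b) ^ 2 := by gcongr
    nlinarith [sq_nonneg (S.quadMoment (S.weight b) p.1 j + d * S.meanEig b j)]
  have hYsq : ∫ p, Y p.1 ^ 2 ∂S.dataLaw ≤ v ^ 2 * (b ^ 2 * normalMoment 2) := by
    rw [hfst fun a => Y a ^ 2]
    refine (integral_sq_weighted_sum_sq_sub_le S.posSemidef S.eigval S.eigvec S.eigen
      S.eigval_nonneg (fun i => S.weight b i ^ j)).trans ?_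
    calc _ ≤ ∑ _i : Fin d, ((1 / 2 : ℝ) ^ j) ^ 2 * b ^ 2 * normalMoment 2 := by
          refine Finset.sum_le_sum fun i _ => ?_
          have := normalMoment_nonneg 2
          have h1 := S.eigval_nonneg i
          have h2 := C.eig i
          have h3 := hw0 i
          have h4 := hw i
          gcongr
      _ = _ := by
          rw [Finset.sum_const, Finset.card_univ, Fintype.card_fin, nsmul_eq_mul, hv, mul_pow,
            Real.sq_sqrt hd0.le]
          ring
  have hPsq : ∫ p, P p ^ 2 ∂S.dataLaw ≤ ((12 * ℓ + 1) * b ^ 3) ^ 2 * normalMoment 2 :=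
    S.integral_stepSum_pow_le C.one_le C.dim C.eig hw0 hw 0 hX C.star 2
  have hdom : Integrable (fun p => v⁻¹ * Y p.1 ^ 2 + v * b ^ 4 * P p ^ 2) S.dataLaw :=
    (hYsq_i.const_mul _).add ((hPi 2).const_mul _)
  have hle : ∀ᵐ p ∂S.dataLaw, ‖Y p.1 * (S.grad₀ f X p q * S.grad₀ f X p r)‖
      ≤ v⁻¹ * Y p.1 ^ 2 + v * b ^ 4 * P p ^ 2 := by
    filter_upwards [C.ae_gradX_le A (S.weight b) 0 X] with p hp
    have h2 := abs_mul_le_of_sq_le ((S.abs_grad₀_sq_le X p q).trans hp)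
      ((S.abs_grad₀_sq_le X p r).trans hp)
    have h3 := hP0 p
    rw [norm_mul, Real.norm_eq_abs, Real.norm_eq_abs]
    calc |Y p.1| * |S.grad₀ f X p q * S.grad₀ f X p r| ≤ |Y p.1| * (b ^ 2 * P p) := by gcongr
      _ ≤ v⁻¹ * |Y p.1| ^ 2 + v * (b ^ 2 * P p) ^ 2 := by
          have e1 : v⁻¹ * |Y p.1| ^ 2 + v * (b ^ 2 * P p) ^ 2 - |Y p.1| * (b ^ 2 * P p)
              = v⁻¹ * ((|Y p.1| - v * (b ^ 2 * P p)) ^ 2 + |Y p.1| * (v * (b ^ 2 * P p))) := by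
            field_simp
            ring
          have e2 : 0 ≤ v⁻¹ * ((|Y p.1| - v * (b ^ 2 * P p)) ^ 2
            + |Y p.1| * (v * (b ^ 2 * P p))) := by positivity
          linarith
      _ = _ := by rw [sq_abs]; ring
  rw [← Real.norm_eq_abs]
  calc _ ≤ ∫ p, (v⁻¹ * Y p.1 ^ 2 + v * b ^ 4 * P p ^ 2) ∂S.dataLaw :=
        norm_integral_le_of_norm_le hdom hle
    _ = v⁻¹ * ∫ p, Y p.1 ^ 2 ∂S.dataLaw + v * b ^ 4 * ∫ p, P p ^ 2 ∂S.dataLaw := by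
        rw [integral_add (hYsq_i.const_mul _) ((hPi 2).const_mul _), integral_const_mul,
          integral_const_mul]
    _ ≤ v⁻¹ * (v ^ 2 * (b ^ 2 * normalMoment 2))
        + v * b ^ 4 * (((12 * ℓ + 1) * b ^ 3) ^ 2 * normalMoment 2) := by gcongr
    _ = fluctConst ℓ b * v := by unfold fluctConst; field_simp
    _ = _ := by rw [hv]; ring

end Setup.Controlled

end MeanUpdate

/-! ### The mean change of the deviation from the curve. -/

section MomentStep

variable {ℓ d : ℕ} {Lhat : ℝ} {f : ObsPlus ℓ → Obs ℓ → ℝ} {S : Setup ℓ d} {h : GramMat ℓ → ℝ}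
  {U : Set (GramMat ℓ)} {γ : ℝ → ℝ} {T : ℝ} {𝓑 : Fin d → ℝ → GramMat ℓ} {α Lf Lh : ℝ} {b : ℝ}

/-- The Lipschitz constant in time of the spectral moments of the curve. -/
def timeLip (ℓ : ℕ) (b : ℝ) : ℝ := entryCount ℓ * (5 * b ^ 4)

lemma timeLip_nonneg (ℓ : ℕ) (b : ℝ) : 0 ≤ timeLip ℓ b := by unfold timeLip; positivity

/-- The constant in `Setup.Controlled.norm_integral_increment_le`. -/
def meanConst (ℓ : ℕ) (b : ℝ) : ℝ :=
  2 * entryCount ℓ * (8 * b ^ 3 * (1 + 3 * b ^ 2) + b ^ 2 * fluctConst ℓ b + 10 * b ^ 3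
    + 26 * b ^ 5 * timeLip ℓ b + 18 * b ^ 5)

lemma fluctConst_nonneg (ℓ : ℕ) (b : ℝ) : 0 ≤ fluctConst ℓ b := by
  have := normalMoment_nonneg 2
  unfold fluctConst; positivity

lemma meanConst_nonneg (ℓ : ℕ) (hb : 0 ≤ b) : 0 ≤ meanConst ℓ b := by
  have := fluctConst_nonneg ℓ b
  have := timeLip_nonneg ℓ b
  unfold meanConst; positivity

/-- The distance of an iterate from the curve, through the first `d + 2` spectral moments. -/
def Setup.deviation (S : Setup ℓ d) (b : ℝ) (𝓑 : Fin d → ℝ → GramMat ℓ)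
    (X : Matrix (Fin d) (Fin ℓ) ℝ) (t : ℝ) : StackSpace ℓ (d + 2) :=
  stack (d + 2) fun j => S.iterMoment b X j - S.curveMoment b 𝓑 j t

/-- The change of the deviation in one step. -/
def Setup.increment (S : Setup ℓ d) (b : ℝ) (𝓑 : Fin d → ℝ → GramMat ℓ)
    (X X' : Matrix (Fin d) (Fin ℓ) ℝ) (t t' : ℝ) : StackSpace ℓ (d + 2) :=
  stack (d + 2) fun j => (S.iterMoment b X' j - S.iterMoment b X j)
    - (S.curveMoment b 𝓑 j t' - S.curveMoment b 𝓑 j t)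

lemma Setup.deviation_add_increment (X X' : Matrix (Fin d) (Fin ℓ) ℝ) (t t' : ℝ) :
    S.deviation b 𝓑 X t + S.increment b 𝓑 X X' t t' = S.deviation b 𝓑 X' t' := by
  ext x
  simp only [Setup.deviation, Setup.increment, PiLp.add_apply, stack_apply, Matrix.sub_apply]
  ring

lemma Setup.measurable_stack {Ω : Type*} [MeasurableSpace Ω] {J : ℕ} {v : Ω → ℕ → GramMat ℓ}
    (hv : ∀ j q r, Measurable fun ω => v ω j q r) : Measurable fun ω => stack J (v ω) :=
  (PiLp.continuous_toLp 2 _).measurable.comp (measurable_pi_lambda _ fun _ => hv _ _ _)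

lemma le_two_mul_add {x a c S : ℝ} (ha : 0 ≤ a) (hc : 0 ≤ c) (hx : x ^ 2 ≤ 2 * S + 4 * c ^ 2)
    (hS : S ≤ a ^ 2) : x ≤ 2 * a + 2 * c := by
  refine le_of_sq_le_sq ?_ (by positivity)
  nlinarith [mul_nonneg ha hc]

/-- Bookkeeping for the mean of the increment: `δ` is the step length `1/d`, `v` the first moment
beyond the truncation, `w` the deviation of the first moment, `I` the sampling error of `γ` in the
step, and `s` the order `√d / d²` of the fluctuation. -/
lemma mean_bound_arith {b n φ L δ Δ v w I s : ℝ} (hb : 0 ≤ b) (hn : 0 ≤ n) (hφ : 0 ≤ φ)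
    (hL : 0 ≤ L) (hδ : 0 ≤ δ) (hΔ : 0 ≤ Δ) (hv : v ≤ 3 * b ^ 2 * δ) (hw : w ≤ Δ) (hI : 0 ≤ I)
    (hs : 0 ≤ s) (hδs : δ * δ ≤ s) :
    2 * (n * (8 * b ^ 3 * δ) * (Δ + v))
      + 2 * (n * (b ^ 2 * φ * s + 10 * b ^ 3 * I + δ * (26 * b ^ 5 * L * δ + 18 * b ^ 5 * w)))
      ≤ 2 * n * (8 * b ^ 3 * (1 + 3 * b ^ 2) + b ^ 2 * φ + 10 * b ^ 3 + 26 * b ^ 5 * L + 18 * b ^ 5)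
        * (δ * Δ + (I + s)) := by
  have h1 : 26 * b ^ 5 * L * (δ * δ) ≤ 26 * b ^ 5 * L * s :=
    mul_le_mul_of_nonneg_left hδs (by positivity)
  have h2 : 18 * b ^ 5 * (δ * w) ≤ 18 * b ^ 5 * (δ * Δ) :=
    mul_le_mul_of_nonneg_left (mul_le_mul_of_nonneg_left hw hδ) (by positivity)
  have h3 : 8 * b ^ 3 * δ * v ≤ 8 * b ^ 3 * δ * (3 * b ^ 2 * δ) :=
    mul_le_mul_of_nonneg_left hv (by positivity)
  have h4 : 8 * b ^ 3 * (3 * b ^ 2) * (δ * δ) ≤ 8 * b ^ 3 * (3 * b ^ 2) * s :=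
    mul_le_mul_of_nonneg_left hδs (by positivity)
  have hx : 0 ≤ δ * Δ := by positivity
  set x := δ * Δ
  have p1 : 0 ≤ 8 * b ^ 3 * (3 * b ^ 2) * (x + I) := by positivity
  have p2 : 0 ≤ 8 * b ^ 3 * (I + s) := by positivity
  have p3 : 0 ≤ b ^ 2 * φ * (x + I) := by positivity
  have p4 : 0 ≤ 10 * b ^ 3 * (x + s) := by positivity
  have p5 : 0 ≤ 26 * b ^ 5 * L * (x + I) := by positivity
  have p6 : 0 ≤ 18 * b ^ 5 * (I + s) := by positivity
  have htot : 8 * b ^ 3 * δ * (Δ + v)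
      + (b ^ 2 * φ * s + 10 * b ^ 3 * I + δ * (26 * b ^ 5 * L * δ + 18 * b ^ 5 * w))
      ≤ (8 * b ^ 3 * (1 + 3 * b ^ 2) + b ^ 2 * φ + 10 * b ^ 3 + 26 * b ^ 5 * L + 18 * b ^ 5)
        * (x + (I + s)) := by
    have e : 8 * b ^ 3 * δ * Δ = 8 * b ^ 3 * x := by ring
    linarith
  have := mul_le_mul_of_nonneg_left htot (show 0 ≤ 2 * n by positivity)
  linarith

namespace Setup.Controlled

variable (C : S.Controlled Lhat f h U γ T 𝓑 b) (A : Admissible Lhat α Lf Lh f h U)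
include C

/-- The iterate uses data frozen at time `t`, while the curve moves up to `u`. The curve is
Lipschitz in time, which gives errors of order `1/d`; all remaining terms are deviations at time `t`
or the change of `γ`. Every term except the next moment's deviation keeps the factor `2⁻ʲ`. -/
lemma norm_momentDrift_sub_le {X : Matrix (Fin d) (Fin ℓ) ℝ} (N : S.Near f h U T 𝓑 b X)
    (j : ℕ) {t t' u : ℝ} (ht : t ∈ Set.Icc 0 T) (ht' : t' ∈ Set.Icc 0 T) (htt : t' - t = 1 / (d : ℝ))
    (hu : u ∈ Set.Icc t t') :
    ‖momentDrift b (S.meanEig b j) (γ t) (S.iterMoment b X (j + 1))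
          (gradCol h (S.gram X)) (fisher f (S.gram X))
      - momentDrift b (S.meanEig b j) (γ u) (S.curveMoment b 𝓑 (j + 1) u)
          (gradCol h (S.avg 𝓑 u)) (fisher f (S.avg 𝓑 u))‖
      ≤ 10 * b ^ 3 * (1 / 2) ^ j * |γ u - γ t|
        + (8 * b ^ 3 * ‖S.iterMoment b X (j + 1) - S.curveMoment b 𝓑 (j + 1) t‖
          + (1 / 2) ^ j * (26 * b ^ 5 * timeLip ℓ b * (1 / d)
            + 18 * b ^ 5 * ‖S.iterMoment b X 1 - S.curveMoment b 𝓑 1 t‖)) := by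
  have hb0 : 0 ≤ b := zero_le_one.trans C.one_le
  have huT : u ∈ Set.Icc 0 T := ⟨ht.1.trans hu.1, hu.2.trans ht'.2⟩
  have hd0 : (0 : ℝ) < d := by have := C.dim; positivity
  have hw : ∀ j, ‖S.iterMoment b X j - S.curveMoment b 𝓑 j u‖
      ≤ ‖S.iterMoment b X j - S.curveMoment b 𝓑 j t‖ + timeLip ℓ b * (1 / d) * (1 / 2) ^ j := by
    intro j
    have h1 := C.norm_curveMoment_sub_le j ht huT hu.1
    have h2 : entryCount ℓ * (5 * b ^ 4 * (u - t)) * (1 / 2) ^ j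
        ≤ timeLip ℓ b * (1 / d) * (1 / 2) ^ j := by
      unfold timeLip
      have : u - t ≤ 1 / (d : ℝ) := by rw [← htt]; linarith [hu.2]
      rw [show entryCount ℓ * (5 * b ^ 4 * (u - t)) = entryCount ℓ * (5 * b ^ 4) * (u - t) by ring]
      gcongr
    have h3 := norm_sub_le_norm_sub_add_norm_sub (S.iterMoment b X j) (S.curveMoment b 𝓑 j t)
      (S.curveMoment b 𝓑 j u)
    rw [norm_sub_rev (S.curveMoment b 𝓑 j t)] at h3
    linarith
  have hgram : ‖S.gram X - S.avg 𝓑 u‖ ≤ 2 * b * (‖S.iterMoment b X 1 - S.curveMoment b 𝓑 1 t‖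
      + timeLip ℓ b * (1 / d)) := by
    rw [S.gram_eq_iterMoment C.one_le, S.avg_eq_curveMoment C.one_le, ← smul_sub, norm_smul,
      Real.norm_of_nonneg (by positivity)]
    have h1 := hw 1
    have h2 : timeLip ℓ b * (1 / d) * (1 / 2) ^ 1 ≤ timeLip ℓ b * (1 / d) := by
      have : 0 ≤ timeLip ℓ b * (1 / d) := mul_nonneg (timeLip_nonneg _ _) (by positivity)
      linarith
    exact mul_le_mul_of_nonneg_left (by linarith) (by positivity)
  have hγt := C.rate t ht.1
  have hγu := C.rate u huT.1
  have hmain := HighDimSGD.norm_momentDrift_sub_le (z := S.iterMoment b X (j + 1))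
    (z' := S.curveMoment b 𝓑 (j + 1) u) (F := fisher f (S.gram X)) hb0 hγt.1 hγt.2 hγu.1 hγu.2
    N.grad (C.grad u huT) (C.fish u huT) (S.meanEig_nonneg C.one_le j)
  refine hmain.trans ?_
  set w1 := ‖S.iterMoment b X 1 - S.curveMoment b 𝓑 1 t‖ with hw1
  set wj := ‖S.iterMoment b X (j + 1) - S.curveMoment b 𝓑 (j + 1) t‖ with hwj
  set L := timeLip ℓ b * (1 / d) with hL
  have hL0 : 0 ≤ L := mul_nonneg (timeLip_nonneg _ _) (by positivity)
  have hz : ‖S.curveMoment b 𝓑 (j + 1) u‖ ≤ b * (1 / 2) ^ j := by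
    refine (C.norm_curveMoment_le (j + 1) huT).trans ?_
    have h0 : (0 : ℝ) ≤ (1 / 2) ^ j := by positivity
    rw [pow_succ]
    nlinarith
  have hκ := S.meanEig_le C.one_le C.eig C.dim j
  have hκ0 := Setup.meanEig_nonneg (S := S) C.one_le j
  have hG := (N.lip_grad u huT).trans (mul_le_mul_of_nonneg_left hgram hb0)
  have hF := (N.lip_fish u huT).trans (mul_le_mul_of_nonneg_left hgram hb0)
  have hZ := hw (j + 1)
  have h2j : ((1 : ℝ) / 2) ^ (j + 1) ≤ (1 / 2) ^ j := by
    rw [pow_succ]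
    have h0 : (0 : ℝ) ≤ (1 / 2) ^ j := by positivity
    linarith
  have hZ' : ‖S.iterMoment b X (j + 1) - S.curveMoment b 𝓑 (j + 1) u‖ ≤ wj + L * (1 / 2) ^ j :=
    hZ.trans (add_le_add le_rfl (mul_le_mul_of_nonneg_left h2j hL0))
  set v : ℝ := (1 / 2) ^ j with hv
  have hv0 : 0 ≤ v := by positivity
  have hw10 : 0 ≤ w1 := norm_nonneg _
  rw [abs_sub_comm (γ t)]
  have t1 : (8 * b ^ 2 * ‖S.curveMoment b 𝓑 (j + 1) u‖ + 2 * b ^ 2 * S.meanEig b j) * |γ u - γ t|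
      ≤ (8 * b ^ 2 * (b * v) + 2 * b ^ 2 * (b * v)) * |γ u - γ t| := by gcongr
  have t2 : 8 * b ^ 3 * ‖S.iterMoment b X (j + 1) - S.curveMoment b 𝓑 (j + 1) u‖
      ≤ 8 * b ^ 3 * wj + 8 * b ^ 5 * (L * v) := by
    have h35 : b ^ 3 ≤ b ^ 5 := pow_le_pow_right₀ C.one_le (by norm_num)
    have h1 := mul_le_mul_of_nonneg_left hZ' (show 0 ≤ 8 * b ^ 3 by positivity)
    have h2 := mul_le_mul_of_nonneg_right h35 (mul_nonneg hL0 hv0)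
    linarith
  have t3 : 8 * b ^ 2 * ‖S.curveMoment b 𝓑 (j + 1) u‖
      * ‖gradCol h (S.gram X) - gradCol h (S.avg 𝓑 u)‖
      ≤ 8 * b ^ 2 * (b * v) * (b * (2 * b * (w1 + L))) := by gcongr
  have t4 : b ^ 2 * S.meanEig b j * ‖fisher f (S.gram X) - fisher f (S.avg 𝓑 u)‖
      ≤ b ^ 2 * (b * v) * (b * (2 * b * (w1 + L))) := by gcongr
  have e1 : 26 * b ^ 5 * timeLip ℓ b * (1 / d) = 26 * b ^ 5 * L := by rw [hL]; ring
  rw [e1]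
  linarith

include A

/-- The mean of the increment of one spectral moment. -/
lemma abs_integral_increment_le {X : Matrix (Fin d) (Fin ℓ) ℝ} (N : S.Near f h U T 𝓑 b X)
    (j : ℕ) {t t' : ℝ} (ht : t ∈ Set.Icc 0 T) (ht' : t' ∈ Set.Icc 0 T) (htt : t' - t = 1 / (d : ℝ))
    (q r : Fin ℓ ⊕ Fin ℓ) :
    |∫ p, (S.iterMoment b (S.update f (γ t / d) X p) j - S.iterMoment b X j) q r ∂S.dataLaw
        - (S.curveMoment b 𝓑 j t' - S.curveMoment b 𝓑 j t) q r|
      ≤ 8 * b ^ 3 * (1 / d) * ‖S.iterMoment b X (j + 1) - S.curveMoment b 𝓑 (j + 1) t‖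
        + (b ^ 2 * fluctConst ℓ b * (Real.sqrt d / d ^ 2) + 10 * b ^ 3 * (∫ u in t..t', |γ u - γ t|)
          + (1 / d) * (26 * b ^ 5 * timeLip ℓ b * (1 / d)
            + 18 * b ^ 5 * ‖S.iterMoment b X 1 - S.curveMoment b 𝓑 1 t‖)) * (1 / 2) ^ j := by
  have hb0 : 0 ≤ b := zero_le_one.trans C.one_le
  have hd0 : (0 : ℝ) < d := by have := C.dim; positivity
  have hle : t ≤ t' := by
    have : 0 < 1 / (d : ℝ) := by positivity
    linarith
  rw [(C.integral_specMoment_update_sub A N.mem (γ t) j q r).2]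
  obtain ⟨hI, heq⟩ := C.sol.curveMoment_sub_eq C.one_le j ht ht' q r
  rw [Matrix.sub_apply, heq]
  set D := momentDrift b (S.meanEig b j) (γ t) (S.iterMoment b X (j + 1))
    (gradCol h (S.gram X)) (fisher f (S.gram X)) with hD
  have e1 : 1 / (d : ℝ) * D q r = ∫ _u in t..t', D q r := by
    rw [intervalIntegral.integral_const, htt, smul_eq_mul]
  have hfl := C.abs_integral_fluctuation_le A N.norm j q r
  set Fl := ∫ p, (∑ i, S.weight b i ^ j * (S.coord p.1 i ^ 2 - S.eigval i))
    * (S.grad₀ f X p q * S.grad₀ f X p r) ∂S.dataLaw with hFl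
  set w1 := ‖S.iterMoment b X 1 - S.curveMoment b 𝓑 1 t‖ with hw1
  set wj := ‖S.iterMoment b X (j + 1) - S.curveMoment b 𝓑 (j + 1) t‖ with hwj
  set cst : ℝ := 8 * b ^ 3 * wj + (1 / 2) ^ j * (26 * b ^ 5 * timeLip ℓ b * (1 / d)
            + 18 * b ^ 5 * w1) with hcst
  have hγi : IntervalIntegrable (fun u => |γ u - γ t|) volume t t' := by
    rw [intervalIntegrable_iff_integrableOn_Ioc_of_le hle]
    refine IntegrableOn.of_bound (C := b) (by simp)
      (by have := C.rate_meas; exact Measurable.aestronglyMeasurable (by fun_prop)) ?_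
    filter_upwards [ae_restrict_mem measurableSet_Ioc] with u hu
    have h1 := C.rate u (ht.1.trans hu.1.le)
    have h2 := C.rate t ht.1
    rw [Real.norm_of_nonneg (abs_nonneg _), abs_le]
    constructor <;> linarith
  have hdrift : |1 / (d : ℝ) * D q r - ∫ u in t..t', momentDrift b (S.meanEig b j) (γ u)
      (S.curveMoment b 𝓑 (j + 1) u) (gradCol h (S.avg 𝓑 u)) (fisher f (S.avg 𝓑 u)) q r|
      ≤ 10 * b ^ 3 * (1 / 2) ^ j * (∫ u in t..t', |γ u - γ t|) + (1 / d) * cst := by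
    rw [e1, ← intervalIntegral.integral_sub intervalIntegrable_const hI, ← Real.norm_eq_abs]
    have hbd : IntervalIntegrable (fun u => 10 * b ^ 3 * (1 / 2) ^ j * |γ u - γ t| + cst)
        volume t t' := (hγi.const_mul _).add intervalIntegrable_const
    refine (intervalIntegral.norm_integral_le_of_norm_le hle (Eventually.of_forall fun u hu => ?_)
      hbd).trans (le_of_eq ?_)
    · refine le_trans ?_ (C.norm_momentDrift_sub_le N j ht ht' htt ⟨hu.1.le, hu.2⟩)
      rw [← Matrix.sub_apply]
      exact abs_entry_le_norm _ q r
    · rw [intervalIntegral.integral_add (hγi.const_mul _) intervalIntegrable_const,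
        intervalIntegral.integral_const_mul, intervalIntegral.integral_const, htt, smul_eq_mul]
  have hγt := C.rate t ht.1
  have hfl2 : |(γ t / d) ^ 2 * Fl| ≤ b ^ 2 * fluctConst ℓ b * (Real.sqrt d / d ^ 2) * (1 / 2) ^ j := by
    rw [abs_mul, abs_of_nonneg (sq_nonneg _)]
    calc (γ t / d) ^ 2 * |Fl| ≤ (b / d) ^ 2 * (fluctConst ℓ b * Real.sqrt d * (1 / 2) ^ j) := by
          gcongr
          · exact div_nonneg hγt.1 hd0.le
          · exact hγt.2
      _ = _ := by ring
  rw [add_sub_right_comm]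
  refine (abs_add_le _ _).trans ((add_le_add hdrift hfl2).trans (le_of_eq ?_))
  rw [hcst]
  ring

/-- The mean of the increment. -/
lemma norm_integral_increment_le {X : Matrix (Fin d) (Fin ℓ) ℝ} (N : S.Near f h U T 𝓑 b X)
    {t t' : ℝ} (ht : t ∈ Set.Icc 0 T) (ht' : t' ∈ Set.Icc 0 T) (htt : t' - t = 1 / (d : ℝ)) :
    AEStronglyMeasurable (fun p => S.increment b 𝓑 X (S.update f (γ t / d) X p) t t') S.dataLaw ∧
    ‖∫ p, S.increment b 𝓑 X (S.update f (γ t / d) X p) t t' ∂S.dataLaw‖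
      ≤ meanConst ℓ b * (1 / d * ‖S.deviation b 𝓑 X t‖
        + ((∫ u in t..t', |γ u - γ t|) + Real.sqrt d / d ^ 2)) := by
  have hb0 : 0 ≤ b := zero_le_one.trans C.one_le
  have hd1 : (1 : ℝ) ≤ d := by exact_mod_cast C.dim
  have hd0 : (0 : ℝ) < d := by linarith
  have hle : t ≤ t' := by
    have : 0 < 1 / (d : ℝ) := by positivity
    linarith
  have hint : ∀ j q r, Integrable (fun p =>
      ((S.iterMoment b (S.update f (γ t / d) X p) j - S.iterMoment b X j)
        - (S.curveMoment b 𝓑 j t' - S.curveMoment b 𝓑 j t)) q r) S.dataLaw := fun j q r =>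
    (C.integral_specMoment_update_sub A N.mem (γ t) j q r).1.sub (integrable_const _)
  have hG : Integrable (fun p => S.increment b 𝓑 X (S.update f (γ t / d) X p) t t') S.dataLaw :=
    Integrable.of_eval_piLp fun x => hint x.1 x.2.1 x.2.2
  refine ⟨hG.aestronglyMeasurable, ?_⟩
  set M : ℕ → GramMat ℓ := fun j => Matrix.of fun q r => ∫ p,
    ((S.iterMoment b (S.update f (γ t / d) X p) j - S.iterMoment b X j)
        - (S.curveMoment b 𝓑 j t' - S.curveMoment b 𝓑 j t)) q r ∂S.dataLaw with hM
  have hGM : ∫ p, S.increment b 𝓑 X (S.update f (γ t / d) X p) t t' ∂S.dataLaw = stack (d + 2) M := by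
    ext x
    rw [eval_integral_piLp fun x => hint x.1 x.2.1 x.2.2]
    rfl
  rw [hGM]
  set w : ℕ → ℝ := fun j => ‖S.iterMoment b X j - S.curveMoment b 𝓑 j t‖ with hw
  set I := ∫ u in t..t', |γ u - γ t| with hI
  have hI0 : 0 ≤ I := intervalIntegral.integral_nonneg hle fun u _ => abs_nonneg _
  set E := b ^ 2 * fluctConst ℓ b * (Real.sqrt d / d ^ 2) + 10 * b ^ 3 * I
          + (1 / d) * (26 * b ^ 5 * timeLip ℓ b * (1 / d) + 18 * b ^ 5 * w 1) with hE
  have hfc := fluctConst_nonneg ℓ b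
  have htl := timeLip_nonneg ℓ b
  have hw0 : ∀ j, 0 ≤ w j := fun j => norm_nonneg _
  have hE0 : 0 ≤ E := by have := hw0 1; positivity
  have hMj : ∀ j < d + 2, ‖M j‖ ≤ entryCount ℓ * (8 * b ^ 3 * (1 / d)) * w (j + 1)
      + entryCount ℓ * E * (1 / 2) ^ j := by
    intro j _
    refine (norm_le_of_entry_le (c := 8 * b ^ 3 * (1 / d) * w (j + 1) + E * (1 / 2) ^ j) _
      (fun q r => ?_) (by have := hw0 (j + 1); positivity)).trans
      (le_of_eq (by unfold entryCount; ring))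
    have h1 := C.abs_integral_increment_le A N j ht ht' htt q r
    refine le_trans (le_of_eq ?_) h1
    congr 1
    simp only [hM, of_apply]
    change ∫ p, ((S.iterMoment b (S.update f (γ t / d) X p) j - S.iterMoment b X j) q r
        - (S.curveMoment b 𝓑 j t' - S.curveMoment b 𝓑 j t) q r) ∂S.dataLaw = _
    rw [integral_sub (C.integral_specMoment_update_sub A N.mem (γ t) j q r).1 (integrable_const _)]
    simp
  have hst := norm_stack_le hMj
  have hN : 0 ≤ entryCount ℓ := by positivity
  set Δ := ‖S.deviation b 𝓑 X t‖ with hΔ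
  have hΔ0 : 0 ≤ Δ := norm_nonneg _
  have hΔsq : Δ ^ 2 = ∑ j ∈ Finset.range (d + 2), w j ^ 2 := norm_stack_sq _ _
  have hw1 : w 1 ≤ Δ := norm_le_norm_stack (J := d + 2)
    (fun j => S.iterMoment b X j - S.curveMoment b 𝓑 j t) (by omega)
  -- The truncation of the hierarchy: the first moment that is not stacked has size `O(2^(-(d+2)))`,
  -- hence `O(1/d)`.
  have hwJ : w (d + 2) ≤ 3 * b ^ 2 * (1 / d) := by
    have h1 := S.norm_iterMoment_le C.one_le C.eig C.star N.norm (d + 2)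
    have h2 := C.norm_curveMoment_le (d + 2) ht
    have h3 := norm_sub_le (S.iterMoment b X (d + 2)) (S.curveMoment b 𝓑 (d + 2) t)
    have h4 : ((1 : ℝ) / 2) ^ (d + 2) ≤ 1 / d := by
      rw [div_pow, one_pow]
      refine one_div_le_one_div_of_le hd0 ?_
      have : (d + 2 : ℕ) < 2 ^ (d + 2) := Nat.lt_two_pow_self
      have h5 : ((d + 2 : ℕ) : ℝ) < 2 ^ (d + 2) := by exact_mod_cast this
      push_cast at h5
      linarith
    have h5 : b ≤ b ^ 2 := le_self_pow₀ C.one_le (by norm_num)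
    calc w (d + 2) ≤ 2 * b ^ 2 * (1 / 2) ^ (d + 2) + b * (1 / 2) ^ (d + 2) := by
          simp only [hw]; linarith
      _ ≤ 2 * b ^ 2 * (1 / d) + b ^ 2 * (1 / d) := by gcongr
      _ = _ := by ring
  -- Shifting the index by one drops the moment of index `0` and adds the truncated one, so the
  -- shifted family is bounded by the full deviation plus the truncation error.
  have hsum : ∑ j ∈ Finset.range (d + 2), (entryCount ℓ * (8 * b ^ 3 * (1 / d)) * w (j + 1)) ^ 2
      ≤ (entryCount ℓ * (8 * b ^ 3 * (1 / d))) ^ 2 * (Δ + w (d + 2)) ^ 2 := by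
    simp_rw [mul_pow _ (w _)]
    rw [← Finset.mul_sum]
    refine mul_le_mul_of_nonneg_left ?_ (sq_nonneg _)
    have h1 := Finset.sum_range_succ (fun j => w j ^ 2) (d + 2)
    rw [Finset.sum_range_succ' (fun j => w j ^ 2) (d + 2), ← hΔsq] at h1
    have := hw0 (d + 2)
    nlinarith [sq_nonneg (w 0)]
  have hbound : ‖stack (d + 2) M‖ ≤ 2 * (entryCount ℓ * (8 * b ^ 3 * (1 / d)) * (Δ + w (d + 2)))
      + 2 * (entryCount ℓ * E) := by
    have h0 := hw0 (d + 2)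
    refine le_two_mul_add ?_ (mul_nonneg hN hE0) hst (hsum.trans_eq (mul_pow _ _ 2).symm)
    exact mul_nonneg (mul_nonneg hN (by positivity)) (add_nonneg hΔ0 h0)
  refine hbound.trans ?_
  set s := Real.sqrt d / (d : ℝ) ^ 2 with hs
  have hs0 : 0 ≤ s := by positivity
  have hds : 1 / (d : ℝ) * (1 / d) ≤ s := by
    rw [hs, div_mul_div_comm, one_mul, ← pow_two]
    gcongr
    exact Real.one_le_sqrt.2 hd1
  exact mean_bound_arith hb0 hN hfc htl (by positivity) hΔ0 hwJ hw1 hI0 hs0 hds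

end Setup.Controlled

end MomentStep

/-! ### Growth of high moments of the deviation in one step. -/

section MomentStep

variable {ℓ d : ℕ} {Lhat : ℝ} {f : ObsPlus ℓ → Obs ℓ → ℝ} {S : Setup ℓ d} {h : GramMat ℓ → ℝ}
  {U : Set (GramMat ℓ)} {γ : ℝ → ℝ} {T : ℝ} {𝓑 : Fin d → ℝ → GramMat ℓ} {α Lf Lh : ℝ} {b : ℝ}

/-- The factor in the bound of the squared increment. -/
def incrementConst (ℓ : ℕ) (b : ℝ) : ℝ := 24 * b ^ 8 + 8 * timeLip ℓ b ^ 2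

/-- The moment bounds of the increment. -/
def incrementMoment (ℓ : ℕ) (b : ℝ) (q : ℕ) : ℝ :=
  incrementConst ℓ b ^ q
    * (2 ^ (4 * q) * (1 + ((12 * ℓ + 1) * b ^ 3) ^ (4 * q) * normalMoment (4 * q)))

/-- The growth constant of the `p`-th moment of the deviation. -/
def growthConst (ℓ : ℕ) (b : ℝ) (p : ℕ) : ℝ :=
  stepConst p (meanConst ℓ b) (incrementMoment ℓ b)

lemma incrementConst_nonneg (ℓ : ℕ) (b : ℝ) : 0 ≤ incrementConst ℓ b := by
  have : 0 ≤ b ^ 8 := Even.pow_nonneg (by decide) b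
  unfold incrementConst; positivity

lemma growthConst_nonneg (ℓ : ℕ) (hb : 0 ≤ b) (p : ℕ) : 0 ≤ growthConst ℓ b p := by
  have h1 := meanConst_nonneg ℓ hb
  have h2 : ∀ q, 0 ≤ incrementMoment ℓ b q := fun q => by
    have := incrementConst_nonneg ℓ b
    have := normalMoment_nonneg (4 * q)
    unfold incrementMoment; positivity
  have := h2 1; have := h2 2; have := h2 p; have := h2 (2 * p)
  unfold growthConst stepConst; positivity

lemma one_add_pow_le_two_pow {x : ℝ} (hx : 0 ≤ x) (n : ℕ) : (1 + x) ^ n ≤ 2 ^ n * (1 + x ^ n) := by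
  calc (1 + x) ^ n ≤ 2 ^ (n - 1) * (1 ^ n + x ^ n) := add_pow_le zero_le_one hx n
    _ ≤ 2 ^ n * (1 + x ^ n) := by
        rw [one_pow]
        gcongr
        · norm_num
        · omega

lemma Setup.norm_increment_sq_le (X X' : Matrix (Fin d) (Fin ℓ) ℝ) (t t' : ℝ) :
    ‖S.increment b 𝓑 X X' t t'‖ ^ 2
      ≤ 2 * ‖stack (d + 2) fun j => S.iterMoment b X' j - S.iterMoment b X j‖ ^ 2
        + 2 * ‖stack (d + 2) fun j => S.curveMoment b 𝓑 j t' - S.curveMoment b 𝓑 j t‖ ^ 2 := by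
  have e : S.increment b 𝓑 X X' t t' = (stack (d + 2) fun j => S.iterMoment b X' j - S.iterMoment b X j)
      - stack (d + 2) fun j => S.curveMoment b 𝓑 j t' - S.curveMoment b 𝓑 j t := rfl
  rw [e]
  have h1 := norm_sub_le (stack (d + 2) fun j => S.iterMoment b X' j - S.iterMoment b X j)
    (stack (d + 2) fun j => S.curveMoment b 𝓑 j t' - S.curveMoment b 𝓑 j t)
  have h2 := pow_le_pow_left₀ (norm_nonneg _) h1 2
  refine h2.trans ?_
  nlinarith [sq_nonneg (‖stack (d + 2) fun j => S.iterMoment b X' j - S.iterMoment b X j‖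
    - ‖stack (d + 2) fun j => S.curveMoment b 𝓑 j t' - S.curveMoment b 𝓑 j t‖)]

namespace Setup.Controlled

variable (C : S.Controlled Lhat f h U γ T 𝓑 b) (A : Admissible Lhat α Lf Lh f h U)
include C

lemma norm_stack_curve_sq_le {t t' : ℝ} (ht : t ∈ Set.Icc 0 T) (ht' : t' ∈ Set.Icc 0 T)
    (htt : t' - t = 1 / (d : ℝ)) :
    ‖stack (d + 2) fun j => S.curveMoment b 𝓑 j t' - S.curveMoment b 𝓑 j t‖ ^ 2
      ≤ 4 * timeLip ℓ b ^ 2 / d ^ 2 := by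
  have hle : t ≤ t' := by
    have : 0 ≤ 1 / (d : ℝ) := by positivity
    linarith
  refine (norm_stack_le (u := fun _ => 0) (c := timeLip ℓ b * (1 / d)) fun j _ => ?_).trans
    (le_of_eq ?_)
  · have := C.norm_curveMoment_sub_le j ht ht' hle
    rw [htt] at this
    unfold timeLip
    linarith
  · simp only [ne_eq, OfNat.ofNat_ne_zero, not_false_eq_true, zero_pow, Finset.sum_const_zero]
    ring

include A

/-- The `p`-th moment of the squared deviation in one step of SGD. -/
theorem lintegral_deviation_update_le {X : Matrix (Fin d) (Fin ℓ) ℝ} (N : S.Near f h U T 𝓑 b X)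
    {t t' : ℝ} (ht : t ∈ Set.Icc 0 T) (ht' : t' ∈ Set.Icc 0 T) (htt : t' - t = 1 / (d : ℝ))
    {p : ℕ} (hp : 1 ≤ p) {ρ : ℝ} (hρ : 0 < ρ) (hρd : 1 / (d : ℝ) ≤ ρ ^ 2) :
    ∫⁻ z, ENNReal.ofReal ((‖S.deviation b 𝓑 (S.update f (γ t / d) X z) t'‖ ^ 2 + ρ ^ 2) ^ p)
        ∂S.dataLaw
      ≤ ENNReal.ofReal (1 + growthConst ℓ b p
          * (1 / d + ((∫ u in t..t', |γ u - γ t|) + Real.sqrt d / d ^ 2) / ρ))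
        * ENNReal.ofReal ((‖S.deviation b 𝓑 X t‖ ^ 2 + ρ ^ 2) ^ p) := by
  have hb0 : 0 ≤ b := zero_le_one.trans C.one_le
  have hd1 : (1 : ℝ) ≤ d := by exact_mod_cast C.dim
  have hd0 : (0 : ℝ) < d := by linarith
  have hle : t ≤ t' := by
    have : 0 < 1 / (d : ℝ) := by positivity
    linarith
  have hI0 : 0 ≤ ∫ u in t..t', |γ u - γ t| :=
    intervalIntegral.integral_nonneg hle fun u _ => abs_nonneg _
  have hw0 := S.weight_nonneg C.one_le
  have hw := S.weight_le C.one_le C.eig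
  have hγt := C.rate t ht.1
  have hK := incrementConst_nonneg ℓ b
  obtain ⟨hmeas, hmean⟩ := C.norm_integral_increment_le A N ht ht' htt
  simp_rw [← S.deviation_add_increment X _ t t']
  set P : EuclideanSpace ℝ (Fin d) × Obs ℓ → ℝ :=
    fun z => S.stepSum (S.weight b) (d + 2) X z.1 with hP
  have hP0 : ∀ z, 0 ≤ P z := fun z => S.stepSum_nonneg _ _ _ _
  have hPm : Measurable P := by
    simp only [hP, Setup.stepSum, dotProduct]; fun_prop
  have hPi := S.integrable_stepSum_pow (S.weight b) (d + 2) X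
  have hpowle : ∀ q z, (incrementConst ℓ b * (1 + P z) ^ 4) ^ q
      ≤ incrementConst ℓ b ^ q * (2 ^ (4 * q) * (1 + P z ^ (4 * q))) := by
    intro q z
    rw [mul_pow, ← pow_mul]
    exact mul_le_mul_of_nonneg_left (one_add_pow_le_two_pow (hP0 z) _) (pow_nonneg hK q)
  have hdom : ∀ q, Integrable (fun z => incrementConst ℓ b ^ q
      * (2 ^ (4 * q) * (1 + P z ^ (4 * q)))) S.dataLaw := fun q =>
    (((integrable_const 1).add (hPi (4 * q))).const_mul _).const_mul _
  have hΨi : ∀ q, Integrable (fun z => (incrementConst ℓ b * (1 + P z) ^ 4) ^ q) S.dataLaw := by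
    intro q
    refine Integrable.mono' (hdom q) (by fun_prop) (Eventually.of_forall fun z => ?_)
    have := hP0 z
    rw [Real.norm_of_nonneg (by positivity)]
    exact hpowle q z
  -- Here `s = 1/d`. The squared increment is `O(1/d²)` times a polynomial in Gaussian variables,
  -- and `1/d ≤ ρ²` brings this into the required form `s ρ² Ψ`.
  refine lintegral_moment_step_le (m := incrementMoment ℓ b)
    (Ψ := fun z => incrementConst ℓ b * (1 + P z) ^ 4) hp (by positivity)
    ((div_le_one hd0).2 hd1) hρ (meanConst_nonneg ℓ hb0) (by positivity) hmeas
    (fun z => by have := hP0 z; positivity) ?_ hΨi ?_ hmean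
  · filter_upwards [C.ae_gradX_le A (S.weight b) (d + 2) X] with z hz
    have h1 := S.norm_stack_update_sub_sq_le C.one_le C.dim (s := γ t / d)
      (div_nonneg hγt.1 hd0.le) (by gcongr; exact hγt.2) hw0 hw (d + 2) X z hz
    have h2 := C.norm_stack_curve_sq_le ht ht' htt
    have h3 := S.norm_increment_sq_le (b := b) (𝓑 := 𝓑) X (S.update f (γ t / d) X z) t t'
    have hPz := hP0 z
    have h4 : (1 : ℝ) ≤ (1 + P z) ^ 4 := one_le_pow₀ (by linarith)
    calc _ ≤ 2 * (12 * b ^ 8 / d ^ 2 * (1 + P z) ^ 4)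
          + 2 * (4 * timeLip ℓ b ^ 2 / d ^ 2 * (1 + P z) ^ 4) := by
          refine h3.trans (add_le_add (mul_le_mul_of_nonneg_left h1 (by norm_num))
            (mul_le_mul_of_nonneg_left (h2.trans ?_) (by norm_num)))
          exact le_mul_of_one_le_right (by positivity) h4
      _ = 1 / d * (1 / d) * (incrementConst ℓ b * (1 + P z) ^ 4) := by
          unfold incrementConst; field_simp; ring
      _ ≤ _ := by gcongr
  · intro q
    calc ∫ z, (incrementConst ℓ b * (1 + P z) ^ 4) ^ q ∂S.dataLaw
        ≤ ∫ z, incrementConst ℓ b ^ q * (2 ^ (4 * q) * (1 + P z ^ (4 * q))) ∂S.dataLaw :=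
          integral_mono (hΨi q) (hdom q) (hpowle q)
      _ = incrementConst ℓ b ^ q * (2 ^ (4 * q) * (1 + ∫ z, P z ^ (4 * q) ∂S.dataLaw)) := by
          rw [integral_const_mul, integral_const_mul, integral_add (integrable_const 1) (hPi _),
            integral_const, probReal_univ, one_smul]
      _ ≤ incrementMoment ℓ b q := by
          have := S.integral_stepSum_pow_le C.one_le C.dim C.eig hw0 hw (d + 2) N.norm C.star (4 * q)
          unfold incrementMoment
          gcongr

end Setup.Controlled

end MomentStep

/-! ### Overwhelming probability -/

section Overwhelming

/-- A sequence of events whose complements have probabilities smaller than any power of the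
dimension holds with overwhelming probability. -/
lemma withOverwhelmingProbability_of_forall_pow {Ω : ℕ → Type*} [∀ d, MeasurableSpace (Ω d)]
    {P : ∀ d, Measure (Ω d)} [∀ d, IsProbabilityMeasure (P d)] {E : ∀ d, Set (Ω d)}
    (hE : ∀ q : ℕ, ∃ c : ℝ, ∀ᶠ d : ℕ in atTop,
      P d (E d)ᶜ ≤ ENNReal.ofReal (c * ((d : ℝ) ^ q)⁻¹)) :
    WithOverwhelmingProbability P E := by
  -- The maximum with `e^{-d}` keeps the logarithm meaningful when the probability is zero, and `d /
  -- log d` still tends to infinity.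
  set m : ℕ → ℝ := fun d => max (P d (E d)ᶜ).toReal (Real.exp (-d)) with hm
  have hm0 : ∀ d, 0 < m d := fun d => lt_max_of_lt_right (Real.exp_pos _)
  refine ⟨fun d => -Real.log (m d), ?_, fun d => ?_⟩
  · rw [tendsto_atTop]
    intro M
    obtain ⟨q, hq⟩ := exists_nat_ge M
    -- One extra power of `d` absorbs the constant `c`, which is at most `d` eventually.
    obtain ⟨c, hc⟩ := hE (q + 1)
    have hexp : ∀ᶠ d : ℕ in atTop, (q : ℝ) * Real.log d ≤ d := by
      have h1 := (Real.isLittleO_log_id_atTop.comp_tendsto tendsto_natCast_atTop_atTop).def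
        (show (0 : ℝ) < 1 / (q + 1) by positivity)
      filter_upwards [h1, eventually_ge_atTop 1] with d hd hd1
      simp only [Function.comp_apply, id_eq, Real.norm_eq_abs, Nat.abs_cast] at hd
      have h2 := (le_abs_self (Real.log d)).trans hd
      have h3 : 0 ≤ Real.log d := Real.log_natCast_nonneg d
      rw [one_div, inv_mul_eq_div, le_div_iff₀ (by positivity)] at h2
      nlinarith
    filter_upwards [hc, hexp, eventually_ge_atTop 2, eventually_ge_atTop ⌈c⌉₊] with d h1 h2 h3 h4
    have hd2 : (2 : ℝ) ≤ d := by exact_mod_cast h3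
    have hd0 : (0 : ℝ) < d := by linarith
    have hlog : 0 < Real.log d := Real.log_pos (by linarith)
    have hcd : c ≤ d := (Nat.le_ceil c).trans (by exact_mod_cast h4)
    have hmle : m d ≤ ((d : ℝ) ^ q)⁻¹ := by
      refine max_le ?_ ?_
      · refine ENNReal.toReal_le_of_le_ofReal (by positivity) (h1.trans (ENNReal.ofReal_le_ofReal ?_))
        rw [pow_succ, mul_inv, mul_comm, mul_assoc]
        refine mul_le_of_le_one_right (by positivity) ?_
        rw [inv_mul_le_iff₀ hd0]
        linarith
      · rw [← Real.exp_log (show 0 < ((d : ℝ) ^ q)⁻¹ by positivity), Real.exp_le_exp, Real.log_inv,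
          Real.log_pow]
        linarith
    have h5 := Real.log_le_log (hm0 d) hmle
    rw [Real.log_inv, Real.log_pow] at h5
    rw [le_div_iff₀ hlog]
    nlinarith
  · rw [neg_neg, Real.exp_log (hm0 d)]
    rw [← ENNReal.ofReal_toReal (measure_ne_top (P d) (E d)ᶜ)]
    exact ENNReal.ofReal_le_ofReal (le_max_left _ _)

end Overwhelming

/-! ### Bounds that are uniform in the dimension -/

section Uniform

variable {ℓ d : ℕ} {Lhat : ℝ} {f : ObsPlus ℓ → Obs ℓ → ℝ} {S : Setup ℓ d} {h : GramMat ℓ → ℝ}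
  {U : Set (GramMat ℓ)} {γ : ℝ → ℝ} {T : ℝ} {𝓑 : Fin d → ℝ → GramMat ℓ} {α Lf Lh LI : ℝ} {b : ℝ}

lemma abs_trace_le_norm {n : Type*} [Fintype n] (B : Matrix n n ℝ) :
    |B.trace| ≤ Fintype.card n * ‖B‖ := by
  unfold Matrix.trace
  refine (Finset.abs_sum_le_sum_abs _ _).trans
    ((Finset.sum_le_sum fun p _ => abs_entry_le_norm B p p).trans ?_)
  rw [Finset.sum_const, Finset.card_univ, nsmul_eq_mul]

lemma abs_blockDist_le_norm (B : GramMat ℓ) : |blockDist B| ≤ 4 * ℓ * ‖B‖ := by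
  rw [blockDist_eq_sum]
  refine (Finset.abs_sum_le_sum_abs _ _).trans
    ((Finset.sum_le_sum (g := fun _ => 4 * ‖B‖) fun q _ => ?_).trans (le_of_eq ?_))
  · have h1 := abs_le.1 (abs_entry_le_norm B (Sum.inl q) (Sum.inl q))
    have h2 := abs_le.1 (abs_entry_le_norm B (Sum.inl q) (Sum.inr q))
    have h3 := abs_le.1 (abs_entry_le_norm B (Sum.inr q) (Sum.inr q))
    rw [abs_le]
    constructor <;> linarith
  · rw [Finset.sum_const, Finset.card_univ, Fintype.card_fin, nsmul_eq_mul]; ring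

lemma Setup.trace_iterMoment_zero (X : Matrix (Fin d) (Fin ℓ) ℝ) :
    (S.iterMoment b X 0).trace = ‖X‖ ^ 2 + ‖S.Xstar‖ ^ 2 := by
  rw [← S.sum_coeff_sq X, Setup.iterMoment, specMoment, Matrix.trace_sum]
  refine Finset.sum_congr rfl fun i _ => ?_
  simp only [pow_zero, one_smul, Setup.outer, Matrix.trace, Matrix.diag, vecMulVec_apply, sq]

lemma Setup.trace_curveMoment_zero (t : ℝ) :
    (S.curveMoment b 𝓑 0 t).trace = 1 / (d : ℝ) * ∑ i, (𝓑 i t).trace := by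
  rw [Setup.curveMoment, specMoment, Matrix.trace_sum, Finset.mul_sum]
  refine Finset.sum_congr rfl fun i _ => ?_
  rw [pow_zero, one_smul, Matrix.trace_smul, smul_eq_mul]

/-- The zeroth moment sums over all eigendirections without weights. It is stacked for this reason,
although the drift does not depend on it. -/
lemma Setup.blockDist_iterMoment_zero (X : Matrix (Fin d) (Fin ℓ) ℝ) :
    blockDist (S.iterMoment b X 0) = ‖X - S.Xstar‖ ^ 2 := by
  rw [← blockDist_transpose_mul, S.transpose_mul_eq_sum]
  simp only [Setup.iterMoment, specMoment, pow_zero, one_smul, Setup.outer]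

lemma Setup.blockDist_curveMoment_zero (t : ℝ) :
    blockDist (S.curveMoment b 𝓑 0 t) = distSq 𝓑 t := by
  rw [distSq_eq, Setup.curveMoment, specMoment, blockDist_sum, Finset.mul_sum]
  refine Finset.sum_congr rfl fun i _ => ?_
  rw [pow_zero, one_smul, blockDist_smul]

lemma Setup.norm_moment_sub_le {j : ℕ} (hj : j < d + 2) (X : Matrix (Fin d) (Fin ℓ) ℝ) (t : ℝ) :
    ‖S.iterMoment b X j - S.curveMoment b 𝓑 j t‖ ≤ ‖S.deviation b 𝓑 X t‖ :=
  norm_le_norm_stack (fun j => S.iterMoment b X j - S.curveMoment b 𝓑 j t) hj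

lemma Setup.norm_avg_le {κ M t : ℝ} (hκ : ∀ i, S.eigval i ≤ κ) (hκ0 : 0 ≤ κ)
    (hM : 1 / (d : ℝ) * ∑ i, ‖𝓑 i t‖ ≤ M) : ‖S.avg 𝓑 t‖ ≤ κ * M := by
  unfold Setup.avg
  rw [norm_smul, Real.norm_of_nonneg (by positivity)]
  calc 1 / (d : ℝ) * ‖∑ i, S.eigval i • 𝓑 i t‖ ≤ 1 / (d : ℝ) * ∑ i, κ * ‖𝓑 i t‖ := by
        gcongr
        refine norm_sum_le_of_le _ fun i _ => ?_
        rw [norm_smul, Real.norm_of_nonneg (S.eigval_nonneg i)]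
        exact mul_le_mul_of_nonneg_right (hκ i) (norm_nonneg _)
    _ = κ * (1 / (d : ℝ) * ∑ i, ‖𝓑 i t‖) := by rw [← Finset.mul_sum]; ring
    _ ≤ κ * M := mul_le_mul_of_nonneg_left hM hκ0

lemma Admissible.mass_le (A : Admissible Lhat α Lf Lh f h U) (hd : 1 ≤ d)
    (hcrit : CriticalAE f (S.Xstarᵀ * S.K * S.Xstar)) (hγ0 : ∀ t, 0 ≤ t → 0 ≤ γ t)
    (hγ : ∀ t, 0 ≤ t → γ t * (Lhat * ((1 / (d : ℝ)) * S.K.trace)) ≤ 1)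
    (sol : S.IsSolution f h U γ T 𝓑) {c : ℝ} (h0 : ‖S.X₀‖ ≤ c) (hs : ‖S.Xstar‖ ≤ c)
    {t : ℝ} (ht : t ∈ Set.Icc 0 T) :
    1 / (d : ℝ) * ∑ i, (𝓑 i t).trace ≤ 11 * c ^ 2 ∧
      1 / (d : ℝ) * ∑ i, ‖𝓑 i t‖ ≤ entryCount ℓ * (11 * c ^ 2) := by
  have h1 : 1 / (d : ℝ) * ∑ i, (𝓑 i t).trace ≤ 11 * c ^ 2 := by
    refine (A.sum_trace_le hd hcrit hγ0 hγ sol ht).trans ?_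
    have h2 : ‖S.X₀ - S.Xstar‖ ≤ 2 * c := (norm_sub_le _ _).trans (by linarith)
    have h3 := pow_le_pow_left₀ (norm_nonneg _) h2 2
    have h4 := pow_le_pow_left₀ (norm_nonneg _) hs 2
    linarith
  refine ⟨h1, le_trans ?_ (mul_le_mul_of_nonneg_left h1 (by positivity))⟩
  calc 1 / (d : ℝ) * ∑ i, ‖𝓑 i t‖ ≤ 1 / (d : ℝ) * ∑ i, entryCount ℓ * (𝓑 i t).trace := by
        gcongr with i
        exact norm_le_trace (sol.posSemidef i t ht)
    _ = _ := by rw [← Finset.mul_sum]; ring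

/-- The curves in all dimensions are controlled by a single constant, and iterates with a small
deviation from them are near. -/
theorem Admissible.exists_uniform (A : Admissible Lhat α Lf Lh f h U)
    (hI : PseudoLipschitzFisher α LI f U) {d₀ : ℕ} (hd₀ : 1 ≤ d₀) {S : ∀ d, Setup ℓ d}
    {𝓑 : ∀ d : ℕ, Fin d → ℝ → GramMat ℓ} {c κ γmax η : ℝ}
    (hX₀ : ∀ d ≥ d₀, ‖(S d).X₀‖ ≤ c) (hXs : ∀ d ≥ d₀, ‖(S d).Xstar‖ ≤ c)
    (hκ0 : 0 ≤ κ) (hκ : ∀ d ≥ d₀, ∀ i, (S d).eigval i ≤ κ)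
    (hcrit : ∀ d ≥ d₀, CriticalAE f ((S d).Xstarᵀ * (S d).K * (S d).Xstar))
    (hγ_meas : Measurable γ) (hγ_bdd : ∀ t, 0 ≤ t → 0 ≤ γ t ∧ γ t ≤ γmax)
    (hγ : ∀ d ≥ d₀, ∀ t, 0 ≤ t → γ t * (Lhat * ((1 / (d : ℝ)) * (S d).K.trace)) ≤ 1)
    (hT : 0 ≤ T) (hη : 0 < η)
    (hmargin : ∀ d ≥ d₀, ∀ t ∈ Set.Icc 0 T, ∀ V ∉ U, η ≤ ‖(S d).avg (𝓑 d) t - V‖)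
    (sol : ∀ d ≥ d₀, (S d).IsSolution f h U γ T (𝓑 d)) :
    ∃ b θ₀ : ℝ, 0 < θ₀ ∧ ∀ d ≥ d₀, (S d).Controlled Lhat f h U γ T (𝓑 d) b ∧
      ∀ t ∈ Set.Icc 0 T, ∀ X, ‖(S d).deviation b (𝓑 d) X t‖ ≤ θ₀ →
        (S d).Near f h U T (𝓑 d) b X := by
  have hc0 : 0 ≤ c := (norm_nonneg _).trans (hX₀ d₀ le_rfl)
  have hγm : 0 ≤ γmax := (hγ_bdd 0 le_rfl).1.trans (hγ_bdd 0 le_rfl).2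
  have hLhat := A.hL
  set M : ℝ := entryCount ℓ * (11 * c ^ 2) with hM
  have hM0 : 0 ≤ M := by positivity
  have hmass := fun d (hd : d ≥ d₀) t (ht : t ∈ Set.Icc 0 T) =>
    A.mass_le (hd₀.trans hd) (hcrit d hd) (fun t ht => (hγ_bdd t ht).1) (hγ d hd) (sol d hd)
      (hX₀ d hd) (hXs d hd) ht
  have havg : ∀ d ≥ d₀, ∀ t ∈ Set.Icc 0 T, ‖(S d).avg (𝓑 d) t‖ ≤ κ * M := fun d hd t ht =>
    (S d).norm_avg_le (hκ d hd) hκ0 (hmass d hd t ht).2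
  set R : ℝ := κ * M + 1 with hR
  have hR0 : 0 ≤ R := by positivity
  set ΛH : ℝ := |Lh| * (1 + 2 * R ^ α) with hΛH
  set ΛI : ℝ := |LI| * (1 + 2 * R ^ α) with hΛI
  have hΛH0 : 0 ≤ ΛH := by positivity
  have hΛI0 : 0 ≤ ΛI := by positivity
  have lipH : ∀ B ∈ U, ∀ B' ∈ U, ‖B‖ ≤ R → ‖B'‖ ≤ R →
      ‖gradCol h B - gradCol h B'‖ ≤ ΛH * ‖B - B'‖ := fun B hB B' hB' hn hn' =>
    (norm_gradCol_le h B B').trans ((A.risk.pseudoLipschitz B hB B' hB').trans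
      (pseudoLipschitz_factor_le A.hα hn hn'))
  have lipI : ∀ B ∈ U, ∀ B' ∈ U, B.PosSemidef → B'.PosSemidef → ‖B‖ ≤ R → ‖B'‖ ≤ R →
      ‖fisher f B - fisher f B'‖ ≤ ΛI * ‖B - B'‖ := fun B hB B' hB' hp hp' hn hn' =>
    (hI B hB B' hB' hp hp').trans (pseudoLipschitz_factor_le A.hα hn hn')
  have h0 : (0 : ℝ) ∈ Set.Icc 0 T := ⟨le_rfl, hT⟩
  -- A reference covariance from a single dimension. As `f`, `h` and `U` are common to all
  -- dimensions, the Lipschitz bounds around it control the gradient and the Fisher matrix in every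
  -- dimension.
  set B₀ := (S d₀).avg (𝓑 d₀) 0 with hB₀
  have hB₀U : B₀ ∈ U := (sol d₀ le_rfl).mem 0 h0
  have hB₀p : B₀.PosSemidef := (sol d₀ le_rfl).nonneg_of_mem h0
  have hB₀n : ‖B₀‖ ≤ R := (havg d₀ le_rfl 0 h0).trans (by linarith)
  set G : ℝ := ‖gradCol h B₀‖ + ΛH * (2 * R) with hG
  set F : ℝ := ‖fisher f B₀‖ + ΛI * (2 * R) with hF
  have hG0 : 0 ≤ G := by positivity
  have hF0 : 0 ≤ F := by positivity
  have bdH : ∀ B ∈ U, ‖B‖ ≤ R → ‖gradCol h B‖ ≤ G := by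
    intro B hB hn
    have h1 := lipH B hB B₀ hB₀U hn hB₀n
    have h2 : ‖B - B₀‖ ≤ 2 * R := (norm_sub_le _ _).trans (by linarith)
    have h3 := norm_le_norm_add_norm_sub' (gradCol h B) (gradCol h B₀)
    have h4 := mul_le_mul_of_nonneg_left h2 hΛH0
    linarith
  have bdI : ∀ B ∈ U, B.PosSemidef → ‖B‖ ≤ R → ‖fisher f B‖ ≤ F := by
    intro B hB hp hn
    have h1 := lipI B hB B₀ hB₀U hp hB₀p hn hB₀n
    have h2 : ‖B - B₀‖ ≤ 2 * R := (norm_sub_le _ _).trans (by linarith)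
    have h3 := norm_le_norm_add_norm_sub' (fisher f B) (fisher f B₀)
    have h4 := mul_le_mul_of_nonneg_left h2 hΛI0
    linarith
  obtain ⟨b, hb⟩ : ∃ b : ℝ, b = 1 + κ + c + 2 * Lhat + γmax + M + G + F + 11 * c ^ 2 + 2 * ℓ
      + ΛH + ΛI := ⟨_, rfl⟩
  have hcc : 0 ≤ 11 * c ^ 2 := by positivity
  have hll : (0 : ℝ) ≤ 2 * ℓ := by positivity
  have hb1 : 1 ≤ b := by linarith
  have hb0 : 0 < b := by linarith
  have hmin0 : 0 < min 1 η := lt_min one_pos hη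
  -- The Gram matrix is `2b` times the first moment, so this radius keeps it within `min 1 η / 2` of
  -- the curve: inside `U` by the margin, and inside the ball of radius `R`.
  refine ⟨b, min 1 η / (4 * b), by positivity, fun d hd => ⟨⟨hb1, hd₀.trans hd, sol d hd,
    hcrit d hd, fun i => (hκ d hd i).trans (by linarith), (hXs d hd).trans (by linarith),
    by linarith, fun t ht => ⟨(hγ_bdd t ht).1, (hγ_bdd t ht).2.trans (by linarith)⟩, hγ_meas,
    fun t ht => (hmass d hd t ht).2.trans (by linarith),
    fun t ht => (bdH _ ((sol d hd).mem t ht) ((havg d hd t ht).trans (by linarith))).trans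
      (by linarith),
    fun t ht => (bdI _ ((sol d hd).mem t ht) ((sol d hd).nonneg_of_mem ht)
      ((havg d hd t ht).trans (by linarith))).trans (by linarith)⟩, fun t ht X hX => ?_⟩⟩
  have hθ1 : min 1 η / (4 * b) ≤ 1 := by
    rw [div_le_one (by positivity)]
    exact (min_le_left _ _).trans (by linarith)
  have hgram : ‖(S d).gram X - (S d).avg (𝓑 d) t‖ ≤ min 1 η / 2 := by
    rw [(S d).gram_eq_iterMoment hb1, (S d).avg_eq_curveMoment hb1, ← smul_sub, norm_smul,
      Real.norm_of_nonneg (by positivity)]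
    calc 2 * b * ‖(S d).iterMoment b X 1 - (S d).curveMoment b (𝓑 d) 1 t‖
        ≤ 2 * b * (min 1 η / (4 * b)) := by
          gcongr
          exact ((S d).norm_moment_sub_le (by omega) X t).trans hX
      _ = _ := by field_simp; norm_num
  have hmem : (S d).gram X ∈ U := by
    by_contra hV
    have h1 := hmargin d hd t ht _ hV
    rw [norm_sub_rev] at h1
    have := min_le_right 1 η
    linarith
  have hn : ‖(S d).gram X‖ ≤ R := by
    have h1 := norm_le_norm_add_norm_sub' ((S d).gram X) ((S d).avg (𝓑 d) t)
    have h2 := havg d hd t ht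
    have := min_le_left 1 η
    linarith
  have hnavg : ∀ s ∈ Set.Icc 0 T, ‖(S d).avg (𝓑 d) s‖ ≤ R := fun s hs =>
    (havg d hd s hs).trans (by linarith)
  refine ⟨hmem, ?_, (bdH _ hmem hn).trans (by linarith), fun s hs => ?_, fun s hs => ?_⟩
  -- The trace of the zeroth moment contains `‖X‖²` and differs from that of the curve by at most
  -- `2ℓ`. This gives `‖X‖² ≤ b ≤ b²`.
  · have h1 := (S d).trace_iterMoment_zero (b := b) X
    have h2 := (S d).trace_curveMoment_zero (b := b) (𝓑 := 𝓑 d) t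
    have h3 := abs_trace_le_norm ((S d).iterMoment b X 0 - (S d).curveMoment b (𝓑 d) 0 t)
    have h4 := ((S d).norm_moment_sub_le (b := b) (𝓑 := 𝓑 d) (j := 0) (by omega) X t).trans
      (hX.trans hθ1)
    rw [Matrix.trace_sub, h1, h2] at h3
    have h5 := (hmass d hd t ht).1
    have h6 := (abs_le.1 h3).2
    have h7 : (Fintype.card (Fin ℓ ⊕ Fin ℓ) : ℝ) = 2 * ℓ := by
      simp [Fintype.card_sum]; ring
    rw [h7] at h6
    have h8 := mul_le_mul_of_nonneg_left h4 hll
    have h9 := sq_nonneg ‖(S d).Xstar‖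
    have h10 : ‖X‖ ^ 2 ≤ b := by linarith
    refine le_of_sq_le_sq (h10.trans ?_) hb0.le
    nlinarith
  · exact (lipH _ hmem _ ((sol d hd).mem s hs) hn (hnavg s hs)).trans
      (mul_le_mul_of_nonneg_right (by linarith) (norm_nonneg _))
  · exact (lipI _ hmem _ ((sol d hd).mem s hs) ((S d).posSemidef_gram X)
      ((sol d hd).nonneg_of_mem hs) hn (hnavg s hs)).trans
      (mul_le_mul_of_nonneg_right (by linarith) (norm_nonneg _))

end Uniform

/-! ### The exit of SGD from a neighbourhood of the curve -/

section StepSizes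

variable {γ : ℝ → ℝ} {T g : ℝ} {d : ℕ}

/-- The error made by sampling `γ` at the multiples of `1/d` up to time `T`. -/
def samplingError (γ : ℝ → ℝ) (T : ℝ) (d : ℕ) : ℝ :=
  ∫ s in (0 : ℝ)..T, |γ s - γ ((⌊s * d⌋₊ : ℝ) / d)|

lemma intervalIntegrable_samplingError (hγ : Measurable γ) (hb : ∀ t, 0 ≤ t → 0 ≤ γ t ∧ γ t ≤ g)
    {a c : ℝ} (ha : 0 ≤ a) (hac : a ≤ c) :
    IntervalIntegrable (fun s => |γ s - γ ((⌊s * d⌋₊ : ℝ) / d)|) volume a c := by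
  have hm : Measurable fun s : ℝ => |γ s - γ ((⌊s * d⌋₊ : ℝ) / d)| := by
    have h1 : Measurable fun s : ℝ => ((⌊s * d⌋₊ : ℝ)) :=
      measurable_from_top.comp (Nat.measurable_floor.comp (measurable_id.mul_const _))
    have h2 : Measurable fun s : ℝ => γ ((⌊s * d⌋₊ : ℝ) / d) := hγ.comp (h1.div_const _)
    exact (hγ.sub h2).norm
  rw [intervalIntegrable_iff, Set.uIoc_of_le hac]
  refine Measure.integrableOn_of_bounded (M := g) measure_Ioc_lt_top.ne hm.aestronglyMeasurable ?_
  refine (ae_restrict_iff' measurableSet_Ioc).2 (Eventually.of_forall fun s hs => ?_)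
  have h1 := hb s (ha.trans hs.1.le)
  have h2 := hb ((⌊s * d⌋₊ : ℝ) / d) (by positivity)
  rw [Real.norm_eq_abs, abs_abs, abs_le]
  constructor <;> linarith

/-- Inside the `j`-th interval of length `1/d` the floor equals `j`, so the errors of the single
steps add up to the sampling error. -/
lemma sum_stepError_le (hγ : Measurable γ) (hb : ∀ t, 0 ≤ t → 0 ≤ γ t ∧ γ t ≤ g) (hd : 1 ≤ d)
    {k : ℕ} (hk : (k : ℝ) / d ≤ T) :
    ∑ j ∈ Finset.range k, ∫ u in ((j : ℝ) / d)..(((j + 1 : ℕ) : ℝ) / d), |γ u - γ ((j : ℝ) / d)|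
      ≤ samplingError γ T d := by
  have hd0 : (0 : ℝ) < d := by positivity
  have hk0 : 0 ≤ (k : ℝ) / d := by positivity
  have hmono : ∀ j : ℕ, (j : ℝ) / d ≤ ((j + 1 : ℕ) : ℝ) / d := fun j => by
    gcongr; exact_mod_cast j.le_succ
  calc _ = ∑ j ∈ Finset.range k, ∫ u in ((j : ℝ) / d)..(((j + 1 : ℕ) : ℝ) / d),
        |γ u - γ ((⌊u * d⌋₊ : ℝ) / d)| := by
        refine Finset.sum_congr rfl fun j _ => ?_
        refine intervalIntegral.integral_congr_Ioo_of_le (hmono j) fun u hu => ?_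
        have h1 : ⌊u * d⌋₊ = j := by
          rw [Nat.floor_eq_iff (mul_nonneg ((by positivity : (0:ℝ) ≤ (j : ℝ) / d).trans hu.1.le)
            hd0.le)]
          have h2 := (div_lt_iff₀ hd0).1 hu.1
          have h3 := (lt_div_iff₀ hd0).1 hu.2
          push_cast at h3
          exact ⟨h2.le, h3⟩
        rw [h1]
    _ = ∫ u in (0 : ℝ)..((k : ℝ) / d), |γ u - γ ((⌊u * d⌋₊ : ℝ) / d)| := by
        have := intervalIntegral.sum_integral_adjacent_intervals (μ := volume)
          (f := fun u : ℝ => |γ u - γ ((⌊u * d⌋₊ : ℝ) / d)|) (a := fun j : ℕ => (j : ℝ) / d) (n := k)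
          fun j _ => intervalIntegrable_samplingError hγ hb (by positivity) (hmono j)
        rw [this]
        simp
    _ ≤ _ := by
        refine intervalIntegral.integral_mono_interval le_rfl hk0 hk
          (Eventually.of_forall fun _ => abs_nonneg _)
          (intervalIntegrable_samplingError hγ hb le_rfl (hk0.trans hk))

/-- By `1 + x ≤ exp x` the product is an exponential of a sum. The fluctuation term is at most `1/d`
per step because `√d ≤ ρ d`, so it only doubles the time `T`. -/
lemma prod_growth_le (hγ : Measurable γ) (hb : ∀ t, 0 ≤ t → 0 ≤ γ t ∧ γ t ≤ g) (hd : 1 ≤ d)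
    {ρ G : ℝ} (hG : 0 ≤ G) (hρ : 0 < ρ) (hρd : 1 / (d : ℝ) ≤ ρ ^ 2) {k : ℕ} (hk : (k : ℝ) / d ≤ T) :
    ∏ j ∈ Finset.range k, ENNReal.ofReal (1 + G * (1 / d
        + ((∫ u in ((j : ℝ) / d)..(((j + 1 : ℕ) : ℝ) / d), |γ u - γ ((j : ℝ) / d)|)
          + Real.sqrt d / d ^ 2) / ρ))
      ≤ ENNReal.ofReal (Real.exp (G * (2 * T + samplingError γ T d / ρ))) := by
  have hd0 : (0 : ℝ) < d := by positivity
  set I : ℕ → ℝ := fun j => ∫ u in ((j : ℝ) / d)..(((j + 1 : ℕ) : ℝ) / d), |γ u - γ ((j : ℝ) / d)|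
    with hI
  have hI0 : ∀ j, 0 ≤ I j := fun j => intervalIntegral.integral_nonneg
    (by gcongr; exact_mod_cast j.le_succ) fun _ _ => abs_nonneg _
  have hsq : Real.sqrt d / d ^ 2 / ρ ≤ 1 / d := by
    have h1 : Real.sqrt d ≤ ρ * d := by
      refine Real.sqrt_le_iff.2 ⟨by positivity, ?_⟩
      have := mul_le_mul_of_nonneg_right hρd (sq_nonneg (d : ℝ))
      calc (d : ℝ) = 1 / d * d ^ 2 := by field_simp
        _ ≤ _ := by rw [mul_pow]; exact this
    rw [div_div, div_le_div_iff₀ (by positivity) hd0]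
    calc Real.sqrt d * d ≤ ρ * d * d := by gcongr
      _ = _ := by ring
  rw [← ENNReal.ofReal_prod_of_nonneg fun j _ => by have := hI0 j; positivity]
  refine ENNReal.ofReal_le_ofReal ?_
  calc ∏ j ∈ Finset.range k, (1 + G * (1 / d + (I j + Real.sqrt d / d ^ 2) / ρ))
      ≤ ∏ j ∈ Finset.range k, Real.exp (G * (2 * (1 / d) + I j / ρ)) := by
        refine Finset.prod_le_prod (fun j _ => by have := hI0 j; positivity) fun j _ => ?_
        have h1 : 1 / d + (I j + Real.sqrt d / d ^ 2) / ρ ≤ 2 * (1 / d) + I j / ρ := by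
          rw [add_div]; linarith
        have h2 := mul_le_mul_of_nonneg_left h1 hG
        have h3 := Real.add_one_le_exp (G * (2 * (1 / d) + I j / ρ))
        linarith
    _ = Real.exp (G * (2 * (k / d) + (∑ j ∈ Finset.range k, I j) / ρ)) := by
        rw [← Real.exp_sum, ← Finset.mul_sum, Finset.sum_add_distrib, ← Finset.sum_div,
          Finset.sum_const, Finset.card_range, nsmul_eq_mul]
        congr 3
        ring
    _ ≤ _ := by
        have := sum_stepError_le hγ hb hd hk
        gcongr

end StepSizes

/-! ### The probability of leaving the tube around the curve. -/

section Exit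

variable {ℓ d : ℕ} {Lhat : ℝ} {f : ObsPlus ℓ → Obs ℓ → ℝ} {S : Setup ℓ d} {h : GramMat ℓ → ℝ}
  {U : Set (GramMat ℓ)} {γ : ℝ → ℝ} {T : ℝ} {𝓑 : Fin d → ℝ → GramMat ℓ} {α Lf Lh LI : ℝ} {b : ℝ}

/-- The product `σ`-algebra on matrices. -/
@[reducible] def matrixMeasurableSpace (m n : Type*) : MeasurableSpace (Matrix m n ℝ) :=
  MeasurableSpace.pi

attribute [local instance] matrixMeasurableSpace

lemma measurable_matrix_apply {m n : Type*} (i : m) (j : n) :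
    Measurable fun X : Matrix m n ℝ => X i j :=
  (measurable_pi_apply j).comp (measurable_pi_apply i)

lemma Setup.measurable_update (A : Admissible Lhat α Lf Lh f h U) (s : ℝ) :
    Measurable (Function.uncurry (S.update f s)) := by
  have hX : ∀ i j, Measurable fun z : Matrix (Fin d) (Fin ℓ) ℝ
      × (EuclideanSpace ℝ (Fin d) × Obs ℓ) => z.1 i j :=
    fun i j => (measurable_matrix_apply i j).comp measurable_fst
  have ha : ∀ i, Measurable fun z : Matrix (Fin d) (Fin ℓ) ℝ
      × (EuclideanSpace ℝ (Fin d) × Obs ℓ) => z.2.1 i := fun i => by fun_prop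
  have hr : Measurable fun z : Matrix (Fin d) (Fin ℓ) ℝ
      × (EuclideanSpace ℝ (Fin d) × Obs ℓ) => S.preact z.1 z.2.1 := by
    refine (PiLp.continuous_toLp 2 _).measurable.comp (measurable_pi_lambda _ fun q => ?_)
    rcases q with q | q
    · simp only [Sum.elim_inl, contract, Matrix.mulVec, dotProduct, transpose_apply]
      exact Finset.measurable_sum _ fun i _ => (hX i q).mul (ha i)
    · simp only [Sum.elim_inr, contract, Matrix.mulVec, dotProduct, transpose_apply]
      exact Finset.measurable_sum _ fun i _ => (ha i).const_mul _
  have hg : Measurable fun z : Matrix (Fin d) (Fin ℓ) ℝ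
      × (EuclideanSpace ℝ (Fin d) × Obs ℓ) => gradX f (S.preact z.1 z.2.1) z.2.2 :=
    (A.conv.measurable_gradX A.meas).comp (hr.prodMk measurable_snd.snd)
  refine measurable_pi_lambda _ fun i => measurable_pi_lambda _ fun q => ?_
  have hgq : Measurable fun z : Matrix (Fin d) (Fin ℓ) ℝ
      × (EuclideanSpace ℝ (Fin d) × Obs ℓ) => gradX f (S.preact z.1 z.2.1) z.2.2 q := by fun_prop
  exact (hX i q).sub (((ha i).mul hgq).const_mul s)

lemma Setup.measurable_deviation (t : ℝ) : Measurable fun X => S.deviation b 𝓑 X t := by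
  refine Setup.measurable_stack fun j q r => ?_
  simp only [Matrix.sub_apply]
  refine Measurable.sub_const ?_ _
  have hc : ∀ i q, Measurable fun X : Matrix (Fin d) (Fin ℓ) ℝ => S.coeff X i q := by
    intro i q
    simp only [Setup.coeff, Matrix.mulVec, dotProduct, transpose_apply]
    refine Finset.measurable_sum _ fun k _ => Measurable.mul_const ?_ _
    rcases q with q | q
    · simp only [fromCols_apply_inl]; exact measurable_matrix_apply k q
    · simp only [fromCols_apply_inr]; exact measurable_const
  simp only [Setup.iterMoment, specMoment, Matrix.sum_apply, Matrix.smul_apply, Setup.outer,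
    vecMulVec_apply, smul_eq_mul]
  exact Finset.measurable_sum _ fun i _ => ((hc i q).mul (hc i r)).const_mul _

lemma Setup.IsSolution.deviation_init (sol : S.IsSolution f h U γ T 𝓑) (hd : 1 ≤ d) (hT : 0 ≤ T) :
    S.deviation b 𝓑 S.X₀ 0 = 0 := by
  have hd' : (d : ℝ) ≠ 0 := by positivity
  have h0 : (0 : ℝ) ∈ Set.Icc 0 T := ⟨le_rfl, hT⟩
  have h𝓑 : ∀ i, 𝓑 i 0 = S.init i := fun i => by
    ext p q
    rw [sol.equation i 0 h0]; simp
  have : ∀ j, S.iterMoment b S.X₀ j - S.curveMoment b 𝓑 j 0 = 0 := by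
    intro j
    unfold Setup.iterMoment Setup.curveMoment
    rw [sub_eq_zero]
    congr 1
    funext i
    rw [h𝓑, S.init_eq, smul_smul, one_div, inv_mul_cancel₀ hd', one_smul]
    rfl
  ext x
  simp only [Setup.deviation, stack_apply, this]
  rfl

/-- SGD stays, up to time `T`, in a neighbourhood of the curve in which iterates are near, up to
an event of small probability. -/
theorem Setup.Controlled.measure_exit_le (C : S.Controlled Lhat f h U γ T 𝓑 b)
    (A : Admissible Lhat α Lf Lh f h U) (hT : 0 ≤ T) {Ω : Type*} [MeasurableSpace Ω]
    {P : Measure Ω} [IsProbabilityMeasure P] {sample : ℕ → Ω → EuclideanSpace ℝ (Fin d) × Obs ℓ}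
    (hlaw : ∀ k, HasLaw (sample k) S.dataLaw P) (hind : iIndepFun sample P) {θ ρ : ℝ}
    (hnear : ∀ t ∈ Set.Icc 0 T, ∀ X, ‖S.deviation b 𝓑 X t‖ ≤ θ → S.Near f h U T 𝓑 b X)
    (hθ : 0 < θ) (hρ : 0 < ρ) (hρd : 1 / (d : ℝ) ≤ ρ ^ 2) {p : ℕ} (hp : 1 ≤ p) :
    P {ω | ∃ k ≤ ⌊T * d⌋₊,
        θ < ‖S.deviation b 𝓑 (S.sgd f γ (fun k => sample k ω) k) ((k : ℝ) / d)‖}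
      ≤ ENNReal.ofReal ((T * d + 1)
        * Real.exp (growthConst ℓ b p * (2 * T + samplingError γ T d / ρ))
        * ((ρ / θ) ^ 2) ^ p) := by
  have hb0 : 0 ≤ b := zero_le_one.trans C.one_le
  have hd0 : (0 : ℝ) < d := by have := C.dim; positivity
  have hkT : ∀ k ≤ ⌊T * d⌋₊, (k : ℝ) / d ≤ T := fun k hk => by
    rw [div_le_iff₀ hd0]
    exact (Nat.cast_le.2 hk).trans (Nat.floor_le (by positivity))
  -- The samples are only almost everywhere measurable; measurable versions generate the same
  -- iterates almost surely.
  set ξ : ℕ → Ω → EuclideanSpace ℝ (Fin d) × Obs ℓ := fun k => (hlaw k).aemeasurable.mk (sample k)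
    with hξ
  have hξm : ∀ k, Measurable (ξ k) := fun k => (hlaw k).aemeasurable.measurable_mk
  have hξe : ∀ k, sample k =ᵐ[P] ξ k := fun k => (hlaw k).aemeasurable.ae_eq_mk
  have hξl : ∀ k, P.map (ξ k) = S.dataLaw := fun k => by
    rw [← Measure.map_congr (hξe k), (hlaw k).map_eq]
  -- The function `W` equals `ρ^(2p)` at the start, where the deviation vanishes, and is at least
  -- `θ^(2p)` off the tube. Inside the tube the iterate is near the curve, so the one-step moment
  -- bound applies.
  have key := measure_exit_mul_le (P := P) (ν := S.dataLaw) (ξ := ξ)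
    (Φ := fun k => S.update f (γ ((k : ℝ) / d) / d)) (x₀ := S.X₀)
    (X := fun k ω => S.sgd f γ (fun k => ξ k ω) k)
    (A := fun k => {X | ‖S.deviation b 𝓑 X ((k : ℝ) / d)‖ ≤ θ})
    (W := fun k X => ENNReal.ofReal ((‖S.deviation b 𝓑 X ((k : ℝ) / d)‖ ^ 2 + ρ ^ 2) ^ p))
    (b := fun j => ENNReal.ofReal (1 + growthConst ℓ b p * (1 / d
        + ((∫ u in ((j : ℝ) / d)..(((j + 1 : ℕ) : ℝ) / d), |γ u - γ ((j : ℝ) / d)|)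
          + Real.sqrt d / d ^ 2) / ρ)))
    (c := ENNReal.ofReal ((θ ^ 2) ^ p))
    (D := ENNReal.ofReal (Real.exp (growthConst ℓ b p * (2 * T + samplingError γ T d / ρ))))
    (n := ⌊T * d⌋₊) hξm hξl (hind.congr hξe) (fun k => S.measurable_update A _) (fun _ => rfl)
    (fun _ _ => rfl)
    (fun k => measurableSet_le (S.measurable_deviation _).norm measurable_const)
    (fun k => ((((S.measurable_deviation _).norm.pow_const 2).add_const _).pow_const p).ennreal_ofReal)
    (fun k hk X hX => ?_) (fun k _ X hX => ?_)
    (fun k hk => prod_growth_le C.rate_meas C.rate C.dim (growthConst_nonneg ℓ hb0 p) hρ hρd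
      (hkT k hk))
  · have hset : P {ω | ∃ k ≤ ⌊T * d⌋₊,
          θ < ‖S.deviation b 𝓑 (S.sgd f γ (fun k => sample k ω) k) ((k : ℝ) / d)‖}
        ≤ P {ω | ∃ k ≤ ⌊T * d⌋₊, S.sgd f γ (fun k => ξ k ω) k
          ∉ {X | ‖S.deviation b 𝓑 X ((k : ℝ) / d)‖ ≤ θ}} := by
      refine measure_mono_ae ?_
      filter_upwards [ae_all_iff.2 hξe] with ω hω
      rintro ⟨k, hk, hkθ⟩
      refine ⟨k, hk, ?_⟩
      simp_rw [hω] at hkθ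
      simpa using hkθ
    have h0 : S.deviation b 𝓑 S.X₀ (((0 : ℕ) : ℝ) / d) = 0 := by
      rw [Nat.cast_zero, zero_div]; exact C.sol.deviation_init C.dim hT
    rw [h0, norm_zero] at key
    have hθp : 0 < (θ ^ 2) ^ p := by positivity
    refine hset.trans ?_
    have hfl : ((⌊T * d⌋₊ : ENNReal) + 1) ≤ ENNReal.ofReal (T * d + 1) := by
      rw [ENNReal.ofReal_add (by positivity) zero_le_one, ENNReal.ofReal_one]
      gcongr
      rw [← ENNReal.ofReal_natCast]
      exact ENNReal.ofReal_le_ofReal (Nat.floor_le (by positivity))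
    have h1 := key.trans (mul_le_mul_left hfl _)
    rw [← ENNReal.ofReal_mul (Real.exp_nonneg _), ← ENNReal.ofReal_mul (by positivity), mul_comm,
      ← ENNReal.le_div_iff_mul_le (Or.inl (by simpa using hθp)) (Or.inl ENNReal.ofReal_ne_top),
      ← ENNReal.ofReal_div_of_pos hθp] at h1
    refine h1.trans (le_of_eq ?_)
    congr 1
    rw [div_pow, div_pow]
    ring
  · have hk1 : ((k + 1 : ℕ) : ℝ) / d ≤ T := hkT (k + 1) hk
    have hk0 : (k : ℝ) / d ∈ Set.Icc 0 T := ⟨by positivity, hkT k hk.le⟩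
    exact C.lintegral_deviation_update_le A (hnear _ hk0 X hX) hk0 ⟨by positivity, hk1⟩
      (by push_cast; ring) hp hρ hρd
  · have : θ < ‖S.deviation b 𝓑 X ((k : ℝ) / d)‖ := by simpa using hX
    refine ENNReal.ofReal_le_ofReal ?_
    refine pow_le_pow_left₀ (by positivity) ?_ p
    have := pow_le_pow_left₀ hθ.le this.le 2
    have := sq_nonneg ρ
    linarith

/-- If the deviations are small at the grid points, then the distance to optimality of SGD follows
that of the curve. -/
lemma Setup.Controlled.abs_distSq_sub_le (C : S.Controlled Lhat f h U γ T 𝓑 b) {θ t : ℝ}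
    (ht : t ∈ Set.Icc 0 T) {X : Matrix (Fin d) (Fin ℓ) ℝ}
    (hX : ‖S.deviation b 𝓑 X ((⌊t * d⌋₊ : ℝ) / d)‖ ≤ θ) :
    |‖X - S.Xstar‖ ^ 2 - distSq 𝓑 t| ≤ 4 * ℓ * (θ + timeLip ℓ b / d) := by
  have hd0 : (0 : ℝ) < d := by have := C.dim; positivity
  have htd : 0 ≤ t * d := mul_nonneg ht.1 hd0.le
  have hs : (⌊t * d⌋₊ : ℝ) / d ≤ t := by
    rw [div_le_iff₀ hd0]; exact Nat.floor_le htd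
  have hs' : t - (⌊t * d⌋₊ : ℝ) / d ≤ 1 / d := by
    have := (Nat.lt_floor_add_one (t * d)).le
    rw [sub_le_iff_le_add, ← add_div, le_div_iff₀ hd0]
    linarith
  have hsI : (⌊t * d⌋₊ : ℝ) / d ∈ Set.Icc 0 T := ⟨by positivity, hs.trans ht.2⟩
  have h1 := (S.norm_moment_sub_le (b := b) (𝓑 := 𝓑) (j := 0) (by omega) X
    ((⌊t * d⌋₊ : ℝ) / d)).trans hX
  have h2 := C.norm_curveMoment_sub_le 0 hsI ht hs
  rw [pow_zero, mul_one] at h2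
  have h3 : ‖S.curveMoment b 𝓑 0 t - S.curveMoment b 𝓑 0 ((⌊t * d⌋₊ : ℝ) / d)‖
      ≤ timeLip ℓ b / d := by
    refine h2.trans ?_
    have : 0 ≤ 5 * b ^ 4 := by positivity
    calc _ ≤ entryCount ℓ * (5 * b ^ 4 * (1 / d)) := by gcongr
      _ = _ := by unfold timeLip; ring
  rw [← S.blockDist_iterMoment_zero (b := b), ← S.blockDist_curveMoment_zero (b := b)]
  have h4 : S.iterMoment b X 0 = S.curveMoment b 𝓑 0 t
      + (S.iterMoment b X 0 - S.curveMoment b 𝓑 0 t) := by abel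
  rw [h4, blockDist_add, add_sub_cancel_left]
  refine (abs_blockDist_le_norm _).trans (mul_le_mul_of_nonneg_left ?_ (by positivity))
  have h5 := norm_sub_le_norm_sub_add_norm_sub (S.iterMoment b X 0)
    (S.curveMoment b 𝓑 0 ((⌊t * d⌋₊ : ℝ) / d)) (S.curveMoment b 𝓑 0 t)
  rw [norm_sub_rev (S.curveMoment b 𝓑 0 ((⌊t * d⌋₊ : ℝ) / d))] at h5
  linarith

end Exit

/-! ### Choice of scales and overwhelming probability. -/

section Concentration

variable {ℓ : ℕ} {Lhat : ℝ} {f : ObsPlus ℓ → Obs ℓ → ℝ} {h : GramMat ℓ → ℝ}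
  {U : Set (GramMat ℓ)} {γ : ℝ → ℝ} {T : ℝ} {α Lf Lh : ℝ} {b : ℝ}

lemma eventually_mul_rpow_neg_le {s c δ : ℝ} (hs : 0 < s) (hδ : 0 < δ) :
    ∀ᶠ d : ℕ in atTop, c * (d : ℝ) ^ (-s) ≤ δ := by
  have h1 : Tendsto (fun d : ℕ => c * (d : ℝ) ^ (-s)) atTop (𝓝 (c * 0)) :=
    ((tendsto_rpow_neg_atTop hs).comp tendsto_natCast_atTop_atTop).const_mul c
  rw [mul_zero] at h1
  exact (h1.eventually_lt_const hδ).mono fun _ hd => hd.le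

/-- If the curves in all dimensions are controlled by one constant, then SGD follows them. -/
theorem Admissible.withOverwhelmingProbability (A : Admissible Lhat α Lf Lh f h U) {d₀ : ℕ}
    {S : ∀ d, Setup ℓ d} {𝓑 : ∀ d : ℕ, Fin d → ℝ → GramMat ℓ} (hT : 0 ≤ T) {θ₀ : ℝ} (hθ₀ : 0 < θ₀)
    (hC : ∀ d ≥ d₀, (S d).Controlled Lhat f h U γ T (𝓑 d) b ∧
      ∀ t ∈ Set.Icc 0 T, ∀ X, ‖(S d).deviation b (𝓑 d) X t‖ ≤ θ₀ →
        (S d).Near f h U T (𝓑 d) b X)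
    (hγ : SampledAtRate γ T) {Ω : ℕ → Type*} [∀ d, MeasurableSpace (Ω d)]
    (P : ∀ d, Measure (Ω d)) [∀ d, IsProbabilityMeasure (P d)]
    {sample : ∀ d, ℕ → Ω d → EuclideanSpace ℝ (Fin d) × Obs ℓ}
    (hlaw : ∀ d ≥ d₀, ∀ k, HasLaw (sample d k) (S d).dataLaw (P d))
    (hindep : ∀ d ≥ d₀, iIndepFun (sample d) (P d)) :
    ∃ ε : ℝ, 0 < ε ∧ WithOverwhelmingProbability P (fun d =>
      {ω | ∀ t ∈ Set.Icc 0 T,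
        |‖(S d).sgd f γ (fun k => sample d k ω) ⌊t * d⌋₊ - (S d).Xstar‖ ^ 2
          - distSq (𝓑 d) t| ≤ (d : ℝ) ^ (-ε)}) := by
  obtain ⟨c, β, hβ, hc⟩ := hγ
  -- The scale will be `ρ = d^(-s)`. The bound `s ≤ 1/2` ensures `1/d ≤ ρ²`, and `s ≤ β` keeps the
  -- sampling error divided by `ρ` bounded.
  set s : ℝ := min β (1 / 2) with hs
  have hs0 : 0 < s := lt_min hβ (by norm_num)
  have hsβ : s ≤ β := min_le_left _ _
  have hs2 : s ≤ 1 / 2 := min_le_right _ _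
  have hb0 : 0 ≤ b := zero_le_one.trans (hC d₀ le_rfl).1.one_le
  have htl := timeLip_nonneg ℓ b
  -- The tube has radius `θ = d^(-s/2)`; half of this exponent absorbs the constants and the other
  -- half remains as the rate.
  refine ⟨s / 4, by positivity, withOverwhelmingProbability_of_forall_pow fun q => ?_⟩
  -- Since `(ρ/θ)^(2p) = d^(-sp)`, this `p` yields the power `d^(-(q+1))`; one factor `d` pays for
  -- the number of steps.
  obtain ⟨p, hp⟩ := exists_nat_ge ((q + 1) / s)
  have hp1 : 1 ≤ p := by
    have h1 : (0 : ℝ) < p := lt_of_lt_of_le (by positivity) hp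
    exact_mod_cast h1
  have hps : (q : ℝ) + 1 ≤ s * p := by
    rw [div_le_iff₀ hs0] at hp; linarith
  have hG := growthConst_nonneg ℓ hb0 p
  refine ⟨(T + 1) * Real.exp (growthConst ℓ b p * (2 * T + |c|)), ?_⟩
  filter_upwards [eventually_ge_atTop d₀,
    eventually_mul_rpow_neg_le (c := 1) (half_pos hs0) hθ₀,
    eventually_mul_rpow_neg_le (c := 4 * ℓ * (1 + timeLip ℓ b)) (s := s / 4) (by positivity)
      one_pos] with d hd hdθ hdε
  obtain ⟨C, hnear⟩ := hC d hd
  have hd1 : (1 : ℝ) ≤ d := by exact_mod_cast C.dim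
  have hd0 : (0 : ℝ) < d := by linarith
  set θ : ℝ := (d : ℝ) ^ (-(s / 2)) with hθ
  set ρ : ℝ := (d : ℝ) ^ (-s) with hρ
  have hθ0 : 0 < θ := Real.rpow_pos_of_pos hd0 _
  have hρ0 : 0 < ρ := Real.rpow_pos_of_pos hd0 _
  rw [one_mul] at hdθ
  have hone : 1 / (d : ℝ) = (d : ℝ) ^ (-1 : ℝ) := by rw [Real.rpow_neg_one, one_div]
  have hρd : 1 / (d : ℝ) ≤ ρ ^ 2 := by
    rw [hone, hρ, ← Real.rpow_mul_natCast hd0.le]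
    refine Real.rpow_le_rpow_of_exponent_le hd1 ?_
    push_cast; linarith
  have hmain := C.measure_exit_le A hT (hlaw d hd) (hindep d hd)
    (fun t ht X hX => hnear t ht X (hX.trans hdθ)) hθ0 hρ0 hρd hp1
  have hsub : {ω | ∀ t ∈ Set.Icc 0 T,
        |‖(S d).sgd f γ (fun k => sample d k ω) ⌊t * d⌋₊ - (S d).Xstar‖ ^ 2
          - distSq (𝓑 d) t| ≤ (d : ℝ) ^ (-(s / 4))}ᶜ
      ⊆ {ω | ∃ k ≤ ⌊T * d⌋₊, θ < ‖(S d).deviation b (𝓑 d)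
          ((S d).sgd f γ (fun k => sample d k ω) k) ((k : ℝ) / d)‖} := by
    intro ω hω
    by_contra hexit
    simp only [Set.mem_ofPred_eq, not_exists, not_and, not_lt] at hexit
    refine hω fun t ht => ?_
    have h1 := C.abs_distSq_sub_le ht (hexit ⌊t * d⌋₊
      (Nat.floor_le_floor (mul_le_mul_of_nonneg_right ht.2 hd0.le)))
    refine h1.trans ?_
    have h2 : timeLip ℓ b / d ≤ timeLip ℓ b * θ := by
      rw [div_eq_mul_one_div, hone]
      refine mul_le_mul_of_nonneg_left (Real.rpow_le_rpow_of_exponent_le hd1 ?_) htl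
      linarith
    have h3 : θ = (d : ℝ) ^ (-(s / 4)) * (d : ℝ) ^ (-(s / 4)) := by
      rw [← Real.rpow_add hd0, hθ]; congr 1; ring
    calc 4 * ℓ * (θ + timeLip ℓ b / d) ≤ 4 * ℓ * (θ + timeLip ℓ b * θ) := by gcongr
      _ = 4 * ℓ * (1 + timeLip ℓ b) * (d : ℝ) ^ (-(s / 4)) * (d : ℝ) ^ (-(s / 4)) := by
          rw [h3]; ring
      _ ≤ 1 * (d : ℝ) ^ (-(s / 4)) := by gcongr
      _ = _ := one_mul _
  refine (measure_mono hsub).trans (hmain.trans (ENNReal.ofReal_le_ofReal ?_))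
  have hratio : ((ρ / θ) ^ 2) ^ p ≤ ((d : ℝ) ^ (q + 1))⁻¹ := by
    have h1 : ρ / θ = (d : ℝ) ^ (-(s / 2)) := by
      rw [hρ, hθ, ← Real.rpow_sub hd0]; congr 1; ring
    rw [h1, ← pow_mul, ← Real.rpow_mul_natCast hd0.le, ← Real.rpow_natCast (d : ℝ) (q + 1),
      ← Real.rpow_neg hd0.le]
    refine Real.rpow_le_rpow_of_exponent_le hd1 ?_
    push_cast; linarith
  have herr : samplingError γ T d / ρ ≤ |c| := by
    rw [div_le_iff₀ hρ0]
    calc samplingError γ T d ≤ c * (d : ℝ) ^ (-β) := hc d C.dim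
      _ ≤ |c| * ρ := by
          refine mul_le_mul (le_abs_self c) ?_ (Real.rpow_nonneg hd0.le _) (abs_nonneg c)
          exact Real.rpow_le_rpow_of_exponent_le hd1 (by linarith)
  calc (T * d + 1) * Real.exp (growthConst ℓ b p * (2 * T + samplingError γ T d / ρ))
        * ((ρ / θ) ^ 2) ^ p
      ≤ ((T + 1) * d) * Real.exp (growthConst ℓ b p * (2 * T + |c|)) * ((d : ℝ) ^ (q + 1))⁻¹ := by
        have : T * d + 1 ≤ (T + 1) * d := by linarith
        gcongr
    _ = _ := by
        rw [pow_succ]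
        field_simp

end Concentration

end HighDimSGD

end

/-! ### Assembly of the corollary. -/

theorem mainTheorem5
    {ℓ d₀ : ℕ} (hd₀ : 1 ≤ d₀)
    -- the outer function and its assumptions
    (f : HighDimSGD.ObsPlus ℓ → HighDimSGD.Obs ℓ → ℝ)
    (h : HighDimSGD.GramMat ℓ → ℝ) (U : Set (HighDimSGD.GramMat ℓ)) (hU : IsOpen U)
    (α Lf Lh LI Lhat : ℝ) (hα : 0 ≤ α) (hLhat : 0 < Lhat)
    (hf_meas : Measurable (fun p : HighDimSGD.ObsPlus ℓ × HighDimSGD.Obs ℓ => f p.1 p.2))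
    (hf_int : Integrable (fun e : HighDimSGD.Obs ℓ => f 0 e) (stdGaussian (HighDimSGD.Obs ℓ)))
    (hf : HighDimSGD.PseudoLipschitzOuter α Lf f)
    (hh : HighDimSGD.RiskRepresentation α Lh f U h)
    (hI : HighDimSGD.PseudoLipschitzFisher α LI f U)
    (hconv : HighDimSGD.ConvexSmoothOuter Lhat f)
    -- the data in each dimension `d ≥ d₀`, bounded independently of `d`
    (S : ∀ d : ℕ, HighDimSGD.Setup ℓ d) (C Kbar : ℝ)
    (hX₀ : ∀ d ≥ d₀, ‖(S d).X₀‖ ≤ C) (hXstar : ∀ d ≥ d₀, ‖(S d).Xstar‖ ≤ C)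
    (hK : ∀ d ≥ d₀, ‖Matrix.toEuclideanCLM (n := Fin d) (𝕜 := ℝ) (S d).K‖ ≤ Kbar)
    (hinit : ∀ d ≥ d₀, (S d).gram (S d).X₀ ∈ U)
    (hmin : ∀ d ≥ d₀, (S d).RiskLossMinimizer f)
    -- the learning rate
    (γ : ℝ → ℝ) (γmax : ℝ) (hγ_meas : Measurable γ)
    (hγ_bdd : ∀ t, 0 ≤ t → 0 ≤ γ t ∧ γ t ≤ γmax)
    (hγ : ∀ d ≥ d₀, ∀ t, 0 ≤ t → γ t * (Lhat * ((1 / (d : ℝ)) * (S d).K.trace)) ≤ 1)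
    -- up to time `T`, the deterministic curve keeps a distance `η` from the complement of `U`
    (T η : ℝ) (hT : 0 < T) (hη : 0 < η)
    (hmargin : ∀ d ≥ d₀, ∀ τ ∈ Set.Icc 0 T, ∀ 𝓑, (S d).IsSolution f h U γ τ 𝓑 →
      ∀ t ∈ Set.Icc 0 τ, ∀ V ∉ U, η ≤ ‖(S d).avg 𝓑 t - V‖)
    -- the samples
    {Ω : ℕ → Type*} [∀ d, MeasurableSpace (Ω d)]
    (P : ∀ d, Measure (Ω d)) [∀ d, IsProbabilityMeasure (P d)]
    (sample : ∀ d, ℕ → Ω d → EuclideanSpace ℝ (Fin d) × HighDimSGD.Obs ℓ)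
    (hlaw : ∀ d ≥ d₀, ∀ k, HasLaw (sample d k) (S d).dataLaw (P d))
    (hindep : ∀ d ≥ d₀, iIndepFun (sample d) (P d)) :
    -- the descent condition with `q = 1 / (2 Lhat)`
    (∀ d ≥ d₀, ∀ B : HighDimSGD.GramMat ℓ, B.PosSemidef →
      B.toBlocks₂₂ = (S d).Xstarᵀ * (S d).K * (S d).Xstar →
      HighDimSGD.DescentCondition f (1 / (2 * Lhat)) B) ∧
    -- the deterministic curve exists up to time `T`
    (∀ d ≥ d₀, ∃ 𝓑, (S d).IsSolution f h U γ T 𝓑) ∧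
    -- its distance to optimality decreases for as long as it is defined
    (∀ d ≥ d₀, ∀ τ, 0 ≤ τ → ∀ 𝓑, (S d).IsSolution f h U γ τ 𝓑 →
      AntitoneOn (HighDimSGD.distSq 𝓑) (Set.Icc 0 τ)) ∧
    -- and it is uniformly close to that of SGD
    (HighDimSGD.SampledAtRate γ T →
      ∀ 𝓑 : ∀ d : ℕ, Fin d → ℝ → HighDimSGD.GramMat ℓ,
        (∀ d ≥ d₀, (S d).IsSolution f h U γ T (𝓑 d)) →
        ∃ ε : ℝ, 0 < ε ∧ HighDimSGD.WithOverwhelmingProbability P (fun d =>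
          {ω | ∀ t ∈ Set.Icc 0 T,
            |‖(S d).sgd f γ (fun k => sample d k ω) ⌊t * d⌋₊ - (S d).Xstar‖ ^ 2
              - HighDimSGD.distSq (𝓑 d) t| ≤ (d : ℝ) ^ (-ε)})) := by
  have A : HighDimSGD.Admissible Lhat α Lf Lh f h U :=
    ⟨hα, hLhat, hf_meas, hf_int, hf, hconv, hU, hh⟩
  have hcrit : ∀ d ≥ d₀, HighDimSGD.CriticalAE f ((S d).Xstarᵀ * (S d).K * (S d).Xstar) :=
    fun d hd => (hmin d hd).criticalAE hconv hf_meas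
  refine ⟨fun d hd B hB hB₂₂ => A.descentCondition hB (by rw [hB₂₂]; exact hcrit d hd),
    fun d hd => A.exists_isSolution hI (hd₀.trans hd) (hcrit d hd) (hinit d hd) hγ_meas hγ_bdd
      (hγ d hd) hT.le hη (hmargin d hd),
    fun d hd τ _ 𝓑 sol => A.antitoneOn_distSq (hd₀.trans hd) (hcrit d hd)
      (fun t ht => (hγ_bdd t ht).1) (hγ d hd) sol,
    fun hrate 𝓑 sol => ?_⟩
  obtain ⟨b, θ₀, hθ₀, hC⟩ := A.exists_uniform hI hd₀ hX₀ hXstar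
    ((norm_nonneg _).trans (hK d₀ le_rfl)) (fun d hd => (S d).eigval_le (hK d hd)) hcrit hγ_meas
    hγ_bdd hγ hT.le hη (fun d hd t ht V hV => hmargin d hd T ⟨hT.le, le_rfl⟩ (𝓑 d) (sol d hd) t ht V
      hV) sol
  exact A.withOverwhelmingProbability hT.le hθ₀ hC hrate P hlaw hindep
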